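/- **Setting.** Let $\Omega\subset\mathbb R^2$ be a bounded domain (open, connected) that is the interior of a finite union of closed axis-parallel rectangles and has Lipschitz boundary (equivalently here: every $z\in\partial\Omega$ has the property that all sufficiently small open squares centred at $z$ meet $\Omega$ in a connected set). Let $k\ge 1$ be an integer, $\alpha\ge 1$ and $\sigma>0$ real. Let $\mathcal T_h$ be a conforming mesh of $\overline\Omega$ by closed axis-parallel rectangles (two different elements are disjoint, or share exactly one vertex or exactly one full edge), with $h_T=\operatorname{diam}T\le\sigma\min\{\text{side lengths of }T\}$ for all $T$, $h=\max_T h_T$, and such that each boundary vertex belongs to an element that has a vertex in $\Omega$. $Q_{i,j}$ denotes polynomials of degree at most $i$ in $x$ and $j$ in $y$, $Q_k=Q_{k,k}$, $P_m$ polynomials of total degree at most $m$, and $S_h=\{v\in C^0(\overline\Omega): v|_T\in Q_k\ \forall T\in\mathcal T_h\}$. **Problem.** Let $f\in L^2(\Omega)$ and let $u\in H^1_0(\Omega)$ be the weak solution of $-\Delta u=f$ in $\Omega$, $u=0$ on $\partial\Omega$; assume $u\in H^{k+2}(\Omega)$. **Weak Galerkin solution.** $V_h$ is the space of $v=\{v_0,v_b\}$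 with $v_0|_T\in Q_k$ on each element and a single-valued $v_b|_e\in P_k(e)$ on each edge; $V_h^0$ is its subspace with $v_b=0$ on $\partial\Omega$. On $T$ the discrete weak gradient $\nabla_wv\in W_k(T)=Q_{k-1,k}\times Q_{k,k-1}$ is defined by $(\nabla_wv,q)_T=-(v_0,\nabla\cdot q)_T+\langle v_b,q\cdot n\rangle_{\partial T}$ for all $q\in W_k(T)$. The weak Galerkin solution $u_h\in V_h^0$ satisfies, for all $v\in V_h^0$, $$\sum_T(\nabla_wu_h,\nabla_wv)_T+\sum_Th^{-\alpha}\langle u_0-u_b,v_0-v_b\rangle_{\partial T}=\sum_T(f,v_0)_T .$$ **Recovered gradient.** The nodes of $T$ are the images of the points $(\zeta_i,\zeta_j)$, $0\le i,j\le k$, under the affine map $[-1,1]^2\to T$ (diagonal with positive scaling), where $-1=\zeta_0<\dots<\zeta_k=1$ are the Lobatto points, i.e. the zeros of $(1-x^2)L_k'(x)$ with $L_k$ the Legendre polynomial of degree $k$. Nodes are vertices, edge nodes or internal nodes. Let $\bar u_h\in S_h$ be a function whose value at each node is some weighted average (weights non-negative with sum $1$, arbitrary otherwise) of all values that $u_0$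 on the elements and $u_b$ on the edges take there. For an interior vertex $z$ let $p_z\in P_{k+1}$ be the least-squares fit to the values of $\bar u_h$ at all nodes in the closed patch of elements containing $z$; for a boundary vertex $z$ let $p_z$ be the arithmetic mean of the $p_{z'}$ over all interior vertices $z'$ in the closed patch of elements containing $z$. The recovered gradient $G_hu_h\in S_h\times S_h$ has the nodal values * $\nabla p_z(z)$ at a vertex $z$; * $\lambda\nabla p_{z_1}(z)+(1-\lambda)\nabla p_{z_2}(z)$, $\lambda=|z-z_2|/|z_1-z_2|$, at an edge node $z$ of the edge with end points $z_1,z_2$; * $\sum_{j=1}^4\lambda_j\nabla p_{z_j}(z)$ at an internal node $z$ of the element $T$ with vertices $z_1,\dots,z_4$, where $\lambda_j=|S_j|/|T|$ and $S_j$ is the rectangle with opposite corners $z$ and the vertex of $T$ opposite to $z_j$. **Theorem.** There is a constant $C>0$, depending only on $\Omega$, $k$, $\alpha$ and $\sigma$, such that for all $\mathcal T_h$, $f$, $u$, $u_h$, $\bar u_h$ as above $$\|G_hu_h-\nabla u\|_{L^2(\Omega)}\le C\,h^{\min\{k+1,\;k+(\alpha-1)/2\}}\,\|u\|_{H^{k+2}(\Omega)}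 .$$ -/

import Mathlib

open MeasureTheory Set
open scoped ContDiff

noncomputable section

namespace WG

/-! ### Partial derivatives and Sobolev spaces on open subsets of the plane -/

/-- The classical partial derivative in the first variable. -/
def dx (g : ℝ × ℝ → ℝ) : ℝ × ℝ → ℝ := fun z => fderiv ℝ g z (1, 0)

/-- The classical partial derivative in the second variable. -/
def dy (g : ℝ × ℝ → ℝ) : ℝ × ℝ → ℝ := fun z => fderiv ℝ g z (0, 1)

/-- The classical gradient. -/
def grad (g : ℝ × ℝ → ℝ) (z : ℝ × ℝ) : ℝ × ℝ := (dx g z, dy g z)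

/-- `φ ∈ C_c^∞(Ω)`. -/
def IsTestFunction (Ω : Set (ℝ × ℝ)) (φ : ℝ × ℝ → ℝ) : Prop :=
  ContDiff ℝ ∞ φ ∧ HasCompactSupport φ ∧ tsupport φ ⊆ Ω

/-- `v ∈ L²(Ω)` is the weak derivative `∂_x^a ∂_y^b u` of `u ∈ L²(Ω)` on `Ω`. -/
def HasWeakDeriv (Ω : Set (ℝ × ℝ)) (a b : ℕ) (u v : ℝ × ℝ → ℝ) : Prop :=
  MemLp u 2 (volume.restrict Ω) ∧ MemLp v 2 (volume.restrict Ω) ∧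
    ∀ φ, IsTestFunction Ω φ →
      ∫ z in Ω, u z * (dx^[a] (dy^[b] φ)) z = (-1) ^ (a + b) * ∫ z in Ω, v z * φ z

/-- `u ∈ H^m(Ω)`: all weak derivatives of order at most `m` exist in `L²(Ω)`. -/
def MemSobolev (Ω : Set (ℝ × ℝ)) (m : ℕ) (u : ℝ × ℝ → ℝ) : Prop :=
  ∀ a b, a + b ≤ m → ∃ v, HasWeakDeriv Ω a b u v

open Classical in
/-- The weak derivative `∂_x^a ∂_y^b u` (unique almost everywhere on `Ω`); `0` if there is none. -/
def weakDeriv (Ω : Set (ℝ × ℝ)) (a b : ℕ) (u : ℝ × ℝ → ℝ) : ℝ × ℝ → ℝ :=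
  if h : ∃ v, HasWeakDeriv Ω a b u v then h.choose else 0

/-- The norm `‖u‖_m` of `H^m(Ω)`. -/
def sobolevNorm (Ω : Set (ℝ × ℝ)) (m : ℕ) (u : ℝ × ℝ → ℝ) : ℝ :=
  √(∑ n ∈ Finset.range (m + 1), ∑ ab ∈ Finset.HasAntidiagonal.antidiagonal n,
      ∫ z in Ω, (weakDeriv Ω ab.1 ab.2 u z) ^ 2)

/-- `u ∈ H^1_0(Ω)`, the closure of `C_c^∞(Ω)` in `H^1(Ω)`. -/
def MemH10 (Ω : Set (ℝ × ℝ)) (u : ℝ × ℝ → ℝ) : Prop :=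
  MemSobolev Ω 1 u ∧ ∀ ε : ℝ, 0 < ε → ∃ φ, IsTestFunction Ω φ ∧
    ∫ z in Ω, ((u z - φ z) ^ 2 + (weakDeriv Ω 1 0 u z - dx φ z) ^ 2
      + (weakDeriv Ω 0 1 u z - dy φ z) ^ 2) < ε

/-- `u` is the weak solution of `-Δ u = f` in `Ω`, `u = 0` on `∂Ω`. -/
def IsWeakSolution (Ω : Set (ℝ × ℝ)) (f u : ℝ × ℝ → ℝ) : Prop :=
  MemH10 Ω u ∧ ∀ v, MemH10 Ω v →
    ∫ z in Ω, (weakDeriv Ω 1 0 u z * weakDeriv Ω 1 0 v z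
      + weakDeriv Ω 0 1 u z * weakDeriv Ω 0 1 v z) = ∫ z in Ω, f z * v z

/-- `‖(g₁, g₂) - ∇u‖`, the norm of `L²(Ω)²`. -/
def gradError (Ω : Set (ℝ × ℝ)) (g : ℝ × ℝ → ℝ × ℝ) (u : ℝ × ℝ → ℝ) : ℝ :=
  √(∫ z in Ω, (((g z).1 - weakDeriv Ω 1 0 u z) ^ 2 + ((g z).2 - weakDeriv Ω 0 1 u z) ^ 2))

/-! ### Rectangles, edges, meshes -/

/-- The Euclidean distance in the plane. -/
def eDist (z w : ℝ × ℝ) : ℝ := √((z.1 - w.1) ^ 2 + (z.2 - w.2) ^ 2)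

/-- A segment with ordered end points `p`, `q`. -/
structure Edge where
  p : ℝ × ℝ
  q : ℝ × ℝ

/-- The point of the segment with parameter `s ∈ [0, 1]`. -/
def Edge.pt (e : Edge) (s : ℝ) : ℝ × ℝ := e.p + s • (e.q - e.p)

def Edge.carrier (e : Edge) : Set (ℝ × ℝ) := e.pt '' Icc 0 1

def Edge.inner (e : Edge) : Set (ℝ × ℝ) := e.pt '' Ioo 0 1

def Edge.length (e : Edge) : ℝ := eDist e.p e.q

/-- The arc length integral over `e` of a function given in the parameter `s ∈ [0, 1]`. -/
def Edge.integral (e : Edge) (g : ℝ → ℝ) : ℝ := e.length * ∫ s in (0 : ℝ)..1, g s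

/-- A non-degenerate rectangle `[l, r] × [b, t]`. -/
structure Rect where
  l : ℝ
  r : ℝ
  b : ℝ
  t : ℝ
  hlr : l < r
  hbt : b < t

def Rect.carrier (T : Rect) : Set (ℝ × ℝ) := Icc T.l T.r ×ˢ Icc T.b T.t

def Rect.inner (T : Rect) : Set (ℝ × ℝ) := Ioo T.l T.r ×ˢ Ioo T.b T.t

def Rect.width (T : Rect) : ℝ := T.r - T.l

def Rect.height (T : Rect) : ℝ := T.t - T.b

/-- `h_T` -/
def Rect.diam (T : Rect) : ℝ := √(T.width ^ 2 + T.height ^ 2)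

/-- The corners, counterclockwise from the lower left one. -/
def Rect.corner (T : Rect) : Fin 4 → ℝ × ℝ :=
  ![(T.l, T.b), (T.r, T.b), (T.r, T.t), (T.l, T.t)]

/-- The lower, right, upper and left edge. The orientation is that of the coordinate axes, so two
rectangles that share an edge have it as the same term of type `Edge`. -/
def Rect.edge (T : Rect) : Fin 4 → Edge :=
  ![⟨(T.l, T.b), (T.r, T.b)⟩, ⟨(T.r, T.b), (T.r, T.t)⟩,
    ⟨(T.l, T.t), (T.r, T.t)⟩, ⟨(T.l, T.b), (T.l, T.t)⟩]

/-- The unit outward normals on the lower, right, upper and left edge. -/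
def normal : Fin 4 → ℝ × ℝ := ![(0, -1), (1, 0), (0, 1), (-1, 0)]

/-- A bounded domain (connected, open) that is made of finitely many axis-parallel rectangles and
has no cuts and no points where its boundary touches itself; for such polygons this is the same as
having a Lipschitz boundary. -/
structure IsRectangularDomain (Ω : Set (ℝ × ℝ)) : Prop where
  connected : IsConnected Ω
  union : ∃ R : Finset Rect, Ω = interior (⋃ T ∈ R, T.carrier)
  boundary : ∀ z ∈ frontier Ω, ∃ ε > 0, ∀ δ, 0 < δ → δ < ε → IsConnected (Metric.ball z δ ∩ Ω)

/-- A conforming mesh of `Ω` by closed rectangles: two different elements are disjoint or share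
exactly a common corner or exactly a common edge. -/
structure IsMesh (Ω : Set (ℝ × ℝ)) (M : Finset Rect) : Prop where
  cover : ⋃ T ∈ M, T.carrier = closure Ω
  conforming : ∀ T ∈ M, ∀ T' ∈ M, T ≠ T' →
    T.carrier ∩ T'.carrier = ∅ ∨
    (∃ i j, T.corner i = T'.corner j ∧ T.carrier ∩ T'.carrier = {T.corner i}) ∨
    (∃ i j, T.edge i = T'.edge j ∧ T.carrier ∩ T'.carrier = (T.edge i).carrier)

/-- Shape regularity: the diameter of each element is at most `σ` times the diameter of its
largest inscribed disc. -/
def IsShapeRegular (σ : ℝ) (M : Finset Rect) : Prop :=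
  ∀ T ∈ M, T.diam ≤ σ * min T.width T.height

/-- `h = max_T h_T` -/
def meshSize (M : Finset Rect) : ℝ := sSup (Rect.diam '' (M : Set Rect))

/-- The set of all edges of the mesh. -/
def meshEdges (M : Finset Rect) : Set Edge := {e | ∃ T ∈ M, ∃ i, e = T.edge i}

open Classical in
/-- The set of all vertices of the mesh. -/
def vertices (M : Finset Rect) : Finset (ℝ × ℝ) :=
  M.biUnion fun T => Finset.univ.image T.corner

open Classical in
/-- The interior vertices of the mesh in the closed patch of elements around `z`. -/
def patchInteriorVertices (Ω : Set (ℝ × ℝ)) (M : Finset Rect) (z : ℝ × ℝ) : Finset (ℝ × ℝ) :=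
  (vertices M).filter fun w => w ∈ Ω ∧ ∃ T ∈ M, z ∈ T.carrier ∧ w ∈ T.carrier

/-! ### Polynomial spaces and nodes -/

/-- Polynomials of degree at most `m` in `x` and at most `n` in `y`. -/
def IsQ (m n : ℕ) (g : ℝ × ℝ → ℝ) : Prop :=
  ∃ c : ℕ → ℕ → ℝ, ∀ z, g z = ∑ i ∈ Finset.range (m + 1), ∑ j ∈ Finset.range (n + 1),
    c i j * z.1 ^ i * z.2 ^ j

/-- Polynomials in two variables of total degree at most `m`. -/
def IsP (m : ℕ) (g : ℝ × ℝ → ℝ) : Prop :=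
  ∃ c : ℕ → ℕ → ℝ, ∀ z, g z = ∑ n ∈ Finset.range (m + 1), ∑ ij ∈ Finset.HasAntidiagonal.antidiagonal n,
    c ij.1 ij.2 * z.1 ^ ij.1 * z.2 ^ ij.2

/-- Polynomials in one variable of degree at most `m`. -/
def IsP1 (m : ℕ) (g : ℝ → ℝ) : Prop :=
  ∃ c : ℕ → ℝ, ∀ s, g s = ∑ i ∈ Finset.range (m + 1), c i * s ^ i

/-- The Lobatto polynomial of degree `k + 1`, up to a constant factor: `(x² - 1) L_k'(x)` with the
Legendre polynomial `L_k` given by the formula of Rodrigues. -/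
def lobattoPoly (k : ℕ) : Polynomial ℝ :=
  (Polynomial.X ^ 2 - 1) *
    Polynomial.derivative^[k] (Polynomial.derivative ((Polynomial.X ^ 2 - 1) ^ k))

/-- `ζ_0 < ... < ζ_k` are the `k + 1` zeros of the Lobatto polynomial of degree `k + 1`. -/
def IsLobattoPoints (k : ℕ) (ζ : Fin (k + 1) → ℝ) : Prop :=
  StrictMono ζ ∧ ∀ i, (lobattoPoly k).IsRoot (ζ i)

/-- The node of `T` with index `(i, j)`: the image of `(ζ_i, ζ_j) ∈ [-1, 1]²`. -/
def Rect.node {k : ℕ} (T : Rect) (ζ : Fin (k + 1) → ℝ) (ij : Fin (k + 1) × Fin (k + 1)) : ℝ × ℝ :=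
  ((T.l + T.r) / 2 + T.width / 2 * ζ ij.1, (T.b + T.t) / 2 + T.height / 2 * ζ ij.2)

open Classical in
/-- The set of all mesh nodes. -/
def nodes {k : ℕ} (M : Finset Rect) (ζ : Fin (k + 1) → ℝ) : Finset (ℝ × ℝ) :=
  M.biUnion fun T => Finset.univ.image (T.node ζ)

open Classical in
/-- The mesh nodes in the closed patch of elements around `z`. -/
def patchNodes {k : ℕ} (M : Finset Rect) (ζ : Fin (k + 1) → ℝ) (z : ℝ × ℝ) : Finset (ℝ × ℝ) :=
  (nodes M ζ).filter fun w => ∃ T ∈ M, z ∈ T.carrier ∧ w ∈ T.carrier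

/-- `g ∈ S_h`: continuous on the closure of `Ω` and in `Q_k` on every element. -/
def MemSh (Ω : Set (ℝ × ℝ)) (M : Finset Rect) (k : ℕ) (g : ℝ × ℝ → ℝ) : Prop :=
  ContinuousOn g (closure Ω) ∧ ∀ T ∈ M, ∃ q, IsQ k k q ∧ EqOn g q T.carrier

/-! ### The weak Galerkin method -/

/-- A weak function `{v_0, v_b}`: `v_0` on each element, and `v_b` on each edge, the latter as a
function of the parameter `s ∈ [0, 1]` of the edge. -/
structure WeakFunction where
  v0 : Rect → ℝ × ℝ → ℝ
  vb : Edge → ℝ → ℝ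

/-- `v ∈ V_h` -/
def MemVh (M : Finset Rect) (k : ℕ) (v : WeakFunction) : Prop :=
  (∀ T ∈ M, IsQ k k (v.v0 T)) ∧ ∀ e ∈ meshEdges M, IsP1 k (v.vb e)

/-- `v ∈ V_h^0` -/
def MemVh0 (Ω : Set (ℝ × ℝ)) (M : Finset Rect) (k : ℕ) (v : WeakFunction) : Prop :=
  MemVh M k v ∧ ∀ e ∈ meshEdges M, e.carrier ⊆ frontier Ω → ∀ s ∈ Icc (0 : ℝ) 1, v.vb e s = 0

/-- `q = (q₁, q₂) ∈ W_k(T) = Q_{k-1,k} × Q_{k,k-1}` (for `k ≥ 1`). -/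
def MemWk (k : ℕ) (q : (ℝ × ℝ → ℝ) × (ℝ × ℝ → ℝ)) : Prop :=
  IsQ (k - 1) k q.1 ∧ IsQ k (k - 1) q.2

/-- `q ∈ W_k(T)` satisfies `(q, r)_T = -(v_0, ∇·r)_T + ⟨v_b, r·n⟩_{∂T}` for all `r ∈ W_k(T)`. -/
def IsWeakGrad (k : ℕ) (T : Rect) (v : WeakFunction) (q : (ℝ × ℝ → ℝ) × (ℝ × ℝ → ℝ)) : Prop :=
  MemWk k q ∧ ∀ r, MemWk k r →
    ∫ z in T.carrier, (q.1 z * r.1 z + q.2 z * r.2 z) =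
      -(∫ z in T.carrier, v.v0 T z * (dx r.1 z + dy r.2 z)) +
        ∑ i, (T.edge i).integral fun s => v.vb (T.edge i) s *
          (r.1 ((T.edge i).pt s) * (normal i).1 + r.2 ((T.edge i).pt s) * (normal i).2)

open Classical in
/-- The discrete weak gradient of `v` on `T`. -/
def weakGrad (k : ℕ) (T : Rect) (v : WeakFunction) : (ℝ × ℝ → ℝ) × (ℝ × ℝ → ℝ) :=
  if h : ∃ q, IsWeakGrad k T v q then h.choose else 0

/-- The stabilizer `s(w, v) = ∑_T h^{-α} ⟨w_0 - w_b, v_0 - v_b⟩_{∂T}`. -/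
def stabilizer (M : Finset Rect) (α : ℝ) (w v : WeakFunction) : ℝ :=
  ∑ T ∈ M, meshSize M ^ (-α) * ∑ i, (T.edge i).integral fun s =>
    (w.v0 T ((T.edge i).pt s) - w.vb (T.edge i) s) *
      (v.v0 T ((T.edge i).pt s) - v.vb (T.edge i) s)

/-- `a_s(w, v) = (∇_w w, ∇_w v)_h + s(w, v)` -/
def wgForm (M : Finset Rect) (k : ℕ) (α : ℝ) (w v : WeakFunction) : ℝ :=
  (∑ T ∈ M, ∫ z in T.carrier, ((weakGrad k T w).1 z * (weakGrad k T v).1 z +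
    (weakGrad k T w).2 z * (weakGrad k T v).2 z)) + stabilizer M α w v

/-- `uh` is the weak Galerkin solution: `uh ∈ V_h^0`, `a_s(uh, v) = (f, v_0)` for `v ∈ V_h^0`. -/
def IsWGSolution (Ω : Set (ℝ × ℝ)) (M : Finset Rect) (k : ℕ) (α : ℝ) (f : ℝ × ℝ → ℝ)
    (uh : WeakFunction) : Prop :=
  MemVh0 Ω M k uh ∧ ∀ v, MemVh0 Ω M k v →
    wgForm M k α uh v = ∑ T ∈ M, ∫ z in T.carrier, f z * v.v0 T z

/-! ### Polynomial preserving recovery -/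

/-- All values of the weak function `v` at the point `z`. -/
def valuesAt (M : Finset Rect) (v : WeakFunction) (z : ℝ × ℝ) : Set ℝ :=
  {y | ∃ T ∈ M, z ∈ T.carrier ∧ y = v.v0 T z} ∪
    {y | ∃ e ∈ meshEdges M, ∃ s ∈ Icc (0 : ℝ) 1, z = e.pt s ∧ y = v.vb e s}

/-- `ubar ∈ S_h`, and its value at each node is a weighted average (weights non-negative with
sum one, possibly different from node to node) of the values of `v` there. -/
def IsNodalAverage {k : ℕ} (Ω : Set (ℝ × ℝ)) (M : Finset Rect) (ζ : Fin (k + 1) → ℝ)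
    (v : WeakFunction) (ubar : ℝ × ℝ → ℝ) : Prop :=
  MemSh Ω M k ubar ∧ ∀ z ∈ nodes M ζ, ubar z ∈ convexHull ℝ (valuesAt M v z)

/-- `p ∈ P_m` is the least-squares fit to the values of `g` at the points of `N`. -/
def IsLeastSquaresFit (m : ℕ) (N : Finset (ℝ × ℝ)) (g p : ℝ × ℝ → ℝ) : Prop :=
  IsP m p ∧ ∀ q, IsP m q → ∑ w ∈ N, (p w - g w) ^ 2 ≤ ∑ w ∈ N, (q w - g w) ^ 2

/-- The polynomials `p z` of the vertices `z`, in global coordinates: the least-squares fit in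
`P_{k+1}` on the patch of an interior vertex; for a boundary vertex, the mean of the polynomials
of the interior vertices in its closed patch. -/
def IsVertexPolynomials {k : ℕ} (Ω : Set (ℝ × ℝ)) (M : Finset Rect) (ζ : Fin (k + 1) → ℝ)
    (ubar : ℝ × ℝ → ℝ) (p : ℝ × ℝ → ℝ × ℝ → ℝ) : Prop :=
  (∀ z ∈ vertices M, z ∈ Ω → IsLeastSquaresFit (k + 1) (patchNodes M ζ z) ubar (p z)) ∧
  (∀ z ∈ vertices M, z ∈ frontier Ω → ∀ x,
    p z x = (∑ w ∈ patchInteriorVertices Ω M z, p w x) / (patchInteriorVertices Ω M z).card)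

/-- `G = (G_1, G_2) ∈ S_h × S_h` is the recovered gradient of `ubar`, determined by its values at
the vertices, the edge nodes and the internal nodes. The weights at an internal node `z` are the
relative areas of the subrectangles of `T` spanned by `z` and the corner opposite to the weighted
one. -/
def IsRecoveredGradient {k : ℕ} (Ω : Set (ℝ × ℝ)) (M : Finset Rect) (ζ : Fin (k + 1) → ℝ)
    (ubar : ℝ × ℝ → ℝ) (G : ℝ × ℝ → ℝ × ℝ) : Prop :=
  MemSh Ω M k (fun z => (G z).1) ∧ MemSh Ω M k (fun z => (G z).2) ∧
  ∃ p : ℝ × ℝ → ℝ × ℝ → ℝ, IsVertexPolynomials Ω M ζ ubar p ∧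
    (∀ z ∈ vertices M, G z = grad (p z) z) ∧
    (∀ e ∈ meshEdges M, ∀ z ∈ nodes M ζ, z ∈ e.inner →
      G z = (eDist z e.q / e.length) • grad (p e.p) z
        + (eDist z e.p / e.length) • grad (p e.q) z) ∧
    (∀ T ∈ M, ∀ z ∈ nodes M ζ, z ∈ T.inner →
      G z = ((T.r - z.1) * (T.t - z.2) / (T.width * T.height)) • grad (p (T.l, T.b)) z
        + ((z.1 - T.l) * (T.t - z.2) / (T.width * T.height)) • grad (p (T.r, T.b)) z
        + ((z.1 - T.l) * (z.2 - T.b) / (T.width * T.height)) • grad (p (T.r, T.t)) z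
        + ((T.r - z.1) * (z.2 - T.b) / (T.width * T.height)) • grad (p (T.l, T.t)) z)

end WG

end

namespace WG

open Polynomial in
theorem exists_coeff_sq_le (m : ℕ) : ∃ C : ℝ, 0 < C ∧ ∀ p : ℝ[X], p.natDegree ≤ m → ∀ i,
    (p.coeff i) ^ 2 ≤ C * ∫ x in (-1 : ℝ)..1, (p.eval x) ^ 2 := by
  set f : (Fin (m + 1) → ℝ) → ℝ := fun c => ∫ x in (-1 : ℝ)..1, (∑ i, c i * x ^ (i : ℕ)) ^ 2 with hf
  have hfc : Continuous f := by
    apply intervalIntegral.continuous_parametric_intervalIntegral_of_continuous'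
      (f := fun (c : Fin (m + 1) → ℝ) x => (∑ i, c i * x ^ (i : ℕ)) ^ 2)
    fun_prop
  have hpos : ∀ c, c ≠ 0 → 0 < f c := by
    intro c hc
    have h0 : 0 ≤ f c := intervalIntegral.integral_nonneg (by norm_num) fun x _ => sq_nonneg _
    rcases h0.lt_or_eq with h | h
    · exact h
    exfalso
    apply hc
    have hcont : Continuous fun x : ℝ => (∑ i, c i * x ^ (i : ℕ)) ^ 2 := by fun_prop
    have hz : ∀ x ∈ Icc (-1 : ℝ) 1, (∑ i, c i * x ^ (i : ℕ)) = 0 := by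
      intro x hx
      by_contra hne
      have := intervalIntegral.integral_pos (by norm_num : (-1 : ℝ) < 1) hcont.continuousOn
        (fun x _ => sq_nonneg _) ⟨x, hx, by positivity⟩
      simp only [hf] at h
      linarith
    have hp : (∑ i : Fin (m + 1), Polynomial.C (c i) * X ^ (i : ℕ)) = 0 := by
      apply Polynomial.eq_zero_of_infinite_isRoot
      apply (Icc_infinite (by norm_num : (-1 : ℝ) < 1)).mono
      intro x hx
      simp only [mem_ofPred_eq, IsRoot.def, eval_finsetSum, eval_mul, eval_C, eval_pow, eval_X]
      exact hz x hx
    ext i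
    have := congrArg (fun p => p.coeff (i : ℕ)) hp
    simpa [finsetSum_coeff, coeff_C_mul, coeff_X_pow, Fin.val_inj] using this
  have hne : (Metric.sphere (0 : Fin (m + 1) → ℝ) 1).Nonempty := by
    refine ⟨fun _ => 1, ?_⟩
    rw [mem_sphere_zero_iff_norm, pi_norm_const, norm_one]
  obtain ⟨c0, hc0, hmin⟩ := (isCompact_sphere (0 : Fin (m + 1) → ℝ) 1).exists_isMinOn hne
    hfc.continuousOn
  have hc0' : c0 ≠ 0 := by
    rintro rfl
    simp at hc0
  refine ⟨(f c0)⁻¹, inv_pos.2 (hpos c0 hc0'), fun p hp i => ?_⟩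
  have hI : (∫ x in (-1 : ℝ)..1, (p.eval x) ^ 2) = f (fun i => p.coeff i) := by
    simp only [hf]
    congr 1
    ext x
    rw [eval_eq_sum_range' (Nat.lt_succ_of_le hp), Finset.sum_range]
  have hnn : 0 ≤ ∫ x in (-1 : ℝ)..1, (p.eval x) ^ 2 :=
    intervalIntegral.integral_nonneg (by norm_num) fun x _ => sq_nonneg _
  by_cases hi : i < m + 1
  swap
  · rw [coeff_eq_zero_of_natDegree_lt (by omega)]
    have := inv_pos.2 (hpos c0 hc0')
    rw [zero_pow two_ne_zero]
    exact mul_nonneg this.le hnn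
  rw [hI] at hnn ⊢
  set c : Fin (m + 1) → ℝ := fun i => p.coeff i
  rw [inv_mul_eq_div, le_div_iff₀ (hpos c0 hc0')]
  have hci : |p.coeff i| ≤ ‖c‖ := norm_le_pi_norm c ⟨i, hi⟩
  by_cases hcz : c = 0
  · rw [hcz, norm_zero] at hci
    have : p.coeff i = 0 := abs_nonpos_iff.1 hci
    rw [this]; simpa using hnn
  have hcn : 0 < ‖c‖ := norm_pos_iff.2 hcz
  have hs : (‖c‖⁻¹ • c) ∈ Metric.sphere (0 : Fin (m + 1) → ℝ) 1 := by
    simp [norm_smul, hcn.ne']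
  have h1 := hmin hs
  have h2 : f (‖c‖⁻¹ • c) = (‖c‖⁻¹) ^ 2 * f c := by
    simp only [hf, ← intervalIntegral.integral_const_mul]
    congr 1
    ext x
    simp only [Pi.smul_apply, smul_eq_mul, mul_assoc, ← Finset.mul_sum]
    ring
  simp only [mem_ofPred_eq] at h1
  rw [h2] at h1
  have h3 : ‖c‖ ^ 2 * f c0 ≤ f c := by
    calc ‖c‖ ^ 2 * f c0 ≤ ‖c‖ ^ 2 * ((‖c‖⁻¹) ^ 2 * f c) := by gcongr
      _ = f c := by field_simp
  refine le_trans ?_ h3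
  have := (hpos c0 hc0').le
  rw [← sq_abs (p.coeff i)]
  gcongr

open Polynomial in
theorem exists_eval_sq_le (m : ℕ) (K : ℝ) : ∃ C : ℝ, 0 < C ∧ ∀ p : ℝ[X], p.natDegree ≤ m →
    ∀ x, |x| ≤ K → (p.eval x) ^ 2 ≤ C * ∫ x in (-1 : ℝ)..1, (p.eval x) ^ 2 := by
  obtain ⟨C, hC, h⟩ := exists_coeff_sq_le m
  refine ⟨(∑ i ∈ Finset.range (m + 1), C) * (∑ i ∈ Finset.range (m + 1), (K ^ i) ^ 2) + 1,
    by positivity, fun p hp x hx => ?_⟩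
  have hnn : 0 ≤ ∫ x in (-1 : ℝ)..1, (p.eval x) ^ 2 :=
    intervalIntegral.integral_nonneg (by norm_num) fun x _ => sq_nonneg _
  rw [eval_eq_sum_range' (Nat.lt_succ_of_le hp)]
  refine (Finset.sum_mul_sq_le_sq_mul_sq _ _ _).trans ?_
  have h1 : ∑ i ∈ Finset.range (m + 1), (p.coeff i) ^ 2 ≤
      (∑ i ∈ Finset.range (m + 1), C) * ∫ x in (-1 : ℝ)..1, (p.eval x) ^ 2 := by
    rw [Finset.sum_mul]
    exact Finset.sum_le_sum fun i _ => h p hp i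
  have h2 : ∑ i ∈ Finset.range (m + 1), (x ^ i) ^ 2 ≤ ∑ i ∈ Finset.range (m + 1), (K ^ i) ^ 2 := by
    apply Finset.sum_le_sum fun i _ => ?_
    rw [← sq_abs, abs_pow]
    gcongr
  calc _ ≤ ((∑ i ∈ Finset.range (m + 1), C) * ∫ x in (-1 : ℝ)..1, (p.eval x) ^ 2) *
        ∑ i ∈ Finset.range (m + 1), (K ^ i) ^ 2 := by gcongr
    _ ≤ _ := by rw [add_mul]; nlinarith

open Polynomial in
theorem exists_derivative_sq_le (m : ℕ) (K : ℝ) : ∃ C : ℝ, 0 < C ∧ ∀ p : ℝ[X], p.natDegree ≤ m →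
    ∀ x, |x| ≤ K → (p.derivative.eval x) ^ 2 ≤ C * ∫ x in (-1 : ℝ)..1, (p.eval x) ^ 2 := by
  obtain ⟨C, hC, h⟩ := exists_coeff_sq_le m
  refine ⟨(∑ i ∈ Finset.range (m + 1), C * ((i : ℝ) + 1) ^ 2) *
    (∑ i ∈ Finset.range (m + 1), (K ^ i) ^ 2) + 1, by positivity, fun p hp x hx => ?_⟩
  have hnn : 0 ≤ ∫ x in (-1 : ℝ)..1, (p.eval x) ^ 2 :=
    intervalIntegral.integral_nonneg (by norm_num) fun x _ => sq_nonneg _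
  have hp' : p.derivative.natDegree ≤ m := (natDegree_derivative_le p).trans (by omega)
  rw [eval_eq_sum_range' (Nat.lt_succ_of_le hp')]
  refine (Finset.sum_mul_sq_le_sq_mul_sq _ _ _).trans ?_
  have h1 : ∑ i ∈ Finset.range (m + 1), (p.derivative.coeff i) ^ 2 ≤
      (∑ i ∈ Finset.range (m + 1), C * ((i : ℝ) + 1) ^ 2) * ∫ x in (-1 : ℝ)..1, (p.eval x) ^ 2 := by
    rw [Finset.sum_mul]
    refine Finset.sum_le_sum fun i _ => ?_
    rw [coeff_derivative, mul_pow]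
    nlinarith [h p hp (i + 1), sq_nonneg ((i : ℝ) + 1)]
  have h2 : ∑ i ∈ Finset.range (m + 1), (x ^ i) ^ 2 ≤ ∑ i ∈ Finset.range (m + 1), (K ^ i) ^ 2 := by
    apply Finset.sum_le_sum fun i _ => ?_
    rw [← sq_abs, abs_pow]
    gcongr
  calc _ ≤ ((∑ i ∈ Finset.range (m + 1), C * ((i : ℝ) + 1) ^ 2) *
          ∫ x in (-1 : ℝ)..1, (p.eval x) ^ 2) * ∑ i ∈ Finset.range (m + 1), (K ^ i) ^ 2 := by gcongr
    _ ≤ _ := by rw [add_mul]; nlinarith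

open Polynomial in
/-- Inverse estimates on an interval, valid at all points of a dilated interval. -/
theorem exists_inverse_estimate (m : ℕ) (K : ℝ) : ∃ C : ℝ, 0 < C ∧ ∀ p : ℝ[X], p.natDegree ≤ m →
    ∀ a b x, a < b → |x - (a + b) / 2| ≤ K * ((b - a) / 2) →
      (p.eval x) ^ 2 ≤ C / (b - a) * ∫ x in a..b, (p.eval x) ^ 2 ∧
      (p.derivative.eval x) ^ 2 ≤ C / (b - a) ^ 3 * ∫ x in a..b, (p.eval x) ^ 2 := by
  obtain ⟨C, hC, h⟩ := exists_eval_sq_le m K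
  obtain ⟨C', hC', h'⟩ := exists_derivative_sq_le m K
  refine ⟨2 * C + 8 * C', by positivity, fun p hp a b x hab hx => ?_⟩
  have hd : 0 < b - a := sub_pos.2 hab
  set d := (b - a) / 2 with hdd
  have hd' : 0 < d := by positivity
  set q : ℝ[X] := p.comp (Polynomial.C d * X + Polynomial.C ((a + b) / 2)) with hq
  have hqd : q.natDegree ≤ m := by
    refine (natDegree_comp_le).trans ?_
    refine (Nat.mul_le_mul hp (natDegree_linear_le)).trans (by simp)
  have hqe : ∀ s, q.eval s = p.eval (d * s + (a + b) / 2) := fun s => by simp [hq]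
  have hqe' : ∀ s, q.derivative.eval s = d * p.derivative.eval (d * s + (a + b) / 2) := fun s => by
    simp [hq, derivative_comp]
  have hI : ∫ s in (-1 : ℝ)..1, (q.eval s) ^ 2 = d⁻¹ * ∫ x in a..b, (p.eval x) ^ 2 := by
    simp only [hqe]
    rw [intervalIntegral.integral_comp_mul_add (fun x => (p.eval x) ^ 2) hd'.ne']
    rw [smul_eq_mul]
    congr 2 <;> rw [hdd] <;> ring
  have hnn : 0 ≤ ∫ x in a..b, (p.eval x) ^ 2 :=
    intervalIntegral.integral_nonneg hab.le fun x _ => sq_nonneg _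
  set s := (x - (a + b) / 2) / d with hs
  have hsK : |s| ≤ K := by
    rw [hs, abs_div, abs_of_pos hd', div_le_iff₀ hd']; exact hx
  have hsx : d * s + (a + b) / 2 = x := by rw [hs]; field_simp; ring
  have e1 := h q hqd s hsK
  have e2 := h' q hqd s hsK
  rw [hqe, hsx, hI] at e1
  rw [hqe', hsx, hI] at e2
  set I := ∫ x in a..b, (p.eval x) ^ 2
  have hb : b - a = 2 * d := by rw [hdd]; ring
  constructor
  · refine e1.trans ?_
    rw [hb, ← mul_assoc]
    gcongr
    rw [← div_eq_mul_inv, div_le_div_iff₀ hd' (by positivity)]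
    nlinarith
  · have : (p.derivative.eval x) ^ 2 ≤ C' / d ^ 3 * I := by
      have : (p.derivative.eval x) ^ 2 = (d * p.derivative.eval x) ^ 2 / d ^ 2 := by field_simp
      rw [this, div_le_iff₀ (by positivity)]
      refine e2.trans (le_of_eq ?_)
      field_simp
    refine this.trans ?_
    rw [hb]
    gcongr ?_ * I
    rw [div_le_div_iff₀ (by positivity) (by positivity)]
    have : 0 < d ^ 3 := by positivity
    nlinarith

open Polynomial in
/-- A polynomial is controlled by its values at well separated points. -/
theorem abs_eval_le_of_separated {m : ℕ} {δ K ε : ℝ} (hδ : 0 < δ) (x : Fin (m + 1) → ℝ)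
    (hx : ∀ i j, i ≠ j → δ ≤ |x i - x j|) {p : ℝ[X]} (hp : p.natDegree ≤ m)
    (he : ∀ i, |p.eval (x i)| ≤ ε) {y : ℝ} (hy : ∀ i, |y - x i| ≤ K) :
    |p.eval y| ≤ (m + 1) * (K / δ) ^ m * ε := by
  have hinj : Set.InjOn x (Finset.univ : Finset (Fin (m + 1))) := by
    intro i _ j _ hij
    by_contra hne
    have := hx i j hne
    rw [hij, sub_self, abs_zero] at this
    linarith
  have hdeg : p.degree < (Finset.univ : Finset (Fin (m + 1))).card := by
    rw [Finset.card_univ, Fintype.card_fin]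
    exact lt_of_le_of_lt degree_le_natDegree (by exact_mod_cast Nat.lt_succ_of_le hp)
  have hε : 0 ≤ ε := (abs_nonneg _).trans (he 0)
  have hK : 0 ≤ K := (abs_nonneg _).trans (hy 0)
  rw [Lagrange.eq_interpolate hinj hdeg, Lagrange.interpolate_apply, eval_finsetSum]
  refine (Finset.abs_sum_le_sum_abs _ _).trans ?_
  have : ∀ i ∈ (Finset.univ : Finset (Fin (m + 1))),
      |eval y (Polynomial.C (eval (x i) p) * Lagrange.basis Finset.univ x i)| ≤ (K / δ) ^ m * ε := by
    intro i _
    rw [eval_mul, eval_C, abs_mul, mul_comm]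
    gcongr
    · rw [Lagrange.basis, eval_prod, Finset.abs_prod]
      calc _ ≤ ∏ j ∈ Finset.univ.erase i, (K / δ) := by
            apply Finset.prod_le_prod (fun _ _ => abs_nonneg _)
            intro j hj
            rw [Lagrange.basisDivisor, eval_mul, eval_C, eval_sub, eval_X, eval_C, abs_mul, abs_inv,
              inv_mul_eq_div]
            exact div_le_div₀ hK (hy j) hδ (hx i j (Finset.ne_of_mem_erase hj).symm)
        _ = _ := by
            rw [Finset.prod_const]
            congr 1
            simp
    · exact he i
  refine (Finset.sum_le_card_nsmul _ _ _ this).trans (le_of_eq ?_)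
  simp
  ring

end WG

namespace WG

/-! ### Partial derivatives -/

theorem hasDerivAt_fst {g : ℝ × ℝ → ℝ} {x y : ℝ} (hg : DifferentiableAt ℝ g (x, y)) :
    HasDerivAt (fun s => g (s, y)) (dx g (x, y)) x := by
  have h1 : HasDerivAt (fun s : ℝ => (s, y)) ((1 : ℝ), (0 : ℝ)) x :=
    (hasDerivAt_id x).prodMk (hasDerivAt_const x y)
  exact hg.hasFDerivAt.comp_hasDerivAt x h1

theorem hasDerivAt_snd {g : ℝ × ℝ → ℝ} {x y : ℝ} (hg : DifferentiableAt ℝ g (x, y)) :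
    HasDerivAt (fun s => g (x, s)) (dy g (x, y)) y := by
  have h1 : HasDerivAt (fun s : ℝ => (x, s)) ((0 : ℝ), (1 : ℝ)) y :=
    (hasDerivAt_const y x).prodMk (hasDerivAt_id y)
  exact hg.hasFDerivAt.comp_hasDerivAt y h1

theorem dx_add {f g : ℝ × ℝ → ℝ} (hf : Differentiable ℝ f) (hg : Differentiable ℝ g) :
    dx (f + g) = dx f + dx g := by
  ext z; simp only [dx, Pi.add_apply]; rw [fderiv_add (hf z) (hg z)]; rfl

theorem dy_add {f g : ℝ × ℝ → ℝ} (hf : Differentiable ℝ f) (hg : Differentiable ℝ g) :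
    dy (f + g) = dy f + dy g := by
  ext z; simp only [dy, Pi.add_apply]; rw [fderiv_add (hf z) (hg z)]; rfl

theorem dx_sub {f g : ℝ × ℝ → ℝ} (hf : Differentiable ℝ f) (hg : Differentiable ℝ g) :
    dx (f - g) = dx f - dx g := by
  ext z; simp only [dx, Pi.sub_apply]; rw [fderiv_sub (hf z) (hg z)]; rfl

theorem dy_sub {f g : ℝ × ℝ → ℝ} (hf : Differentiable ℝ f) (hg : Differentiable ℝ g) :
    dy (f - g) = dy f - dy g := by
  ext z; simp only [dy, Pi.sub_apply]; rw [fderiv_sub (hf z) (hg z)]; rfl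

theorem dx_smul {f : ℝ × ℝ → ℝ} (c : ℝ) (hf : Differentiable ℝ f) : dx (c • f) = c • dx f := by
  ext z; simp only [dx, Pi.smul_apply]; rw [fderiv_const_smul (hf z)]; rfl

theorem dy_smul {f : ℝ × ℝ → ℝ} (c : ℝ) (hf : Differentiable ℝ f) : dy (c • f) = c • dy f := by
  ext z; simp only [dy, Pi.smul_apply]; rw [fderiv_const_smul (hf z)]; rfl

theorem dx_zero : dx 0 = 0 := by
  ext z; simp [dx]

theorem dy_zero : dy 0 = 0 := by
  ext z; simp [dy]

theorem contDiff_dx {g : ℝ × ℝ → ℝ} (hg : ContDiff ℝ ∞ g) : ContDiff ℝ ∞ (dx g) :=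
  (hg.fderiv_right (m := ∞) (by norm_cast)).clm_apply contDiff_const

theorem contDiff_dy {g : ℝ × ℝ → ℝ} (hg : ContDiff ℝ ∞ g) : ContDiff ℝ ∞ (dy g) :=
  (hg.fderiv_right (m := ∞) (by norm_cast)).clm_apply contDiff_const

theorem contDiff_iter {g : ℝ × ℝ → ℝ} (hg : ContDiff ℝ ∞ g) (a b : ℕ) :
    ContDiff ℝ ∞ (dx^[a] (dy^[b] g)) := by
  have h1 : ContDiff ℝ ∞ (dy^[b] g) := by
    induction b with
    | zero => exact hg
    | succ n ih => rw [Function.iterate_succ_apply']; exact contDiff_dy ih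
  induction a with
  | zero => exact h1
  | succ n ih => rw [Function.iterate_succ_apply']; exact contDiff_dx ih

theorem dy_dx_comm {g : ℝ × ℝ → ℝ} (hg : ContDiff ℝ ∞ g) : dy (dx g) = dx (dy g) := by
  have hd : Differentiable ℝ (fderiv ℝ g) :=
    (hg.fderiv_right (m := ∞) (by norm_cast)).differentiable (by simp)
  ext z
  have h1 : ∀ v w : ℝ × ℝ, fderiv ℝ (fun z => fderiv ℝ g z v) z w = fderiv ℝ (fderiv ℝ g) z w v := by
    intro v w
    have := (hd z).hasFDerivAt.clm_apply (hasFDerivAt_const v z)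
    rw [this.fderiv]; simp
  have hs : IsSymmSndFDerivAt ℝ g z := (contDiff_infty.1 hg 2).contDiffAt.isSymmSndFDerivAt
    (by rw [minSmoothness_of_isRCLikeNormedField]; rfl)
  unfold dx dy
  rw [h1, h1]
  exact hs _ _

theorem dy_dx_iter_comm {g : ℝ × ℝ → ℝ} (hg : ContDiff ℝ ∞ g) (a b : ℕ) :
    dy (dx^[a] (dy^[b] g)) = dx^[a] (dy^[b + 1] g) := by
  induction a with
  | zero => simp only [Function.iterate_zero, id]; rw [Function.iterate_succ_apply']
  | succ n ih =>
    rw [Function.iterate_succ_apply', dy_dx_comm (contDiff_iter hg n b), ih,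
      ← Function.iterate_succ_apply' dx]

/-! ### Spaces of polynomials in two variables -/

/-- The monomial `x^i y^j`. -/
def mono (ij : ℕ × ℕ) : ℝ × ℝ → ℝ := fun z => z.1 ^ ij.1 * z.2 ^ ij.2

/-- The span of the monomials with exponents in `S`. -/
def polySpan (S : Set (ℕ × ℕ)) : Submodule ℝ (ℝ × ℝ → ℝ) := Submodule.span ℝ (mono '' S)

theorem mono_mem {S : Set (ℕ × ℕ)} {p : ℕ × ℕ} (hp : p ∈ S) : mono p ∈ polySpan S :=
  Submodule.subset_span ⟨p, hp, rfl⟩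

theorem polySpan_mono {S S' : Set (ℕ × ℕ)} (h : S ⊆ S') : polySpan S ≤ polySpan S' :=
  Submodule.span_mono (image_mono h)

theorem isQ_iff {m n : ℕ} {g : ℝ × ℝ → ℝ} :
    IsQ m n g ↔ g ∈ polySpan {p | p.1 ≤ m ∧ p.2 ≤ n} := by
  constructor
  · rintro ⟨c, hc⟩
    have : g = ∑ i ∈ Finset.range (m + 1), ∑ j ∈ Finset.range (n + 1), c i j • mono (i, j) := by
      ext z; rw [hc]; simp [mono, mul_assoc]
    rw [this]
    refine Submodule.sum_mem _ fun i hi => Submodule.sum_mem _ fun j hj =>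
      Submodule.smul_mem _ _ (mono_mem ?_)
    simp only [Finset.mem_range] at hi hj
    exact ⟨by simp; omega, by simp; omega⟩
  · intro h
    refine Submodule.span_induction ?_ ?_ ?_ ?_ h
    · rintro _ ⟨⟨i, j⟩, hij, rfl⟩
      simp only [mem_ofPred_eq] at hij
      refine ⟨fun a b => if a = i ∧ b = j then 1 else 0, fun z => ?_⟩
      rw [Finset.sum_eq_single i, Finset.sum_eq_single j]
      · simp [mono]
      · intro b _ hb; simp [hb]
      · intro hb; simp at hb; omega
      · intro b _ hb; simp [hb]
      · intro hb; simp at hb; omega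
    · exact ⟨fun _ _ => 0, fun z => by simp⟩
    · rintro f g _ _ ⟨c, hc⟩ ⟨c', hc'⟩
      refine ⟨fun i j => c i j + c' i j, fun z => ?_⟩
      simp only [Pi.add_apply, hc, hc', ← Finset.sum_add_distrib, add_mul]
    · rintro a f _ ⟨c, hc⟩
      refine ⟨fun i j => a * c i j, fun z => ?_⟩
      simp only [Pi.smul_apply, hc, smul_eq_mul, Finset.mul_sum, mul_assoc]

theorem isP_iff {m : ℕ} {g : ℝ × ℝ → ℝ} : IsP m g ↔ g ∈ polySpan {p | p.1 + p.2 ≤ m} := by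
  constructor
  · rintro ⟨c, hc⟩
    have : g = ∑ n ∈ Finset.range (m + 1), ∑ ij ∈ Finset.HasAntidiagonal.antidiagonal n,
        c ij.1 ij.2 • mono ij := by
      ext z; rw [hc]; simp [mono, mul_assoc]
    rw [this]
    refine Submodule.sum_mem _ fun i hi => Submodule.sum_mem _ fun j hj =>
      Submodule.smul_mem _ _ (mono_mem ?_)
    have hi' := Finset.mem_range.1 hi
    have hj' := Finset.HasAntidiagonal.mem_antidiagonal.1 hj
    simp only [mem_ofPred_eq]; omega
  · intro h
    refine Submodule.span_induction ?_ ?_ ?_ ?_ h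
    · rintro _ ⟨⟨i, j⟩, hij, rfl⟩
      simp only [mem_ofPred_eq] at hij
      refine ⟨fun a b => if a = i ∧ b = j then 1 else 0, fun z => ?_⟩
      rw [Finset.sum_eq_single (i + j), Finset.sum_eq_single (i, j)]
      · simp [mono]
      · rintro ⟨a, b⟩ _ hb
        have : ¬(a = i ∧ b = j) := by rintro ⟨rfl, rfl⟩; exact hb rfl
        simp [this]
      · intro hb; exact absurd (Finset.HasAntidiagonal.mem_antidiagonal (a := (i, j)).2 rfl) hb
      · intro n _ hb
        refine Finset.sum_eq_zero ?_
        rintro ⟨a, b⟩ hab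
        have hab' : a + b = n := Finset.HasAntidiagonal.mem_antidiagonal.1 hab
        have : ¬(a = i ∧ b = j) := by rintro ⟨rfl, rfl⟩; exact hb hab'.symm
        simp [this]
      · intro hb; simp at hb; omega
    · exact ⟨fun _ _ => 0, fun z => by simp⟩
    · rintro f g _ _ ⟨c, hc⟩ ⟨c', hc'⟩
      refine ⟨fun i j => c i j + c' i j, fun z => ?_⟩
      simp only [Pi.add_apply, hc, hc', ← Finset.sum_add_distrib, add_mul]
    · rintro a f _ ⟨c, hc⟩
      refine ⟨fun i j => a * c i j, fun z => ?_⟩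
      simp only [Pi.smul_apply, hc, smul_eq_mul, Finset.mul_sum, mul_assoc]

theorem contDiff_mono (p : ℕ × ℕ) : ContDiff ℝ ∞ (mono p) := by
  unfold mono; fun_prop

theorem contDiff_of_mem_polySpan {S : Set (ℕ × ℕ)} {g : ℝ × ℝ → ℝ} (h : g ∈ polySpan S) :
    ContDiff ℝ ∞ g := by
  refine Submodule.span_induction ?_ ?_ ?_ ?_ h
  · rintro _ ⟨p, -, rfl⟩; exact contDiff_mono p
  · exact contDiff_const
  · intro f g _ _ hf hg; exact hf.add hg
  · intro a f _ hf; exact contDiff_const.smul hf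

theorem IsQ.contDiff {m n : ℕ} {g : ℝ × ℝ → ℝ} (h : IsQ m n g) : ContDiff ℝ ∞ g :=
  contDiff_of_mem_polySpan (isQ_iff.1 h)

theorem IsP.contDiff {m : ℕ} {g : ℝ × ℝ → ℝ} (h : IsP m g) : ContDiff ℝ ∞ g :=
  contDiff_of_mem_polySpan (isP_iff.1 h)

theorem _root_.ContDiff.diff' {g : ℝ × ℝ → ℝ} (h : ContDiff ℝ ∞ g) : Differentiable ℝ g :=
  h.differentiable (by simp)

theorem dx_mono (i j : ℕ) : dx (mono (i, j)) = (i : ℝ) • mono (i - 1, j) := by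
  ext ⟨x, y⟩
  have h := hasDerivAt_fst ((contDiff_mono (i, j)).diff' (x, y))
  have h' : HasDerivAt (fun s => mono (i, j) (s, y)) ((i * x ^ (i - 1)) * y ^ j) x :=
    (hasDerivAt_pow i x).mul_const (y ^ j)
  rw [h.unique h']; simp [mono, mul_assoc]

theorem dy_mono (i j : ℕ) : dy (mono (i, j)) = (j : ℝ) • mono (i, j - 1) := by
  ext ⟨x, y⟩
  have h := hasDerivAt_snd ((contDiff_mono (i, j)).diff' (x, y))
  have h' : HasDerivAt (fun s => mono (i, j) (x, s)) (x ^ i * (j * y ^ (j - 1))) y :=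
    (hasDerivAt_pow j y).const_mul (x ^ i)
  rw [h.unique h']; simp [mono]; ring

theorem dx_mem {S : Set (ℕ × ℕ)} {g : ℝ × ℝ → ℝ} (h : g ∈ polySpan S) :
    dx g ∈ polySpan {p | (p.1 + 1, p.2) ∈ S} := by
  refine Submodule.span_induction (p := fun g _ => dx g ∈ polySpan {p | (p.1 + 1, p.2) ∈ S})
    ?_ ?_ ?_ ?_ h
  · rintro _ ⟨⟨i, j⟩, hp, rfl⟩
    rw [dx_mono]
    rcases i with _ | i
    · simp
    · exact Submodule.smul_mem _ _ (mono_mem (by simpa using hp))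
  · rw [dx_zero]; exact Submodule.zero_mem _
  · intro f g hf' hg' hf hg
    rw [dx_add (contDiff_of_mem_polySpan hf').diff' (contDiff_of_mem_polySpan hg').diff']
    exact Submodule.add_mem _ hf hg
  · intro a f hf' hf
    rw [dx_smul _ (contDiff_of_mem_polySpan hf').diff']
    exact Submodule.smul_mem _ _ hf

theorem dy_mem {S : Set (ℕ × ℕ)} {g : ℝ × ℝ → ℝ} (h : g ∈ polySpan S) :
    dy g ∈ polySpan {p | (p.1, p.2 + 1) ∈ S} := by
  refine Submodule.span_induction (p := fun g _ => dy g ∈ polySpan {p | (p.1, p.2 + 1) ∈ S})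
    ?_ ?_ ?_ ?_ h
  · rintro _ ⟨⟨i, j⟩, hp, rfl⟩
    rw [dy_mono]
    rcases j with _ | j
    · simp
    · exact Submodule.smul_mem _ _ (mono_mem (by simpa using hp))
  · rw [dy_zero]; exact Submodule.zero_mem _
  · intro f g hf' hg' hf hg
    rw [dy_add (contDiff_of_mem_polySpan hf').diff' (contDiff_of_mem_polySpan hg').diff']
    exact Submodule.add_mem _ hf hg
  · intro a f hf' hf
    rw [dy_smul _ (contDiff_of_mem_polySpan hf').diff']
    exact Submodule.smul_mem _ _ hf

theorem mem_polySpan_of_subset {S S' : Set (ℕ × ℕ)} {g : ℝ × ℝ → ℝ} (hg : g ∈ polySpan S)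
    (h : ∀ i j, (i, j) ∈ S → (i, j) ∈ S') : g ∈ polySpan S' :=
  polySpan_mono (fun p hp => h p.1 p.2 hp) hg

theorem IsP.isQ {m : ℕ} {g : ℝ × ℝ → ℝ} (h : IsP m g) : IsQ m m g :=
  isQ_iff.2 (mem_polySpan_of_subset (isP_iff.1 h) fun i j hp => by
    simp only [mem_ofPred_eq] at hp ⊢; omega)

theorem IsQ.mono {m n m' n' : ℕ} {g : ℝ × ℝ → ℝ} (h : IsQ m n g) (hm : m ≤ m') (hn : n ≤ n') :
    IsQ m' n' g :=
  isQ_iff.2 (mem_polySpan_of_subset (isQ_iff.1 h) fun i j hp => by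
    simp only [mem_ofPred_eq] at hp ⊢; omega)

theorem IsQ.dx {m n : ℕ} {g : ℝ × ℝ → ℝ} (h : IsQ m n g) : IsQ (m - 1) n (dx g) :=
  isQ_iff.2 (mem_polySpan_of_subset (dx_mem (isQ_iff.1 h)) fun i j hp => by
    simp only [mem_ofPred_eq] at hp ⊢; omega)

theorem IsQ.dy {m n : ℕ} {g : ℝ × ℝ → ℝ} (h : IsQ m n g) : IsQ m (n - 1) (dy g) :=
  isQ_iff.2 (mem_polySpan_of_subset (dy_mem (isQ_iff.1 h)) fun i j hp => by
    simp only [mem_ofPred_eq] at hp ⊢; omega)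

theorem IsP.dx {m : ℕ} {g : ℝ × ℝ → ℝ} (h : IsP (m + 1) g) : IsP m (dx g) :=
  isP_iff.2 (mem_polySpan_of_subset (dx_mem (isP_iff.1 h)) fun i j hp => by
    simp only [mem_ofPred_eq] at hp ⊢; omega)

theorem IsP.dy {m : ℕ} {g : ℝ × ℝ → ℝ} (h : IsP (m + 1) g) : IsP m (dy g) :=
  isP_iff.2 (mem_polySpan_of_subset (dy_mem (isP_iff.1 h)) fun i j hp => by
    simp only [mem_ofPred_eq] at hp ⊢; omega)

theorem IsQ.add {m n : ℕ} {f g : ℝ × ℝ → ℝ} (hf : IsQ m n f) (hg : IsQ m n g) : IsQ m n (f + g) :=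
  isQ_iff.2 (Submodule.add_mem _ (isQ_iff.1 hf) (isQ_iff.1 hg))

theorem IsQ.sub {m n : ℕ} {f g : ℝ × ℝ → ℝ} (hf : IsQ m n f) (hg : IsQ m n g) : IsQ m n (f - g) :=
  isQ_iff.2 (Submodule.sub_mem _ (isQ_iff.1 hf) (isQ_iff.1 hg))

theorem IsQ.smul {m n : ℕ} {f : ℝ × ℝ → ℝ} (c : ℝ) (hf : IsQ m n f) : IsQ m n (c • f) :=
  isQ_iff.2 (Submodule.smul_mem _ _ (isQ_iff.1 hf))

theorem IsQ.sum {m n : ℕ} {ι : Type*} (s : Finset ι) {f : ι → ℝ × ℝ → ℝ}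
    (h : ∀ i ∈ s, IsQ m n (f i)) : IsQ m n (∑ i ∈ s, f i) :=
  isQ_iff.2 (Submodule.sum_mem _ fun i hi => isQ_iff.1 (h i hi))

theorem IsP.add {m : ℕ} {f g : ℝ × ℝ → ℝ} (hf : IsP m f) (hg : IsP m g) : IsP m (f + g) :=
  isP_iff.2 (Submodule.add_mem _ (isP_iff.1 hf) (isP_iff.1 hg))

theorem IsP.sub {m : ℕ} {f g : ℝ × ℝ → ℝ} (hf : IsP m f) (hg : IsP m g) : IsP m (f - g) :=
  isP_iff.2 (Submodule.sub_mem _ (isP_iff.1 hf) (isP_iff.1 hg))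

theorem IsP.const (m : ℕ) (c : ℝ) : IsP m fun _ => c := by
  have : (fun _ => c : ℝ × ℝ → ℝ) = c • WG.mono (0, 0) := by ext; simp [WG.mono]
  rw [this]
  exact isP_iff.2 (Submodule.smul_mem _ _ (mono_mem (by simp)))

open Polynomial in
theorem isQ_mul_eval {m n : ℕ} {p q : ℝ[X]} (hp : p.natDegree ≤ m) (hq : q.natDegree ≤ n) :
    IsQ m n fun z => p.eval z.1 * q.eval z.2 := by
  refine ⟨fun i j => p.coeff i * q.coeff j, fun z => ?_⟩
  simp only
  rw [eval_eq_sum_range' (Nat.lt_succ_of_le hp), eval_eq_sum_range' (Nat.lt_succ_of_le hq),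
    Finset.sum_mul_sum]
  exact Finset.sum_congr rfl fun i _ => Finset.sum_congr rfl fun j _ => by ring

open Polynomial in
theorem IsQ.slice_fst {m n : ℕ} {g : ℝ × ℝ → ℝ} (h : IsQ m n g) (y : ℝ) :
    ∃ p : ℝ[X], p.natDegree ≤ m ∧ ∀ x, g (x, y) = p.eval x := by
  obtain ⟨c, hc⟩ := h
  refine ⟨∑ i ∈ Finset.range (m + 1),
    Polynomial.C (∑ j ∈ Finset.range (n + 1), c i j * y ^ j) * X ^ i, ?_, fun x => ?_⟩
  · refine natDegree_sum_le_of_forall_le _ _ fun i hi => ?_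
    refine (natDegree_C_mul_X_pow_le _ _).trans ?_
    simp at hi; omega
  · rw [hc, eval_finsetSum]
    refine Finset.sum_congr rfl fun i _ => ?_
    simp only [eval_mul, eval_C, eval_pow, eval_X, Finset.sum_mul]
    exact Finset.sum_congr rfl fun j _ => by ring

open Polynomial in
theorem IsQ.slice_snd {m n : ℕ} {g : ℝ × ℝ → ℝ} (h : IsQ m n g) (x : ℝ) :
    ∃ p : ℝ[X], p.natDegree ≤ n ∧ ∀ y, g (x, y) = p.eval y := by
  obtain ⟨c, hc⟩ := h
  refine ⟨∑ j ∈ Finset.range (n + 1),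
    Polynomial.C (∑ i ∈ Finset.range (m + 1), c i j * x ^ i) * X ^ j, ?_, fun y => ?_⟩
  · refine natDegree_sum_le_of_forall_le _ _ fun i hi => ?_
    refine (natDegree_C_mul_X_pow_le _ _).trans ?_
    simp at hi; omega
  · rw [hc, eval_finsetSum, Finset.sum_comm]
    refine Finset.sum_congr rfl fun i _ => ?_
    simp only [eval_mul, eval_C, eval_pow, eval_X, Finset.sum_mul]

end WG

namespace WG

/-! ### Integrals over rectangles -/

theorem Rect.width_pos (T : Rect) : 0 < T.width := sub_pos.2 T.hlr

theorem Rect.height_pos (T : Rect) : 0 < T.height := sub_pos.2 T.hbt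

theorem Rect.isCompact_carrier (T : Rect) : IsCompact T.carrier := isCompact_Icc.prod isCompact_Icc

theorem Rect.measurableSet_carrier (T : Rect) : MeasurableSet T.carrier :=
  T.isCompact_carrier.isClosed.measurableSet

theorem Rect.isOpen_inner (T : Rect) : IsOpen T.inner := isOpen_Ioo.prod isOpen_Ioo

theorem Rect.inner_subset (T : Rect) : T.inner ⊆ T.carrier :=
  Set.prod_mono Ioo_subset_Icc_self Ioo_subset_Icc_self

theorem Rect.mem_carrier {T : Rect} {z : ℝ × ℝ} :
    z ∈ T.carrier ↔ (T.l ≤ z.1 ∧ z.1 ≤ T.r) ∧ T.b ≤ z.2 ∧ z.2 ≤ T.t := Iff.rfl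

theorem Rect.mem_inner {T : Rect} {z : ℝ × ℝ} :
    z ∈ T.inner ↔ (T.l < z.1 ∧ z.1 < T.r) ∧ T.b < z.2 ∧ z.2 < T.t := Iff.rfl

theorem Rect.closure_inner (T : Rect) : closure T.inner = T.carrier := by
  rw [Rect.inner, closure_prod_eq, closure_Ioo T.hlr.ne, closure_Ioo T.hbt.ne]; rfl

theorem Rect.inner_ae_eq (T : Rect) : (T.inner : Set (ℝ × ℝ)) =ᵐ[volume] T.carrier := by
  rw [Measure.volume_eq_prod]
  exact Measure.set_prod_ae_eq Ioo_ae_eq_Icc Ioo_ae_eq_Icc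

theorem Rect.volume_carrier (T : Rect) :
    volume.real T.carrier = T.width * T.height := by
  rw [Rect.carrier, Measure.real, Measure.volume_eq_prod, Measure.prod_prod, Real.volume_Icc,
    Real.volume_Icc, ENNReal.toReal_mul, ENNReal.toReal_ofReal (sub_pos.2 T.hlr).le,
    ENNReal.toReal_ofReal (sub_pos.2 T.hbt).le]
  rfl

instance Rect.isFiniteMeasure (T : Rect) : IsFiniteMeasure (volume.restrict T.carrier) :=
  ⟨by rw [Measure.restrict_apply_univ]; exact T.isCompact_carrier.measure_lt_top⟩

theorem Rect.integral_eq {T : Rect} {g : ℝ × ℝ → ℝ} (hg : IntegrableOn g T.carrier) :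
    ∫ z in T.carrier, g z = ∫ x in T.l..T.r, ∫ y in T.b..T.t, g (x, y) := by
  rw [Rect.carrier, Measure.volume_eq_prod] at *
  rw [setIntegral_prod _ hg, intervalIntegral.integral_of_le T.hlr.le, integral_Icc_eq_integral_Ioc]
  refine setIntegral_congr_fun measurableSet_Ioc fun x _ => ?_
  rw [intervalIntegral.integral_of_le T.hbt.le, integral_Icc_eq_integral_Ioc]

theorem Rect.integral_eq' {T : Rect} {g : ℝ × ℝ → ℝ} (hg : IntegrableOn g T.carrier) :
    ∫ z in T.carrier, g z = ∫ y in T.b..T.t, ∫ x in T.l..T.r, g (x, y) := by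
  rw [Rect.carrier, Measure.volume_eq_prod] at *
  rw [IntegrableOn, ← Measure.prod_restrict] at hg
  rw [← Measure.prod_restrict, integral_prod_symm _ hg, intervalIntegral.integral_of_le T.hbt.le,
    integral_Icc_eq_integral_Ioc]
  refine setIntegral_congr_fun measurableSet_Ioc fun x _ => ?_
  rw [intervalIntegral.integral_of_le T.hlr.le, integral_Icc_eq_integral_Ioc]

theorem _root_.Continuous.integrableOn_rect {g : ℝ × ℝ → ℝ} (hg : Continuous g) (T : Rect) :
    IntegrableOn g T.carrier := hg.continuousOn.integrableOn_compact T.isCompact_carrier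

theorem Rect.integral_eq_of_continuous (T : Rect) {g : ℝ × ℝ → ℝ} (hg : Continuous g) :
    ∫ z in T.carrier, g z = ∫ x in T.l..T.r, ∫ y in T.b..T.t, g (x, y) :=
  Rect.integral_eq (hg.integrableOn_rect T)

theorem Rect.integral_eq_of_continuous' (T : Rect) {g : ℝ × ℝ → ℝ} (hg : Continuous g) :
    ∫ z in T.carrier, g z = ∫ y in T.b..T.t, ∫ x in T.l..T.r, g (x, y) :=
  Rect.integral_eq' (hg.integrableOn_rect T)

/-- The rectangle dilated by the factor `K` about its centre. -/
def Rect.dilate (T : Rect) (K : ℝ) : Set (ℝ × ℝ) :=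
  {z | |z.1 - (T.l + T.r) / 2| ≤ K * (T.width / 2) ∧ |z.2 - (T.b + T.t) / 2| ≤ K * (T.height / 2)}

theorem Rect.carrier_subset_dilate (T : Rect) {K : ℝ} (hK : 1 ≤ K) : T.carrier ⊆ T.dilate K := by
  rintro z ⟨⟨h1, h2⟩, h3, h4⟩
  have hw := T.width_pos
  have hh := T.height_pos
  refine ⟨(abs_le.2 ⟨?_, ?_⟩ : _ ≤ T.width / 2).trans (by nlinarith),
    (abs_le.2 ⟨?_, ?_⟩ : _ ≤ T.height / 2).trans (by nlinarith)⟩ <;>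
  simp only [Rect.width, Rect.height] <;> linarith

theorem continuous_intervalIntegral_fst {g : ℝ × ℝ → ℝ} (hg : Continuous g) (a b : ℝ) :
    Continuous fun y => ∫ x in a..b, g (x, y) :=
  intervalIntegral.continuous_parametric_intervalIntegral_of_continuous'
    (f := fun y x => g (x, y)) (hg.comp continuous_swap) a b

theorem continuous_intervalIntegral_snd {g : ℝ × ℝ → ℝ} (hg : Continuous g) (a b : ℝ) :
    Continuous fun x => ∫ y in a..b, g (x, y) :=
  intervalIntegral.continuous_parametric_intervalIntegral_of_continuous'
    (f := fun x y => g (x, y)) hg a b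

/-- Inverse estimates on a rectangle, valid at all points of a dilated rectangle. -/
theorem exists_inverse_estimate_rect (m : ℕ) (K : ℝ) : ∃ C : ℝ, 0 < C ∧ ∀ q, IsQ m m q →
    ∀ (T : Rect), ∀ z ∈ T.dilate K,
      (q z) ^ 2 ≤ C / (T.width * T.height) * ∫ w in T.carrier, (q w) ^ 2 ∧
      (dx q z) ^ 2 ≤ C / (T.width ^ 2 * (T.width * T.height)) * ∫ w in T.carrier, (q w) ^ 2 ∧
      (dy q z) ^ 2 ≤ C / (T.height ^ 2 * (T.width * T.height)) * ∫ w in T.carrier, (q w) ^ 2 := by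
  obtain ⟨C, hC, h⟩ := exists_inverse_estimate m K
  refine ⟨C ^ 2, by positivity, fun q hq T z hz => ?_⟩
  obtain ⟨x, y⟩ := z
  obtain ⟨hx, hy⟩ := hz
  simp only at hx hy
  have hw := T.width_pos
  have hh := T.height_pos
  have hqc : Continuous fun z => (q z) ^ 2 := hq.contDiff.continuous.pow 2
  have hd := hq.contDiff.diff'
  have hX : ∀ y, (q (x, y)) ^ 2 ≤ C / T.width * ∫ s in T.l..T.r, (q (s, y)) ^ 2 ∧
      (dx q (x, y)) ^ 2 ≤ C / T.width ^ 3 * ∫ s in T.l..T.r, (q (s, y)) ^ 2 := by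
    intro y
    obtain ⟨p, hp, hpe⟩ := hq.slice_fst y
    have hdx : dx q (x, y) = p.derivative.eval x := by
      refine (hasDerivAt_fst (hd (x, y))).unique ?_
      simp only [hpe]
      exact p.hasDerivAt x
    have := h p hp T.l T.r x T.hlr hx
    simpa only [hpe, hdx, Rect.width] using this
  have hY : ∀ x, (q (x, y)) ^ 2 ≤ C / T.height * ∫ s in T.b..T.t, (q (x, s)) ^ 2 ∧
      (dy q (x, y)) ^ 2 ≤ C / T.height ^ 3 * ∫ s in T.b..T.t, (q (x, s)) ^ 2 := by
    intro x
    obtain ⟨p, hp, hpe⟩ := hq.slice_snd x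
    have hdx : dy q (x, y) = p.derivative.eval y := by
      refine (hasDerivAt_snd (hd (x, y))).unique ?_
      simp only [hpe]
      exact p.hasDerivAt y
    have := h p hp T.b T.t y T.hbt hy
    simpa only [hpe, hdx, Rect.height] using this
  have hIx : ∫ s in T.l..T.r, (q (s, y)) ^ 2 ≤ C / T.height * ∫ w in T.carrier, (q w) ^ 2 := by
    rw [T.integral_eq_of_continuous hqc, ← intervalIntegral.integral_const_mul]
    refine intervalIntegral.integral_mono_on T.hlr.le ?_ ?_ fun s _ => (hY s).1
    · exact (hqc.comp (by fun_prop : Continuous fun s : ℝ => (s, y))).intervalIntegrable _ _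
    · exact (continuous_const.mul (continuous_intervalIntegral_snd hqc _ _)).intervalIntegrable _ _
  have hIy : ∫ s in T.b..T.t, (q (x, s)) ^ 2 ≤ C / T.width * ∫ w in T.carrier, (q w) ^ 2 := by
    rw [T.integral_eq_of_continuous' hqc, ← intervalIntegral.integral_const_mul]
    refine intervalIntegral.integral_mono_on T.hbt.le ?_ ?_ fun s _ => (hX s).1
    · exact (hqc.comp (by fun_prop : Continuous fun s : ℝ => (x, s))).intervalIntegrable _ _
    · exact (continuous_const.mul (continuous_intervalIntegral_fst hqc _ _)).intervalIntegrable _ _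
  refine ⟨?_, ?_, ?_⟩
  · calc _ ≤ C / T.width * ∫ s in T.l..T.r, (q (s, y)) ^ 2 := (hX y).1
      _ ≤ C / T.width * (C / T.height * ∫ w in T.carrier, (q w) ^ 2) := by gcongr
      _ = _ := by field_simp
  · calc _ ≤ C / T.width ^ 3 * ∫ s in T.l..T.r, (q (s, y)) ^ 2 := (hX y).2
      _ ≤ C / T.width ^ 3 * (C / T.height * ∫ w in T.carrier, (q w) ^ 2) := by gcongr
      _ = _ := by field_simp
  · calc _ ≤ C / T.height ^ 3 * ∫ s in T.b..T.t, (q (x, s)) ^ 2 := (hY x).2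
      _ ≤ C / T.height ^ 3 * (C / T.width * ∫ w in T.carrier, (q w) ^ 2) := by gcongr
      _ = _ := by field_simp

theorem integral_sq_le_of_abs_le {T : Rect} {g : ℝ × ℝ → ℝ} {ε : ℝ}
    (hg : ∀ z ∈ T.carrier, |g z| ≤ ε) :
    ∫ z in T.carrier, (g z) ^ 2 ≤ T.width * T.height * ε ^ 2 := by
  have h := norm_setIntegral_le_of_norm_le_const (μ := volume) (f := fun z => (g z) ^ 2)
    (C := ε ^ 2) T.isCompact_carrier.measure_lt_top fun z hz => by
      rw [Real.norm_eq_abs, abs_pow]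
      exact pow_le_pow_left₀ (abs_nonneg _) (hg z hz) 2
  rw [T.volume_carrier] at h
  exact (le_abs_self _).trans (h.trans (le_of_eq (mul_comm _ _)))

/-- Values and derivatives of a polynomial on a dilated rectangle, by its maximum on the
rectangle. -/
theorem exists_inverse_estimate_sup (m : ℕ) (K : ℝ) : ∃ C : ℝ, 0 < C ∧ ∀ q, IsQ m m q →
    ∀ (T : Rect) (ε : ℝ), (∀ z ∈ T.carrier, |q z| ≤ ε) → ∀ z ∈ T.dilate K,
      |q z| ≤ C * ε ∧ |dx q z| ≤ C / T.width * ε ∧ |dy q z| ≤ C / T.height * ε := by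
  obtain ⟨C, hC, h⟩ := exists_inverse_estimate_rect m K
  refine ⟨√C, by positivity, fun q hq T ε hε z hz => ?_⟩
  have hw := T.width_pos
  have hh := T.height_pos
  have hε0 : 0 ≤ ε := (abs_nonneg _).trans (hε (T.l, T.b) ⟨⟨le_rfl, T.hlr.le⟩, le_rfl, T.hbt.le⟩)
  have hI := integral_sq_le_of_abs_le hε
  obtain ⟨h1, h2, h3⟩ := h q hq T z hz
  refine ⟨abs_le_of_sq_le_sq ?_ (by positivity), abs_le_of_sq_le_sq ?_ (by positivity),
    abs_le_of_sq_le_sq ?_ (by positivity)⟩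
  · refine h1.trans ?_
    calc _ ≤ C / (T.width * T.height) * (T.width * T.height * ε ^ 2) := by gcongr
      _ = _ := by rw [mul_pow, Real.sq_sqrt hC.le]; field_simp
  · refine h2.trans ?_
    calc _ ≤ C / (T.width ^ 2 * (T.width * T.height)) * (T.width * T.height * ε ^ 2) := by gcongr
      _ = _ := by rw [mul_pow, div_pow, Real.sq_sqrt hC.le]; field_simp
  · refine h3.trans ?_
    calc _ ≤ C / (T.height ^ 2 * (T.width * T.height)) * (T.width * T.height * ε ^ 2) := by gcongr
      _ = _ := by rw [mul_pow, div_pow, Real.sq_sqrt hC.le]; field_simp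

end WG

namespace WG

/-! ### Lobatto points -/

section Lobatto

open Polynomial

theorem integral_derivative_mul (p q : ℝ[X]) (a b : ℝ) :
    ∫ x in a..b, p.derivative.eval x * q.eval x =
      p.eval b * q.eval b - p.eval a * q.eval a - ∫ x in a..b, p.eval x * q.derivative.eval x := by
  rw [eq_sub_iff_add_eq, ← intervalIntegral.integral_add]
  · rw [← intervalIntegral.integral_deriv_mul_eq_sub (u := fun x => p.eval x)
      (v := fun x => q.eval x) (fun x _ => p.hasDerivAt x) (fun x _ => q.hasDerivAt x)]
    · exact p.derivative.continuous.intervalIntegrable _ _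
    · exact q.derivative.continuous.intervalIntegrable _ _
  · exact (p.derivative.continuous.mul q.continuous).intervalIntegrable _ _
  · exact (p.continuous.mul q.derivative.continuous).intervalIntegrable _ _

/-- Rodrigues' formula gives polynomials orthogonal to those of lower degree. -/
theorem integral_rodrigues_mul (k : ℕ) : ∀ j ≤ k, ∀ f : ℝ[X], f.natDegree < j →
    ∫ x in (-1 : ℝ)..1, (derivative^[j] ((X ^ 2 - 1 : ℝ[X]) ^ k)).eval x * f.eval x = 0 := by
  intro j
  induction j with
  | zero => intro _ f hf; exact absurd hf (Nat.not_lt_zero _)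
  | succ j ih =>
    intro hj f hf
    have hdvd : (X ^ 2 - 1 : ℝ[X]) ∣ derivative^[j] ((X ^ 2 - 1 : ℝ[X]) ^ k) := by
      refine dvd_trans ?_ (pow_sub_dvd_iterate_derivative_of_pow_dvd j (dvd_refl _))
      exact dvd_pow_self _ (by omega)
    obtain ⟨w, hw⟩ := hdvd
    rw [Function.iterate_succ_apply', integral_derivative_mul]
    have h1 : (derivative^[j] ((X ^ 2 - 1 : ℝ[X]) ^ k)).eval 1 = 0 := by rw [hw]; simp
    have h2 : (derivative^[j] ((X ^ 2 - 1 : ℝ[X]) ^ k)).eval (-1) = 0 := by rw [hw]; simp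
    rw [h1, h2]
    by_cases hj0 : j = 0
    · subst hj0
      have : f.derivative = 0 := derivative_of_natDegree_zero (by omega)
      simp [this]
    · rw [ih (by omega) _ (lt_of_le_of_lt (natDegree_derivative_le f) (by omega))]
      simp

theorem lobattoPoly_eq (k : ℕ) :
    lobattoPoly k = (X ^ 2 - 1) * derivative^[k + 1] ((X ^ 2 - 1 : ℝ[X]) ^ k) := by
  rw [lobattoPoly, Function.iterate_succ_apply]

theorem natDegree_X_sq_sub_one_pow (k : ℕ) : ((X ^ 2 - 1 : ℝ[X]) ^ k).natDegree = 2 * k := by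
  rw [natDegree_pow, show (X ^ 2 - 1 : ℝ[X]) = X ^ 2 - C 1 by simp, natDegree_X_pow_sub_C, mul_comm]

theorem natDegree_lobattoPoly_le {k : ℕ} (hk : 1 ≤ k) : (lobattoPoly k).natDegree ≤ k + 1 := by
  rw [lobattoPoly_eq]
  refine natDegree_mul_le.trans ?_
  have h1 : (X ^ 2 - 1 : ℝ[X]).natDegree = 2 := by
    simpa using natDegree_X_sq_sub_one_pow 1
  have h2 := natDegree_iterate_derivative ((X ^ 2 - 1 : ℝ[X]) ^ k) (k + 1)
  rw [natDegree_X_sq_sub_one_pow] at h2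
  omega

theorem lobattoPoly_ne_zero {k : ℕ} (hk : 1 ≤ k) : lobattoPoly k ≠ 0 := by
  rw [lobattoPoly_eq]
  have hm : (X ^ 2 - 1 : ℝ[X]).Monic := by
    simpa using monic_X_pow_sub_C (1 : ℝ) (two_ne_zero)
  refine mul_ne_zero hm.ne_zero fun h => ?_
  have h1 := congrArg (fun p => p.coeff (k - 1)) h
  simp only [coeff_iterate_derivative, coeff_zero] at h1
  rw [show k - 1 + (k + 1) = 2 * k by omega] at h1
  have h2 : ((X ^ 2 - 1 : ℝ[X]) ^ k).coeff (2 * k) = 1 := by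
    have := (hm.pow k).coeff_natDegree
    rwa [natDegree_X_sq_sub_one_pow] at this
  rw [h2] at h1
  simp only [nsmul_eq_mul, mul_one, Nat.cast_eq_zero] at h1
  exact absurd (Nat.descFactorial_eq_zero_iff_lt.1 h1) (by omega)

theorem re_mem_Icc_of_root (k n : ℕ) : ∀ z ∈ (derivative^[n] ((X ^ 2 - 1 : ℂ[X]) ^ k)).rootSet ℂ,
    z.re ∈ Icc (-1 : ℝ) 1 := by
  have hconv : Convex ℝ (Complex.re ⁻¹' Icc (-1 : ℝ) 1) :=
    (convex_Icc (-1 : ℝ) 1).is_linear_preimage Complex.reLm.isLinear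
  induction n with
  | zero =>
    intro z hz
    have h := (mem_rootSet.1 hz).2
    simp only [Function.iterate_zero, id, map_pow, map_sub, map_one, aeval_X] at h
    have h' : (z - 1) * (z + 1) = 0 := by linear_combination eq_zero_of_pow_eq_zero h
    rcases mul_eq_zero.1 h' with h | h
    · rw [sub_eq_zero.1 h]; simp
    · rw [eq_neg_of_add_eq_zero_left h]; simp
  | succ n ih =>
    intro z hz
    rw [Function.iterate_succ_apply'] at hz
    by_cases hd : 0 < (derivative^[n] ((X ^ 2 - 1 : ℂ[X]) ^ k)).degree
    · exact convexHull_min ih hconv (rootSet_derivative_subset_convexHull_rootSet hd hz)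
    · have : derivative (derivative^[n] ((X ^ 2 - 1 : ℂ[X]) ^ k)) = 0 := by
        rw [not_lt] at hd
        rw [eq_C_of_degree_le_zero hd, derivative_C]
      rw [this] at hz
      simp at hz

variable {k : ℕ} {ζ ζ' : Fin (k + 1) → ℝ}

theorem mem_Icc_of_isRoot_lobattoPoly (hk : 1 ≤ k) {x : ℝ} (hx : (lobattoPoly k).IsRoot x) :
    x ∈ Icc (-1 : ℝ) 1 := by
  rw [lobattoPoly_eq, IsRoot.def, eval_mul] at hx
  rcases mul_eq_zero.1 hx with h | h
  · simp only [eval_sub, eval_pow, eval_X, eval_one] at h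
    constructor <;> nlinarith
  · have hne : derivative^[k + 1] ((X ^ 2 - 1 : ℝ[X]) ^ k) ≠ 0 := fun h0 =>
      lobattoPoly_ne_zero hk (by rw [lobattoPoly_eq, h0, mul_zero])
    have hmap : (derivative^[k + 1] ((X ^ 2 - 1 : ℝ[X]) ^ k)).map (algebraMap ℝ ℂ) =
        derivative^[k + 1] ((X ^ 2 - 1 : ℂ[X]) ^ k) := by
      rw [← iterate_derivative_map]; simp
    have := re_mem_Icc_of_root k (k + 1) (x : ℂ) (by
      rw [mem_rootSet, ← hmap]
      refine ⟨(Polynomial.map_ne_zero_iff (algebraMap ℝ ℂ).injective).2 hne, ?_⟩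
      rw [aeval_map_algebraMap]
      have : aeval (algebraMap ℝ ℂ x) (derivative^[k + 1] ((X ^ 2 - 1 : ℝ[X]) ^ k)) = 0 := by
        rw [aeval_algebraMap_apply, coe_aeval_eq_eval, h, map_zero]
      exact this)
    simpa using this

theorem IsLobattoPoints.mem_range (hk : 1 ≤ k) (h : IsLobattoPoints k ζ) {x : ℝ} :
    x ∈ range ζ ↔ (lobattoPoly k).IsRoot x := by
  constructor
  · rintro ⟨i, rfl⟩; exact h.2 i
  · intro hx
    have hsub : Finset.univ.image ζ ⊆ (lobattoPoly k).roots.toFinset := by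
      intro y hy
      obtain ⟨i, -, rfl⟩ := Finset.mem_image.1 hy
      rw [Multiset.mem_toFinset, mem_roots (lobattoPoly_ne_zero hk)]
      exact h.2 i
    have hcard : (lobattoPoly k).roots.toFinset.card ≤ (Finset.univ.image ζ).card := by
      rw [Finset.card_image_of_injective _ h.1.injective, Finset.card_univ, Fintype.card_fin]
      exact (Multiset.toFinset_card_le _).trans ((card_roots' _).trans (natDegree_lobattoPoly_le hk))
    have heq := Finset.eq_of_subset_of_card_le hsub hcard
    have hx' : x ∈ (lobattoPoly k).roots.toFinset := by
      rw [Multiset.mem_toFinset, mem_roots (lobattoPoly_ne_zero hk)]; exact hx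
    rw [← heq] at hx'
    simpa using hx'

theorem IsLobattoPoints.unique (hk : 1 ≤ k) (h : IsLobattoPoints k ζ) (h' : IsLobattoPoints k ζ') :
    ζ = ζ' := by
  refine (h.1.range_inj h'.1).1 ?_
  ext x
  rw [h.mem_range hk, h'.mem_range hk]

theorem IsLobattoPoints.mem_Icc (hk : 1 ≤ k) (h : IsLobattoPoints k ζ) (i : Fin (k + 1)) :
    ζ i ∈ Icc (-1 : ℝ) 1 := mem_Icc_of_isRoot_lobattoPoly hk (h.2 i)

theorem IsLobattoPoints.apply_zero (hk : 1 ≤ k) (h : IsLobattoPoints k ζ) : ζ 0 = -1 := by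
  obtain ⟨i, hi⟩ := (h.mem_range hk).2 (show (lobattoPoly k).IsRoot (-1) by simp [lobattoPoly])
  have h1 := h.1.monotone (Fin.zero_le i)
  have h2 := (h.mem_Icc hk 0).1
  linarith

theorem IsLobattoPoints.apply_last (hk : 1 ≤ k) (h : IsLobattoPoints k ζ) :
    ζ (Fin.last k) = 1 := by
  obtain ⟨i, hi⟩ := (h.mem_range hk).2 (show (lobattoPoly k).IsRoot 1 by simp [lobattoPoly])
  have h1 := h.1.monotone (Fin.le_last i)
  have h2 := (h.mem_Icc hk (Fin.last k)).2
  linarith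

theorem IsLobattoPoints.exists_gap (h : IsLobattoPoints k ζ) :
    ∃ δ : ℝ, 0 < δ ∧ ∀ i j, i ≠ j → δ ≤ |ζ i - ζ j| := by
  have : ∀ p : Fin (k + 1) × Fin (k + 1), ∃ d : ℝ, 0 < d ∧ (p.1 ≠ p.2 → d ≤ |ζ p.1 - ζ p.2|) := by
    intro p
    by_cases hp : p.1 = p.2
    · exact ⟨1, one_pos, fun h => absurd hp h⟩
    · exact ⟨_, abs_pos.2 (sub_ne_zero.2 (h.1.injective.ne hp)), fun _ => le_rfl⟩
  choose d hd hd' using this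
  refine ⟨Finset.univ.inf' Finset.univ_nonempty d, ?_, fun i j hij => ?_⟩
  · rw [Finset.lt_inf'_iff]; exact fun p _ => hd p
  · exact (Finset.inf'_le d (Finset.mem_univ (i, j))).trans (hd' (i, j) hij)

theorem IsLobattoPoints.integral_nodal (hk : 1 ≤ k) (h : IsLobattoPoints k ζ) {v : ℝ[X]}
    (hv : v.natDegree ≤ k - 1) :
    ∫ x in (-1 : ℝ)..1, (Lagrange.nodal Finset.univ ζ).derivative.eval x * v.eval x = 0 := by
  have hdeg : (Lagrange.nodal Finset.univ ζ).natDegree = k + 1 := by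
    rw [Lagrange.natDegree_nodal]; simp
  have hdvd : Lagrange.nodal Finset.univ ζ ∣ lobattoPoly k := by
    rw [Lagrange.nodal_eq]
    refine Finset.prod_dvd_of_coprime ?_ fun i _ => dvd_iff_isRoot.2 (h.2 i)
    intro i _ j _ hij
    exact isCoprime_X_sub_C_of_isUnit_sub (sub_ne_zero.2 (h.1.injective.ne hij)).isUnit
  obtain ⟨c, hc⟩ := hdvd
  have hc0 : c ≠ 0 := by
    rintro rfl; exact lobattoPoly_ne_zero hk (by rw [hc, mul_zero])
  have hcd : c.natDegree = 0 := by
    have h1 := natDegree_lobattoPoly_le hk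
    rw [hc, natDegree_mul Lagrange.nodal_ne_zero hc0, hdeg] at h1
    omega
  obtain ⟨a, rfl⟩ := natDegree_eq_zero.1 hcd
  have ha : a ≠ 0 := by rintro rfl; exact hc0 (C_0)
  have hN : Lagrange.nodal Finset.univ ζ = C a⁻¹ * lobattoPoly k := by
    rw [hc, mul_comm, mul_assoc, ← C_mul, mul_inv_cancel₀ ha, C_1, mul_one]
  rw [hN, integral_derivative_mul]
  have e1 : (lobattoPoly k).eval 1 = 0 := by simp [lobattoPoly]
  have e2 : (lobattoPoly k).eval (-1) = 0 := by simp [lobattoPoly]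
  simp only [eval_mul, e1, e2, mul_zero, zero_mul, sub_zero, zero_sub, eval_C, mul_assoc,
    intervalIntegral.integral_const_mul, neg_eq_zero, mul_eq_zero, inv_eq_zero, ha, false_or]
  have hkey := integral_derivative_mul (derivative^[k] ((X ^ 2 - 1 : ℝ[X]) ^ k))
    ((X ^ 2 - 1) * v.derivative) (-1) 1
  rw [← Function.iterate_succ_apply' derivative] at hkey
  have hz : ∫ x in (-1 : ℝ)..1, (derivative^[k] ((X ^ 2 - 1 : ℝ[X]) ^ k)).eval x *
      ((X ^ 2 - 1) * v.derivative).derivative.eval x = 0 := by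
    apply integral_rodrigues_mul k k le_rfl
    by_cases hv0 : v.derivative = 0
    · rw [hv0]; simp; omega
    have hvd : v.derivative.natDegree ≤ k - 2 := (natDegree_derivative_le v).trans (by omega)
    have hk2 : 2 ≤ k := by
      by_contra hk2
      exact hv0 (derivative_of_natDegree_zero (by omega))
    have h1 : (X ^ 2 - 1 : ℝ[X]).natDegree = 2 := by
      simpa using natDegree_X_sq_sub_one_pow 1
    have h2 := natDegree_derivative_le ((X ^ 2 - 1) * v.derivative)
    have h3 := natDegree_mul_le (p := (X ^ 2 - 1 : ℝ[X])) (q := v.derivative)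
    omega
  rw [hz] at hkey
  simp only [eval_mul, eval_sub, eval_pow, eval_X, eval_one] at hkey
  norm_num at hkey
  rw [← hkey]
  congr 1
  ext x
  rw [lobattoPoly_eq]
  simp only [eval_mul, eval_sub, eval_pow, eval_X, eval_one]
  rw [Function.iterate_succ_apply]
  ring

/-- The points of `[a, b]` that correspond to the points `ζ i` of `[-1, 1]`. -/
noncomputable def scaledPoint (ζ : Fin (k + 1) → ℝ) (a b : ℝ) (i : Fin (k + 1)) : ℝ :=
  (a + b) / 2 + (b - a) / 2 * ζ i

theorem IsLobattoPoints.integral_nodal_scaled (hk : 1 ≤ k) (h : IsLobattoPoints k ζ) {v : ℝ[X]}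
    (hv : v.natDegree ≤ k - 1) {a b : ℝ} (hab : a < b) :
    ∫ x in a..b, (Lagrange.nodal Finset.univ (scaledPoint ζ a b)).derivative.eval x * v.eval x
      = 0 := by
  set d := (b - a) / 2 with hd
  have hd0 : d ≠ 0 := by rw [hd]; linarith
  have hN : (Lagrange.nodal Finset.univ (scaledPoint ζ a b)).comp (C d * X + C ((a + b) / 2)) =
      C (d ^ (k + 1)) * Lagrange.nodal Finset.univ ζ := by
    rw [Lagrange.nodal_eq, Lagrange.nodal_eq, prod_comp]
    have : ∀ i, (X - C (scaledPoint ζ a b i)).comp (C d * X + C ((a + b) / 2)) =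
        C d * (X - C (ζ i)) := by
      intro i
      rw [sub_comp, X_comp, C_comp, scaledPoint, C_add, C_mul, ← hd]
      ring
    simp only [this, Finset.prod_mul_distrib, Finset.prod_const, Finset.card_univ,
      Fintype.card_fin, C_pow]
  have hN' : ∀ s, d * (Lagrange.nodal Finset.univ (scaledPoint ζ a b)).derivative.eval
      (d * s + (a + b) / 2) = d ^ (k + 1) * (Lagrange.nodal Finset.univ ζ).derivative.eval s := by
    intro s
    generalize d ^ (k + 1) = e at hN
    have := congrArg (fun p => p.derivative.eval s) hN
    simpa [derivative_comp] using this
  have hv' : (v.comp (C d * X + C ((a + b) / 2))).natDegree ≤ k - 1 := by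
    refine natDegree_comp_le.trans ((Nat.mul_le_mul hv natDegree_linear_le).trans (by simp))
  have h0 := h.integral_nodal hk hv'
  have hsub := intervalIntegral.integral_comp_mul_add (a := -1) (b := 1) (fun x =>
    (Lagrange.nodal Finset.univ (scaledPoint ζ a b)).derivative.eval x * v.eval x) hd0 ((a + b) / 2)
  rw [show d * -1 + (a + b) / 2 = a by rw [hd]; ring, show d * 1 + (a + b) / 2 = b by rw [hd]; ring,
    smul_eq_mul] at hsub
  have h1 : d * ∫ s in (-1 : ℝ)..1, (Lagrange.nodal Finset.univ (scaledPoint ζ a b)).derivative.eval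
      (d * s + (a + b) / 2) * v.eval (d * s + (a + b) / 2) = 0 := by
    rw [← intervalIntegral.integral_const_mul]
    simp only [← mul_assoc, hN', eval_comp, eval_add, eval_mul, eval_C, eval_X] at h0 ⊢
    simp only [mul_assoc, intervalIntegral.integral_const_mul]
    rw [h0, mul_zero]
  rw [hsub, ← mul_assoc, mul_inv_cancel₀ hd0, one_mul] at h1
  exact h1

end Lobatto

end WG

namespace WG

/-! ### Tensor grids and interpolation at the Lobatto nodes -/

/-- A polynomial in `Q_m` is controlled by its values on a well separated tensor grid. -/
theorem IsQ.abs_le_of_grid {m : ℕ} {q : ℝ × ℝ → ℝ} (hq : IsQ m m q) {X Y : Fin (m + 1) → ℝ}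
    {δ δ' K K' ε : ℝ} (hδ : 0 < δ) (hδ' : 0 < δ') (hX : ∀ i j, i ≠ j → δ ≤ |X i - X j|)
    (hY : ∀ i j, i ≠ j → δ' ≤ |Y i - Y j|) (hε : ∀ i j, |q (X i, Y j)| ≤ ε) {x y : ℝ}
    (hx : ∀ i, |x - X i| ≤ K) (hy : ∀ i, |y - Y i| ≤ K') :
    |q (x, y)| ≤ (m + 1) * (K / δ) ^ m * ((m + 1) * (K' / δ') ^ m * ε) := by
  obtain ⟨p, hp, hpe⟩ := hq.slice_fst y
  rw [hpe]
  refine abs_eval_le_of_separated hδ X hX hp (fun i => ?_) hx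
  rw [← hpe]
  obtain ⟨p', hp', hpe'⟩ := hq.slice_snd (X i)
  rw [hpe']
  exact abs_eval_le_of_separated hδ' Y hY hp' (fun j => by rw [← hpe']; exact hε i j) hy

variable {k : ℕ} {ζ : Fin (k + 1) → ℝ}

theorem Rect.node_eq (T : Rect) (ζ : Fin (k + 1) → ℝ) (ij : Fin (k + 1) × Fin (k + 1)) :
    T.node ζ ij = (scaledPoint ζ T.l T.r ij.1, scaledPoint ζ T.b T.t ij.2) := rfl

theorem scaledPoint_mem_Icc (hk : 1 ≤ k) (hζ : IsLobattoPoints k ζ) {a b : ℝ} (hab : a ≤ b)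
    (i : Fin (k + 1)) : scaledPoint ζ a b i ∈ Icc a b := by
  obtain ⟨h1, h2⟩ := hζ.mem_Icc hk i
  constructor <;> unfold scaledPoint <;> nlinarith

theorem Rect.node_mem (hk : 1 ≤ k) (hζ : IsLobattoPoints k ζ) (T : Rect)
    (ij : Fin (k + 1) × Fin (k + 1)) : T.node ζ ij ∈ T.carrier :=
  ⟨scaledPoint_mem_Icc hk hζ T.hlr.le _, scaledPoint_mem_Icc hk hζ T.hbt.le _⟩

theorem abs_scaledPoint_sub (ζ : Fin (k + 1) → ℝ) {a b : ℝ} (hab : a < b) (i j : Fin (k + 1)) :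
    |scaledPoint ζ a b i - scaledPoint ζ a b j| = (b - a) / 2 * |ζ i - ζ j| := by
  have : scaledPoint ζ a b i - scaledPoint ζ a b j = (b - a) / 2 * (ζ i - ζ j) := by
    unfold scaledPoint; ring
  rw [this, abs_mul, abs_of_pos (by linarith)]

/-- A polynomial in `Q_k` is controlled by its values at the nodes of the rectangle. -/
theorem exists_abs_le_of_nodes (hk : 1 ≤ k) (hζ : IsLobattoPoints k ζ) : ∃ C : ℝ, 0 < C ∧ ∀ q,
    IsQ k k q → ∀ (T : Rect) (ε : ℝ), (∀ ij, |q (T.node ζ ij)| ≤ ε) → ∀ z ∈ T.carrier,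
      |q z| ≤ C * ε := by
  obtain ⟨δ, hδ, hgap⟩ := hζ.exists_gap
  refine ⟨((k + 1) * (2 / δ) ^ k) * ((k + 1) * (2 / δ) ^ k), by positivity,
    fun q hq T ε hε z hz => ?_⟩
  have hw := T.width_pos
  have hh := T.height_pos
  have hsep : ∀ a b, a < b → ∀ i j, i ≠ j → (b - a) / 2 * δ ≤ |scaledPoint ζ a b i -
      scaledPoint ζ a b j| := by
    intro a b hab i j hij
    rw [abs_scaledPoint_sub ζ hab]
    exact mul_le_mul_of_nonneg_left (hgap i j hij) (by linarith)
  have hdist : ∀ a b, a < b → ∀ x ∈ Icc a b, ∀ i, |x - scaledPoint ζ a b i| ≤ b - a := by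
    intro a b hab x hx i
    have := scaledPoint_mem_Icc hk hζ hab.le i
    exact abs_le.2 ⟨by linarith [hx.1, this.2], by linarith [hx.2, this.1]⟩
  have h := hq.abs_le_of_grid (X := scaledPoint ζ T.l T.r) (Y := scaledPoint ζ T.b T.t)
    (δ := T.width / 2 * δ) (δ' := T.height / 2 * δ) (by positivity) (by positivity)
    (hsep _ _ T.hlr) (hsep _ _ T.hbt) (fun i j => hε (i, j)) (hdist _ _ T.hlr z.1 hz.1)
    (hdist _ _ T.hbt z.2 hz.2)
  rw [show T.r - T.l = T.width from rfl, show T.t - T.b = T.height from rfl] at h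
  rw [show T.width / (T.width / 2 * δ) = 2 / δ by field_simp,
    show T.height / (T.height / 2 * δ) = 2 / δ by field_simp] at h
  simp only [Prod.mk.eta] at h
  linarith

theorem IsQ.eq_zero_of_nodes (hζ : IsLobattoPoints k ζ) {q : ℝ × ℝ → ℝ} (hq : IsQ k k q) (T : Rect)
    (h0 : ∀ ij, q (T.node ζ ij) = 0) (z : ℝ × ℝ) : q z = 0 := by
  obtain ⟨δ, hδ, hgap⟩ := hζ.exists_gap
  have hw := T.width_pos
  have hh := T.height_pos
  have hsep : ∀ a b, a < b → ∀ i j, i ≠ j → (b - a) / 2 * δ ≤ |scaledPoint ζ a b i -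
      scaledPoint ζ a b j| := by
    intro a b hab i j hij
    rw [abs_scaledPoint_sub ζ hab]
    exact mul_le_mul_of_nonneg_left (hgap i j hij) (by linarith)
  have hfin : ∀ (x : ℝ) (X : Fin (k + 1) → ℝ), ∀ i, |x - X i| ≤ ∑ i, |x - X i| := fun x X i =>
    Finset.single_le_sum (f := fun i => |x - X i|) (fun _ _ => abs_nonneg _) (Finset.mem_univ i)
  have h := hq.abs_le_of_grid (X := scaledPoint ζ T.l T.r) (Y := scaledPoint ζ T.b T.t)
    (δ := T.width / 2 * δ) (δ' := T.height / 2 * δ) (ε := 0) (by positivity) (by positivity)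
    (hsep _ _ T.hlr) (hsep _ _ T.hbt) (fun i j => (by
      have := h0 (i, j)
      rw [T.node_eq] at this
      simp only at this
      rw [this, abs_zero])) (hfin z.1 _) (hfin z.2 _)
  simp only [mul_zero, Prod.mk.eta] at h
  exact abs_nonpos_iff.1 h

open Polynomial in
/-- The Lagrange basis polynomials of the points `ζ`. -/
noncomputable def lagr (ζ : Fin (k + 1) → ℝ) (i : Fin (k + 1)) : ℝ[X] :=
  Lagrange.basis Finset.univ ζ i

theorem natDegree_lagr (hζ : IsLobattoPoints k ζ) (i : Fin (k + 1)) : (lagr ζ i).natDegree ≤ k := by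
  rw [lagr, Lagrange.natDegree_basis hζ.1.injective.injOn (Finset.mem_univ i)]
  simp

theorem lagr_eval (hζ : IsLobattoPoints k ζ) (i j : Fin (k + 1)) :
    (lagr ζ i).eval (ζ j) = if i = j then 1 else 0 := by
  split_ifs with h
  · subst h; exact Lagrange.eval_basis_self hζ.1.injective.injOn (Finset.mem_univ i)
  · exact Lagrange.eval_basis_of_ne h (Finset.mem_univ j)

/-- The interpolant of `g` in `Q_k` at the nodes of `T`. -/
noncomputable def interp (ζ : Fin (k + 1) → ℝ) (T : Rect) (g : ℝ × ℝ → ℝ) : ℝ × ℝ → ℝ := fun z =>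
  ∑ i, ∑ j, g (T.node ζ (i, j)) * ((lagr ζ i).eval ((z.1 - (T.l + T.r) / 2) / (T.width / 2)) *
    (lagr ζ j).eval ((z.2 - (T.b + T.t) / 2) / (T.height / 2)))

theorem isQ_interp (hζ : IsLobattoPoints k ζ) (T : Rect) (g : ℝ × ℝ → ℝ) :
    IsQ k k (interp ζ T g) := by
  have hlin : ∀ c d : ℝ, ∀ i, ((lagr ζ i).comp (Polynomial.C (1 / d) * Polynomial.X +
      Polynomial.C (-(c / d)))).natDegree ≤ k := fun c d i =>
    Polynomial.natDegree_comp_le.trans ((Nat.mul_le_mul (natDegree_lagr hζ i)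
      Polynomial.natDegree_linear_le).trans (by simp))
  have : interp ζ T g = ∑ i, ∑ j, g (T.node ζ (i, j)) • fun z : ℝ × ℝ =>
      ((lagr ζ i).comp (Polynomial.C (1 / (T.width / 2)) * Polynomial.X +
        Polynomial.C (-((T.l + T.r) / 2 / (T.width / 2))))).eval z.1 *
      ((lagr ζ j).comp (Polynomial.C (1 / (T.height / 2)) * Polynomial.X +
        Polynomial.C (-((T.b + T.t) / 2 / (T.height / 2))))).eval z.2 := by
    ext z
    simp only [interp, Finset.sum_apply, Pi.smul_apply, smul_eq_mul, Polynomial.eval_comp,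
      Polynomial.eval_add, Polynomial.eval_mul, Polynomial.eval_C, Polynomial.eval_X]
    refine Finset.sum_congr rfl fun i _ => Finset.sum_congr rfl fun j _ => ?_
    congr 3 <;> ring
  rw [this]
  exact IsQ.sum _ fun i _ => IsQ.sum _ fun j _ => (isQ_mul_eval (hlin _ _ i) (hlin _ _ j)).smul _

theorem interp_node (hζ : IsLobattoPoints k ζ) (T : Rect) (g : ℝ × ℝ → ℝ)
    (ij : Fin (k + 1) × Fin (k + 1)) : interp ζ T g (T.node ζ ij) = g (T.node ζ ij) := by
  have hw := T.width_pos
  have hh := T.height_pos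
  have e1 : ((T.node ζ ij).1 - (T.l + T.r) / 2) / (T.width / 2) = ζ ij.1 := by
    simp only [Rect.node]; field_simp; ring
  have e2 : ((T.node ζ ij).2 - (T.b + T.t) / 2) / (T.height / 2) = ζ ij.2 := by
    simp only [Rect.node]; field_simp; ring
  simp only [interp, e1, e2, lagr_eval hζ]
  rw [Finset.sum_eq_single ij.1, Finset.sum_eq_single ij.2]
  · simp
  · intro j _ hj; simp [hj]
  · simp
  · intro i _ hi; simp [hi]
  · simp

theorem interp_eq_of_isQ (hζ : IsLobattoPoints k ζ) (T : Rect) {q g : ℝ × ℝ → ℝ} (hq : IsQ k k q)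
    (h : ∀ ij, g (T.node ζ ij) = q (T.node ζ ij)) : interp ζ T g = q := by
  ext z
  have := ((isQ_interp hζ T g).sub hq).eq_zero_of_nodes hζ T
    (fun ij => by rw [Pi.sub_apply, interp_node hζ, h, sub_self]) z
  exact sub_eq_zero.1 this

theorem interp_sub (T : Rect) (g g' : ℝ × ℝ → ℝ) :
    interp ζ T (g - g') = interp ζ T g - interp ζ T g' := by
  ext z
  simp only [interp, Pi.sub_apply, sub_mul, Finset.sum_sub_distrib]

/-- On an edge the interpolant depends only on the values at the nodes of the edge. -/
theorem interp_edge (hk : 1 ≤ k) (hζ : IsLobattoPoints k ζ) (T : Rect) (g : ℝ × ℝ → ℝ) (e : Fin 4)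
    (s : ℝ) : interp ζ T g ((T.edge e).pt s) =
      ∑ j, g ((T.edge e).pt ((1 + ζ j) / 2)) * (lagr ζ j).eval (2 * s - 1) := by
  have hw := T.width_pos
  have hh := T.height_pos
  have h0 : ∀ i, (lagr ζ i).eval (-1) = if i = 0 then 1 else 0 := fun i => by
    have := lagr_eval hζ i 0
    rwa [hζ.apply_zero hk] at this
  have h1 : ∀ i, (lagr ζ i).eval 1 = if i = Fin.last k then 1 else 0 := fun i => by
    have := lagr_eval hζ i (Fin.last k)
    rwa [hζ.apply_last hk] at this
  have el : (T.l - (T.l + T.r) / 2) / (T.width / 2) = -1 := by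
    rw [div_eq_iff (by positivity), Rect.width]; ring
  have er : (T.r - (T.l + T.r) / 2) / (T.width / 2) = 1 := by
    rw [div_eq_iff (by positivity), Rect.width]; ring
  have eb : (T.b - (T.b + T.t) / 2) / (T.height / 2) = -1 := by
    rw [div_eq_iff (by positivity), Rect.height]; ring
  have et : (T.t - (T.b + T.t) / 2) / (T.height / 2) = 1 := by
    rw [div_eq_iff (by positivity), Rect.height]; ring
  have es : (T.l + s * (T.r - T.l) - (T.l + T.r) / 2) / (T.width / 2) = 2 * s - 1 := by
    rw [div_eq_iff (by positivity), Rect.width]; ring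
  have es' : (T.b + s * (T.t - T.b) - (T.b + T.t) / 2) / (T.height / 2) = 2 * s - 1 := by
    rw [div_eq_iff (by positivity), Rect.height]; ring
  fin_cases e <;> simp [interp, Edge.pt, Rect.edge, el, er, eb, et, es, es', h0, h1,
    Finset.sum_ite_eq'] <;>
  refine Finset.sum_congr rfl fun j _ => ?_ <;> congr 2 <;>
  simp only [Rect.node, hζ.apply_zero hk, hζ.apply_last hk, Rect.width, Rect.height,
    Prod.mk.injEq] <;> constructor <;> ring

end WG

namespace WG

/-! ### Higher derivatives of polynomials -/

theorem D_add {f g : ℝ × ℝ → ℝ} (hf : ContDiff ℝ ∞ f) (hg : ContDiff ℝ ∞ g) (a b : ℕ) :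
    dx^[a] (dy^[b] (f + g)) = dx^[a] (dy^[b] f) + dx^[a] (dy^[b] g) := by
  have h1 : dy^[b] (f + g) = dy^[b] f + dy^[b] g := by
    induction b with
    | zero => rfl
    | succ n ih =>
      simp only [Function.iterate_succ_apply', ih]
      exact dy_add (contDiff_iter hf 0 n).diff' (contDiff_iter hg 0 n).diff'
  rw [h1]
  induction a with
  | zero => rfl
  | succ n ih =>
    simp only [Function.iterate_succ_apply', ih]
    exact dx_add (contDiff_iter hf n b).diff' (contDiff_iter hg n b).diff'

theorem D_smul {f : ℝ × ℝ → ℝ} (c : ℝ) (hf : ContDiff ℝ ∞ f) (a b : ℕ) :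
    dx^[a] (dy^[b] (c • f)) = c • dx^[a] (dy^[b] f) := by
  have h1 : dy^[b] (c • f) = c • dy^[b] f := by
    induction b with
    | zero => rfl
    | succ n ih =>
      simp only [Function.iterate_succ_apply', ih]
      exact dy_smul c (contDiff_iter hf 0 n).diff'
  rw [h1]
  induction a with
  | zero => rfl
  | succ n ih =>
    simp only [Function.iterate_succ_apply', ih]
    exact dx_smul c (contDiff_iter hf n b).diff'

theorem D_sub {f g : ℝ × ℝ → ℝ} (hf : ContDiff ℝ ∞ f) (hg : ContDiff ℝ ∞ g) (a b : ℕ) :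
    dx^[a] (dy^[b] (f - g)) = dx^[a] (dy^[b] f) - dx^[a] (dy^[b] g) := by
  have : f - g = f + (-1 : ℝ) • g := by simp [sub_eq_add_neg]
  have hg' : ContDiff ℝ ∞ ((-1 : ℝ) • g) := contDiff_const.smul hg
  rw [this, D_add hf hg', D_smul _ hg]
  simp [sub_eq_add_neg]

theorem D_zero (a b : ℕ) : dx^[a] (dy^[b] 0) = 0 := by
  simpa using D_smul 0 (f := 0) contDiff_const a b

theorem D_mono (a b i j : ℕ) : dx^[a] (dy^[b] (mono (i, j))) =
    ((i.descFactorial a : ℝ) * (j.descFactorial b)) • mono (i - a, j - b) := by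
  have h1 : dy^[b] (mono (i, j)) = (j.descFactorial b : ℝ) • mono (i, j - b) := by
    induction b with
    | zero => simp
    | succ n ih =>
      rw [Function.iterate_succ_apply', ih, dy_smul _ (contDiff_mono _).diff', dy_mono, smul_smul,
        Nat.descFactorial_succ, Nat.sub_sub]
      push_cast
      rw [mul_comm]
  have h2 := D_smul (j.descFactorial b : ℝ) (contDiff_mono (i, j - b)) a 0
  simp only [Function.iterate_zero, id] at h2
  rw [h1, h2, mul_comm, ← smul_smul]
  congr 1
  clear h1 h2
  induction a with
  | zero => simp
  | succ n ih =>
    rw [Function.iterate_succ_apply', ih, dx_smul _ (contDiff_mono _).diff', dx_mono, smul_smul,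
      Nat.descFactorial_succ, Nat.sub_sub]
    push_cast
    rw [mul_comm]

theorem D_mem {S : Set (ℕ × ℕ)} {g : ℝ × ℝ → ℝ} (h : g ∈ polySpan S) (a b : ℕ) :
    dx^[a] (dy^[b] g) ∈ polySpan {p | (p.1 + a, p.2 + b) ∈ S} := by
  refine Submodule.span_induction
    (p := fun g _ => dx^[a] (dy^[b] g) ∈ polySpan {p | (p.1 + a, p.2 + b) ∈ S}) ?_ ?_ ?_ ?_ h
  · rintro _ ⟨⟨i, j⟩, hp, rfl⟩
    rw [D_mono]
    by_cases hi : a ≤ i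
    · by_cases hj : b ≤ j
      · refine Submodule.smul_mem _ _ (mono_mem ?_)
        simp only [mem_ofPred_eq, Nat.sub_add_cancel hi, Nat.sub_add_cancel hj]; exact hp
      · rw [Nat.descFactorial_eq_zero_iff_lt.2 (not_le.1 hj)]; simp
    · rw [Nat.descFactorial_eq_zero_iff_lt.2 (not_le.1 hi)]; simp
  · rw [D_zero]; exact Submodule.zero_mem _
  · intro f g hf' hg' hf hg
    rw [D_add (contDiff_of_mem_polySpan hf') (contDiff_of_mem_polySpan hg')]
    exact Submodule.add_mem _ hf hg
  · intro c f hf' hf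
    rw [D_smul c (contDiff_of_mem_polySpan hf')]
    exact Submodule.smul_mem _ _ hf

theorem D_eq_zero_of_isP {m : ℕ} {g : ℝ × ℝ → ℝ} (h : IsP m g) {a b : ℕ} (hab : m < a + b) :
    dx^[a] (dy^[b] g) = 0 := by
  have h1 := D_mem (isP_iff.1 h) a b
  have h2 : {p : ℕ × ℕ | (p.1 + a, p.2 + b) ∈ {p : ℕ × ℕ | p.1 + p.2 ≤ m}} = ∅ := by
    ext p
    simp only [mem_ofPred_eq, mem_empty_iff_false, iff_false]
    omega
  rw [h2] at h1
  simpa [polySpan] using h1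

/-- The two coefficients of a polynomial in `P_{k+1}` that prevent it from being in `Q_k`. -/
theorem exists_top_of_isP {k : ℕ} {q : ℝ × ℝ → ℝ} (h : IsP (k + 1) q) : ∃ A B : ℝ,
    IsQ k k (q - A • mono (k + 1, 0) - B • mono (0, k + 1)) ∧
    (∀ z, (dx^[k + 1] (dy^[0] q)) z = (k + 1).factorial * A) ∧
    (∀ z, (dx^[0] (dy^[k + 1] q)) z = (k + 1).factorial * B) := by
  suffices h' : ∃ A B : ℝ, IsQ k k (q - A • mono (k + 1, 0) - B • mono (0, k + 1)) by
    obtain ⟨A, B, hAB⟩ := h'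
    refine ⟨A, B, hAB, fun z => ?_, fun z => ?_⟩
    · have hq : q = (q - A • mono (k + 1, 0) - B • mono (0, k + 1)) +
          (A • mono (k + 1, 0) + B • mono (0, k + 1)) := by abel
      have h0 : dx^[k + 1] (dy^[0] (q - A • mono (k + 1, 0) - B • mono (0, k + 1))) = 0 := by
        have h1 := D_mem (isQ_iff.1 hAB) (k + 1) 0
        have h2 : {p : ℕ × ℕ | (p.1 + (k + 1), p.2 + 0) ∈ {p : ℕ × ℕ | p.1 ≤ k ∧ p.2 ≤ k}} = ∅ := by
          ext p
          simp only [mem_ofPred_eq, mem_empty_iff_false, iff_false]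
          omega
        rw [h2] at h1
        simpa [polySpan] using h1
      have c1 : ContDiff ℝ ∞ (A • mono (k + 1, 0)) := contDiff_const.smul (contDiff_mono _)
      have c2 : ContDiff ℝ ∞ (B • mono (0, k + 1)) := contDiff_const.smul (contDiff_mono _)
      have c3 : ContDiff ℝ ∞ (A • mono (k + 1, 0) + B • mono (0, k + 1)) := c1.add c2
      rw [hq, D_add hAB.contDiff c3, h0, D_add c1 c2, D_smul _ (contDiff_mono _),
        D_smul _ (contDiff_mono _), D_mono, D_mono, Nat.descFactorial_self (k + 1),
        Nat.descFactorial_eq_zero_iff_lt.2 (Nat.succ_pos k)]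
      simp [mono]
      ring
    · have hq : q = (q - A • mono (k + 1, 0) - B • mono (0, k + 1)) +
          (A • mono (k + 1, 0) + B • mono (0, k + 1)) := by abel
      have h0 : dx^[0] (dy^[k + 1] (q - A • mono (k + 1, 0) - B • mono (0, k + 1))) = 0 := by
        have h1 := D_mem (isQ_iff.1 hAB) 0 (k + 1)
        have h2 : {p : ℕ × ℕ | (p.1 + 0, p.2 + (k + 1)) ∈ {p : ℕ × ℕ | p.1 ≤ k ∧ p.2 ≤ k}} = ∅ := by
          ext p
          simp only [mem_ofPred_eq, mem_empty_iff_false, iff_false]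
          omega
        rw [h2] at h1
        simpa [polySpan] using h1
      have c1 : ContDiff ℝ ∞ (A • mono (k + 1, 0)) := contDiff_const.smul (contDiff_mono _)
      have c2 : ContDiff ℝ ∞ (B • mono (0, k + 1)) := contDiff_const.smul (contDiff_mono _)
      have c3 : ContDiff ℝ ∞ (A • mono (k + 1, 0) + B • mono (0, k + 1)) := c1.add c2
      rw [hq, D_add hAB.contDiff c3, h0, D_add c1 c2, D_smul _ (contDiff_mono _),
        D_smul _ (contDiff_mono _), D_mono, D_mono, Nat.descFactorial_self (k + 1),
        Nat.descFactorial_eq_zero_iff_lt.2 (Nat.succ_pos k)]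
      simp [mono]
      ring
  refine Submodule.span_induction (p := fun q _ => ∃ A B : ℝ,
    IsQ k k (q - A • mono (k + 1, 0) - B • mono (0, k + 1))) ?_ ?_ ?_ ?_ (isP_iff.1 h)
  · rintro _ ⟨⟨i, j⟩, hp, rfl⟩
    simp only [mem_ofPred_eq] at hp
    by_cases hi : i = k + 1
    · obtain rfl : j = 0 := by omega
      subst hi
      exact ⟨1, 0, by simpa using isQ_iff.2 (Submodule.zero_mem _)⟩
    by_cases hj : j = k + 1
    · obtain rfl : i = 0 := by omega
      subst hj
      exact ⟨0, 1, by simpa using isQ_iff.2 (Submodule.zero_mem _)⟩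
    refine ⟨0, 0, ?_⟩
    simp only [zero_smul, sub_zero]
    exact isQ_iff.2 (mono_mem (by simp only [mem_ofPred_eq]; omega))
  · exact ⟨0, 0, by simpa using isQ_iff.2 (Submodule.zero_mem _)⟩
  · rintro f g _ _ ⟨A, B, h⟩ ⟨A', B', h'⟩
    refine ⟨A + A', B + B', ?_⟩
    convert h.add h' using 1
    simp only [add_smul]; abel
  · rintro c f _ ⟨A, B, h⟩
    refine ⟨c * A, c * B, ?_⟩
    convert h.smul c using 1
    simp only [smul_sub, smul_smul]

variable {k : ℕ} {ζ : Fin (k + 1) → ℝ}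

open Polynomial in
/-- The error of interpolation of a polynomial in `P_{k+1}`. -/
theorem sub_interp_eq (hζ : IsLobattoPoints k ζ) {q : ℝ × ℝ → ℝ} {A B : ℝ}
    (hAB : IsQ k k (q - A • mono (k + 1, 0) - B • mono (0, k + 1))) (T : Rect) (z : ℝ × ℝ) :
    q z - interp ζ T q z = A * (Lagrange.nodal Finset.univ (scaledPoint ζ T.l T.r)).eval z.1 +
      B * (Lagrange.nodal Finset.univ (scaledPoint ζ T.b T.t)).eval z.2 := by
  have hdeg : ∀ a b, (X ^ (k + 1) - Lagrange.nodal Finset.univ (scaledPoint ζ a b) : ℝ[X]).natDegree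
      ≤ k := by
    intro a b
    have hn : (X ^ (k + 1) : ℝ[X]).degree =
        (Lagrange.nodal Finset.univ (scaledPoint ζ a b)).degree := by
      rw [Lagrange.degree_nodal, degree_X_pow]; simp
    have h2 := degree_sub_lt_left hn (monic_X_pow _).ne_zero (by
      rw [(monic_X_pow _).leadingCoeff, (Lagrange.nodal_monic).leadingCoeff])
    rw [degree_X_pow] at h2
    exact natDegree_le_iff_coeff_eq_zero.2 fun N hN =>
      coeff_eq_zero_of_degree_lt (h2.trans_le (by exact_mod_cast hN))
  have hq0 : IsQ k k fun z => q z - A * (Lagrange.nodal Finset.univ (scaledPoint ζ T.l T.r)).eval z.1 -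
      B * (Lagrange.nodal Finset.univ (scaledPoint ζ T.b T.t)).eval z.2 := by
    have h1 := isQ_mul_eval (hdeg T.l T.r) (q := (1 : ℝ[X])) (n := k) (by simp)
    have h2 := isQ_mul_eval (p := (1 : ℝ[X])) (m := k) (by simp) (hdeg T.b T.t)
    convert (hAB.add (h1.smul A)).add (h2.smul B) using 1
    ext z
    simp [mono]
    ring
  have hin := interp_eq_of_isQ hζ T (g := q) hq0 fun ij => by
    have e1 : (Lagrange.nodal Finset.univ (scaledPoint ζ T.l T.r)).eval (T.node ζ ij).1 = 0 :=
      Lagrange.eval_nodal_at_node (v := scaledPoint ζ T.l T.r) (Finset.mem_univ ij.1)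
    have e2 : (Lagrange.nodal Finset.univ (scaledPoint ζ T.b T.t)).eval (T.node ζ ij).2 = 0 :=
      Lagrange.eval_nodal_at_node (v := scaledPoint ζ T.b T.t) (Finset.mem_univ ij.2)
    rw [e1, e2]; ring
  rw [hin]; ring

theorem dx_sub_interp (hζ : IsLobattoPoints k ζ) {q : ℝ × ℝ → ℝ} (hq : ContDiff ℝ ∞ q) {A B : ℝ}
    (hAB : IsQ k k (q - A • mono (k + 1, 0) - B • mono (0, k + 1))) (T : Rect) (z : ℝ × ℝ) :
    dx q z - dx (interp ζ T q) z =
      A * (Lagrange.nodal Finset.univ (scaledPoint ζ T.l T.r)).derivative.eval z.1 := by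
  have h1 := dx_sub hq.diff' (isQ_interp hζ T q).contDiff.diff'
  rw [← Pi.sub_apply, ← h1]
  have h2 := hasDerivAt_fst (x := z.1) (y := z.2)
    ((hq.sub (isQ_interp hζ T q).contDiff).diff' (z.1, z.2))
  refine h2.unique ?_
  have : (fun s => q (s, z.2) - interp ζ T q (s, z.2)) = fun s =>
      A * (Lagrange.nodal Finset.univ (scaledPoint ζ T.l T.r)).eval s +
      B * (Lagrange.nodal Finset.univ (scaledPoint ζ T.b T.t)).eval z.2 := by
    ext s; exact sub_interp_eq hζ hAB T (s, z.2)
  rw [this]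
  exact (((Lagrange.nodal Finset.univ (scaledPoint ζ T.l T.r)).hasDerivAt z.1).const_mul A).add_const _

theorem dy_sub_interp (hζ : IsLobattoPoints k ζ) {q : ℝ × ℝ → ℝ} (hq : ContDiff ℝ ∞ q) {A B : ℝ}
    (hAB : IsQ k k (q - A • mono (k + 1, 0) - B • mono (0, k + 1))) (T : Rect) (z : ℝ × ℝ) :
    dy q z - dy (interp ζ T q) z =
      B * (Lagrange.nodal Finset.univ (scaledPoint ζ T.b T.t)).derivative.eval z.2 := by
  have h1 := dy_sub hq.diff' (isQ_interp hζ T q).contDiff.diff'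
  rw [← Pi.sub_apply, ← h1]
  have h2 := hasDerivAt_snd (x := z.1) (y := z.2)
    ((hq.sub (isQ_interp hζ T q).contDiff).diff' (z.1, z.2))
  refine h2.unique ?_
  have : (fun s => q (z.1, s) - interp ζ T q (z.1, s)) = fun s =>
      A * (Lagrange.nodal Finset.univ (scaledPoint ζ T.l T.r)).eval z.1 +
      B * (Lagrange.nodal Finset.univ (scaledPoint ζ T.b T.t)).eval s := by
    ext s; exact sub_interp_eq hζ hAB T (z.1, s)
  rw [this]
  exact (((Lagrange.nodal Finset.univ (scaledPoint ζ T.b T.t)).hasDerivAt z.2).const_mul B).const_add _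

theorem abs_derivative_nodal_le (hk : 1 ≤ k) (hζ : IsLobattoPoints k ζ) {a b x : ℝ} (hab : a ≤ b)
    (hx : x ∈ Icc a b) : |(Lagrange.nodal Finset.univ (scaledPoint ζ a b)).derivative.eval x| ≤
      (k + 1) * (b - a) ^ k := by
  rw [Lagrange.derivative_nodal, Polynomial.eval_finsetSum]
  refine (Finset.abs_sum_le_sum_abs _ _).trans ?_
  have : ∀ i ∈ (Finset.univ : Finset (Fin (k + 1))),
      |Polynomial.eval x (Lagrange.nodal (Finset.univ.erase i) (scaledPoint ζ a b))| ≤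
        (b - a) ^ k := by
    intro i _
    rw [Lagrange.eval_nodal, Finset.abs_prod]
    calc _ ≤ ∏ j ∈ Finset.univ.erase i, (b - a) := by
          refine Finset.prod_le_prod (fun _ _ => abs_nonneg _) fun j _ => ?_
          have := scaledPoint_mem_Icc hk hζ hab j
          exact abs_le.2 ⟨by linarith [hx.1, this.2], by linarith [hx.2, this.1]⟩
      _ = _ := by
          rw [Finset.prod_const]
          congr 1
          simp
  refine (Finset.sum_le_card_nsmul _ _ _ this).trans (le_of_eq ?_)
  simp

/-- Superconvergence of the interpolation at the Lobatto nodes. -/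
theorem integral_dx_sub_interp (hk : 1 ≤ k) (hζ : IsLobattoPoints k ζ) {q : ℝ × ℝ → ℝ}
    (hq : IsP (k + 1) q) (T : Rect) {v : ℝ × ℝ → ℝ} (hv : IsQ k k v) :
    ∫ z in T.carrier, (dx q z - dx (interp ζ T q) z) * dx v z = 0 := by
  obtain ⟨A, B, hAB, -, -⟩ := exists_top_of_isP hq
  have hcont : Continuous fun z => (dx q z - dx (interp ζ T q) z) * dx v z :=
    ((contDiff_dx hq.contDiff).continuous.sub
      (contDiff_dx (isQ_interp hζ T q).contDiff).continuous).mul (contDiff_dx hv.contDiff).continuous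
  rw [T.integral_eq_of_continuous' hcont]
  have : ∀ y, ∫ x in T.l..T.r, (dx q (x, y) - dx (interp ζ T q) (x, y)) * dx v (x, y) = 0 := by
    intro y
    obtain ⟨p, hp, hpe⟩ := hv.dx.slice_fst y
    simp only [dx_sub_interp hζ hq.contDiff hAB, hpe, mul_assoc,
      intervalIntegral.integral_const_mul]
    rw [hζ.integral_nodal_scaled hk hp T.hlr, mul_zero]
  simp [this]

theorem integral_dy_sub_interp (hk : 1 ≤ k) (hζ : IsLobattoPoints k ζ) {q : ℝ × ℝ → ℝ}
    (hq : IsP (k + 1) q) (T : Rect) {v : ℝ × ℝ → ℝ} (hv : IsQ k k v) :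
    ∫ z in T.carrier, (dy q z - dy (interp ζ T q) z) * dy v z = 0 := by
  obtain ⟨A, B, hAB, -, -⟩ := exists_top_of_isP hq
  have hcont : Continuous fun z => (dy q z - dy (interp ζ T q) z) * dy v z :=
    ((contDiff_dy hq.contDiff).continuous.sub
      (contDiff_dy (isQ_interp hζ T q).contDiff).continuous).mul (contDiff_dy hv.contDiff).continuous
  rw [T.integral_eq_of_continuous hcont]
  have : ∀ x, ∫ y in T.b..T.t, (dy q (x, y) - dy (interp ζ T q) (x, y)) * dy v (x, y) = 0 := by
    intro x
    obtain ⟨p, hp, hpe⟩ := hv.dy.slice_snd x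
    simp only [dy_sub_interp hζ hq.contDiff hAB, hpe, mul_assoc,
      intervalIntegral.integral_const_mul]
    rw [hζ.integral_nodal_scaled hk hp T.hbt, mul_zero]
  simp [this]

end WG

namespace WG

/-! ### The geometry of conforming meshes -/

/-- `T` and `T'` share a full edge. -/
def Adj (T T' : Rect) : Prop :=
  (T.r = T'.l ∧ T.b = T'.b ∧ T.t = T'.t) ∨ (T.l = T'.r ∧ T.b = T'.b ∧ T.t = T'.t) ∨
  (T.t = T'.b ∧ T.l = T'.l ∧ T.r = T'.r) ∨ (T.b = T'.t ∧ T.l = T'.l ∧ T.r = T'.r)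

/-- The position of two rectangles that share exactly a corner. -/
def Diag (T T' : Rect) : Prop := (T.r = T'.l ∨ T.l = T'.r) ∧ (T.t = T'.b ∨ T.b = T'.t)

theorem Adj.symm {T T' : Rect} (h : Adj T T') : Adj T' T := by
  unfold Adj at *; grind

theorem Rect.edge_carrier_subset {T : Rect} {i : Fin 4} {z : ℝ × ℝ}
    (hz : z ∈ (T.edge i).carrier) : z ∈ T.carrier ∧
      ((i = 0 ∧ z.2 = T.b) ∨ (i = 1 ∧ z.1 = T.r) ∨ (i = 2 ∧ z.2 = T.t) ∨ (i = 3 ∧ z.1 = T.l)) := by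
  obtain ⟨s, ⟨h0, h1⟩, rfl⟩ := hz
  have hx := T.hlr
  have hy := T.hbt
  rw [Rect.mem_carrier]
  fin_cases i <;> simp [Rect.edge, Edge.pt] <;> (try constructor) <;> (try constructor) <;> nlinarith

theorem Rect.edge_pt_mem (T : Rect) (i : Fin 4) {s : ℝ} (hs : s ∈ Icc (0 : ℝ) 1) :
    (T.edge i).pt s ∈ T.carrier := (Rect.edge_carrier_subset ⟨s, hs, rfl⟩).1

variable {Ω : Set (ℝ × ℝ)} {M : Finset Rect}

/-- Conformity in terms of coordinates. -/
theorem IsMesh.trichotomy (hM : IsMesh Ω M) {T T' : Rect} (hT : T ∈ M) (hT' : T' ∈ M)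
    (hne : T ≠ T') : T.carrier ∩ T'.carrier = ∅ ∨ Adj T T' ∨ Diag T T' := by
  have h1 := T.hlr
  have h2 := T.hbt
  have h1' := T'.hlr
  have h2' := T'.hbt
  by_cases hemp : T.carrier ∩ T'.carrier = ∅
  · exact Or.inl hemp
  right
  obtain ⟨w, hw, hw'⟩ := nonempty_iff_ne_empty.2 hemp
  rw [Rect.mem_carrier] at hw hw'
  set p : ℝ × ℝ := (max T.l T'.l, max T.b T'.b) with hp
  set q : ℝ × ℝ := (min T.r T'.r, min T.t T'.t) with hq
  have hpm : p ∈ T.carrier ∩ T'.carrier := by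
    simp only [mem_inter_iff, Rect.mem_carrier, hp]
    refine ⟨⟨⟨le_max_left _ _, ?_⟩, le_max_left _ _, ?_⟩, ⟨le_max_right _ _, ?_⟩, le_max_right _ _, ?_⟩ <;>
    apply max_le <;> linarith
  have hqm : q ∈ T.carrier ∩ T'.carrier := by
    simp only [mem_inter_iff, Rect.mem_carrier, hq]
    refine ⟨⟨⟨?_, min_le_left _ _⟩, ?_, min_le_left _ _⟩, ⟨?_, min_le_right _ _⟩, ?_, min_le_right _ _⟩ <;>
    apply le_min <;> linarith
  rcases hM.conforming T hT T' hT' hne with h | ⟨i, j, -, h⟩ | ⟨i, j, he, h⟩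
  · exact absurd h hemp
  · right
    rw [h] at hpm hqm
    have hpq : p = q := by rw [mem_singleton_iff.1 hpm, mem_singleton_iff.1 hqm]
    have e1 : max T.l T'.l = min T.r T'.r := congrArg Prod.fst hpq
    have e2 : max T.b T'.b = min T.t T'.t := congrArg Prod.snd hpq
    constructor
    · rcases max_choice T.l T'.l with h | h <;> rcases min_choice T.r T'.r with h' | h' <;>
        rw [h, h'] at e1 <;> first | (left; linarith) | (right; linarith)
    · rcases max_choice T.b T'.b with h | h <;> rcases min_choice T.t T'.t with h' | h' <;>
        rw [h, h'] at e2 <;> first | (left; linarith) | (right; linarith)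
  · left
    rw [h] at hpm hqm
    have ep := (Rect.edge_carrier_subset hpm).2
    have eq := (Rect.edge_carrier_subset hqm).2
    have e3 : (T.edge i).p = (T'.edge j).p := by rw [he]
    have e4 : (T.edge i).q = (T'.edge j).q := by rw [he]
    simp only [hp, hq] at ep eq
    have m1 := max_choice T.l T'.l
    have m2 := min_choice T.r T'.r
    have m3 := max_choice T.b T'.b
    have m4 := min_choice T.t T'.t
    unfold Adj
    fin_cases i <;> fin_cases j <;> simp [Rect.edge] at e3 e4 ep eq <;> grind

theorem IsMesh.eq_of_mem_inner (hM : IsMesh Ω M) {T T' : Rect} (hT : T ∈ M) (hT' : T' ∈ M)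
    {z : ℝ × ℝ} (hz : z ∈ T.inner) (hz' : z ∈ T'.carrier) : T = T' := by
  by_contra hne
  have h1 := T.hlr
  have h2 := T.hbt
  rcases hM.trichotomy hT hT' hne with h | h | h
  · exact eq_empty_iff_forall_notMem.1 h z ⟨T.inner_subset hz, hz'⟩
  all_goals
    rw [Rect.mem_inner] at hz
    rw [Rect.mem_carrier] at hz'
    simp only [Adj, Diag] at h
    grind

theorem IsMesh.adj_or_diag (hM : IsMesh Ω M) {T T' : Rect} (hT : T ∈ M) (hT' : T' ∈ M)
    (hne : T ≠ T') {z : ℝ × ℝ} (hz : z ∈ T.carrier) (hz' : z ∈ T'.carrier) :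
    Adj T T' ∨ Diag T T' := by
  rcases hM.trichotomy hT hT' hne with h | h
  · exact absurd ⟨hz, hz'⟩ (eq_empty_iff_forall_notMem.1 h z)
  · exact h

theorem IsRectangularDomain.isOpen (hΩ : IsRectangularDomain Ω) : IsOpen Ω := by
  obtain ⟨R, rfl⟩ := hΩ.union
  exact isOpen_interior

theorem IsRectangularDomain.isCompact_union (R : Finset Rect) : IsCompact (⋃ T ∈ R, T.carrier) :=
  R.isCompact_biUnion fun T _ => T.isCompact_carrier

theorem IsRectangularDomain.interior_closure (hΩ : IsRectangularDomain Ω) :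
    interior (closure Ω) = Ω := by
  refine subset_antisymm ?_ (interior_maximal subset_closure hΩ.isOpen)
  obtain ⟨R, hR⟩ := hΩ.union
  rw [hR]
  apply interior_mono
  exact closure_minimal interior_subset
    (IsRectangularDomain.isCompact_union R).isClosed

theorem IsMesh.carrier_subset (hM : IsMesh Ω M) {T : Rect} (hT : T ∈ M) : T.carrier ⊆ closure Ω := by
  rw [← hM.cover]
  exact subset_biUnion_of_mem (u := fun T : Rect => T.carrier) hT

theorem IsMesh.inner_subset (hM : IsMesh Ω M) (hΩ : IsRectangularDomain Ω) {T : Rect} (hT : T ∈ M) :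
    T.inner ⊆ Ω := by
  rw [← hΩ.interior_closure]
  exact interior_maximal (T.inner_subset.trans (hM.carrier_subset hT)) T.isOpen_inner

theorem IsMesh.exists_mem (hM : IsMesh Ω M) {z : ℝ × ℝ} (hz : z ∈ closure Ω) :
    ∃ T ∈ M, z ∈ T.carrier := by
  rw [← hM.cover] at hz
  simpa using hz

theorem exists_dist_lt_imp_mem (M : Finset Rect) (z : ℝ × ℝ) :
    ∃ δ > 0, ∀ T ∈ M, ∀ w ∈ T.carrier, dist w z < δ → z ∈ T.carrier := by
  have : ∀ T : Rect, ∃ δ > 0, ∀ w ∈ T.carrier, dist w z < δ → z ∈ T.carrier := by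
    intro T
    by_cases hz : z ∈ T.carrier
    · exact ⟨1, one_pos, fun _ _ _ => hz⟩
    · obtain ⟨δ, hδ, h⟩ := Metric.isOpen_iff.1 T.isCompact_carrier.isClosed.isOpen_compl z hz
      exact ⟨δ, hδ, fun w hw hd => absurd hw (h hd)⟩
  choose δ hδ h using this
  classical
  rcases M.eq_empty_or_nonempty with rfl | hne
  · exact ⟨1, one_pos, by simp⟩
  · refine ⟨M.inf' hne δ, ?_, fun T hT w hw hd => h T w hw (hd.trans_le (Finset.inf'_le δ hT))⟩
    exact (Finset.lt_inf'_iff hne).2 fun T _ => hδ T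

/-- In every direction from an interior point there is an element that contains a segment. -/
theorem IsMesh.exists_mem_direction (hM : IsMesh Ω M) (hΩ : IsRectangularDomain Ω) {z : ℝ × ℝ}
    (hz : z ∈ Ω) (d : ℝ × ℝ) :
    ∃ T ∈ M, z ∈ T.carrier ∧ ∃ ε > 0, (z.1 + ε * d.1, z.2 + ε * d.2) ∈ T.carrier := by
  obtain ⟨δ, hδ, h⟩ := exists_dist_lt_imp_mem M z
  have hc : Filter.Tendsto (fun ε : ℝ => (z.1 + ε * d.1, z.2 + ε * d.2)) (nhdsWithin 0 (Ioi 0))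
      (nhds z) := by
    have : Continuous fun ε : ℝ => (z.1 + ε * d.1, z.2 + ε * d.2) := by fun_prop
    have h1 := this.tendsto 0
    simp only [zero_mul, add_zero, Prod.mk.eta] at h1
    exact h1.mono_left nhdsWithin_le_nhds
  have h1 := hc.eventually (Metric.ball_mem_nhds z hδ)
  have h2 := hc.eventually (hΩ.isOpen.mem_nhds hz)
  obtain ⟨ε, ⟨h3, h4⟩, hε⟩ := ((h1.and h2).and self_mem_nhdsWithin).exists
  obtain ⟨T, hT, hm⟩ := hM.exists_mem (subset_closure h4)
  exact ⟨T, hT, h T hT _ hm h3, ε, hε, hm⟩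

theorem mem_vertices {M : Finset Rect} {z : ℝ × ℝ} :
    z ∈ vertices M ↔ ∃ T ∈ M, ∃ i, z = T.corner i := by
  classical
  simp only [vertices, Finset.mem_biUnion, Finset.mem_image, Finset.mem_univ, true_and]
  constructor <;> rintro ⟨T, hT, i, rfl⟩ <;> exact ⟨T, hT, i, rfl⟩

theorem Rect.corner_coords (T : Rect) (i : Fin 4) :
    ((T.corner i).1 = T.l ∨ (T.corner i).1 = T.r) ∧
      ((T.corner i).2 = T.b ∨ (T.corner i).2 = T.t) := by
  fin_cases i <;> simp [Rect.corner]

theorem Rect.corner_mem (T : Rect) (i : Fin 4) : T.corner i ∈ T.carrier := by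
  have h1 := T.hlr
  have h2 := T.hbt
  obtain ⟨h3, h4⟩ := T.corner_coords i
  rw [Rect.mem_carrier]
  grind

/-- A mesh vertex is a corner of every element that contains it. -/
theorem IsMesh.corner_of_mem (hM : IsMesh Ω M) {T : Rect} (hT : T ∈ M) {z : ℝ × ℝ}
    (hv : z ∈ vertices M) (hz : z ∈ T.carrier) :
    (z.1 = T.l ∨ z.1 = T.r) ∧ (z.2 = T.b ∨ z.2 = T.t) := by
  obtain ⟨T0, hT0, i, rfl⟩ := mem_vertices.1 hv
  have hc := T0.corner_coords i
  by_cases hne : T = T0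
  · rw [hne]; exact hc
  have h0 := T0.corner_mem i
  have h := hM.adj_or_diag hT hT0 hne hz h0
  rw [Rect.mem_carrier] at hz h0
  have h1 := T.hlr
  have h2 := T.hbt
  have h1' := T0.hlr
  have h2' := T0.hbt
  simp only [Adj, Diag] at h
  grind

/-- The four elements around an interior vertex. -/
theorem IsMesh.exists_patch (hM : IsMesh Ω M) (hΩ : IsRectangularDomain Ω) {z : ℝ × ℝ}
    (hv : z ∈ vertices M) (hz : z ∈ Ω) :
    ∃ T₁ ∈ M, ∃ T₂ ∈ M, ∃ T₃ ∈ M, ∃ T₄ ∈ M,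
      (T₁.l = z.1 ∧ T₁.b = z.2) ∧ (T₂.r = z.1 ∧ T₂.b = z.2 ∧ T₂.t = T₁.t) ∧
      (T₃.r = z.1 ∧ T₃.t = z.2 ∧ T₃.l = T₂.l) ∧
      (T₄.l = z.1 ∧ T₄.t = z.2 ∧ T₄.r = T₁.r ∧ T₄.b = T₃.b) := by
  obtain ⟨T₁, hT₁, hz₁, ε₁, hε₁, hm₁⟩ := hM.exists_mem_direction hΩ hz (1, 1)
  obtain ⟨T₂, hT₂, hz₂, ε₂, hε₂, hm₂⟩ := hM.exists_mem_direction hΩ hz (-1, 1)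
  obtain ⟨T₃, hT₃, hz₃, ε₃, hε₃, hm₃⟩ := hM.exists_mem_direction hΩ hz (-1, -1)
  obtain ⟨T₄, hT₄, hz₄, ε₄, hε₄, hm₄⟩ := hM.exists_mem_direction hΩ hz (1, -1)
  have c₁ := hM.corner_of_mem hT₁ hv hz₁
  have c₂ := hM.corner_of_mem hT₂ hv hz₂
  have c₃ := hM.corner_of_mem hT₃ hv hz₃
  have c₄ := hM.corner_of_mem hT₄ hv hz₄
  rw [Rect.mem_carrier] at hm₁ hm₂ hm₃ hm₄
  simp only at hm₁ hm₂ hm₃ hm₄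
  have e₁ : T₁.l = z.1 ∧ T₁.b = z.2 := by
    constructor <;> rcases c₁ with ⟨c | c, c' | c'⟩ <;> linarith [T₁.hlr, T₁.hbt]
  have e₂ : T₂.r = z.1 ∧ T₂.b = z.2 := by
    constructor <;> rcases c₂ with ⟨c | c, c' | c'⟩ <;> linarith [T₂.hlr, T₂.hbt]
  have e₃ : T₃.r = z.1 ∧ T₃.t = z.2 := by
    constructor <;> rcases c₃ with ⟨c | c, c' | c'⟩ <;> linarith [T₃.hlr, T₃.hbt]
  have e₄ : T₄.l = z.1 ∧ T₄.t = z.2 := by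
    constructor <;> rcases c₄ with ⟨c | c, c' | c'⟩ <;> linarith [T₄.hlr, T₄.hbt]
  have h1 := T₁.hlr
  have h2 := T₂.hlr
  have h3 := T₃.hlr
  have h4 := T₄.hlr
  have h1' := T₁.hbt
  have h2' := T₂.hbt
  have h3' := T₃.hbt
  have h4' := T₄.hbt
  have n12 : T₁ ≠ T₂ := by rintro rfl; linarith
  have n23 : T₂ ≠ T₃ := by rintro rfl; linarith
  have n34 : T₃ ≠ T₄ := by rintro rfl; linarith
  have n14 : T₁ ≠ T₄ := by rintro rfl; linarith
  have a12 := hM.adj_or_diag hT₁ hT₂ n12 hz₁ hz₂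
  have a23 := hM.adj_or_diag hT₂ hT₃ n23 hz₂ hz₃
  have a34 := hM.adj_or_diag hT₃ hT₄ n34 hz₃ hz₄
  have a14 := hM.adj_or_diag hT₁ hT₄ n14 hz₁ hz₄
  simp only [Adj, Diag] at a12 a23 a34 a14
  refine ⟨T₁, hT₁, T₂, hT₂, T₃, hT₃, T₄, hT₄, e₁, ⟨e₂.1, e₂.2, ?_⟩, ⟨e₃.1, e₃.2, ?_⟩, e₄.1, e₄.2, ?_, ?_⟩
  · clear a23 a34 a14; grind
  · clear a12 a34 a14; grind
  · clear a23 a34 a12; grind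
  · clear a23 a12 a14; grind

theorem IsMesh.exists_pt_mem (hM : IsMesh Ω M) (hΩ : IsRectangularDomain Ω) {T : Rect} (hT : T ∈ M)
    {i : Fin 4} (h : ¬ (T.edge i).carrier ⊆ frontier Ω) :
    ∃ s ∈ Ioo (0 : ℝ) 1, (T.edge i).pt s ∈ Ω := by
  obtain ⟨z, hz, hzf⟩ := not_subset.1 h
  have hzΩ : z ∈ Ω := by
    by_contra hn
    apply hzf
    rw [frontier, hΩ.isOpen.interior_eq]
    exact ⟨hM.carrier_subset hT (Rect.edge_carrier_subset hz).1, hn⟩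
  obtain ⟨s, hs, rfl⟩ := hz
  have hc : Continuous (T.edge i).pt := by unfold Edge.pt; fun_prop
  have hs' : s ∈ closure (Ioo (0 : ℝ) 1) := by rw [closure_Ioo (by norm_num)]; exact hs
  obtain ⟨s', h1, h2⟩ := mem_closure_iff.1 hs' _ (hΩ.isOpen.preimage hc) hzΩ
  exact ⟨s', h2, h1⟩

/-- An edge that is not on the boundary belongs to an element on its other side. -/
theorem IsMesh.exists_neighbor (hM : IsMesh Ω M) (hΩ : IsRectangularDomain Ω) {T : Rect} (hT : T ∈ M)
    {i : Fin 4} (h : ¬ (T.edge i).carrier ⊆ frontier Ω) :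
    ∃ T' ∈ M, Adj T T' ∧ T.edge i = T'.edge (i + 2) := by
  obtain ⟨s, ⟨hs0, hs1⟩, hs⟩ := hM.exists_pt_mem hΩ hT h
  have hx := T.hlr
  have hy := T.hbt
  have hzT := T.edge_pt_mem i ⟨hs0.le, hs1.le⟩
  have key : ∀ d : ℝ × ℝ, (∀ ε > 0, (((T.edge i).pt s).1 + ε * d.1, ((T.edge i).pt s).2 + ε * d.2) ∉
      T.carrier) → ∃ T' ∈ M, T' ≠ T ∧ (Adj T T' ∨ Diag T T') ∧ (T.edge i).pt s ∈ T'.carrier ∧ ∃ ε > 0,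
        (((T.edge i).pt s).1 + ε * d.1, ((T.edge i).pt s).2 + ε * d.2) ∈ T'.carrier := by
    intro d hd
    obtain ⟨T', hT', hz, ε, hε, hm⟩ := hM.exists_mem_direction hΩ hs d
    have hne : T' ≠ T := by rintro rfl; exact hd ε hε hm
    exact ⟨T', hT', hne, hM.adj_or_diag hT hT' hne.symm hzT hz, hz, ε, hε, hm⟩
  have p1 : 0 < s * (T.r - T.l) := mul_pos hs0 (by linarith)
  have p2 : 0 < s * (T.t - T.b) := mul_pos hs0 (by linarith)
  have p3 : s * (T.r - T.l) < T.r - T.l := by nlinarith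
  have p4 : s * (T.t - T.b) < T.t - T.b := by nlinarith
  fin_cases i
  · obtain ⟨T', hT', hne, h, hz, ε, hε, hm⟩ := key (0, -1) (fun ε hε hm => by
      rw [Rect.mem_carrier] at hm; simp [Rect.edge, Edge.pt] at hm; linarith)
    rw [Rect.mem_carrier] at hm hz
    simp [Rect.edge, Edge.pt] at hm hz
    have h1 := T'.hlr
    have h2 := T'.hbt
    have : T.b = T'.t ∧ T.l = T'.l ∧ T.r = T'.r := by simp only [Adj, Diag] at h; grind
    refine ⟨T', hT', Or.inr (Or.inr (Or.inr this)), ?_⟩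
    simp [Rect.edge, this.1, this.2.1, this.2.2]
  · obtain ⟨T', hT', hne, h, hz, ε, hε, hm⟩ := key (1, 0) (fun ε hε hm => by
      rw [Rect.mem_carrier] at hm; simp [Rect.edge, Edge.pt] at hm; linarith)
    rw [Rect.mem_carrier] at hm hz
    simp [Rect.edge, Edge.pt] at hm hz
    have h1 := T'.hlr
    have h2 := T'.hbt
    have : T.r = T'.l ∧ T.b = T'.b ∧ T.t = T'.t := by simp only [Adj, Diag] at h; grind
    refine ⟨T', hT', Or.inl this, ?_⟩
    simp [Rect.edge, this.1, this.2.1, this.2.2]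
  · obtain ⟨T', hT', hne, h, hz, ε, hε, hm⟩ := key (0, 1) (fun ε hε hm => by
      rw [Rect.mem_carrier] at hm; simp [Rect.edge, Edge.pt] at hm; linarith)
    rw [Rect.mem_carrier] at hm hz
    simp [Rect.edge, Edge.pt] at hm hz
    have h1 := T'.hlr
    have h2 := T'.hbt
    have : T.t = T'.b ∧ T.l = T'.l ∧ T.r = T'.r := by simp only [Adj, Diag] at h; grind
    refine ⟨T', hT', Or.inr (Or.inr (Or.inl this)), ?_⟩
    simp [Rect.edge, this.1, this.2.1, this.2.2]
  · obtain ⟨T', hT', hne, h, hz, ε, hε, hm⟩ := key (-1, 0) (fun ε hε hm => by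
      rw [Rect.mem_carrier] at hm; simp [Rect.edge, Edge.pt] at hm; linarith)
    rw [Rect.mem_carrier] at hm hz
    simp [Rect.edge, Edge.pt] at hm hz
    have h1 := T'.hlr
    have h2 := T'.hbt
    have : T.l = T'.r ∧ T.b = T'.b ∧ T.t = T'.t := by simp only [Adj, Diag] at h; grind
    refine ⟨T', hT', Or.inr (Or.inl this), ?_⟩
    simp [Rect.edge, this.1, this.2.1, this.2.2]

/-- Two elements of a mesh with the same edge in the same position are equal. -/
theorem IsMesh.eq_of_edge_eq (hM : IsMesh Ω M) {T T' : Rect} (hT : T ∈ M) (hT' : T' ∈ M) {i : Fin 4}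
    (h : T.edge i = T'.edge i) : T = T' := by
  by_contra hne
  have h1 := T.hlr
  have h2 := T.hbt
  have h1' := T'.hlr
  have h2' := T'.hbt
  have hp : (T.edge i).p = (T'.edge i).p := by rw [h]
  have hq : (T.edge i).q = (T'.edge i).q := by rw [h]
  have hz := T.edge_pt_mem i (s := 0) (by simp)
  have hz' := T'.edge_pt_mem i (s := 0) (by simp)
  rw [← h] at hz'
  have := hM.adj_or_diag hT hT' hne hz hz'
  simp only [Adj, Diag] at this
  fin_cases i <;> simp [Rect.edge] at hp hq <;> grind

end WG

namespace WG

variable {Ω : Set (ℝ × ℝ)} {M : Finset Rect}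

theorem Rect.exists_mem_inner_dist_lt {T : Rect} {z : ℝ × ℝ} (hz : z ∈ T.carrier) {δ : ℝ}
    (hδ : 0 < δ) : ∃ w ∈ T.inner, dist w z < δ := by
  rw [← T.closure_inner] at hz
  obtain ⟨w, hw, hd⟩ := Metric.mem_closure_iff.1 hz δ hδ
  exact ⟨w, hw, by rwa [dist_comm]⟩

/-- The domain does not touch itself in a corner. -/
theorem IsRectangularDomain.not_opposite (hΩ : IsRectangularDomain Ω) {z : ℝ × ℝ}
    (hz : z ∈ closure Ω) {s : ℝ} (hs : s = 1 ∨ s = -1) {δ : ℝ} (hδ : 0 < δ)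
    (h1 : ∀ w ∈ Ω, dist w z < δ → ¬ (s * (w.1 - z.1) < 0 ∧ z.2 < w.2))
    (h2 : ∀ w ∈ Ω, dist w z < δ → ¬ (0 < s * (w.1 - z.1) ∧ w.2 < z.2))
    (h3 : ∀ ε > 0, ∃ w ∈ Ω, dist w z < ε ∧ 0 < s * (w.1 - z.1) ∧ z.2 < w.2)
    (h4 : ∀ ε > 0, ∃ w ∈ Ω, dist w z < ε ∧ s * (w.1 - z.1) < 0 ∧ w.2 < z.2) : False := by
  have hss : s * s = 1 := by rcases hs with rfl | rfl <;> norm_num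
  have perturb : ∀ w ∈ Ω, dist w z < δ → ∀ a b : ℝ, ∃ η > 0,
      (w.1 + η * a, w.2 + η * b) ∈ Ω ∧ dist ((w.1 + η * a, w.2 + η * b) : ℝ × ℝ) z < δ := by
    intro w hw hd a b
    have hopen : IsOpen (Ω ∩ Metric.ball z δ) := hΩ.isOpen.inter Metric.isOpen_ball
    have hc : Continuous fun η : ℝ => ((w.1 + η * a, w.2 + η * b) : ℝ × ℝ) := by fun_prop
    have ht := (hc.tendsto 0).mono_left (nhdsWithin_le_nhds (s := Ioi 0))
    simp only [zero_mul, add_zero, Prod.mk.eta] at ht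
    obtain ⟨η, h, hη⟩ := ((ht.eventually (hopen.mem_nhds ⟨hw, hd⟩)).and self_mem_nhdsWithin).exists
    exact ⟨η, hη, h.1, h.2⟩
  have hcover : ∀ w ∈ Ω, dist w z < δ →
      (0 < s * (w.1 - z.1) ∧ z.2 < w.2) ∨ (s * (w.1 - z.1) < 0 ∧ w.2 < z.2) := by
    intro w hw hd
    obtain ⟨η, hη, hm, hm'⟩ := perturb w hw hd (-s) 1
    obtain ⟨θ, hθ, hn, hn'⟩ := perturb w hw hd s (-1)
    have k1 := h1 _ hm hm'
    have k2 := h2 _ hn hn'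
    simp only at k1 k2
    have e1 : s * (w.1 + η * -s - z.1) = s * (w.1 - z.1) - η := by linear_combination (-η) * hss
    have e2 : s * (w.1 + θ * s - z.1) = s * (w.1 - z.1) + θ := by linear_combination θ * hss
    rw [e1] at k1
    rw [e2] at k2
    by_contra hcon
    push Not at k1 k2 hcon
    rcases lt_trichotomy (s * (w.1 - z.1)) 0 with h | h | h
    · have a1 := k1 (by linarith)
      have a2 := hcon.2 h
      linarith
    · have a1 := k1 (by linarith)
      have a2 := k2 (by linarith)
      linarith
    · have a2 := k2 (by linarith)
      have a1 := hcon.1 h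
      linarith
  have hzf : z ∈ frontier Ω := by
    rw [frontier, hΩ.isOpen.interior_eq]
    refine ⟨hz, fun hzΩ => ?_⟩
    rcases hcover z hzΩ (by rwa [dist_self]) with h | h <;> linarith [h.2]
  obtain ⟨ε, hε, hcon⟩ := hΩ.boundary z hzf
  set d := min δ ε / 2 with hd
  have hm : 0 < min δ ε := lt_min hδ hε
  have hd0 : 0 < d := by positivity
  have hdδ : d < δ := by have := min_le_left δ ε; rw [hd]; linarith
  have hdε : d < ε := by have := min_le_right δ ε; rw [hd]; linarith
  have hpre := (hcon d hd0 hdε).isPreconnected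
  have hc1 : Continuous fun w : ℝ × ℝ => s * (w.1 - z.1) := by fun_prop
  have o1 : IsOpen {w : ℝ × ℝ | 0 < s * (w.1 - z.1) ∧ z.2 < w.2} :=
    (isOpen_lt continuous_const hc1).inter (isOpen_lt continuous_const continuous_snd)
  have o2 : IsOpen {w : ℝ × ℝ | s * (w.1 - z.1) < 0 ∧ w.2 < z.2} :=
    (isOpen_lt hc1 continuous_const).inter (isOpen_lt continuous_snd continuous_const)
  obtain ⟨w, -, hw1, hw2⟩ := hpre _ _ o1 o2
    (fun w hw => hcover w hw.2 ((Metric.mem_ball.1 hw.1).trans hdδ))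
    (by obtain ⟨w, hw, hwd, h⟩ := h3 d hd0; exact ⟨w, ⟨hwd, hw⟩, h⟩)
    (by obtain ⟨w, hw, hwd, h⟩ := h4 d hd0; exact ⟨w, ⟨hwd, hw⟩, h⟩)
  exact lt_asymm hw1.2 hw2.2

theorem IsMesh.exists_between (hM : IsMesh Ω M) (hΩ : IsRectangularDomain Ω) {T T' : Rect}
    (hT : T ∈ M) (hT' : T' ∈ M) (h : Diag T T') : ∃ T'' ∈ M, Adj T T'' ∧ Adj T'' T' := by
  have main : ∀ T T' : Rect, T ∈ M → T' ∈ M → ∀ z : ℝ × ℝ, ∀ s : ℝ, (s = 1 ∨ s = -1) →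
      T.b = z.2 → T'.t = z.2 → (s = 1 → T.l = z.1 ∧ T'.r = z.1) →
      (s = -1 → T.r = z.1 ∧ T'.l = z.1) → ∃ T'' ∈ M, Adj T T'' ∧ Adj T'' T' := by
    intro T T' hT hT' z s hs hb ht hp hm
    by_contra hcon
    have i1 := T.hlr
    have i2 := T.hbt
    have i1' := T'.hlr
    have i2' := T'.hbt
    have hzT : z ∈ T.carrier := by rw [Rect.mem_carrier]; grind
    have hzT' : z ∈ T'.carrier := by rw [Rect.mem_carrier]; grind
    obtain ⟨δ, hδ, hloc⟩ := exists_dist_lt_imp_mem M z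
    have elem : ∀ w ∈ Ω, dist w z < δ → T.b = z.2 → ∃ T'' ∈ M, z ∈ T''.carrier ∧ w ∈ T''.carrier := by
      intro w hw hd _
      obtain ⟨T'', hT'', hwm⟩ := hM.exists_mem (subset_closure hw)
      exact ⟨T'', hT'', hloc T'' hT'' w hwm hd, hwm⟩
    refine hΩ.not_opposite (hM.carrier_subset hT hzT) hs hδ ?_ ?_ ?_ ?_
    · rintro w hw hd ⟨hq1, hq2⟩
      obtain ⟨T'', hT'', hz, hwm⟩ := elem w hw hd hb
      apply hcon
      have n1 : T ≠ T'' := by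
        rintro rfl
        rw [Rect.mem_carrier] at hwm
        rcases hs with rfl | rfl
        · have := hp rfl; linarith
        · have := hm rfl; linarith
      have n2 : T'' ≠ T' := by
        rintro rfl
        rw [Rect.mem_carrier] at hwm
        linarith
      have a1 := hM.adj_or_diag hT hT'' n1 hzT hz
      have a2 := hM.adj_or_diag hT'' hT' n2 hz hzT'
      have j1 := T''.hlr
      have j2 := T''.hbt
      rw [Rect.mem_carrier] at hz hwm
      refine ⟨T'', hT'', ?_, ?_⟩
      · clear a2
        simp only [Adj, Diag] at a1 ⊢
        rcases hs with rfl | rfl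
        · obtain ⟨p1, p2⟩ := hp rfl; grind
        · obtain ⟨p1, p2⟩ := hm rfl; grind
      · clear a1
        simp only [Adj, Diag] at a2 ⊢
        rcases hs with rfl | rfl
        · obtain ⟨p1, p2⟩ := hp rfl; grind
        · obtain ⟨p1, p2⟩ := hm rfl; grind
    · rintro w hw hd ⟨hq1, hq2⟩
      obtain ⟨T'', hT'', hz, hwm⟩ := elem w hw hd hb
      apply hcon
      have n1 : T ≠ T'' := by
        rintro rfl
        rw [Rect.mem_carrier] at hwm
        linarith
      have n2 : T'' ≠ T' := by
        rintro rfl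
        rw [Rect.mem_carrier] at hwm
        rcases hs with rfl | rfl
        · have := hp rfl; linarith
        · have := hm rfl; linarith
      have a1 := hM.adj_or_diag hT hT'' n1 hzT hz
      have a2 := hM.adj_or_diag hT'' hT' n2 hz hzT'
      have j1 := T''.hlr
      have j2 := T''.hbt
      rw [Rect.mem_carrier] at hz hwm
      refine ⟨T'', hT'', ?_, ?_⟩
      · clear a2
        simp only [Adj, Diag] at a1 ⊢
        rcases hs with rfl | rfl
        · obtain ⟨p1, p2⟩ := hp rfl; grind
        · obtain ⟨p1, p2⟩ := hm rfl; grind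
      · clear a1
        simp only [Adj, Diag] at a2 ⊢
        rcases hs with rfl | rfl
        · obtain ⟨p1, p2⟩ := hp rfl; grind
        · obtain ⟨p1, p2⟩ := hm rfl; grind
    · intro ε hε
      obtain ⟨w, hw, hd⟩ := Rect.exists_mem_inner_dist_lt hzT hε
      refine ⟨w, hM.inner_subset hΩ hT hw, hd, ?_, ?_⟩ <;> rw [Rect.mem_inner] at hw
      · rcases hs with rfl | rfl
        · have := hp rfl; linarith
        · have := hm rfl; linarith
      · linarith
    · intro ε hε
      obtain ⟨w, hw, hd⟩ := Rect.exists_mem_inner_dist_lt hzT' hε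
      refine ⟨w, hM.inner_subset hΩ hT' hw, hd, ?_, ?_⟩ <;> rw [Rect.mem_inner] at hw
      · rcases hs with rfl | rfl
        · have := hp rfl; linarith
        · have := hm rfl; linarith
      · linarith
  have hn : ¬ (1 : ℝ) = -1 := by norm_num
  have hn' : ¬ (-1 : ℝ) = 1 := by norm_num
  rcases h with ⟨h1 | h1, h2 | h2⟩
  · obtain ⟨T'', h, ha, hb⟩ := main T' T hT' hT (T'.l, T'.b) 1 (Or.inl rfl) rfl h2
      (fun _ => ⟨rfl, h1⟩) (fun h => absurd h hn)
    exact ⟨T'', h, hb.symm, ha.symm⟩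
  · exact main T T' hT hT' (T.r, T.b) (-1) (Or.inr rfl) rfl h2.symm
      (fun h => absurd h hn') (fun _ => ⟨rfl, h1.symm⟩)
  · obtain ⟨T'', h, ha, hb⟩ := main T' T hT' hT (T'.r, T'.b) (-1) (Or.inr rfl) rfl h2
      (fun h => absurd h hn') (fun _ => ⟨rfl, h1⟩)
    exact ⟨T'', h, hb.symm, ha.symm⟩
  · exact main T T' hT hT' (T.l, T.b) 1 (Or.inl rfl) rfl h2.symm
      (fun _ => ⟨rfl, h1.symm⟩) (fun h => absurd h hn)

/-- `T` and `T'` are equal or share a full edge. -/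
def AdjEq (T T' : Rect) : Prop := T = T' ∨ Adj T T'

theorem AdjEq.refl (T : Rect) : AdjEq T T := Or.inl rfl

theorem AdjEq.symm {T T' : Rect} (h : AdjEq T T') : AdjEq T' T := by
  rcases h with h | h
  · exact Or.inl h.symm
  · exact Or.inr h.symm

theorem Adj.exists_edge_eq {T T' : Rect} (h : Adj T T') : ∃ i, T.edge i = T'.edge (i + 2) := by
  rcases h with h | h | h | h
  · exact ⟨1, by simp [Rect.edge, h.1, h.2.1, h.2.2]⟩
  · exact ⟨3, by simp [Rect.edge, h.1, h.2.1, h.2.2]⟩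
  · exact ⟨2, by simp [Rect.edge, h.1, h.2.1, h.2.2]⟩
  · exact ⟨0, by simp [Rect.edge, h.1, h.2.1, h.2.2]⟩

open Classical in
theorem IsMesh.card_adjEq_le (hM : IsMesh Ω M) (T : Rect) :
    (M.filter fun T' => AdjEq T T').card ≤ 5 := by
  have hsub : (M.filter fun T' => AdjEq T T') ⊆
      {T} ∪ Finset.univ.biUnion fun i : Fin 4 => M.filter fun T' => T.edge i = T'.edge (i + 2) := by
    intro T' hT'
    rw [Finset.mem_filter] at hT'
    rw [Finset.mem_union, Finset.mem_singleton, Finset.mem_biUnion]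
    rcases hT'.2 with h | h
    · exact Or.inl h.symm
    · obtain ⟨i, hi⟩ := h.exists_edge_eq
      exact Or.inr ⟨i, Finset.mem_univ i, Finset.mem_filter.2 ⟨hT'.1, hi⟩⟩
  refine (Finset.card_le_card hsub).trans ((Finset.card_union_le _ _).trans ?_)
  rw [Finset.card_singleton]
  have : ∀ i ∈ (Finset.univ : Finset (Fin 4)),
      (M.filter fun T' => T.edge i = T'.edge (i + 2)).card ≤ 1 := by
    intro i _
    rw [Finset.card_le_one]
    intro a ha b hb
    rw [Finset.mem_filter] at ha hb
    exact hM.eq_of_edge_eq ha.1 hb.1 (ha.2.symm.trans hb.2)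
  have h2 := Finset.card_biUnion_le_card_mul _ _ 1 this
  simp only [Finset.card_univ, Fintype.card_fin] at h2
  omega

open Classical in
/-- The sum of `b` over an element and its neighbours. -/
noncomputable def nbSum (M : Finset Rect) (b : Rect → ℝ) (T : Rect) : ℝ :=
  ∑ T' ∈ M.filter fun T' => AdjEq T T', b T'

theorem nbSum_nonneg {b : Rect → ℝ} (hb : ∀ T ∈ M, 0 ≤ b T) (T : Rect) : 0 ≤ nbSum M b T := by
  classical
  exact Finset.sum_nonneg fun T' h => hb T' (Finset.mem_filter.1 h).1

theorem le_nbSum {b : Rect → ℝ} (hb : ∀ T ∈ M, 0 ≤ b T) {T T' : Rect} (hT' : T' ∈ M)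
    (h : AdjEq T T') : b T' ≤ nbSum M b T := by
  classical
  exact Finset.single_le_sum (f := b) (fun T' h => hb T' (Finset.mem_filter.1 h).1)
    (Finset.mem_filter.2 ⟨hT', h⟩)

theorem IsMesh.sum_nbSum_le (hM : IsMesh Ω M) {b : Rect → ℝ} (hb : ∀ T ∈ M, 0 ≤ b T) :
    ∑ T ∈ M, nbSum M b T ≤ 5 * ∑ T ∈ M, b T := by
  classical
  have : ∀ T, nbSum M b T = ∑ T' ∈ M, if AdjEq T T' then b T' else 0 := fun T => by
    unfold nbSum; rw [Finset.sum_filter]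
  simp only [this]
  rw [Finset.sum_comm, Finset.mul_sum]
  refine Finset.sum_le_sum fun T' hT' => ?_
  rw [← Finset.sum_filter, Finset.sum_const, nsmul_eq_mul]
  have h1 : (M.filter fun T => AdjEq T T') = M.filter fun T => AdjEq T' T :=
    Finset.filter_congr fun T _ => ⟨AdjEq.symm, AdjEq.symm⟩
  rw [h1]
  have h2 : ((M.filter fun T => AdjEq T' T).card : ℝ) ≤ 5 := by exact_mod_cast hM.card_adjEq_le T'
  exact mul_le_mul_of_nonneg_right h2 (hb T' hT')

end WG

namespace WG

variable {Ω : Set (ℝ × ℝ)} {M : Finset Rect} {σ : ℝ}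

/-! ### Quasi-uniformity -/

theorem Rect.width_le_diam (T : Rect) : T.width ≤ T.diam :=
  Real.le_sqrt_of_sq_le (by nlinarith [sq_nonneg T.height])

theorem Rect.height_le_diam (T : Rect) : T.height ≤ T.diam :=
  Real.le_sqrt_of_sq_le (by nlinarith [sq_nonneg T.width])

theorem Rect.diam_pos (T : Rect) : 0 < T.diam := T.width_pos.trans_le T.width_le_diam

theorem IsShapeRegular.pos (h : IsShapeRegular σ M) {T : Rect} (hT : T ∈ M) : 0 < σ := by
  by_contra hσ
  have h1 := h T hT
  have h2 := lt_min T.width_pos T.height_pos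
  have h3 := T.diam_pos
  nlinarith

theorem IsShapeRegular.diam_le_width (h : IsShapeRegular σ M) {T : Rect} (hT : T ∈ M) :
    T.diam ≤ σ * T.width :=
  (h T hT).trans (mul_le_mul_of_nonneg_left (min_le_left _ _) (h.pos hT).le)

theorem IsShapeRegular.diam_le_height (h : IsShapeRegular σ M) {T : Rect} (hT : T ∈ M) :
    T.diam ≤ σ * T.height :=
  (h T hT).trans (mul_le_mul_of_nonneg_left (min_le_right _ _) (h.pos hT).le)

theorem isClosed_biUnion_filter (M : Finset Rect) (P : Rect → Prop) :
    IsClosed (⋃ T ∈ {T ∈ (M : Set Rect) | P T}, T.carrier) :=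
  (M.finite_toSet.subset (sep_subset _ _)).isClosed_biUnion fun T _ => T.isCompact_carrier.isClosed

theorem IsMesh.exists_same_height (hM : IsMesh Ω M) {x₀ x₁ y : ℝ}
    (hy : ∀ T ∈ M, y ≠ T.b ∧ y ≠ T.t) (hseg : ∀ x ∈ uIcc x₀ x₁, (x, y) ∈ Ω) {T₀ : Rect}
    (hT₀ : T₀ ∈ M) (hm : (x₀, y) ∈ T₀.carrier) :
    ∃ T₁ ∈ M, (x₁, y) ∈ T₁.carrier ∧ T₁.height = T₀.height := by
  set A := ⋃ T ∈ {T ∈ (M : Set Rect) | T.height = T₀.height}, T.carrier with hA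
  set B := ⋃ T ∈ {T ∈ (M : Set Rect) | T.height ≠ T₀.height}, T.carrier with hB
  have hc : Continuous fun x : ℝ => (x, y) := by fun_prop
  have cA := (isClosed_biUnion_filter M fun T => T.height = T₀.height).preimage hc
  have cB := (isClosed_biUnion_filter M fun T => T.height ≠ T₀.height).preimage hc
  have key := isPreconnected_closed_iff.1 (isPreconnected_uIcc (a := x₀) (b := x₁)) _ _ cA cB ?_
    ⟨x₀, left_mem_uIcc, by simp only [mem_preimage, mem_iUnion]; exact ⟨T₀, ⟨hT₀, rfl⟩, hm⟩⟩
  · by_contra hcon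
    push Not at hcon
    obtain ⟨T₁, hT₁, hm₁⟩ := hM.exists_mem (subset_closure (hseg x₁ right_mem_uIcc))
    obtain ⟨x, hx, hxA, hxB⟩ := key ⟨x₁, right_mem_uIcc, by
      simp only [mem_preimage, mem_iUnion]; exact ⟨T₁, ⟨hT₁, hcon T₁ hT₁ hm₁⟩, hm₁⟩⟩
    simp only [mem_preimage, mem_iUnion] at hxA hxB
    obtain ⟨T, ⟨hT, hTh⟩, hTm⟩ := hxA
    obtain ⟨T', ⟨hT', hTh'⟩, hTm'⟩ := hxB
    have hne : T ≠ T' := by rintro rfl; exact hTh' hTh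
    have h := hM.adj_or_diag hT hT' hne hTm hTm'
    apply hTh'
    rw [← hTh]
    have h1 := hy T hT
    have h2 := hy T' hT'
    rw [Rect.mem_carrier] at hTm hTm'
    simp only [Adj, Diag, Rect.height] at h ⊢
    grind
  · intro x hx
    obtain ⟨T, hT, hm⟩ := hM.exists_mem (subset_closure (hseg x hx))
    by_cases hh : T.height = T₀.height
    · left; simp only [mem_preimage, mem_iUnion]; exact ⟨T, ⟨hT, hh⟩, hm⟩
    · right; simp only [mem_preimage, mem_iUnion]; exact ⟨T, ⟨hT, hh⟩, hm⟩

theorem IsMesh.exists_same_width (hM : IsMesh Ω M) {x y₀ y₁ : ℝ}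
    (hx : ∀ T ∈ M, x ≠ T.l ∧ x ≠ T.r) (hseg : ∀ y ∈ uIcc y₀ y₁, (x, y) ∈ Ω) {T₀ : Rect}
    (hT₀ : T₀ ∈ M) (hm : (x, y₀) ∈ T₀.carrier) :
    ∃ T₁ ∈ M, (x, y₁) ∈ T₁.carrier ∧ T₁.width = T₀.width := by
  set A := ⋃ T ∈ {T ∈ (M : Set Rect) | T.width = T₀.width}, T.carrier with hA
  set B := ⋃ T ∈ {T ∈ (M : Set Rect) | T.width ≠ T₀.width}, T.carrier with hB
  have hc : Continuous fun y : ℝ => (x, y) := by fun_prop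
  have cA := (isClosed_biUnion_filter M fun T => T.width = T₀.width).preimage hc
  have cB := (isClosed_biUnion_filter M fun T => T.width ≠ T₀.width).preimage hc
  have key := isPreconnected_closed_iff.1 (isPreconnected_uIcc (a := y₀) (b := y₁)) _ _ cA cB ?_
    ⟨y₀, left_mem_uIcc, by simp only [mem_preimage, mem_iUnion]; exact ⟨T₀, ⟨hT₀, rfl⟩, hm⟩⟩
  · by_contra hcon
    push Not at hcon
    obtain ⟨T₁, hT₁, hm₁⟩ := hM.exists_mem (subset_closure (hseg y₁ right_mem_uIcc))
    obtain ⟨y, hy, hyA, hyB⟩ := key ⟨y₁, right_mem_uIcc, by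
      simp only [mem_preimage, mem_iUnion]; exact ⟨T₁, ⟨hT₁, hcon T₁ hT₁ hm₁⟩, hm₁⟩⟩
    simp only [mem_preimage, mem_iUnion] at hyA hyB
    obtain ⟨T, ⟨hT, hTh⟩, hTm⟩ := hyA
    obtain ⟨T', ⟨hT', hTh'⟩, hTm'⟩ := hyB
    have hne : T ≠ T' := by rintro rfl; exact hTh' hTh
    have h := hM.adj_or_diag hT hT' hne hTm hTm'
    apply hTh'
    rw [← hTh]
    have h1 := hx T hT
    have h2 := hx T' hT'
    rw [Rect.mem_carrier] at hTm hTm'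
    simp only [Adj, Diag, Rect.width] at h ⊢
    grind
  · intro y hy
    obtain ⟨T, hT, hm⟩ := hM.exists_mem (subset_closure (hseg y hy))
    by_cases hh : T.width = T₀.width
    · left; simp only [mem_preimage, mem_iUnion]; exact ⟨T, ⟨hT, hh⟩, hm⟩
    · right; simp only [mem_preimage, mem_iUnion]; exact ⟨T, ⟨hT, hh⟩, hm⟩

/-- Elements that meet the same rectangle inside the domain have comparable size. -/
theorem IsMesh.diam_le_of_inter (hM : IsMesh Ω M) (hσ : IsShapeRegular σ M) {R : Rect}
    (hR : R.inner ⊆ Ω) {T T' : Rect} (hT : T ∈ M) (hT' : T' ∈ M) (h : (T.inner ∩ R.inner).Nonempty)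
    (h' : (T'.inner ∩ R.inner).Nonempty) : T.diam ≤ σ ^ 2 * T'.diam := by
  classical
  obtain ⟨p, hp, hpR⟩ := h
  obtain ⟨q, hq, hqR⟩ := h'
  rw [Rect.mem_inner] at hp hpR hq hqR
  obtain ⟨y, hy, hyM⟩ := (Ioo_infinite (show max T.b R.b < min T.t R.t by
    apply lt_min <;> apply max_lt <;> linarith)).exists_notMem_finset
    (M.image Rect.b ∪ M.image Rect.t)
  obtain ⟨x, hx, hxM⟩ := (Ioo_infinite (show max T'.l R.l < min T'.r R.r by
    apply lt_min <;> apply max_lt <;> linarith)).exists_notMem_finset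
    (M.image Rect.l ∪ M.image Rect.r)
  rw [mem_Ioo, max_lt_iff, lt_min_iff] at hx hy
  have hy' : ∀ T ∈ M, y ≠ T.b ∧ y ≠ T.t := by
    intro T hT
    constructor
    · rintro rfl; exact hyM (Finset.mem_union_left _ (Finset.mem_image_of_mem _ hT))
    · rintro rfl; exact hyM (Finset.mem_union_right _ (Finset.mem_image_of_mem _ hT))
  have hx' : ∀ T ∈ M, x ≠ T.l ∧ x ≠ T.r := by
    intro T hT
    constructor
    · rintro rfl; exact hxM (Finset.mem_union_left _ (Finset.mem_image_of_mem _ hT))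
    · rintro rfl; exact hxM (Finset.mem_union_right _ (Finset.mem_image_of_mem _ hT))
  have hRx : ∀ a b c, a ∈ Ioo R.l R.r → b ∈ Ioo R.l R.r → c ∈ uIcc a b → c ∈ Ioo R.l R.r :=
    fun a b c ha hb hc => ordConnected_Ioo.uIcc_subset ha hb hc
  have hRy : ∀ a b c, a ∈ Ioo R.b R.t → b ∈ Ioo R.b R.t → c ∈ uIcc a b → c ∈ Ioo R.b R.t :=
    fun a b c ha hb hc => ordConnected_Ioo.uIcc_subset ha hb hc
  obtain ⟨T₁, hT₁, hm₁, hh⟩ := hM.exists_same_height (x₀ := p.1) (x₁ := x) hy'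
    (fun c hc => hR ⟨hRx _ _ c hpR.1 ⟨hx.1.2, hx.2.2⟩ hc, ⟨hy.1.2, hy.2.2⟩⟩) hT
    (Rect.mem_carrier.2 ⟨⟨hp.1.1.le, hp.1.2.le⟩, hy.1.1.le, hy.2.1.le⟩)
  obtain ⟨T₂, hT₂, hm₂, hw⟩ := hM.exists_same_width (y₀ := y) (y₁ := q.2) hx'
    (fun c hc => hR ⟨⟨hx.1.2, hx.2.2⟩, hRy _ _ c ⟨hy.1.2, hy.2.2⟩ hqR.2 hc⟩) hT₁ hm₁
  have hT₂' : T' = T₂ := hM.eq_of_mem_inner hT' hT₂ (z := (x, q.2))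
    (Rect.mem_inner.2 ⟨⟨hx.1.1, hx.2.1⟩, hq.2⟩) hm₂
  have hσ0 := hσ.pos hT
  calc T.diam ≤ σ * T.height := hσ.diam_le_height hT
    _ = σ * T₁.height := by rw [hh]
    _ ≤ σ * T₁.diam := mul_le_mul_of_nonneg_left T₁.height_le_diam hσ0.le
    _ ≤ σ * (σ * T₁.width) := mul_le_mul_of_nonneg_left (hσ.diam_le_width hT₁) hσ0.le
    _ = σ ^ 2 * T'.width := by rw [hT₂', hw]; ring
    _ ≤ σ ^ 2 * T'.diam := mul_le_mul_of_nonneg_left T'.width_le_diam (sq_nonneg _)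

theorem inner_inter_nonempty {T : Rect} {z : ℝ × ℝ} (hz : z ∈ T.carrier) {B : Set (ℝ × ℝ)}
    (hB : IsOpen B) (hzB : z ∈ B) : (T.inner ∩ B).Nonempty := by
  rw [← T.closure_inner] at hz
  rw [inter_comm]
  exact mem_closure_iff.1 hz B hB hzB

theorem exists_rect_mem_inner {U : Set (ℝ × ℝ)} (hU : IsOpen U) {z : ℝ × ℝ} (hz : z ∈ U) :
    ∃ R : Rect, z ∈ R.inner ∧ R.inner ⊆ U := by
  obtain ⟨ε, hε, h⟩ := Metric.isOpen_iff.1 hU z hz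
  refine ⟨⟨z.1 - ε, z.1 + ε, z.2 - ε, z.2 + ε, by linarith, by linarith⟩, ?_, ?_⟩
  · rw [Rect.mem_inner]; simp [hε]
  · intro w hw
    rw [Rect.mem_inner] at hw
    simp only at hw
    apply h
    rw [Metric.mem_ball, Prod.dist_eq, Real.dist_eq, Real.dist_eq]
    apply max_lt <;> rw [abs_lt] <;> constructor <;> linarith

theorem exists_diam_le_of_mem (hΩ : IsRectangularDomain Ω) (σ : ℝ) {z w : ℝ × ℝ} (hz : z ∈ Ω)
    (hw : w ∈ Ω) : ∃ C : ℝ, 0 ≤ C ∧ ∀ M, IsMesh Ω M → IsShapeRegular σ M → ∀ T ∈ M, ∀ T' ∈ M,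
      z ∈ T.carrier → w ∈ T'.carrier → T.diam ≤ C * T'.diam := by
  refine hΩ.connected.isPreconnected.induction₂' (fun z w => ∃ C : ℝ, 0 ≤ C ∧ ∀ M, IsMesh Ω M →
    IsShapeRegular σ M → ∀ T ∈ M, ∀ T' ∈ M, z ∈ T.carrier → w ∈ T'.carrier →
    T.diam ≤ C * T'.diam) ?_ ?_ hz hw
  · intro x hx
    obtain ⟨R, hxR, hR⟩ := exists_rect_mem_inner hΩ.isOpen hx
    filter_upwards [mem_nhdsWithin_of_mem_nhds (R.isOpen_inner.mem_nhds hxR)] with y hy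
    exact ⟨⟨σ ^ 2, sq_nonneg _, fun M hM hσ T hT T' hT' h h' => hM.diam_le_of_inter hσ hR hT hT'
        (inner_inter_nonempty h R.isOpen_inner hxR) (inner_inter_nonempty h' R.isOpen_inner hy)⟩,
      ⟨σ ^ 2, sq_nonneg _, fun M hM hσ T hT T' hT' h h' => hM.diam_le_of_inter hσ hR hT hT'
        (inner_inter_nonempty h R.isOpen_inner hy) (inner_inter_nonempty h' R.isOpen_inner hxR)⟩⟩
  · rintro x y z hx hy hz ⟨C, hC, h⟩ ⟨C', hC', h'⟩
    refine ⟨C * C', mul_nonneg hC hC', fun M hM hσ T hT T' hT' hxT hzT' => ?_⟩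
    obtain ⟨S, hS, hyS⟩ := hM.exists_mem (subset_closure hy)
    calc T.diam ≤ C * S.diam := h M hM hσ T hT S hS hxT hyS
      _ ≤ C * (C' * T'.diam) := mul_le_mul_of_nonneg_left (h' M hM hσ S hS T' hT' hyS hzT') hC
      _ = _ := by ring

theorem Rect.inner_nonempty (T : Rect) : T.inner.Nonempty := by
  have h1 := T.hlr
  have h2 := T.hbt
  exact ⟨((T.l + T.r) / 2, (T.b + T.t) / 2), Rect.mem_inner.2 (by simp only; grind)⟩

/-- Shape regular conforming meshes of rectangles are quasi-uniform. -/
theorem exists_diam_le (hΩ : IsRectangularDomain Ω) (σ : ℝ) : ∃ C : ℝ, 0 ≤ C ∧ ∀ M, IsMesh Ω M →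
    IsShapeRegular σ M → ∀ T ∈ M, ∀ T' ∈ M, T.diam ≤ C * T'.diam := by
  classical
  obtain ⟨𝓡, h𝓡⟩ := hΩ.union
  have hin : ∀ R ∈ 𝓡, R.inner ⊆ Ω := by
    intro R hR
    rw [h𝓡]
    exact interior_maximal (R.inner_subset.trans
      (subset_biUnion_of_mem (u := fun T : Rect => T.carrier) hR)) R.isOpen_inner
  choose c hc using Rect.inner_nonempty
  have hpair : ∀ p : Rect × Rect, ∃ C : ℝ, 0 ≤ C ∧ (p ∈ 𝓡 ×ˢ 𝓡 → ∀ M, IsMesh Ω M →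
      IsShapeRegular σ M → ∀ T ∈ M, ∀ T' ∈ M, c p.1 ∈ T.carrier → c p.2 ∈ T'.carrier →
        T.diam ≤ C * T'.diam) := by
    intro p
    by_cases hp : p ∈ 𝓡 ×ˢ 𝓡
    · rw [Finset.mem_product] at hp
      obtain ⟨C, hC, h⟩ := exists_diam_le_of_mem hΩ σ (hin _ hp.1 (hc p.1)) (hin _ hp.2 (hc p.2))
      exact ⟨C, hC, fun _ => h⟩
    · exact ⟨0, le_rfl, fun h => absurd h hp⟩
  choose C hC hC' using hpair
  refine ⟨σ ^ 2 * ((∑ p ∈ 𝓡 ×ˢ 𝓡, C p) * σ ^ 2), by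
    have := Finset.sum_nonneg fun p (_ : p ∈ 𝓡 ×ˢ 𝓡) => hC p
    positivity, fun M hM hσ T hT T' hT' => ?_⟩
  have hmeet : ∀ T ∈ M, ∃ R ∈ 𝓡, (T.inner ∩ R.inner).Nonempty := by
    intro T hT
    obtain ⟨w, hw⟩ := T.inner_nonempty
    have hwΩ := hM.inner_subset hΩ hT hw
    rw [h𝓡] at hwΩ
    have := interior_subset hwΩ
    simp only [mem_iUnion] at this
    obtain ⟨R, hR, hwR⟩ := this
    refine ⟨R, hR, ?_⟩
    rw [inter_comm]
    exact inner_inter_nonempty hwR T.isOpen_inner hw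
  obtain ⟨R, hR, hTR⟩ := hmeet T hT
  obtain ⟨R', hR', hTR'⟩ := hmeet T' hT'
  obtain ⟨S, hS, hcS⟩ := hM.exists_mem (subset_closure (hin R hR (hc R)))
  obtain ⟨S', hS', hcS'⟩ := hM.exists_mem (subset_closure (hin R' hR' (hc R')))
  have hp : (R, R') ∈ 𝓡 ×ˢ 𝓡 := Finset.mem_product.2 ⟨hR, hR'⟩
  have h1 := hM.diam_le_of_inter hσ (hin R hR) hT hS hTR
    (inner_inter_nonempty hcS R.isOpen_inner (hc R))
  have h2 := hC' (R, R') hp M hM hσ S hS S' hS' hcS hcS'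
  have h3 := hM.diam_le_of_inter hσ (hin R' hR') hS' hT'
    (inner_inter_nonempty hcS' R'.isOpen_inner (hc R')) hTR'
  have h4 : C (R, R') ≤ ∑ p ∈ 𝓡 ×ˢ 𝓡, C p := Finset.single_le_sum (fun p _ => hC p) hp
  have hs := sq_nonneg σ
  calc T.diam ≤ σ ^ 2 * S.diam := h1
    _ ≤ σ ^ 2 * (C (R, R') * S'.diam) := by gcongr
    _ ≤ σ ^ 2 * ((∑ p ∈ 𝓡 ×ˢ 𝓡, C p) * (σ ^ 2 * T'.diam)) := by
        have := S'.diam_pos.le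
        have := (hC (R, R')).trans h4
        gcongr
    _ = _ := by ring

theorem IsMesh.nonempty (hM : IsMesh Ω M) (hΩ : IsRectangularDomain Ω) : M.Nonempty := by
  obtain ⟨z, hz⟩ := hΩ.connected.nonempty
  obtain ⟨T, hT, -⟩ := hM.exists_mem (subset_closure hz)
  exact ⟨T, hT⟩

theorem diam_le_meshSize {T : Rect} (hT : T ∈ M) : T.diam ≤ meshSize M :=
  le_csSup (M.finite_toSet.image _).bddAbove ⟨T, hT, rfl⟩

theorem exists_diam_eq_meshSize (h : M.Nonempty) : ∃ T ∈ M, meshSize M = T.diam := by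
  obtain ⟨T, hT, h⟩ := ((Finset.coe_nonempty.2 h).image Rect.diam).csSup_mem
    (M.finite_toSet.image Rect.diam)
  exact ⟨T, hT, h.symm⟩

/-- The dimensions of all elements are comparable to the mesh size. -/
theorem exists_meshSize_le (hΩ : IsRectangularDomain Ω) (σ : ℝ) : ∃ κ : ℝ, 1 ≤ κ ∧ ∀ M,
    IsMesh Ω M → IsShapeRegular σ M → 0 < meshSize M ∧ ∀ T ∈ M,
      T.width ≤ meshSize M ∧ T.height ≤ meshSize M ∧
      meshSize M ≤ κ * T.width ∧ meshSize M ≤ κ * T.height := by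
  obtain ⟨C, hC, h⟩ := exists_diam_le hΩ σ
  refine ⟨max 1 (C * |σ|), le_max_left _ _, fun M hM hσ => ?_⟩
  obtain ⟨T₀, hT₀, hmax⟩ := exists_diam_eq_meshSize (hM.nonempty hΩ)
  have hσ0 := hσ.pos hT₀
  refine ⟨hmax ▸ T₀.diam_pos, fun T hT => ⟨T.width_le_diam.trans (diam_le_meshSize hT),
    T.height_le_diam.trans (diam_le_meshSize hT), ?_, ?_⟩⟩
  all_goals rw [hmax]
  · have := T.width_pos
    calc T₀.diam ≤ C * T.diam := h M hM hσ T₀ hT₀ T hT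
      _ ≤ C * (σ * T.width) := mul_le_mul_of_nonneg_left (hσ.diam_le_width hT) hC
      _ = C * |σ| * T.width := by rw [abs_of_pos hσ0]; ring
      _ ≤ _ := by gcongr; exact le_max_right _ _
  · have := T.height_pos
    calc T₀.diam ≤ C * T.diam := h M hM hσ T₀ hT₀ T hT
      _ ≤ C * (σ * T.height) := mul_le_mul_of_nonneg_left (hσ.diam_le_height hT) hC
      _ = C * |σ| * T.height := by rw [abs_of_pos hσ0]; ring
      _ ≤ _ := by gcongr; exact le_max_right _ _

/-- The mesh size is bounded in terms of the domain. -/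
theorem exists_meshSize_le_domain (hΩ : IsRectangularDomain Ω) : ∃ D : ℝ, 1 ≤ D ∧ ∀ M, IsMesh Ω M →
    meshSize M ≤ D := by
  obtain ⟨𝓡, h𝓡⟩ := hΩ.union
  obtain ⟨B, hB⟩ := (IsRectangularDomain.isCompact_union 𝓡).isBounded.exists_norm_le
  refine ⟨max 1 (4 * B), le_max_left _ _, fun M hM => ?_⟩
  obtain ⟨T, hT, hmax⟩ := exists_diam_eq_meshSize (hM.nonempty hΩ)
  have hsub : T.carrier ⊆ ⋃ T ∈ 𝓡, T.carrier := by
    refine (hM.carrier_subset hT).trans (closure_minimal ?_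
      (IsRectangularDomain.isCompact_union 𝓡).isClosed)
    rw [h𝓡]; exact interior_subset
  have h1 := hB _ (hsub (Rect.mem_carrier.2 ⟨⟨le_rfl, T.hlr.le⟩, le_rfl, T.hbt.le⟩ :
    (T.l, T.b) ∈ T.carrier))
  have h2 := hB _ (hsub (Rect.mem_carrier.2 ⟨⟨T.hlr.le, le_rfl⟩, T.hbt.le, le_rfl⟩ :
    (T.r, T.t) ∈ T.carrier))
  rw [Prod.norm_def, max_le_iff, Real.norm_eq_abs, Real.norm_eq_abs, abs_le, abs_le] at h1 h2
  refine le_trans ?_ (le_max_right _ _)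
  have hw : T.width ≤ 2 * B := by unfold Rect.width; linarith
  have hh : T.height ≤ 2 * B := by unfold Rect.height; linarith
  have := T.width_pos
  have := T.height_pos
  rw [hmax]
  exact Real.sqrt_le_iff.2 ⟨by linarith, by nlinarith⟩

end WG

namespace WG

/-! ### Inequalities for smooth functions on a rectangle -/

theorem integral_mul_sq_le {α : Type*} {mα : MeasurableSpace α} {μ : Measure α} {f g : α → ℝ}
    (hf : MemLp f 2 μ) (hg : MemLp g 2 μ) :
    (∫ x, f x * g x ∂μ) ^ 2 ≤ (∫ x, f x ^ 2 ∂μ) * ∫ x, g x ^ 2 ∂μ := by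
  have hfg : Integrable (fun x => f x * g x) μ := hf.integrable_mul hg
  have hf2 : Integrable (fun x => f x ^ 2) μ := hf.integrable_sq
  have hg2 : Integrable (fun x => g x ^ 2) μ := hg.integrable_sq
  have key : ∀ t : ℝ, 0 ≤ (∫ x, g x ^ 2 ∂μ) * (t * t) + 2 * (∫ x, f x * g x ∂μ) * t +
      ∫ x, f x ^ 2 ∂μ := by
    intro t
    have h0 : 0 ≤ ∫ x, (f x + t * g x) ^ 2 ∂μ := integral_nonneg fun x => sq_nonneg _
    have h1 : (fun x => (f x + t * g x) ^ 2) =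
        fun x => (f x ^ 2 + 2 * t * (f x * g x)) + t * t * g x ^ 2 := by ext x; ring
    have i1 := hfg.const_mul (2 * t)
    have i2 := hg2.const_mul (t * t)
    have i3 : Integrable (fun x => f x ^ 2 + 2 * t * (f x * g x)) μ := hf2.add i1
    rw [h1, integral_add i3 i2, integral_add hf2 i1, integral_const_mul,
      integral_const_mul] at h0
    linarith
  have := discrim_le_zero key
  rw [discrim] at this
  nlinarith

theorem _root_.Continuous.memLp_restrict {T : Rect} {g : ℝ × ℝ → ℝ} (hg : Continuous g) :
    MemLp g 2 (volume.restrict T.carrier) := by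
  rw [memLp_two_iff_integrable_sq hg.aestronglyMeasurable]
  exact (hg.pow 2).integrableOn_rect T

theorem intervalIntegral_sq_le {f : ℝ → ℝ} (hf : Continuous f) {a b : ℝ} (hab : a ≤ b) :
    (∫ x in a..b, f x) ^ 2 ≤ (b - a) * ∫ x in a..b, f x ^ 2 := by
  rw [intervalIntegral.integral_of_le hab, intervalIntegral.integral_of_le hab]
  have h1 : MemLp f 2 (volume.restrict (Ioc a b)) := by
    rw [memLp_two_iff_integrable_sq hf.aestronglyMeasurable]
    exact ((hf.pow 2).integrableOn_Icc).mono_set Ioc_subset_Icc_self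
  have h := integral_mul_sq_le (memLp_const (1 : ℝ) (μ := volume.restrict (Ioc a b))) h1
  simpa [hab] using h

theorem sub_sq_le_integral {f f' : ℝ → ℝ} (hf : ∀ x, HasDerivAt f (f' x) x) (hc : Continuous f')
    {a b x y : ℝ} (hx : x ∈ Icc a b) (hy : y ∈ Icc a b) :
    (f x - f y) ^ 2 ≤ (b - a) * ∫ s in a..b, f' s ^ 2 := by
  wlog hxy : y ≤ x generalizing x y
  · have := this hy hx (by linarith)
    linarith [sq_abs (f x - f y), sq_abs (f y - f x), abs_sub_comm (f x) (f y),
      (by ring : (f x - f y) ^ 2 = (f y - f x) ^ 2)]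
  have h1 := intervalIntegral.integral_eq_sub_of_hasDerivAt (a := y) (b := x) (fun s _ => hf s)
    (hc.intervalIntegrable _ _)
  rw [← h1]
  refine (intervalIntegral_sq_le hc hxy).trans ?_
  have h2 : ∫ s in y..x, f' s ^ 2 ≤ ∫ s in a..b, f' s ^ 2 :=
    intervalIntegral.integral_mono_interval hy.1 hxy hx.2
      (Filter.Eventually.of_forall fun s => sq_nonneg _) ((hc.pow 2).intervalIntegrable _ _)
  have h3 : 0 ≤ ∫ s in y..x, f' s ^ 2 :=
    intervalIntegral.integral_nonneg hxy fun s _ => sq_nonneg _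
  exact mul_le_mul (by linarith [hx.2, hy.1]) h2 h3 (by linarith [hx.1, hx.2])

theorem sq_le_integral {f f' : ℝ → ℝ} (hf : ∀ x, HasDerivAt f (f' x) x) (hc : Continuous f')
    {a b x : ℝ} (hab : a < b) (hx : x ∈ Icc a b) :
    f x ^ 2 ≤ 2 / (b - a) * (∫ s in a..b, f s ^ 2) + 2 * (b - a) * ∫ s in a..b, f' s ^ 2 := by
  have hfc : Continuous f := continuous_iff_continuousAt.2 fun x => (hf x).continuousAt
  have hd : 0 < b - a := sub_pos.2 hab
  set J := ∫ s in a..b, f' s ^ 2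
  have h1 : ∫ y in a..b, f x ^ 2 ≤ ∫ y in a..b, (2 * f y ^ 2 + 2 * ((b - a) * J)) := by
    refine intervalIntegral.integral_mono_on hab.le (by simp) ?_ fun y hy => ?_
    · exact ((continuous_const.mul (hfc.pow 2)).add continuous_const).intervalIntegrable _ _
    · have := sub_sq_le_integral hf hc hx hy
      nlinarith [sq_nonneg (f x - 2 * f y), sq_nonneg (f x - f y + f y - f y)]
  have c2 : Continuous fun y => 2 * f y ^ 2 := continuous_const.mul (hfc.pow 2)
  rw [intervalIntegral.integral_const, intervalIntegral.integral_add
    (c2.intervalIntegrable _ _) (by simp),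
    intervalIntegral.integral_const_mul, intervalIntegral.integral_const, smul_eq_mul,
    smul_eq_mul] at h1
  rw [div_mul_eq_mul_div, ← sub_nonneg]
  have h2 : 0 ≤ (b - a)⁻¹ * (2 * (∫ s in a..b, f s ^ 2) + (b - a) * (2 * ((b - a) * J)) -
      (b - a) * f x ^ 2) := mul_nonneg (inv_pos.2 hd).le (by linarith)
  have h3 : (b - a)⁻¹ * (2 * (∫ s in a..b, f s ^ 2) + (b - a) * (2 * ((b - a) * J)) -
      (b - a) * f x ^ 2) = 2 * (∫ s in a..b, f s ^ 2) / (b - a) + 2 * (b - a) * J - f x ^ 2 := by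
    field_simp
  linarith

theorem hasDerivAt_slice_fst {g : ℝ × ℝ → ℝ} (hg : ContDiff ℝ ∞ g) (y s : ℝ) :
    HasDerivAt (fun s => g (s, y)) (dx g (s, y)) s := hasDerivAt_fst (hg.diff' _)

theorem hasDerivAt_slice_snd {g : ℝ × ℝ → ℝ} (hg : ContDiff ℝ ∞ g) (x s : ℝ) :
    HasDerivAt (fun s => g (x, s)) (dy g (x, s)) s := hasDerivAt_snd (hg.diff' _)

theorem integral_slice_le {g : ℝ × ℝ → ℝ} (hg : ContDiff ℝ ∞ g) (T : Rect) {y : ℝ}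
    (hy : y ∈ Icc T.b T.t) : ∫ s in T.l..T.r, g (s, y) ^ 2 ≤
      2 / T.height * (∫ z in T.carrier, g z ^ 2) + 2 * T.height * ∫ z in T.carrier, dy g z ^ 2 := by
  have hgc := hg.continuous
  have hdc := (contDiff_dy hg).continuous
  have c1 : Continuous fun z => g z ^ 2 := hgc.pow 2
  have c2 : Continuous fun z => dy g z ^ 2 := hdc.pow 2
  rw [T.integral_eq_of_continuous c1, T.integral_eq_of_continuous c2,
    ← intervalIntegral.integral_const_mul, ← intervalIntegral.integral_const_mul,
    ← intervalIntegral.integral_add]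
  · refine intervalIntegral.integral_mono_on T.hlr.le ?_ ?_ fun s _ => ?_
    · exact (c1.comp (by fun_prop : Continuous fun s : ℝ => (s, y))).intervalIntegrable _ _
    · exact ((continuous_const.mul (continuous_intervalIntegral_snd c1 _ _)).add
        (continuous_const.mul (continuous_intervalIntegral_snd c2 _ _))).intervalIntegrable _ _
    · exact sq_le_integral (hasDerivAt_slice_snd hg s)
        (hdc.comp (by fun_prop : Continuous fun t : ℝ => (s, t))) T.hbt hy
  · exact (continuous_const.mul (continuous_intervalIntegral_snd c1 _ _)).intervalIntegrable _ _
  · exact (continuous_const.mul (continuous_intervalIntegral_snd c2 _ _)).intervalIntegrable _ _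

/-- A Sobolev inequality. -/
theorem sq_le_integral_rect {g : ℝ × ℝ → ℝ} (hg : ContDiff ℝ ∞ g) (T : Rect) {z : ℝ × ℝ}
    (hz : z ∈ T.carrier) : g z ^ 2 ≤
      4 / (T.width * T.height) * (∫ z in T.carrier, g z ^ 2) +
      4 * T.height / T.width * (∫ z in T.carrier, dy g z ^ 2) +
      4 * T.width / T.height * (∫ z in T.carrier, dx g z ^ 2) +
      4 * (T.width * T.height) * (∫ z in T.carrier, dx (dy g) z ^ 2) := by
  obtain ⟨x, y⟩ := z
  have hw := T.width_pos
  have hh := T.height_pos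
  have h1 := sq_le_integral (hasDerivAt_slice_fst hg y)
    ((contDiff_dx hg).continuous.comp (by fun_prop : Continuous fun s : ℝ => (s, y))) T.hlr hz.1
  have h2 := integral_slice_le hg T hz.2
  have h3 := integral_slice_le (contDiff_dx hg) T hz.2
  rw [dy_dx_comm hg] at h3
  change g (x, y) ^ 2 ≤ 2 / T.width * (∫ s in T.l..T.r, g (s, y) ^ 2) +
    2 * T.width * ∫ s in T.l..T.r, dx g (s, y) ^ 2 at h1
  simp only at h2 h3
  refine h1.trans ?_
  calc _ ≤ 2 / T.width * (2 / T.height * (∫ z in T.carrier, g z ^ 2) +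
          2 * T.height * ∫ z in T.carrier, dy g z ^ 2) +
        2 * T.width * (2 / T.height * (∫ z in T.carrier, dx g z ^ 2) +
          2 * T.height * ∫ z in T.carrier, dx (dy g) z ^ 2) := by gcongr
    _ = _ := by field_simp; ring

theorem sub_sq_le_rect {g : ℝ × ℝ → ℝ} (hg : ContDiff ℝ ∞ g) (T : Rect) {z w : ℝ × ℝ}
    (hz : z ∈ T.carrier) (hw : w ∈ T.carrier) : (g z - g w) ^ 2 ≤
      2 * T.width * (∫ s in T.l..T.r, dx g (s, z.2) ^ 2) +
      2 * T.height * ∫ s in T.b..T.t, dy g (w.1, s) ^ 2 := by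
  have h1 := sub_sq_le_integral (hasDerivAt_slice_fst hg z.2)
    ((contDiff_dx hg).continuous.comp (by fun_prop : Continuous fun s : ℝ => (s, z.2))) hz.1 hw.1
  have h2 := sub_sq_le_integral (hasDerivAt_slice_snd hg w.1)
    ((contDiff_dy hg).continuous.comp (by fun_prop : Continuous fun s : ℝ => (w.1, s))) hz.2 hw.2
  change (g z - g (w.1, z.2)) ^ 2 ≤ T.width * ∫ s in T.l..T.r, dx g (s, z.2) ^ 2 at h1
  change (g (w.1, z.2) - g w) ^ 2 ≤ T.height * ∫ s in T.b..T.t, dy g (w.1, s) ^ 2 at h2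
  nlinarith [sq_nonneg ((g z - g (w.1, z.2)) - (g (w.1, z.2) - g w))]

theorem integral_rect_fst (T : Rect) {f : ℝ → ℝ} (hf : Continuous f) :
    ∫ z in T.carrier, f z.1 = T.height * ∫ x in T.l..T.r, f x := by
  have c : Continuous fun z : ℝ × ℝ => f z.1 := hf.comp continuous_fst
  rw [T.integral_eq_of_continuous c]
  simp [Rect.height]

theorem integral_rect_snd (T : Rect) {f : ℝ → ℝ} (hf : Continuous f) :
    ∫ z in T.carrier, f z.2 = T.width * ∫ x in T.b..T.t, f x := by
  have c : Continuous fun z : ℝ × ℝ => f z.2 := hf.comp continuous_snd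
  rw [T.integral_eq_of_continuous' c]
  simp [Rect.width]

/-- Poincaré's inequality. -/
theorem integral_sq_le_poincare {g : ℝ × ℝ → ℝ} (hg : ContDiff ℝ ∞ g) (T : Rect) :
    ∫ z in T.carrier, g z ^ 2 ≤ (∫ z in T.carrier, g z) ^ 2 / (T.width * T.height) +
      2 * T.width ^ 2 * (∫ z in T.carrier, dx g z ^ 2) +
      2 * T.height ^ 2 * ∫ z in T.carrier, dy g z ^ 2 := by
  have hw := T.width_pos
  have hh := T.height_pos
  set a := T.width * T.height with ha
  have ha0 : 0 < a := mul_pos hw hh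
  have c0 := hg.continuous
  have c1 : Continuous fun z => dx g z ^ 2 := (contDiff_dx hg).continuous.pow 2
  have c2 : Continuous fun z => dy g z ^ 2 := (contDiff_dy hg).continuous.pow 2
  set Ix := ∫ z in T.carrier, dx g z ^ 2 with hIx
  set Iy := ∫ z in T.carrier, dy g z ^ 2 with hIy
  set m := (∫ z in T.carrier, g z) / a with hm
  have hI : ∫ z in T.carrier, g z = a * m := by rw [hm]; field_simp
  have step1 : ∀ z ∈ T.carrier, (g z - m) ^ 2 ≤
      2 * T.width * (∫ s in T.l..T.r, dx g (s, z.2) ^ 2) + 2 * T.height / T.width * Iy := by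
    intro z hz
    have e1 : ∫ w in T.carrier, (g z - g w) = a * (g z - m) := by
      rw [integral_sub (continuous_const.integrableOn_rect T) (c0.integrableOn_rect T), hI,
        setIntegral_const, T.volume_carrier, smul_eq_mul]
      ring
    have e2 := integral_mul_sq_le (μ := volume.restrict T.carrier) (memLp_const (1 : ℝ))
      ((continuous_const.sub c0).memLp_restrict (T := T) (g := fun w => g z - g w))
    simp only [one_mul, one_pow] at e2
    rw [e1, setIntegral_const, T.volume_carrier, smul_eq_mul, mul_one, ← ha] at e2
    have e3 : ∫ w in T.carrier, (g z - g w) ^ 2 ≤ ∫ w in T.carrier,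
        (2 * T.width * (∫ s in T.l..T.r, dx g (s, z.2) ^ 2) +
          2 * T.height * ∫ s in T.b..T.t, dy g (w.1, s) ^ 2) := by
      refine setIntegral_mono_on (((continuous_const.sub c0).pow 2).integrableOn_rect T) ?_
        T.measurableSet_carrier fun w hw => sub_sq_le_rect hg T hz hw
      exact (continuous_const.add (continuous_const.mul
        ((continuous_intervalIntegral_snd c2 _ _).comp continuous_fst))).integrableOn_rect T
    have e4 : ∫ w in T.carrier, (2 * T.width * (∫ s in T.l..T.r, dx g (s, z.2) ^ 2) +
          2 * T.height * ∫ s in T.b..T.t, dy g (w.1, s) ^ 2) =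
        a * (2 * T.width * (∫ s in T.l..T.r, dx g (s, z.2) ^ 2)) + 2 * T.height * (T.height * Iy) := by
      have c3 : Continuous fun w : ℝ × ℝ => 2 * T.height * ∫ s in T.b..T.t, dy g (w.1, s) ^ 2 :=
        continuous_const.mul ((continuous_intervalIntegral_snd c2 T.b T.t).comp continuous_fst)
      rw [integral_add (continuous_const.integrableOn_rect T) (c3.integrableOn_rect T),
        setIntegral_const, T.volume_carrier, smul_eq_mul, integral_const_mul,
        integral_rect_fst T (continuous_intervalIntegral_snd c2 T.b T.t), hIy,
        T.integral_eq_of_continuous c2]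
    rw [e4] at e3
    have e5 : a * (a * (g z - m) ^ 2) ≤ a * (a * (2 * T.width * (∫ s in T.l..T.r, dx g (s, z.2) ^ 2)) +
        2 * T.height * (T.height * Iy)) := by
      calc _ = (a * (g z - m)) ^ 2 := by ring
        _ ≤ _ := e2.trans (mul_le_mul_of_nonneg_left e3 ha0.le)
    have e6 := le_of_mul_le_mul_left e5 ha0
    have e7 : a * (2 * T.width * (∫ s in T.l..T.r, dx g (s, z.2) ^ 2)) +
        2 * T.height * (T.height * Iy) =
        a * (2 * T.width * (∫ s in T.l..T.r, dx g (s, z.2) ^ 2) + 2 * T.height / T.width * Iy) := by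
      rw [ha]; field_simp
    rw [e7] at e6
    exact le_of_mul_le_mul_left e6 ha0
  have step2 : ∫ z in T.carrier, (g z - m) ^ 2 ≤ ∫ z in T.carrier,
      (2 * T.width * (∫ s in T.l..T.r, dx g (s, z.2) ^ 2) + 2 * T.height / T.width * Iy) := by
    refine setIntegral_mono_on (((c0.sub continuous_const).pow 2).integrableOn_rect T) ?_
      T.measurableSet_carrier step1
    exact ((continuous_const.mul ((continuous_intervalIntegral_fst c1 _ _).comp
      continuous_snd)).add continuous_const).integrableOn_rect T
  have step3 : ∫ z in T.carrier,
      (2 * T.width * (∫ s in T.l..T.r, dx g (s, z.2) ^ 2) + 2 * T.height / T.width * Iy) =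
      2 * T.width ^ 2 * Ix + 2 * T.height ^ 2 * Iy := by
    have c3 : Continuous fun w : ℝ × ℝ => 2 * T.width * ∫ s in T.l..T.r, dx g (s, w.2) ^ 2 :=
      continuous_const.mul ((continuous_intervalIntegral_fst c1 T.l T.r).comp continuous_snd)
    rw [integral_add (c3.integrableOn_rect T) (continuous_const.integrableOn_rect T),
      setIntegral_const, T.volume_carrier, smul_eq_mul, integral_const_mul,
      integral_rect_snd T (continuous_intervalIntegral_fst c1 T.l T.r), hIx,
      T.integral_eq_of_continuous' c1]
    field_simp
  have step4 : ∫ z in T.carrier, (g z - m) ^ 2 = (∫ z in T.carrier, g z ^ 2) - a * m ^ 2 := by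
    have : (fun z => (g z - m) ^ 2) = fun z => (g z ^ 2 - 2 * m * g z) + m ^ 2 := by ext z; ring
    have c3 : Continuous fun z => g z ^ 2 := c0.pow 2
    have c4 : Continuous fun z => 2 * m * g z := continuous_const.mul c0
    have c5 : Continuous fun z => g z ^ 2 - 2 * m * g z := c3.sub c4
    rw [this, integral_add (c5.integrableOn_rect T)
      (continuous_const.integrableOn_rect T), integral_sub (c3.integrableOn_rect T)
      (c4.integrableOn_rect T), integral_const_mul, hI, setIntegral_const,
      T.volume_carrier, smul_eq_mul]
    ring
  rw [step3, step4] at step2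
  rw [hI]
  have : (a * m) ^ 2 / a = a * m ^ 2 := by field_simp
  linarith

end WG

namespace WG

/-! ### Approximation of Sobolev functions by smooth functions on a rectangle -/

theorem IsTestFunction.dx {Ω : Set (ℝ × ℝ)} {φ : ℝ × ℝ → ℝ} (h : IsTestFunction Ω φ) :
    IsTestFunction Ω (dx φ) :=
  ⟨contDiff_dx h.1, h.2.1.fderiv_apply ℝ _, (tsupport_fderiv_apply_subset ℝ _).trans h.2.2⟩

theorem IsTestFunction.dy {Ω : Set (ℝ × ℝ)} {φ : ℝ × ℝ → ℝ} (h : IsTestFunction Ω φ) :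
    IsTestFunction Ω (dy φ) :=
  ⟨contDiff_dy h.1, h.2.1.fderiv_apply ℝ _, (tsupport_fderiv_apply_subset ℝ _).trans h.2.2⟩

theorem IsTestFunction.iter {Ω : Set (ℝ × ℝ)} {φ : ℝ × ℝ → ℝ} (h : IsTestFunction Ω φ) (a b : ℕ) :
    IsTestFunction Ω (WG.dx^[a] (WG.dy^[b] φ)) := by
  have hb : IsTestFunction Ω (WG.dy^[b] φ) := by
    induction b with
    | zero => exact h
    | succ b ih => rw [Function.iterate_succ_apply']; exact ih.dy
  induction a with
  | zero => exact hb
  | succ a ih => rw [Function.iterate_succ_apply']; exact ih.dx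

theorem D_comp_affine {g : ℝ × ℝ → ℝ} (hg : ContDiff ℝ ∞ g) (v : ℝ × ℝ) (c : ℝ) (a b : ℕ) :
    dx^[a] (dy^[b] fun z => g (v + c • z)) =
      fun z => c ^ (a + b) * (dx^[a] (dy^[b] g)) (v + c • z) := by
  have key : ∀ (f : ℝ × ℝ → ℝ), Differentiable ℝ f → ∀ e z w : ℝ, ∀ p : ℝ × ℝ,
      fderiv ℝ (fun z => e * f (v + c • z)) p (z, w) =
        e * (c * fderiv ℝ f (v + c • p) (z, w)) := by
    intro f hf e z w p
    have h1 : HasFDerivAt (fun z : ℝ × ℝ => v + c • z)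
        (c • ContinuousLinearMap.id ℝ (ℝ × ℝ)) p :=
      ((hasFDerivAt_id p).const_smul c).const_add v
    have h2 := (((hf (v + c • p)).hasFDerivAt.comp p h1).const_mul e).fderiv
    change fderiv ℝ (fun z => e * f (v + c • z)) p = _ at h2
    rw [h2]
    simp only [smul_apply, ContinuousLinearMap.comp_apply,
      ContinuousLinearMap.id_apply, map_smul, smul_eq_mul]
  have hb : dy^[b] (fun z => g (v + c • z)) = fun z => c ^ b * (dy^[b] g) (v + c • z) := by
    induction b with
    | zero => simp
    | succ b ih =>
      rw [Function.iterate_succ_apply', ih, Function.iterate_succ_apply']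
      ext p
      have hd : Differentiable ℝ (dy^[b] g) := (contDiff_iter hg 0 b).diff'
      rw [WG.dy, key _ hd]
      simp only [WG.dy]; ring
  induction a with
  | zero => simpa using hb
  | succ a ih =>
    rw [Function.iterate_succ_apply', ih, Function.iterate_succ_apply']
    ext p
    rw [WG.dx, key _ (contDiff_iter hg a b).diff']
    simp only [WG.dx]; ring

/-- Convolution in the plane. -/
noncomputable def conv (g κ : ℝ × ℝ → ℝ) : ℝ × ℝ → ℝ :=
  MeasureTheory.convolution g κ (ContinuousLinearMap.mul ℝ ℝ) volume

theorem conv_apply (g κ : ℝ × ℝ → ℝ) (v : ℝ × ℝ) : conv g κ v = ∫ w, g w * κ (v - w) := rfl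

theorem contDiff_conv {g κ : ℝ × ℝ → ℝ} (hg : LocallyIntegrable g) (hκ : ContDiff ℝ ∞ κ)
    (hc : HasCompactSupport κ) : ContDiff ℝ ∞ (conv g κ) :=
  hc.contDiff_convolution_right _ hg hκ

theorem fderiv_conv {g κ : ℝ × ℝ → ℝ} (hg : LocallyIntegrable g) (hκ : ContDiff ℝ ∞ κ)
    (hc : HasCompactSupport κ) (v e : ℝ × ℝ) :
    fderiv ℝ (conv g κ) v e = conv g (fun z => fderiv ℝ κ z e) v := by
  have h1 : ContDiff ℝ 1 κ := hκ.of_le (by exact_mod_cast le_top)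
  rw [conv, (hc.hasFDerivAt_convolution_right _ hg h1 v).fderiv,
    convolution_precompR_apply _ hg (hc.fderiv ℝ) (h1.continuous_fderiv one_ne_zero)]
  rfl

theorem D_conv {g κ : ℝ × ℝ → ℝ} (hg : LocallyIntegrable g) (hκ : IsTestFunction univ κ) (a b : ℕ) :
    dx^[a] (dy^[b] (conv g κ)) = conv g (dx^[a] (dy^[b] κ)) := by
  have hb : dy^[b] (conv g κ) = conv g (dy^[b] κ) := by
    induction b with
    | zero => rfl
    | succ b ih =>
      rw [Function.iterate_succ_apply', ih, Function.iterate_succ_apply']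
      ext v
      exact fderiv_conv hg (hκ.iter 0 b).1 (hκ.iter 0 b).2.1 v _
  induction a with
  | zero => exact hb
  | succ a ih =>
    rw [Function.iterate_succ_apply', ih, Function.iterate_succ_apply']
    ext v
    exact fderiv_conv hg (hκ.iter a b).1 (hκ.iter a b).2.1 v _

/-- Continuous, compactly supported, non-negative and of integral one. -/
structure IsMollifier (κ : ℝ × ℝ → ℝ) : Prop where
  cont : Continuous κ
  supp : HasCompactSupport κ
  nonneg : ∀ z, 0 ≤ κ z
  integral : ∫ z, κ z = 1

theorem IsMollifier.comp_sub {κ : ℝ × ℝ → ℝ} (h : IsMollifier κ) (v : ℝ × ℝ) :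
    IsMollifier fun w => κ (v - w) where
  cont := h.cont.comp (by fun_prop)
  supp := h.supp.comp_homeomorph (Homeomorph.subLeft v)
  nonneg _ := h.nonneg _
  integral := by rw [integral_sub_left_eq_self, h.integral]

theorem IsMollifier.integrable {κ : ℝ × ℝ → ℝ} (h : IsMollifier κ) : Integrable κ :=
  h.cont.integrable_of_hasCompactSupport h.supp

theorem IsMollifier.exists_bound {κ : ℝ × ℝ → ℝ} (h : IsMollifier κ) : ∃ B, ∀ z, ‖κ z‖ ≤ B :=
  h.supp.exists_bound_of_continuous h.cont

theorem IsMollifier.memLp {κ : ℝ × ℝ → ℝ} (h : IsMollifier κ) : MemLp κ 2 :=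
  h.cont.memLp_of_hasCompactSupport h.supp

theorem IsMollifier.sq_conv_le {κ g : ℝ × ℝ → ℝ} (h : IsMollifier κ) (hg : MemLp g 2) (v : ℝ × ℝ) :
    conv g κ v ^ 2 ≤ ∫ w, g w ^ 2 * κ (v - w) := by
  set χ := fun w => κ (v - w) with hχ
  have hm : IsMollifier χ := h.comp_sub v
  obtain ⟨B, hB⟩ := hm.exists_bound
  have i1 : Integrable fun w => g w ^ 2 * χ w :=
    hg.integrable_sq.mul_bdd hm.cont.aestronglyMeasurable (Filter.Eventually.of_forall hB)
  have i2 : Integrable fun w => g w * χ w := hg.integrable_mul hm.memLp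
  have i3 := hm.integrable
  set m := conv g κ v with hmdef
  have hmm : ∫ w, g w * χ w = m := rfl
  have h0 : 0 ≤ ∫ w, (g w - m) ^ 2 * χ w :=
    integral_nonneg fun w => mul_nonneg (sq_nonneg _) (hm.nonneg w)
  have e : (fun w => (g w - m) ^ 2 * χ w) =
      fun w => (g w ^ 2 * χ w - 2 * m * (g w * χ w)) + m ^ 2 * χ w := by ext w; ring
  have i4 : Integrable fun w => g w ^ 2 * χ w - 2 * m * (g w * χ w) := i1.sub (i2.const_mul _)
  rw [e, integral_add i4 (i3.const_mul _), integral_sub i1 (i2.const_mul _), integral_const_mul,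
    integral_const_mul, hm.integral, hmm] at h0
  have : ∫ w, g w ^ 2 * κ (v - w) = ∫ w, g w ^ 2 * χ w := rfl
  rw [this]; linarith

theorem IsMollifier.abs_conv_sub_le {κ g : ℝ × ℝ → ℝ} (h : IsMollifier κ) (hg : MemLp g 2)
    {v z : ℝ × ℝ} {ε : ℝ} (hε : ∀ w, κ (v - w) ≠ 0 → |g w - g z| ≤ ε) :
    |conv g κ v - g z| ≤ ε := by
  have hm := h.comp_sub v
  have i2 : Integrable fun w => g w * κ (v - w) := hg.integrable_mul hm.memLp
  have e : conv g κ v - g z = ∫ w, (g w - g z) * κ (v - w) := by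
    simp only [sub_mul]
    rw [integral_sub i2 (hm.integrable.const_mul _), integral_const_mul, hm.integral, mul_one]; rfl
  rw [e, ← Real.norm_eq_abs]
  refine (norm_integral_le_of_norm_le (hm.integrable.const_mul ε)
    (Filter.Eventually.of_forall fun w => ?_)).trans (by rw [integral_const_mul, hm.integral, mul_one])
  rw [norm_mul, Real.norm_eq_abs, Real.norm_eq_abs, abs_of_nonneg (hm.nonneg w)]
  by_cases hw : κ (v - w) = 0
  · simp [hw]
  · exact mul_le_mul_of_nonneg_right (hε w hw) (hm.nonneg w)

theorem locallyIntegrable_of_memLp {g : ℝ × ℝ → ℝ} (hg : MemLp g 2) : LocallyIntegrable g :=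
  hg.locallyIntegrable (by norm_num)

theorem IsMollifier.continuous_conv {κ g : ℝ × ℝ → ℝ} (h : IsMollifier κ) (hg : MemLp g 2) :
    Continuous (conv g κ) :=
  h.supp.continuous_convolution_right _ (locallyIntegrable_of_memLp hg) h.cont

theorem IsMollifier.integral_sq_conv_le {κ g : ℝ × ℝ → ℝ} (h : IsMollifier κ) (hg : MemLp g 2)
    {θ : ℝ} (hθ : 1 / 2 ≤ θ) (R : Rect) :
    ∫ z in R.carrier, conv g κ (θ • z) ^ 2 ≤ 4 * ∫ w, g w ^ 2 := by
  obtain ⟨B, hB⟩ := h.exists_bound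
  have hF : Integrable (fun p : (ℝ × ℝ) × (ℝ × ℝ) => g p.2 ^ 2 * κ (θ • p.1 - p.2))
      ((volume.restrict R.carrier).prod volume) := by
    refine (hg.integrable_sq.comp_snd (volume.restrict R.carrier)).mul_bdd (c := B) ?_
      (Filter.Eventually.of_forall fun p => hB _)
    exact (h.cont.comp (by fun_prop)).aestronglyMeasurable
  have h1 : ∫ z in R.carrier, conv g κ (θ • z) ^ 2 ≤
      ∫ z in R.carrier, ∫ w, g w ^ 2 * κ (θ • z - w) := by
    have c : Continuous fun z => conv g κ (θ • z) ^ 2 :=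
      ((h.continuous_conv hg).comp (continuous_const_smul θ)).pow 2
    exact integral_mono (c.integrableOn_rect R) hF.integral_prod_left fun z => h.sq_conv_le hg _
  refine h1.trans ?_
  rw [integral_integral_swap hF, ← integral_const_mul]
  refine integral_mono hF.integral_prod_right (hg.integrable_sq.const_mul 4) fun w => ?_
  simp only
  rw [integral_const_mul, mul_comm]
  refine mul_le_mul_of_nonneg_right ?_ (sq_nonneg _)
  have hθ0 : 0 < θ := by linarith
  have i : Integrable fun z : ℝ × ℝ => κ (θ • z - w) := by
    have : Integrable fun z : ℝ × ℝ => κ (z - w) := h.integrable.comp_sub_right w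
    exact this.comp_smul hθ0.ne'
  have e : ∫ z : ℝ × ℝ, κ (θ • z - w) = (θ ^ 2)⁻¹ := by
    have := Measure.integral_comp_smul (volume : Measure (ℝ × ℝ)) (fun z => κ (z - w)) θ
    rw [this, integral_sub_right_eq_self, h.integral]
    simp [abs_of_pos hθ0]
  calc ∫ z in R.carrier, κ (θ • z - w) ≤ ∫ z : ℝ × ℝ, κ (θ • z - w) :=
        setIntegral_le_integral i (Filter.Eventually.of_forall fun z => h.nonneg _)
    _ ≤ 4 := by
        rw [e]
        calc (θ ^ 2)⁻¹ ≤ ((1 / 2 : ℝ) ^ 2)⁻¹ := by gcongr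
          _ = 4 := by norm_num

/-- `κ` rescaled and reflected, so that `conv g (rescale t η) v` is the mean of `g (v + t y)`. -/
noncomputable def rescale (t : ℝ) (η : ℝ × ℝ → ℝ) (x : ℝ × ℝ) : ℝ := (t ^ 2)⁻¹ * η ((-t⁻¹) • x)

theorem IsMollifier.rescale {η : ℝ × ℝ → ℝ} (h : IsMollifier η) {t : ℝ} (ht : 0 < t) :
    IsMollifier (rescale t η) where
  cont := continuous_const.mul (h.cont.comp (continuous_const_smul _))
  supp := (h.supp.comp_smul (neg_ne_zero.2 (inv_ne_zero ht.ne'))).mul_left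
  nonneg z := mul_nonneg (by positivity) (h.nonneg _)
  integral := by
    simp only [WG.rescale]
    rw [integral_const_mul, Measure.integral_comp_smul, h.integral]
    simp [abs_of_pos ht, ht.ne']

theorem contDiff_rescale {η : ℝ × ℝ → ℝ} (h : ContDiff ℝ ∞ η) (t : ℝ) : ContDiff ℝ ∞ (rescale t η) :=
  contDiff_const.mul (h.comp (contDiff_const_smul _))

end WG

namespace WG

theorem IsMollifier.eventually_integral_conv_sub_le {η g : ℝ × ℝ → ℝ} (hη : IsMollifier η)
    (hg : MemLp g 2) (R : Rect) {ε : ℝ} (hε : 0 < ε) :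
    ∀ᶠ t in nhdsWithin (0 : ℝ) (Ioi 0),
      ∫ z in R.carrier, (conv g (WG.rescale t η) ((1 - t) • z) - g z) ^ 2 < ε := by
  set A := volume.real R.carrier with hA
  have hA0 : 0 ≤ A := measureReal_nonneg
  set ε₁ := ε / 60 with hε₁
  have hε₁0 : 0 < ε₁ := by positivity
  obtain ⟨h, hc, hle, hcont, hmem⟩ := MemLp.exists_hasCompactSupport_integral_rpow_sub_le (p := 2)
    (μ := volume) two_pos (f := g) (by simpa using hg) hε₁0
  have hmem : MemLp h 2 := by simpa using hmem
  have hle : ∫ x, (g x - h x) ^ 2 ≤ ε₁ := by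
    refine (integral_congr_ae (Filter.Eventually.of_forall fun x => ?_)).trans_le hle
    simp
  set ε₂ := √(ε / (12 * (A + 1))) with hε₂
  have hε₂0 : 0 < ε₂ := by positivity
  obtain ⟨δ, hδ, hu⟩ := Metric.uniformContinuous_iff.1 (hc.uniformContinuous_of_continuous hcont) ε₂ hε₂0
  obtain ⟨D, hD⟩ := (hη.supp.isBounded.union R.isCompact_carrier.isBounded).exists_norm_le
  have hD' : ∀ y, η y ≠ 0 → ∀ z ∈ R.carrier, dist y z ≤ 2 * D := by
    intro y hy z hz
    have h1 := hD y (Or.inl (subset_tsupport _ hy))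
    have h2 := hD z (Or.inr hz)
    calc dist y z ≤ ‖y‖ + ‖z‖ := dist_le_norm_add_norm y z
      _ ≤ 2 * D := by linarith
  have ev1 : ∀ᶠ t in nhdsWithin (0 : ℝ) (Ioi 0), t * (2 * D) < δ := by
    have : Filter.Tendsto (fun t : ℝ => t * (2 * D)) (nhds 0) (nhds (0 * (2 * D))) :=
      (continuous_id.mul continuous_const).tendsto 0
    rw [zero_mul] at this
    exact (this.mono_left nhdsWithin_le_nhds).eventually_lt_const hδ
  have ev2 : ∀ᶠ t in nhdsWithin (0 : ℝ) (Ioi 0), t < 1 / 2 :=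
    nhdsWithin_le_nhds (Iio_mem_nhds (by norm_num))
  filter_upwards [ev1, ev2, self_mem_nhdsWithin] with t ht1 ht2 ht0
  have ht0 : 0 < t := ht0
  have hκ := hη.rescale ht0
  set κ := WG.rescale t η with hκd
  have hsub : MemLp (fun z => g z - h z) 2 := hg.sub hmem
  have p1 := hκ.integral_sq_conv_le hsub (θ := 1 - t) (by linarith) R
  have p2 : ∀ z ∈ R.carrier, (conv h κ ((1 - t) • z) - h z) ^ 2 ≤ ε₂ ^ 2 := by
    intro z hz
    rw [← sq_abs]
    refine pow_le_pow_left₀ (abs_nonneg _) (hκ.abs_conv_sub_le hmem fun w hw => ?_) 2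
    have hw' : η ((-t⁻¹) • ((1 - t) • z - w)) ≠ 0 := right_ne_zero_of_mul hw
    set y := (-t⁻¹) • ((1 - t) • z - w) with hy
    have hwy : w - z = t • (y - z) := by
      rw [hy, smul_sub t, smul_smul, mul_neg, mul_inv_cancel₀ ht0.ne']
      ext <;> simp <;> ring
    refine (hu (a := w) (b := z) ?_).le
    rw [dist_eq_norm, hwy, norm_smul, ← dist_eq_norm, Real.norm_eq_abs, abs_of_pos ht0]
    exact (mul_le_mul_of_nonneg_left (hD' y hw' z hz) ht0.le).trans_lt ht1
  have cg := hκ.continuous_conv hsub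
  have ch := hκ.continuous_conv hmem
  have hlin : ∀ v, conv g κ v = conv (fun z => g z - h z) κ v + conv h κ v := by
    intro v
    have hm := hκ.comp_sub v
    have i1 : Integrable fun w => (g w - h w) * κ (v - w) := hsub.integrable_mul hm.memLp
    have i2 : Integrable fun w => h w * κ (v - w) := hmem.integrable_mul hm.memLp
    rw [conv_apply, conv_apply, conv_apply, ← integral_add i1 i2]
    congr 1; ext w; ring
  set a := fun z : ℝ × ℝ => conv (fun z => g z - h z) κ ((1 - t) • z) with had
  have ca : Continuous a := cg.comp (continuous_const_smul _)
  have ia : Integrable (fun z => a z ^ 2) (volume.restrict R.carrier) := (ca.pow 2).integrableOn_rect R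
  have ib : Integrable (fun z => (h z - g z) ^ 2) (volume.restrict R.carrier) :=
    ((hmem.sub hg).restrict _).integrable_sq
  have ibound : Integrable (fun z => 3 * a z ^ 2 + 3 * ε₂ ^ 2 + 3 * (h z - g z) ^ 2)
      (volume.restrict R.carrier) :=
    ((ia.const_mul 3).add (integrable_const _)).add (ib.const_mul 3)
  have i3 : Integrable (fun z => 3 * a z ^ 2 + 3 * ε₂ ^ 2) (volume.restrict R.carrier) :=
    (ia.const_mul 3).add (integrable_const _)
  have q1 : ∫ z in R.carrier, (conv g κ ((1 - t) • z) - g z) ^ 2 ≤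
      ∫ z in R.carrier, (3 * a z ^ 2 + 3 * ε₂ ^ 2 + 3 * (h z - g z) ^ 2) := by
    refine setIntegral_mono_on ?_ ibound R.measurableSet_carrier fun z hz => ?_
    · have c : Continuous fun z : ℝ × ℝ => conv g κ ((1 - t) • z) :=
        (hκ.continuous_conv hg).comp (continuous_const_smul _)
      exact ((c.memLp_restrict (T := R)).sub (hg.restrict _)).integrable_sq
    · rw [hlin]
      have := p2 z hz
      change (a z + conv h κ ((1 - t) • z) - g z) ^ 2 ≤ _
      nlinarith [sq_nonneg (a z - (conv h κ ((1 - t) • z) - h z)),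
        sq_nonneg (a z - (h z - g z)), sq_nonneg (conv h κ ((1 - t) • z) - h z - (h z - g z))]
  refine q1.trans_lt ?_
  rw [integral_add i3 (ib.const_mul 3), integral_add (ia.const_mul 3) (integrable_const _),
    integral_const_mul, integral_const_mul, integral_const_mul, setIntegral_const, smul_eq_mul, ← hA]
  have r1 : ∫ z in R.carrier, (h z - g z) ^ 2 ≤ ε₁ := by
    refine (setIntegral_le_integral (hmem.sub hg).integrable_sq
      (Filter.Eventually.of_forall fun z => sq_nonneg _)).trans ((integral_congr_ae
      (Filter.Eventually.of_forall fun x => ?_)).trans_le hle)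
    simp only [Pi.sub_apply]; ring
  have r2 : A * (3 * ε₂ ^ 2) ≤ ε / 4 := by
    rw [hε₂, Real.sq_sqrt (by positivity)]
    rw [← sub_nonneg]
    have : ε / 4 - A * (3 * (ε / (12 * (A + 1)))) = ε / (4 * (A + 1)) := by field_simp; ring
    rw [this]; positivity
  linarith

/-- `F a b` are the `L²(R)` limits of the derivatives of a sequence of smooth functions. -/
def SobolevOn (R : Rect) (m : ℕ) (F : ℕ → ℕ → ℝ × ℝ → ℝ) : Prop :=
  (∀ a b, a + b ≤ m → MemLp (F a b) 2 (volume.restrict R.carrier)) ∧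
  ∃ ψ : ℕ → ℝ × ℝ → ℝ, (∀ n, ContDiff ℝ ∞ (ψ n)) ∧ ∀ a b, a + b ≤ m →
    Filter.Tendsto (fun n => ∫ z in R.carrier, ((dx^[a] (dy^[b] (ψ n))) z - F a b z) ^ 2)
      Filter.atTop (nhds 0)

theorem exists_mollifier (R : Rect) : ∃ η, IsMollifier η ∧ IsTestFunction R.inner η := by
  obtain ⟨c, hc⟩ := R.inner_nonempty
  obtain ⟨ε, hε, hb⟩ := Metric.isOpen_iff.1 R.isOpen_inner c hc
  let f : ContDiffBump c := ⟨ε / 4, ε / 2, by positivity, by linarith⟩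
  refine ⟨f.normed volume, ⟨f.continuous_normed, f.hasCompactSupport_normed, f.nonneg_normed,
    f.integral_normed⟩, f.contDiff_normed, f.hasCompactSupport_normed, ?_⟩
  rw [f.tsupport_normed_eq]
  exact (Metric.closedBall_subset_ball (by change ε / 2 < ε; linarith)).trans hb

theorem conv_D_eq {Ω : Set (ℝ × ℝ)} (hΩ : MeasurableSet Ω) {R : Rect} (hR : R.inner ⊆ Ω) {a b : ℕ}
    {u v : ℝ × ℝ → ℝ} (h : HasWeakDeriv Ω a b u v) {κ : ℝ × ℝ → ℝ} (hκ : ContDiff ℝ ∞ κ) {p : ℝ × ℝ}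
    (hc : HasCompactSupport κ) (hp : ∀ w ∈ tsupport κ, p - w ∈ R.inner) :
    conv (R.inner.indicator u) (dx^[a] (dy^[b] κ)) p = conv (R.inner.indicator v) κ p := by
  have hsupp : tsupport (fun w => κ (p - w)) ⊆ R.inner := by
    intro w hw
    have h1 : tsupport (fun w => κ (p - w)) ⊆ (fun w => p - w) ⁻¹' tsupport κ :=
      tsupport_comp_subset_preimage κ (by fun_prop)
    simpa using hp _ (h1 hw)
  have hφ : IsTestFunction R.inner fun w => κ (p - w) :=
    ⟨hκ.comp (contDiff_const.sub contDiff_id), hc.comp_homeomorph (Homeomorph.subLeft p), hsupp⟩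
  have hD : dx^[a] (dy^[b] fun w => κ (p - w)) =
      fun w => (-1) ^ (a + b) * (dx^[a] (dy^[b] κ)) (p - w) := by
    have := D_comp_affine hκ p (-1) a b
    simpa [sub_eq_add_neg] using this
  have hres : ∀ (g χ : ℝ × ℝ → ℝ), tsupport χ ⊆ R.inner →
      ∫ w in Ω, g w * χ w = ∫ w, R.inner.indicator g w * χ w := by
    intro g χ hχ
    have h0 : ∀ w, w ∉ R.inner → χ w = 0 := fun w hw => by
      by_contra hne
      exact hw (hχ (subset_tsupport _ hne))
    have e : (fun w => R.inner.indicator g w * χ w) = Ω.indicator fun w => g w * χ w := by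
      ext w
      by_cases hw : w ∈ R.inner
      · rw [indicator_of_mem hw, indicator_of_mem (hR hw)]
      · rw [indicator_of_notMem hw, zero_mul]
        by_cases hw' : w ∈ Ω
        · rw [indicator_of_mem hw', h0 w hw, mul_zero]
        · rw [indicator_of_notMem hw']
    rw [e, integral_indicator hΩ]
  have key := h.2.2 _ ⟨hφ.1, hφ.2.1, hφ.2.2.trans hR⟩
  rw [hres _ _ (hφ.iter a b).2.2, hres _ _ hφ.2.2, hD] at key
  rw [conv_apply, conv_apply]
  have hs : ((-1 : ℝ) ^ (a + b)) * (-1) ^ (a + b) = 1 := by rw [← mul_pow]; simp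
  calc _ = (-1) ^ (a + b) * ∫ w, R.inner.indicator u w *
        ((-1) ^ (a + b) * (dx^[a] (dy^[b] κ)) (p - w)) := by
        rw [← integral_const_mul]
        congr 1; ext w
        linear_combination -(R.inner.indicator u w * (dx^[a] (dy^[b] κ)) (p - w)) * hs
    _ = _ := by rw [key, ← mul_assoc, hs, one_mul]

theorem sobolevOn_of_hasWeakDeriv {Ω : Set (ℝ × ℝ)} (hΩ : IsOpen Ω) {R : Rect} (hR : R.inner ⊆ Ω)
    {m : ℕ} {u : ℝ × ℝ → ℝ} {F : ℕ → ℕ → ℝ × ℝ → ℝ}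
    (hF : ∀ a b, a + b ≤ m → HasWeakDeriv Ω a b u (F a b)) : SobolevOn R m F := by
  have hmem : ∀ g : ℝ × ℝ → ℝ, MemLp g 2 (volume.restrict Ω) → MemLp (R.inner.indicator g) 2 := fun g hg => by
    rw [memLp_indicator_iff_restrict R.isOpen_inner.measurableSet]
    exact hg.mono_measure (Measure.restrict_mono hR le_rfl)
  have hrest : volume.restrict R.inner = volume.restrict R.carrier :=
    Measure.restrict_congr_set R.inner_ae_eq
  obtain ⟨η, hη, hηt⟩ := exists_mollifier R
  set τ : ℕ → ℝ := fun n => 1 / ((n : ℝ) + 2) with hτ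
  have hτ0 : ∀ n, 0 < τ n := fun n => by positivity
  have hτlim : Filter.Tendsto τ Filter.atTop (nhds 0) := by
    have := (tendsto_one_div_add_atTop_nhds_zero_nat (𝕜 := ℝ)).comp (Filter.tendsto_add_atTop_nat 1)
    refine this.congr fun n => ?_
    simp only [Function.comp_apply, hτ]; push_cast; ring
  have hτ1 : ∀ n, τ n ≤ 1 / 2 := fun n => by
    simp only [hτ]; gcongr; linarith [(Nat.cast_nonneg n : (0 : ℝ) ≤ n)]
  refine ⟨fun a b hab => ((hF a b hab).2.1.mono_measure (Measure.restrict_mono hR le_rfl)).mono_measure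
    hrest.ge, fun n z => conv (R.inner.indicator u) (rescale (τ n) η) (0 + (1 - τ n) • z), fun n => ?_,
    fun a b hab => ?_⟩
  · exact (contDiff_conv (locallyIntegrable_of_memLp (hmem u (hF 0 0 (by lia)).1))
      (contDiff_rescale hηt.1 _) (hη.rescale (hτ0 n)).supp).comp
      (contDiff_const.add (contDiff_const_smul _))
  · set g := R.inner.indicator (F a b) with hg
    have hgm : MemLp g 2 := hmem _ (hF a b hab).2.1
    have hum := hmem u (hF a b hab).1
    have e : ∀ n, ∫ z in R.carrier, ((dx^[a] (dy^[b] fun z => conv (R.inner.indicator u)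
        (rescale (τ n) η) (0 + (1 - τ n) • z))) z - F a b z) ^ 2 =
        ∫ z in R.carrier, ((1 - τ n) ^ (a + b) * conv g (rescale (τ n) η) ((1 - τ n) • z) - g z) ^ 2 := by
      intro n
      rw [← hrest]
      refine setIntegral_congr_fun R.isOpen_inner.measurableSet fun z hz => ?_
      have hκ := contDiff_rescale hηt.1 (τ n)
      have hκm := hη.rescale (hτ0 n)
      rw [D_comp_affine (contDiff_conv (locallyIntegrable_of_memLp hum) hκ hκm.supp),
        D_conv (locallyIntegrable_of_memLp hum) ⟨hκ, hκm.supp, subset_univ _⟩]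
      simp only [zero_add]
      rw [conv_D_eq hΩ.measurableSet hR (hF a b hab) hκ hκm.supp, hg, indicator_of_mem hz]
      intro w hw
      have hw' : (-(τ n)⁻¹) • w ∈ tsupport η := by
        have h1 : tsupport (rescale (τ n) η) ⊆ (fun w => (-(τ n)⁻¹) • w) ⁻¹' tsupport η :=
          (tsupport_mul_subset_right).trans
            (tsupport_comp_subset_preimage η (continuous_const_smul _))
        exact h1 hw
      have h2 := hηt.2.2 hw'
      have ht0 := hτ0 n
      have ht1 := hτ1 n
      have h3 : (1 - τ n) • z - w = (1 - τ n) • z + τ n • ((-(τ n)⁻¹) • w) := by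
        rw [smul_smul, mul_neg, mul_inv_cancel₀ ht0.ne']; module
      rw [h3]
      exact ((convex_Ioo _ _).prod (convex_Ioo _ _)) hz h2 (by linarith) ht0.le (by ring)
    simp_rw [e]
    have lim1 : Filter.Tendsto (fun n => ∫ z in R.carrier,
        (conv g (rescale (τ n) η) ((1 - τ n) • z) - g z) ^ 2) Filter.atTop (nhds 0) := by
      rw [Metric.tendsto_nhds]
      intro ε hε
      have hw : Filter.Tendsto τ Filter.atTop (nhdsWithin 0 (Ioi 0)) :=
        tendsto_nhdsWithin_iff.2 ⟨hτlim, Filter.Eventually.of_forall hτ0⟩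
      filter_upwards [hw.eventually (hη.eventually_integral_conv_sub_le hgm R hε)] with n hn
      rwa [Real.dist_eq, sub_zero, abs_of_nonneg (integral_nonneg fun z => sq_nonneg _)]
    set J := ∫ z in R.carrier, g z ^ 2 with hJ
    have lim2 : Filter.Tendsto (fun n => 2 * (∫ z in R.carrier,
        (conv g (rescale (τ n) η) ((1 - τ n) • z) - g z) ^ 2) + 2 * (1 - (1 - τ n) ^ (a + b)) ^ 2 * J)
        Filter.atTop (nhds 0) := by
      have : Filter.Tendsto (fun n => 2 * (1 - (1 - τ n) ^ (a + b)) ^ 2 * J) Filter.atTop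
          (nhds (2 * (1 - (1 - 0) ^ (a + b)) ^ 2 * J)) :=
        (((((hτlim.const_sub 1).pow (a + b)).const_sub 1).pow 2).const_mul 2).mul_const J
      have h2 := (lim1.const_mul 2).add this
      simpa using h2
    refine squeeze_zero (fun n => integral_nonneg fun z => sq_nonneg _) (fun n => ?_) lim2
    have c : Continuous fun z : ℝ × ℝ => conv g (rescale (τ n) η) ((1 - τ n) • z) :=
      ((hη.rescale (hτ0 n)).continuous_conv hgm).comp (continuous_const_smul _)
    have m1 := c.memLp_restrict (T := R)
    have m2 : MemLp g 2 (volume.restrict R.carrier) := hgm.restrict _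
    have i1 : Integrable (fun z => (conv g (rescale (τ n) η) ((1 - τ n) • z) - g z) ^ 2)
      (volume.restrict R.carrier) := (m1.sub m2).integrable_sq
    have i2 : Integrable (fun z => g z ^ 2) (volume.restrict R.carrier) := m2.integrable_sq
    rw [hJ, ← integral_const_mul, ← integral_const_mul, ← integral_add (i1.const_mul _) (i2.const_mul _)]
    refine integral_mono ((m1.const_mul _).sub m2).integrable_sq
      ((i1.const_mul _).add (i2.const_mul _)) fun z => ?_
    have t1 : 0 ≤ (1 - τ n) ^ (a + b) := pow_nonneg (by linarith [hτ1 n]) _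
    have t2 : (1 - τ n) ^ (a + b) ≤ 1 := pow_le_one₀ (by linarith [hτ1 n]) (by linarith [hτ0 n])
    simp only
    generalize (1 - τ n) ^ (a + b) = s at *
    generalize conv g (rescale (τ n) η) ((1 - τ n) • z) = x
    generalize g z = y
    have e1 : (s * x - y) ^ 2 ≤ 2 * (s * (x - y)) ^ 2 + 2 * ((1 - s) * y) ^ 2 := by
      nlinarith [sq_nonneg (s * (x - y) + (1 - s) * y)]
    have e2 : (s * (x - y)) ^ 2 ≤ (x - y) ^ 2 := by
      rw [mul_pow]; exact mul_le_of_le_one_left (sq_nonneg _) (pow_le_one₀ t1 t2)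
    nlinarith

end WG

namespace WG

theorem dy_iter_dx_iter {g : ℝ × ℝ → ℝ} (hg : ContDiff ℝ ∞ g) (a b : ℕ) :
    dy^[b] (dx^[a] g) = dx^[a] (dy^[b] g) := by
  induction b with
  | zero => rfl
  | succ b ih => rw [Function.iterate_succ_apply', ih, dy_dx_iter_comm hg]

theorem D_D {g : ℝ × ℝ → ℝ} (hg : ContDiff ℝ ∞ g) (a b c d : ℕ) :
    dx^[a] (dy^[b] (dx^[c] (dy^[d] g))) = dx^[a + c] (dy^[b + d] g) := by
  have h : dy^[b] (dx^[c] (dy^[d] g)) = dx^[c] (dy^[b] (dy^[d] g)) :=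
    dy_iter_dx_iter (contDiff_iter hg 0 d) c b
  rw [h, ← Function.iterate_add_apply, ← Function.iterate_add_apply dy]

/-! ### Passage to the limit -/

theorem tendsto_integral_mul {α : Type*} {mα : MeasurableSpace α} {μ : Measure α} {f : ℕ → α → ℝ}
    {F g : α → ℝ} (hf : ∀ n, MemLp (f n) 2 μ) (hF : MemLp F 2 μ) (hg : MemLp g 2 μ)
    (h : Filter.Tendsto (fun n => ∫ x, (f n x - F x) ^ 2 ∂μ) Filter.atTop (nhds 0)) :
    Filter.Tendsto (fun n => ∫ x, f n x * g x ∂μ) Filter.atTop (nhds (∫ x, F x * g x ∂μ)) := by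
  rw [tendsto_iff_norm_sub_tendsto_zero]
  have e : ∀ n, ‖(∫ x, f n x * g x ∂μ) - ∫ x, F x * g x ∂μ‖ ≤
      √((∫ x, (f n x - F x) ^ 2 ∂μ) * ∫ x, g x ^ 2 ∂μ) := by
    intro n
    have i1 : Integrable (fun x => f n x * g x) μ := (hf n).integrable_mul hg
    have i2 : Integrable (fun x => F x * g x) μ := hF.integrable_mul hg
    rw [← integral_sub i1 i2, Real.norm_eq_abs]
    apply Real.abs_le_sqrt
    have := integral_mul_sq_le ((hf n).sub hF) hg
    simp only [Pi.sub_apply] at this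
    simpa only [sub_mul] using this
  refine squeeze_zero (fun n => norm_nonneg _) e ?_
  have := (h.mul_const (∫ x, g x ^ 2 ∂μ)).sqrt
  simpa using this

theorem tendsto_integral_sq {α : Type*} {mα : MeasurableSpace α} {μ : Measure α} {f : ℕ → α → ℝ}
    {F : α → ℝ} (hf : ∀ n, MemLp (f n) 2 μ) (hF : MemLp F 2 μ)
    (h : Filter.Tendsto (fun n => ∫ x, (f n x - F x) ^ 2 ∂μ) Filter.atTop (nhds 0)) :
    Filter.Tendsto (fun n => ∫ x, f n x ^ 2 ∂μ) Filter.atTop (nhds (∫ x, F x ^ 2 ∂μ)) := by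
  have h1 := tendsto_integral_mul hf hF hF h
  have e : ∀ n, ∫ x, f n x ^ 2 ∂μ = (∫ x, (f n x - F x) ^ 2 ∂μ) + 2 * (∫ x, f n x * F x ∂μ) -
      ∫ x, F x ^ 2 ∂μ := by
    intro n
    have i0 : Integrable (fun x => (f n x - F x) ^ 2) μ := ((hf n).sub hF).integrable_sq
    have i1 : Integrable (fun x => f n x * F x) μ := (hf n).integrable_mul hF
    have i2 : Integrable (fun x => F x ^ 2) μ := hF.integrable_sq
    have i3 : Integrable (fun x => (f n x - F x) ^ 2 + 2 * (f n x * F x)) μ := i0.add (i1.const_mul 2)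
    rw [← integral_const_mul, ← integral_add i0 (i1.const_mul 2), ← integral_sub i3 i2]
    congr 1; ext x; ring
  simp_rw [e]
  have h2 := ((h.add (h1.const_mul 2)).sub_const (∫ x, F x ^ 2 ∂μ))
  convert h2 using 2
  have : ∫ x, F x * F x ∂μ = ∫ x, F x ^ 2 ∂μ := by congr 1; ext x; ring
  rw [this]; ring

namespace SobolevOn

variable {R : Rect} {m : ℕ} {F : ℕ → ℕ → ℝ × ℝ → ℝ}

theorem shift (h : SobolevOn R m F) {n c d : ℕ} (hn : n + c + d ≤ m) :
    SobolevOn R n fun a b => F (a + c) (b + d) := by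
  obtain ⟨h1, ψ, hψ, hl⟩ := h
  refine ⟨fun a b hab => h1 _ _ (by lia), fun n => dx^[c] (dy^[d] (ψ n)),
    fun n => contDiff_iter (hψ n) c d, fun a b hab => ?_⟩
  simp only [D_D (hψ _)]
  exact hl _ _ (by lia)

theorem sub_smooth (h : SobolevOn R m F) {q : ℝ × ℝ → ℝ} (hq : ContDiff ℝ ∞ q) :
    SobolevOn R m fun a b z => F a b z - (dx^[a] (dy^[b] q)) z := by
  obtain ⟨h1, ψ, hψ, hl⟩ := h
  refine ⟨fun a b hab => (h1 a b hab).sub (contDiff_iter hq a b).continuous.memLp_restrict,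
    fun n => ψ n - q, fun n => (hψ n).sub hq, fun a b hab => ?_⟩
  refine (hl a b hab).congr fun n => ?_
  rw [D_sub (hψ n) hq]
  congr 1; ext z; simp only [Pi.sub_apply]; ring

/-- Poincaré's inequality. -/
theorem integral_sq_le (h : SobolevOn R m F) (hm : 1 ≤ m) :
    ∫ z in R.carrier, F 0 0 z ^ 2 ≤ (∫ z in R.carrier, F 0 0 z) ^ 2 / (R.width * R.height) +
      2 * R.width ^ 2 * (∫ z in R.carrier, F 1 0 z ^ 2) +
      2 * R.height ^ 2 * ∫ z in R.carrier, F 0 1 z ^ 2 := by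
  obtain ⟨h1, ψ, hψ, hl⟩ := h
  have hmem : ∀ a b n, MemLp (dx^[a] (dy^[b] (ψ n))) 2 (volume.restrict R.carrier) := fun a b n =>
    (contDiff_iter (hψ n) a b).continuous.memLp_restrict
  have l : ∀ a b, a + b ≤ m → _ := fun a b hab =>
    tendsto_integral_sq (hmem a b) (h1 a b hab) (hl a b hab)
  have l0 := tendsto_integral_mul (hmem 0 0) (h1 0 0 (by lia)) (memLp_const 1) (hl 0 0 (by lia))
  simp only [mul_one] at l0
  refine le_of_tendsto_of_tendsto' (l 0 0 (by lia)) ((((l0.pow 2).div_const _).add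
    ((l 1 0 (by lia)).const_mul _)).add ((l 0 1 (by lia)).const_mul _)) fun n => ?_
  exact integral_sq_le_poincare (hψ n) R

/-- The right-hand side of Sobolev's inequality. -/
noncomputable def supBound (R : Rect) (G : ℕ → ℕ → ℝ × ℝ → ℝ) : ℝ :=
  4 / (R.width * R.height) * (∫ z in R.carrier, G 0 0 z ^ 2) +
      4 * R.height / R.width * (∫ z in R.carrier, G 0 1 z ^ 2) +
      4 * R.width / R.height * (∫ z in R.carrier, G 1 0 z ^ 2) +
      4 * (R.width * R.height) * (∫ z in R.carrier, G 1 1 z ^ 2)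

theorem exists_continuous_aux (h : SobolevOn R m F) (hm : 2 ≤ m) :
    ∃ U, ContinuousOn U R.carrier ∧ U =ᵐ[volume.restrict R.carrier] F 0 0 ∧
      ∃ ψ : ℕ → ℝ × ℝ → ℝ, (∀ n, ContDiff ℝ ∞ (ψ n)) ∧ (∀ a b, a + b ≤ m →
        Filter.Tendsto (fun n => ∫ z in R.carrier, ((dx^[a] (dy^[b] (ψ n))) z - F a b z) ^ 2)
        Filter.atTop (nhds 0)) ∧ TendstoUniformlyOn ψ U Filter.atTop R.carrier := by
  obtain ⟨h1, ψ, hψ, hl⟩ := h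
  have hw := R.width_pos
  have hh := R.height_pos
  set β : ℕ → ℝ := fun n =>
    supBound R fun a b z => (dx^[a] (dy^[b] (ψ n))) z - F a b z with hβ
  have hβ0 : Filter.Tendsto β Filter.atTop (nhds 0) := by
    have := ((((hl 0 0 (by lia)).const_mul (4 / (R.width * R.height))).add
      ((hl 0 1 (by lia)).const_mul (4 * R.height / R.width))).add
      ((hl 1 0 (by lia)).const_mul (4 * R.width / R.height))).add
      ((hl 1 1 (by lia)).const_mul (4 * (R.width * R.height)))
    simp only [mul_zero, add_zero] at this
    exact this
  have hdiff : ∀ n l, ∀ z ∈ R.carrier, (ψ n z - ψ l z) ^ 2 ≤ 2 * (β n + β l) := by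
    intro n l z hz
    have h2 := sq_le_integral_rect ((hψ n).sub (hψ l)) R hz
    have key : ∀ a b, a + b ≤ m → ∫ z in R.carrier, (dx^[a] (dy^[b] (ψ n - ψ l))) z ^ 2 ≤
        2 * ((∫ z in R.carrier, ((dx^[a] (dy^[b] (ψ n))) z - F a b z) ^ 2) +
          ∫ z in R.carrier, ((dx^[a] (dy^[b] (ψ l))) z - F a b z) ^ 2) := by
      intro a b hab
      have m1 : ∀ n, MemLp (dx^[a] (dy^[b] (ψ n))) 2 (volume.restrict R.carrier) := fun n =>
        (contDiff_iter (hψ n) a b).continuous.memLp_restrict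
      have i : ∀ n, Integrable (fun z => ((dx^[a] (dy^[b] (ψ n))) z - F a b z) ^ 2)
        (volume.restrict R.carrier) := fun n => ((m1 n).sub (h1 a b hab)).integrable_sq
      rw [← integral_add (i n) (i l), ← integral_const_mul, D_sub (hψ n) (hψ l)]
      refine integral_mono ((m1 n).sub (m1 l)).integrable_sq (((i n).add (i l)).const_mul 2)
        fun z => ?_
      simp only [Pi.sub_apply]
      nlinarith [sq_nonneg (((dx^[a] (dy^[b] (ψ n))) z - F a b z) +
        ((dx^[a] (dy^[b] (ψ l))) z - F a b z))]
    refine h2.trans ?_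
    have k00 := key 0 0 (by lia)
    have k01 := key 0 1 (by lia)
    have k10 := key 1 0 (by lia)
    have k11 := key 1 1 (by lia)
    calc _ ≤ 4 / (R.width * R.height) * _ + 4 * R.height / R.width * _ +
          4 * R.width / R.height * _ + 4 * (R.width * R.height) * _ := by
          refine add_le_add (add_le_add (add_le_add (mul_le_mul_of_nonneg_left k00 (by positivity))
            (mul_le_mul_of_nonneg_left k01 (by positivity))) (mul_le_mul_of_nonneg_left k10 (by positivity)))
            (mul_le_mul_of_nonneg_left k11 (by positivity))
      _ = _ := by simp only [hβ, supBound]; ring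
  have hcauchy : UniformCauchySeqOn ψ Filter.atTop R.carrier := by
    rw [Metric.uniformCauchySeqOn_iff]
    intro ε hε
    obtain ⟨N, hN⟩ := Filter.eventually_atTop.1 (hβ0.eventually_lt_const
      (show (0 : ℝ) < ε ^ 2 / 4 by positivity))
    refine ⟨N, fun n hn l hl z hz => ?_⟩
    rw [Real.dist_eq]
    refine abs_lt_of_sq_lt_sq ((hdiff n l z hz).trans_lt ?_) hε.le
    linarith [hN n hn, hN l hl]
  have hlim : ∀ z, ∃ y, z ∈ R.carrier → Filter.Tendsto (fun n => ψ n z) Filter.atTop (nhds y) := by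
    intro z
    by_cases hz : z ∈ R.carrier
    · obtain ⟨y, hy⟩ := cauchySeq_tendsto_of_complete (hcauchy.cauchySeq hz)
      exact ⟨y, fun _ => hy⟩
    · exact ⟨0, fun h => absurd h hz⟩
  choose U hU using hlim
  have hunif := hcauchy.tendstoUniformlyOn_of_tendsto fun z hz => hU z hz
  have hUc : ContinuousOn U R.carrier :=
    hunif.continuousOn (Filter.Frequently.of_forall fun n => (hψ n).continuous.continuousOn)
  refine ⟨U, hUc, ?_, ψ, hψ, hl, hunif⟩
  have hUm : MemLp U 2 (volume.restrict R.carrier) := by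
    rw [memLp_two_iff_integrable_sq (hUc.aestronglyMeasurable R.measurableSet_carrier)]
    exact (hUc.pow 2).integrableOn_compact R.isCompact_carrier
  have hz : ∀ n, ∫ z in R.carrier, (U z - F 0 0 z) ^ 2 ≤
      4 * (R.width * R.height) * β n + 2 * ∫ z in R.carrier, (ψ n z - F 0 0 z) ^ 2 := by
    intro n
    have m1 : MemLp (ψ n) 2 (volume.restrict R.carrier) := (hψ n).continuous.memLp_restrict
    have i1 : Integrable (fun z => (ψ n z - F 0 0 z) ^ 2) (volume.restrict R.carrier) :=
      (m1.sub (h1 0 0 (by lia))).integrable_sq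
    have b1 : ∀ z ∈ R.carrier, (ψ n z - U z) ^ 2 ≤ 2 * β n := fun z hz => by
      have := (hβ0.const_add (β n)).const_mul 2
      rw [add_zero] at this
      exact le_of_tendsto_of_tendsto' (((hU z hz).const_sub (ψ n z)).pow 2) this
        fun l => hdiff n l z hz
    have e : 4 * (R.width * R.height) * β n = ∫ z in R.carrier, (4 * β n) := by
      rw [setIntegral_const, R.volume_carrier, smul_eq_mul]; ring
    rw [e, ← integral_const_mul, ← integral_add (integrable_const _) (i1.const_mul 2)]
    refine setIntegral_mono_on (hUm.sub (h1 0 0 (by lia))).integrable_sq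
      ((integrable_const _).add (i1.const_mul 2)) R.measurableSet_carrier fun z hz => ?_
    nlinarith [b1 z hz, sq_nonneg ((U z - ψ n z) - (ψ n z - F 0 0 z))]
  have hzero : ∫ z in R.carrier, (U z - F 0 0 z) ^ 2 = 0 := by
    refine le_antisymm ?_ (integral_nonneg fun z => sq_nonneg _)
    have := (hβ0.const_mul (4 * (R.width * R.height))).add ((hl 0 0 (by lia)).const_mul 2)
    simp only [mul_zero, add_zero] at this
    exact ge_of_tendsto' this hz
  have := (integral_eq_zero_iff_of_nonneg (fun z => sq_nonneg _)
    (hUm.sub (h1 0 0 (by lia))).integrable_sq).1 hzero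
  filter_upwards [this] with z hz
  have : U z - F 0 0 z = 0 := by simpa using hz
  linarith

theorem _root_.WG.Rect.eqOn_of_ae_eq {R : Rect} {U V : ℝ × ℝ → ℝ} (hU : ContinuousOn U R.carrier)
    (hV : ContinuousOn V R.carrier) (h : U =ᵐ[volume.restrict R.carrier] V) :
    EqOn U V R.carrier := by
  refine Measure.eqOn_of_ae_eq h hU hV ?_
  rw [← R.closure_inner]
  exact closure_mono (interior_maximal (R.inner_subset.trans R.closure_inner.ge) R.isOpen_inner)

theorem exists_continuous (h : SobolevOn R m F) (hm : 2 ≤ m) :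
    ∃ U, ContinuousOn U R.carrier ∧ U =ᵐ[volume.restrict R.carrier] F 0 0 :=
  let ⟨U, h1, h2, _⟩ := h.exists_continuous_aux hm
  ⟨U, h1, h2⟩

/-- A continuous representative is a uniform limit of the approximating smooth functions. -/
theorem exists_tendstoUniformlyOn (h : SobolevOn R m F) (hm : 2 ≤ m) {U : ℝ × ℝ → ℝ}
    (hU : ContinuousOn U R.carrier) (hUF : U =ᵐ[volume.restrict R.carrier] F 0 0) :
    ∃ ψ : ℕ → ℝ × ℝ → ℝ, (∀ n, ContDiff ℝ ∞ (ψ n)) ∧ (∀ a b, a + b ≤ m →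
        Filter.Tendsto (fun n => ∫ z in R.carrier, ((dx^[a] (dy^[b] (ψ n))) z - F a b z) ^ 2)
        Filter.atTop (nhds 0)) ∧ TendstoUniformlyOn ψ U Filter.atTop R.carrier := by
  obtain ⟨V, hV, hVF, ψ, h1, h2, h3⟩ := h.exists_continuous_aux hm
  exact ⟨ψ, h1, h2, h3.congr_right (Rect.eqOn_of_ae_eq hV hU (hVF.trans hUF.symm))⟩

/-- Sobolev's inequality. -/
theorem sq_le_supBound (h : SobolevOn R m F) (hm : 2 ≤ m) {U : ℝ × ℝ → ℝ}
    (hU : ContinuousOn U R.carrier) (hUF : U =ᵐ[volume.restrict R.carrier] F 0 0) {z : ℝ × ℝ}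
    (hz : z ∈ R.carrier) : U z ^ 2 ≤ supBound R F := by
  obtain ⟨ψ, hψ, hl, hu⟩ := h.exists_tendstoUniformlyOn hm hU hUF
  have hmem : ∀ a b n, MemLp (dx^[a] (dy^[b] (ψ n))) 2 (volume.restrict R.carrier) := fun a b n =>
    (contDiff_iter (hψ n) a b).continuous.memLp_restrict
  have l : ∀ a b, a + b ≤ m → _ := fun a b hab =>
    tendsto_integral_sq (hmem a b) (h.1 a b hab) (hl a b hab)
  exact le_of_tendsto_of_tendsto' ((hu.tendsto_at hz).pow 2)
    (((((l 0 0 (by lia)).const_mul _).add ((l 0 1 (by lia)).const_mul _)).add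
    ((l 1 0 (by lia)).const_mul _)).add ((l 1 1 (by lia)).const_mul _))
    fun n => sq_le_integral_rect (hψ n) R hz

end SobolevOn

end WG

namespace WG

namespace SobolevOn

variable {R : Rect} {m : ℕ} {F : ℕ → ℕ → ℝ × ℝ → ℝ}

theorem _root_.WG.integral_rect_dx {g : ℝ × ℝ → ℝ} (hg : ContDiff ℝ ∞ g) (R : Rect) :
    ∫ z in R.carrier, dx g z = ∫ y in R.b..R.t, (g (R.r, y) - g (R.l, y)) := by
  rw [R.integral_eq_of_continuous' (contDiff_dx hg).continuous]
  congr 1; ext y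
  exact intervalIntegral.integral_eq_sub_of_hasDerivAt (fun s _ => hasDerivAt_slice_fst hg y s)
    (((contDiff_dx hg).continuous.comp
      (by fun_prop : Continuous fun s : ℝ => (s, y))).intervalIntegrable _ _)

theorem _root_.WG.integral_rect_dy {g : ℝ × ℝ → ℝ} (hg : ContDiff ℝ ∞ g) (R : Rect) :
    ∫ z in R.carrier, dy g z = ∫ x in R.l..R.r, (g (x, R.t) - g (x, R.b)) := by
  rw [R.integral_eq_of_continuous (contDiff_dy hg).continuous]
  congr 1; ext x
  exact intervalIntegral.integral_eq_sub_of_hasDerivAt (fun s _ => hasDerivAt_slice_snd hg x s)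
    (((contDiff_dy hg).continuous.comp
      (by fun_prop : Continuous fun s : ℝ => (x, s))).intervalIntegrable _ _)

theorem _root_.WG.dx_mul {f g : ℝ × ℝ → ℝ} (hf : Differentiable ℝ f) (hg : Differentiable ℝ g)
    (z : ℝ × ℝ) : dx (fun z => f z * g z) z = dx f z * g z + f z * dx g z := by
  unfold dx
  have h : fderiv ℝ (fun z => f z * g z) z = _ := fderiv_mul (hf z) (hg z)
  rw [h]; simp; ring

theorem _root_.WG.dy_mul {f g : ℝ × ℝ → ℝ} (hf : Differentiable ℝ f) (hg : Differentiable ℝ g)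
    (z : ℝ × ℝ) : dy (fun z => f z * g z) z = dy f z * g z + f z * dy g z := by
  unfold dy
  have h : fderiv ℝ (fun z => f z * g z) z = _ := fderiv_mul (hf z) (hg z)
  rw [h]; simp; ring

theorem _root_.WG.intervalIntegrable_mul {f g : ℝ → ℝ} (hf : Continuous f) (hg : Continuous g)
    (a b : ℝ) : IntervalIntegrable (fun x => f x * g x) volume a b :=
  (hf.mul hg).intervalIntegrable a b

theorem _root_.WG.tendsto_intervalIntegral_of_tendstoUniformlyOn {f : ℕ → ℝ → ℝ} {F g : ℝ → ℝ}
    {a b : ℝ} (hab : a ≤ b) (hf : ∀ n, Continuous (f n)) (hg : Continuous g)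
    (h : TendstoUniformlyOn f F Filter.atTop (Icc a b)) :
    Filter.Tendsto (fun n => ∫ x in a..b, f n x * g x) Filter.atTop (nhds (∫ x in a..b, F x * g x)) := by
  have hF : ContinuousOn F (Icc a b) :=
    h.continuousOn (Filter.Frequently.of_forall fun n => (hf n).continuousOn)
  obtain ⟨B, hB⟩ := isCompact_Icc.exists_bound_of_continuousOn (hg.continuousOn (s := Icc a b))
  have hB0 : 0 ≤ B := (norm_nonneg _).trans (hB a (left_mem_Icc.2 hab))
  have hFi : IntervalIntegrable (fun x => F x * g x) volume a b :=
    ContinuousOn.intervalIntegrable (by rw [uIcc_of_le hab]; exact hF.mul hg.continuousOn)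
  rw [Metric.tendsto_atTop]
  intro ε hε
  have hδ : 0 < ε / ((B + 1) * (b - a + 1)) := by
    have : 0 ≤ b - a := sub_nonneg.2 hab
    positivity
  obtain ⟨N, hN⟩ := Filter.eventually_atTop.1 (Metric.tendstoUniformlyOn_iff.1 h _ hδ)
  refine ⟨N, fun n hn => ?_⟩
  rw [dist_eq_norm, ← intervalIntegral.integral_sub (intervalIntegrable_mul (hf n) hg _ _) hFi]
  have hb : ∀ x ∈ uIoc a b, ‖f n x * g x - F x * g x‖ ≤ ε / ((B + 1) * (b - a + 1)) * B := by
    intro x hx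
    rw [uIoc_of_le hab] at hx
    have hx' := Ioc_subset_Icc_self hx
    rw [← sub_mul, norm_mul]
    have := hN n hn x hx'
    rw [dist_comm, dist_eq_norm] at this
    exact mul_le_mul this.le (hB x hx') (norm_nonneg _) hδ.le
  refine (intervalIntegral.norm_integral_le_of_norm_le_const hb).trans_lt ?_
  have h0 : 0 ≤ b - a := sub_nonneg.2 hab
  rw [abs_of_nonneg h0, ← sub_pos]
  have : ε - ε / ((B + 1) * (b - a + 1)) * B * (b - a) =
      ε * (B + (b - a) + 1) / ((B + 1) * (b - a + 1)) := by field_simp; ring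
  rw [this]; positivity

theorem tendstoUniformlyOn_fst {ψ : ℕ → ℝ × ℝ → ℝ} {U : ℝ × ℝ → ℝ}
    (h : TendstoUniformlyOn ψ U Filter.atTop R.carrier) {y : ℝ} (hy : y ∈ Icc R.b R.t) :
    TendstoUniformlyOn (fun n x => ψ n (x, y)) (fun x => U (x, y)) Filter.atTop (Icc R.l R.r) :=
  (h.comp fun x : ℝ => (x, y)).mono fun _ hx => ⟨hx, hy⟩

theorem tendstoUniformlyOn_snd {ψ : ℕ → ℝ × ℝ → ℝ} {U : ℝ × ℝ → ℝ}
    (h : TendstoUniformlyOn ψ U Filter.atTop R.carrier) {x : ℝ} (hx : x ∈ Icc R.l R.r) :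
    TendstoUniformlyOn (fun n y => ψ n (x, y)) (fun y => U (x, y)) Filter.atTop (Icc R.b R.t) :=
  (h.comp fun y : ℝ => (x, y)).mono fun _ hy => ⟨hx, hy⟩

/-- Integration by parts in the first variable. -/
theorem integral_fst (h : SobolevOn R m F) (hm : 2 ≤ m) {U : ℝ × ℝ → ℝ}
    (hU : ContinuousOn U R.carrier) (hUF : U =ᵐ[volume.restrict R.carrier] F 0 0) {v : ℝ × ℝ → ℝ}
    (hv : ContDiff ℝ ∞ v) :
    (∫ z in R.carrier, F 1 0 z * v z) + ∫ z in R.carrier, F 0 0 z * dx v z =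
      (∫ y in R.b..R.t, U (R.r, y) * v (R.r, y)) - ∫ y in R.b..R.t, U (R.l, y) * v (R.l, y) := by
  obtain ⟨ψ, hψ, hl, hu⟩ := h.exists_tendstoUniformlyOn hm hU hUF
  have hmem : ∀ a b n, MemLp (dx^[a] (dy^[b] (ψ n))) 2 (volume.restrict R.carrier) := fun a b n =>
    (contDiff_iter (hψ n) a b).continuous.memLp_restrict
  have cv : ∀ x : ℝ, Continuous fun y => v (x, y) := fun x => hv.continuous.comp (by fun_prop)
  have cψ : ∀ x : ℝ, ∀ n, Continuous fun y => ψ n (x, y) := fun x n =>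
    (hψ n).continuous.comp (by fun_prop)
  have l1 := (tendsto_integral_mul (hmem 1 0) (h.1 1 0 (by lia)) (hv.continuous.memLp_restrict (T := R))
    (hl 1 0 (by lia))).add (tendsto_integral_mul (hmem 0 0) (h.1 0 0 (by lia))
    ((contDiff_dx hv).continuous.memLp_restrict (T := R)) (hl 0 0 (by lia)))
  have l2 := (tendsto_intervalIntegral_of_tendstoUniformlyOn R.hbt.le (cψ R.r) (cv R.r)
    (tendstoUniformlyOn_snd hu (right_mem_Icc.2 R.hlr.le))).sub
    (tendsto_intervalIntegral_of_tendstoUniformlyOn R.hbt.le (cψ R.l) (cv R.l)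
    (tendstoUniformlyOn_snd hu (left_mem_Icc.2 R.hlr.le)))
  refine tendsto_nhds_unique l1 (l2.congr fun n => ?_)
  have c1 : Continuous fun z => dx (ψ n) z * v z := (contDiff_dx (hψ n)).continuous.mul hv.continuous
  have c2 : Continuous fun z => ψ n z * dx v z := (hψ n).continuous.mul (contDiff_dx hv).continuous
  have e := integral_rect_dx ((hψ n).mul hv) R
  have e2 : dx (fun z => ψ n z * v z) = fun z => dx (ψ n) z * v z + ψ n z * dx v z :=
    funext fun z => dx_mul (hψ n).diff' hv.diff' z
  change ∫ z in R.carrier, dx (fun z => ψ n z * v z) z = _ at e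
  rw [e2, integral_add (c1.integrableOn_rect R) (c2.integrableOn_rect R),
    intervalIntegral.integral_sub (intervalIntegrable_mul (cψ R.r n) (cv R.r) _ _)
    (intervalIntegrable_mul (cψ R.l n) (cv R.l) _ _)] at e
  exact e.symm

/-- Integration by parts in the second variable. -/
theorem integral_snd (h : SobolevOn R m F) (hm : 2 ≤ m) {U : ℝ × ℝ → ℝ}
    (hU : ContinuousOn U R.carrier) (hUF : U =ᵐ[volume.restrict R.carrier] F 0 0) {v : ℝ × ℝ → ℝ}
    (hv : ContDiff ℝ ∞ v) :
    (∫ z in R.carrier, F 0 1 z * v z) + ∫ z in R.carrier, F 0 0 z * dy v z =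
      (∫ x in R.l..R.r, U (x, R.t) * v (x, R.t)) - ∫ x in R.l..R.r, U (x, R.b) * v (x, R.b) := by
  obtain ⟨ψ, hψ, hl, hu⟩ := h.exists_tendstoUniformlyOn hm hU hUF
  have hmem : ∀ a b n, MemLp (dx^[a] (dy^[b] (ψ n))) 2 (volume.restrict R.carrier) := fun a b n =>
    (contDiff_iter (hψ n) a b).continuous.memLp_restrict
  have cv : ∀ y : ℝ, Continuous fun x => v (x, y) := fun x => hv.continuous.comp (by fun_prop)
  have cψ : ∀ y : ℝ, ∀ n, Continuous fun x => ψ n (x, y) := fun x n =>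
    (hψ n).continuous.comp (by fun_prop)
  have l1 := (tendsto_integral_mul (hmem 0 1) (h.1 0 1 (by lia)) (hv.continuous.memLp_restrict (T := R))
    (hl 0 1 (by lia))).add (tendsto_integral_mul (hmem 0 0) (h.1 0 0 (by lia))
    ((contDiff_dy hv).continuous.memLp_restrict (T := R)) (hl 0 0 (by lia)))
  have l2 := (tendsto_intervalIntegral_of_tendstoUniformlyOn R.hlr.le (cψ R.t) (cv R.t)
    (tendstoUniformlyOn_fst hu (right_mem_Icc.2 R.hbt.le))).sub
    (tendsto_intervalIntegral_of_tendstoUniformlyOn R.hlr.le (cψ R.b) (cv R.b)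
    (tendstoUniformlyOn_fst hu (left_mem_Icc.2 R.hbt.le)))
  refine tendsto_nhds_unique l1 (l2.congr fun n => ?_)
  have c1 : Continuous fun z => dy (ψ n) z * v z := (contDiff_dy (hψ n)).continuous.mul hv.continuous
  have c2 : Continuous fun z => ψ n z * dy v z := (hψ n).continuous.mul (contDiff_dy hv).continuous
  have e := integral_rect_dy ((hψ n).mul hv) R
  have e2 : dy (fun z => ψ n z * v z) = fun z => dy (ψ n) z * v z + ψ n z * dy v z :=
    funext fun z => dy_mul (hψ n).diff' hv.diff' z
  change ∫ z in R.carrier, dy (fun z => ψ n z * v z) z = _ at e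
  rw [e2, integral_add (c1.integrableOn_rect R) (c2.integrableOn_rect R),
    intervalIntegral.integral_sub (intervalIntegrable_mul (cψ R.t n) (cv R.t) _ _)
    (intervalIntegrable_mul (cψ R.b n) (cv R.b) _ _)] at e
  exact e.symm

end SobolevOn

/-! ### Averaged Taylor polynomials -/

theorem isP_iff_of_le {m n : ℕ} {g : ℝ × ℝ → ℝ} (h : IsP m g) (hmn : m ≤ n) : IsP n g :=
  isP_iff.2 (polySpan_mono (fun p (hp : p.1 + p.2 ≤ m) => (hp.trans hmn : p.1 + p.2 ≤ n))
    (isP_iff.1 h))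

theorem exists_isP_integral_eq (R : Rect) (n : ℕ) (t : ℕ → ℕ → ℝ) :
    ∃ q, IsP n q ∧ ∀ a b, a + b ≤ n → ∫ z in R.carrier, (dx^[a] (dy^[b] q)) z = t a b := by
  have hR : 0 < R.width * R.height := mul_pos R.width_pos R.height_pos
  have top : ∀ (n : ℕ) (t : ℕ → ℕ → ℝ), ∃ q, IsP n q ∧ ∀ a b, a + b = n →
      ∫ z in R.carrier, (dx^[a] (dy^[b] q)) z = t a b := by
    intro n t
    set c : ℕ → ℕ → ℝ := fun i j => t i j / (R.width * R.height * (i.factorial * j.factorial)) with hc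
    have hq : ∀ s : Finset (ℕ × ℕ), s ⊆ Finset.HasAntidiagonal.antidiagonal n →
        IsP n (∑ ij ∈ s, c ij.1 ij.2 • mono ij) := fun s hs => by
      refine isP_iff.2 (Submodule.sum_mem _ fun ij hij => Submodule.smul_mem _ _ (mono_mem ?_))
      exact (Finset.HasAntidiagonal.mem_antidiagonal.1 (hs hij)).le
    refine ⟨∑ ij ∈ Finset.HasAntidiagonal.antidiagonal n, c ij.1 ij.2 • mono ij, hq _ subset_rfl,
      fun a b hab => ?_⟩
    have hD : ∀ s : Finset (ℕ × ℕ), s ⊆ Finset.HasAntidiagonal.antidiagonal n →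
        dx^[a] (dy^[b] (∑ ij ∈ s, c ij.1 ij.2 • mono ij)) =
        ∑ ij ∈ s, c ij.1 ij.2 • dx^[a] (dy^[b] (mono ij)) := by
      classical
      intro s
      induction s using Finset.induction_on with
      | empty => intro _; simpa using D_zero a b
      | insert p s hp ih =>
        intro hs
        have h1 : ContDiff ℝ ∞ (c p.1 p.2 • mono p) := (contDiff_mono p).const_smul (c p.1 p.2)
        rw [Finset.sum_insert hp, Finset.sum_insert hp, D_add h1
          (hq s ((Finset.subset_insert _ _).trans hs)).contDiff, D_smul _ (contDiff_mono p),
          ih ((Finset.subset_insert _ _).trans hs)]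
    rw [hD _ subset_rfl, Finset.sum_eq_single (a, b)]
    · rw [D_mono]
      simp only [hc, Nat.descFactorial_self, Nat.sub_self, Pi.smul_apply, mono, pow_zero, mul_one,
        smul_eq_mul]
      rw [setIntegral_const, R.volume_carrier, smul_eq_mul]
      have ha : (a.factorial : ℝ) ≠ 0 := by positivity
      have hb : (b.factorial : ℝ) ≠ 0 := by positivity
      have hR' := hR.ne'
      generalize R.width * R.height = A at *
      field_simp
    · rintro ⟨i, j⟩ hij hne
      have hij' : i + j = n := Finset.HasAntidiagonal.mem_antidiagonal.1 hij
      rw [D_mono]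
      have : i < a ∨ j < b := by
        by_contra hcon
        push Not at hcon
        exact hne (by ext <;> simp <;> lia)
      rcases this with h | h
      · rw [Nat.descFactorial_eq_zero_iff_lt.2 h]; simp
      · rw [Nat.descFactorial_eq_zero_iff_lt.2 h]; simp
    · intro h
      exact absurd (Finset.HasAntidiagonal.mem_antidiagonal.2 hab) h
  induction n generalizing t with
  | zero =>
    obtain ⟨q, h1, h2⟩ := top 0 t
    exact ⟨q, h1, fun a b hab => h2 a b (by lia)⟩
  | succ n ih =>
    obtain ⟨q, h1, h2⟩ := top (n + 1) t
    obtain ⟨p, h3, h4⟩ := ih fun a b => t a b - ∫ z in R.carrier, (dx^[a] (dy^[b] q)) z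
    refine ⟨q + p, h1.add (isP_iff_of_le h3 n.le_succ), fun a b hab => ?_⟩
    rw [D_add h1.contDiff h3.contDiff]
    simp only [Pi.add_apply]
    rw [integral_add ((contDiff_iter h1.contDiff a b).continuous.integrableOn_rect R)
      ((contDiff_iter h3.contDiff a b).continuous.integrableOn_rect R)]
    rcases Nat.lt_or_ge (a + b) (n + 1) with h | h
    · rw [h4 a b (by lia)]; ring
    · rw [h2 a b (by lia), D_eq_zero_of_isP h3 (by lia)]; simp

/-- The square of the `H^m(R)` seminorm. -/
noncomputable def seminormSq (R : Rect) (m : ℕ) (F : ℕ → ℕ → ℝ × ℝ → ℝ) : ℝ :=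
  ∑ ab ∈ Finset.HasAntidiagonal.antidiagonal m, ∫ z in R.carrier, F ab.1 ab.2 z ^ 2

theorem seminormSq_nonneg (R : Rect) (m : ℕ) (F : ℕ → ℕ → ℝ × ℝ → ℝ) : 0 ≤ seminormSq R m F :=
  Finset.sum_nonneg fun _ _ => integral_nonneg fun _ => sq_nonneg _

theorem integral_le_seminormSq (R : Rect) {m a b : ℕ} (h : a + b = m) (F : ℕ → ℕ → ℝ × ℝ → ℝ) :
    ∫ z in R.carrier, F a b z ^ 2 ≤ seminormSq R m F :=
  Finset.single_le_sum (f := fun ab : ℕ × ℕ => ∫ z in R.carrier, F ab.1 ab.2 z ^ 2)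
    (fun _ _ => integral_nonneg fun _ => sq_nonneg _)
    (Finset.HasAntidiagonal.mem_antidiagonal.2 h : (a, b) ∈ _)

theorem SobolevOn.exists_isP {R : Rect} {n : ℕ} {F : ℕ → ℕ → ℝ × ℝ → ℝ} (h : SobolevOn R (n + 1) F)
    {d : ℝ} (hw : R.width ≤ d) (hh : R.height ≤ d) :
    ∃ q, IsP n q ∧ ∀ l a b, a + b + l = n + 1 →
      ∫ z in R.carrier, (F a b z - (dx^[a] (dy^[b] q)) z) ^ 2 ≤
        (4 * d ^ 2) ^ l * seminormSq R (n + 1) F := by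
  obtain ⟨q, hq, hi⟩ := exists_isP_integral_eq R n fun a b => ∫ z in R.carrier, F a b z
  refine ⟨q, hq, fun l => ?_⟩
  have hw0 := R.width_pos
  have hh0 := R.height_pos
  induction l with
  | zero =>
    intro a b hab
    rw [D_eq_zero_of_isP hq (by lia)]
    simpa using integral_le_seminormSq R (by lia) F
  | succ l ih =>
    intro a b hab
    have hs := (h.sub_smooth hq.contDiff).shift (n := 1) (c := a) (d := b) (by lia)
    have hp := hs.integral_sq_le le_rfl
    simp only [zero_add] at hp
    have h0 : ∫ z in R.carrier, (F a b z - (dx^[a] (dy^[b] q)) z) = 0 := by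
      have m1 : Integrable (F a b) (volume.restrict R.carrier) :=
        (h.1 a b (by lia)).integrable (by norm_num)
      rw [integral_sub m1 ((contDiff_iter hq.contDiff a b).continuous.integrableOn_rect R),
        hi a b (by lia), sub_self]
    rw [h0] at hp
    have e1 := ih (1 + a) b (by lia)
    have e2 := ih a (1 + b) (by lia)
    have k1 : R.width ^ 2 ≤ d ^ 2 := by gcongr
    have k2 : R.height ^ 2 ≤ d ^ 2 := by gcongr
    set X := (4 * d ^ 2) ^ l * seminormSq R (n + 1) F
    have e1' : 0 ≤ ∫ z in R.carrier, (F (1 + a) b z - (dx^[1 + a] (dy^[b] q)) z) ^ 2 :=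
      integral_nonneg fun _ => sq_nonneg _
    have e2' : 0 ≤ ∫ z in R.carrier, (F a (1 + b) z - (dx^[a] (dy^[1 + b] q)) z) ^ 2 :=
      integral_nonneg fun _ => sq_nonneg _
    calc _ ≤ 2 * R.width ^ 2 * (∫ z in R.carrier, (F (1 + a) b z - (dx^[1 + a] (dy^[b] q)) z) ^ 2) +
          2 * R.height ^ 2 * ∫ z in R.carrier, (F a (1 + b) z - (dx^[a] (dy^[1 + b] q)) z) ^ 2 := by
          refine hp.trans (le_of_eq ?_); simp
      _ ≤ 2 * d ^ 2 * X + 2 * d ^ 2 * X := by gcongr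
      _ = _ := by rw [pow_succ]; ring

end WG

namespace WG

/-! ### Local polynomial approximation -/

theorem supBound_le {R : Rect} {G : ℕ → ℕ → ℝ × ℝ → ℝ} {d κ X : ℝ} {l : ℕ} (hκ : 1 ≤ κ) (hX : 0 ≤ X)
    (hw : R.width ≤ d) (hh : R.height ≤ d) (hw' : d ≤ κ * R.width) (hh' : d ≤ κ * R.height)
    (h00 : ∫ z in R.carrier, G 0 0 z ^ 2 ≤ (4 * d ^ 2) ^ (l + 2) * X)
    (h01 : ∫ z in R.carrier, G 0 1 z ^ 2 ≤ (4 * d ^ 2) ^ (l + 1) * X)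
    (h10 : ∫ z in R.carrier, G 1 0 z ^ 2 ≤ (4 * d ^ 2) ^ (l + 1) * X)
    (h11 : ∫ z in R.carrier, G 1 1 z ^ 2 ≤ (4 * d ^ 2) ^ l * X) :
    SobolevOn.supBound R G ≤ 100 * κ ^ 2 * 4 ^ l * d ^ (2 * l + 2) * X := by
  have hw0 := R.width_pos
  have hh0 := R.height_pos
  have hd : 0 < d := hw0.trans_le hw
  have hκ0 : 0 < κ := by linarith
  have a1 : 4 / (R.width * R.height) ≤ 4 * κ ^ 2 / d ^ 2 := by
    rw [div_le_div_iff₀ (by positivity) (by positivity)]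
    nlinarith [mul_le_mul hw' hh' hd.le (by positivity)]
  have a2 : 4 * R.height / R.width ≤ 4 * κ := by
    rw [div_le_iff₀ hw0]; linarith
  have a3 : 4 * R.width / R.height ≤ 4 * κ := by
    rw [div_le_iff₀ hh0]; linarith
  have a4 : 4 * (R.width * R.height) ≤ 4 * d ^ 2 := by nlinarith
  unfold SobolevOn.supBound
  calc _ ≤ 4 * κ ^ 2 / d ^ 2 * ((4 * d ^ 2) ^ (l + 2) * X) + 4 * κ * ((4 * d ^ 2) ^ (l + 1) * X) +
        4 * κ * ((4 * d ^ 2) ^ (l + 1) * X) + 4 * d ^ 2 * ((4 * d ^ 2) ^ l * X) := by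
        have nn : ∀ a b, 0 ≤ ∫ z in R.carrier, G a b z ^ 2 :=
          fun a b => integral_nonneg fun _ => sq_nonneg _
        refine add_le_add (add_le_add (add_le_add ?_ ?_) ?_) ?_
        · exact mul_le_mul a1 h00 (nn _ _) (by positivity)
        · exact mul_le_mul a2 h01 (nn _ _) (by positivity)
        · exact mul_le_mul a3 h10 (nn _ _) (by positivity)
        · exact mul_le_mul a4 h11 (nn _ _) (by positivity)
    _ = (64 * κ ^ 2 + 32 * κ + 4) * (4 ^ l * d ^ (2 * l + 2) * X) := by
        rw [pow_add, pow_add, mul_pow, ← pow_mul, pow_add d (2 * l) 2]; field_simp; ring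
    _ ≤ (100 * κ ^ 2) * (4 ^ l * d ^ (2 * l + 2) * X) := by
        gcongr; nlinarith
    _ = _ := by ring

/-- The continuous functions `U`, `V₁`, `V₂` represent `F 0 0`, `F 1 0`, `F 0 1` on `R`. -/
structure IsRep (R : Rect) (F : ℕ → ℕ → ℝ × ℝ → ℝ) (U V₁ V₂ : ℝ × ℝ → ℝ) : Prop where
  cont : ContinuousOn U R.carrier
  cont₁ : ContinuousOn V₁ R.carrier
  cont₂ : ContinuousOn V₂ R.carrier
  ae : U =ᵐ[volume.restrict R.carrier] F 0 0
  ae₁ : V₁ =ᵐ[volume.restrict R.carrier] F 1 0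
  ae₂ : V₂ =ᵐ[volume.restrict R.carrier] F 0 1

/-- `q ∈ P_{k+1}` approximates `U` on `R`, with `A = C d^{2k} |u|²_{k+2}`. -/
structure IsApprox (k : ℕ) (R : Rect) (F : ℕ → ℕ → ℝ × ℝ → ℝ) (U V₁ V₂ : ℝ × ℝ → ℝ) (d A B : ℝ)
    (q : ℝ × ℝ → ℝ) : Prop where
  isP : IsP (k + 1) q
  sub : ∀ z ∈ R.carrier, (U z - q z) ^ 2 ≤ d ^ 2 * A
  sub₁ : ∀ z ∈ R.carrier, (V₁ z - dx q z) ^ 2 ≤ A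
  sub₂ : ∀ z ∈ R.carrier, (V₂ z - dy q z) ^ 2 ≤ A
  grad₁ : ∫ z in R.carrier, (F 1 0 z - dx q z) ^ 2 ≤ d ^ 2 * A
  grad₂ : ∫ z in R.carrier, (F 0 1 z - dy q z) ^ 2 ≤ d ^ 2 * A
  top₁ : ∫ z in R.carrier, (F (k + 1) 0 z - (dx^[k + 1] (dy^[0] q)) z) ^ 2 ≤ B
  top₂ : ∫ z in R.carrier, (F 0 (k + 1) z - (dx^[0] (dy^[k + 1] q)) z) ^ 2 ≤ B

theorem _root_.ContDiff.continuousOn' {g : ℝ × ℝ → ℝ} (h : ContDiff ℝ ∞ g) (s : Set (ℝ × ℝ)) :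
    ContinuousOn g s := h.continuous.continuousOn

theorem exists_isApprox {k : ℕ} (hk : 1 ≤ k) {κ : ℝ} (hκ : 1 ≤ κ) : ∃ C : ℝ, 0 < C ∧
    ∀ (R : Rect) (F : ℕ → ℕ → ℝ × ℝ → ℝ) (U V₁ V₂ : ℝ × ℝ → ℝ) (d : ℝ), SobolevOn R (k + 2) F →
      R.width ≤ d → R.height ≤ d → d ≤ κ * R.width → d ≤ κ * R.height → IsRep R F U V₁ V₂ →
      ∃ q, IsApprox k R F U V₁ V₂ d (C * d ^ (2 * k) * seminormSq R (k + 2) F)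
        (C * d ^ 2 * seminormSq R (k + 2) F) q := by
  obtain ⟨j, rfl⟩ : ∃ j, k = j + 1 := ⟨k - 1, by lia⟩
  refine ⟨100 * κ ^ 2 * 4 ^ (j + 2), by positivity, fun R F U V₁ V₂ d hF hw hh hw' hh' hr => ?_⟩
  obtain ⟨q, hq, hi⟩ := hF.exists_isP hw hh
  have hqs := hF.sub_smooth hq.contDiff
  set X := seminormSq R (j + 1 + 2) F with hXd
  have hX : 0 ≤ X := seminormSq_nonneg _ _ _
  have hw0 := R.width_pos
  have hd : 0 < d := hw0.trans_le hw
  have hκ2 : 1 ≤ κ ^ 2 := one_le_pow₀ hκ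
  have bnd : ∀ c e, c + e = 1 → ∀ V : ℝ × ℝ → ℝ, ContinuousOn V R.carrier →
      V =ᵐ[volume.restrict R.carrier] F c e → ∀ z ∈ R.carrier, (V z - (dx^[c] (dy^[e] q)) z) ^ 2 ≤
        100 * κ ^ 2 * 4 ^ (j + 2) * d ^ (2 * (j + 1)) * X := by
    intro c e hce V hV hVF z hz
    have hs := hqs.shift (n := j + 2) (c := c) (d := e) (by lia)
    have := hs.sq_le_supBound (by lia) (U := fun z => V z - (dx^[c] (dy^[e] q)) z)
      (hV.sub ((contDiff_iter hq.contDiff c e).continuousOn' _))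
      (by filter_upwards [hVF] with z hz; simp [hz]) hz
    refine this.trans ((supBound_le (l := j) hκ hX hw hh hw' hh' ?_ ?_ ?_ ?_).trans ?_)
    · exact hi (j + 2) _ _ (by lia)
    · exact hi (j + 1) _ _ (by lia)
    · exact hi (j + 1) _ _ (by lia)
    · exact hi j _ _ (by lia)
    · calc 100 * κ ^ 2 * 4 ^ j * d ^ (2 * j + 2) * X ≤
          100 * κ ^ 2 * 4 ^ (j + 2) * d ^ (2 * j + 2) * X := by gcongr <;> [norm_num; lia]
        _ = _ := by ring
  refine ⟨q, hq, fun z hz => ?_, fun z hz => bnd 1 0 rfl V₁ hr.cont₁ hr.ae₁ z hz,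
    fun z hz => bnd 0 1 rfl V₂ hr.cont₂ hr.ae₂ z hz, ?_, ?_, ?_, ?_⟩
  · have := hqs.sq_le_supBound (by lia) (U := fun z => U z - q z)
      (hr.cont.sub (hq.contDiff.continuousOn' _))
      (by filter_upwards [hr.ae] with z hz; simp [hz]) hz
    refine this.trans ((supBound_le (l := j + 1) hκ hX hw hh hw' hh' (hi (j + 3) 0 0 (by lia))
      (hi (j + 2) 0 1 (by lia)) (hi (j + 2) 1 0 (by lia)) (hi (j + 1) 1 1 (by lia))).trans ?_)
    calc 100 * κ ^ 2 * 4 ^ (j + 1) * d ^ (2 * (j + 1) + 2) * X ≤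
        100 * κ ^ 2 * 4 ^ (j + 2) * d ^ (2 * (j + 1) + 2) * X := by gcongr <;> norm_num
      _ = _ := by ring
  all_goals
    have h1 : ∀ c e, c + e = 1 → ∫ z in R.carrier, (F c e z - (dx^[c] (dy^[e] q)) z) ^ 2 ≤
        d ^ 2 * (100 * κ ^ 2 * 4 ^ (j + 2) * d ^ (2 * (j + 1)) * X) := by
      intro c e hce
      refine (hi (j + 2) c e (by lia)).trans ?_
      calc (4 * d ^ 2) ^ (j + 2) * X = 1 * 1 * 4 ^ (j + 2) * d ^ (2 * (j + 2)) * X := by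
            rw [mul_pow, ← pow_mul]; ring
        _ ≤ 100 * κ ^ 2 * 4 ^ (j + 2) * d ^ (2 * (j + 2)) * X := by gcongr; norm_num
        _ = _ := by ring
    have h2 : (4 * d ^ 2) ^ 1 * X ≤ 100 * κ ^ 2 * 4 ^ (j + 2) * d ^ 2 * X := by
      rw [pow_one]
      have : (4 : ℝ) ≤ 100 * κ ^ 2 * 4 ^ (j + 2) := by
        have : (1 : ℝ) ≤ 4 ^ (j + 2) := one_le_pow₀ (by norm_num)
        nlinarith
      gcongr
    first
    | exact h1 1 0 rfl
    | exact h1 0 1 rfl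
    | exact (hi 1 (j + 1 + 1) 0 (by lia)).trans h2
    | exact (hi 1 0 (j + 1 + 1) (by lia)).trans h2

/-! ### Pairs of adjacent elements, global representatives -/

theorem Adj.exists_union {T T' : Rect} (h : Adj T T') : ∃ R : Rect,
    R.carrier = T.carrier ∪ T'.carrier ∧ T.width ≤ R.width ∧ T.height ≤ R.height ∧
    R.width ≤ T.width + T'.width ∧ R.height ≤ T.height + T'.height := by
  have h1 := T.hlr
  have h2 := T.hbt
  have h3 := T'.hlr
  have h4 := T'.hbt
  refine ⟨⟨min T.l T'.l, max T.r T'.r, min T.b T'.b, max T.t T'.t, ?_, ?_⟩, ?_, ?_, ?_, ?_, ?_⟩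
  · exact (min_le_left _ _).trans_lt (h1.trans_le (le_max_left _ _))
  · exact (min_le_left _ _).trans_lt (h2.trans_le (le_max_left _ _))
  · ext z
    simp only [mem_union, Rect.mem_carrier]
    unfold Adj at h
    grind
  all_goals
    simp only [Rect.width, Rect.height]
    unfold Adj at h
    grind

variable {Ω : Set (ℝ × ℝ)} {M : Finset Rect}

theorem IsMesh.inner_union_subset (hM : IsMesh Ω M) (hΩ : IsRectangularDomain Ω) {T T' R : Rect}
    (hT : T ∈ M) (hT' : T' ∈ M) (hR : R.carrier = T.carrier ∪ T'.carrier) : R.inner ⊆ Ω := by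
  rw [← hΩ.interior_closure]
  refine interior_maximal (R.inner_subset.trans ?_) R.isOpen_inner
  rw [hR]
  exact union_subset (hM.carrier_subset hT) (hM.carrier_subset hT')

theorem IsMesh.exists_chain_mem (hM : IsMesh Ω M) (hΩ : IsRectangularDomain Ω) {T T' : Rect}
    (hT : T ∈ M) (hT' : T' ∈ M) {z : ℝ × ℝ} (hz : z ∈ T.carrier) (hz' : z ∈ T'.carrier) :
    ∃ T'' ∈ M, z ∈ T''.carrier ∧ AdjEq T T'' ∧ AdjEq T'' T' := by
  by_cases hne : T = T'
  · exact ⟨T, hT, hz, AdjEq.refl _, Or.inl hne⟩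
  rcases hM.adj_or_diag hT hT' hne hz hz' with h | h
  · exact ⟨T, hT, hz, AdjEq.refl _, Or.inr h⟩
  · obtain ⟨T'', hT'', h1, h2⟩ := hM.exists_between hΩ hT hT' h
    refine ⟨T'', hT'', ?_, Or.inr h1, Or.inr h2⟩
    have k1 := T.hlr
    have k2 := T.hbt
    have k3 := T'.hlr
    have k4 := T'.hbt
    have k5 := T''.hlr
    have k6 := T''.hbt
    rw [Rect.mem_carrier] at hz hz' ⊢
    simp only [Adj, Diag] at h h1 h2
    grind

theorem IsMesh.exists_rep (hM : IsMesh Ω M) (hΩ : IsRectangularDomain Ω) {G : ℕ → ℕ → ℝ × ℝ → ℝ}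
    (hG : ∀ R : Rect, R.inner ⊆ Ω → SobolevOn R 2 G) : ∃ U : ℝ × ℝ → ℝ, ∀ T ∈ M,
      ContinuousOn U T.carrier ∧ U =ᵐ[volume.restrict T.carrier] G 0 0 := by
  classical
  have h1 : ∀ T : Rect, ∃ U : ℝ × ℝ → ℝ, T ∈ M → ContinuousOn U T.carrier ∧
      U =ᵐ[volume.restrict T.carrier] G 0 0 := by
    intro T
    by_cases hT : T ∈ M
    · obtain ⟨U, hU⟩ := (hG T (hM.inner_subset hΩ hT)).exists_continuous le_rfl
      exact ⟨U, fun _ => hU⟩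
    · exact ⟨0, fun h => absurd h hT⟩
  choose W hW using h1
  have adj : ∀ T ∈ M, ∀ T' ∈ M, AdjEq T T' → ∀ z ∈ T.carrier, z ∈ T'.carrier → W T z = W T' z := by
    intro T hT T' hT' h z hz hz'
    rcases h with rfl | h
    · rfl
    obtain ⟨R, hR, -⟩ := h.exists_union
    obtain ⟨U, hU, hUG⟩ := (hG R (hM.inner_union_subset hΩ hT hT' hR)).exists_continuous le_rfl
    have key : ∀ S ∈ M, S.carrier ⊆ R.carrier → EqOn (W S) U S.carrier := fun S hS hsub =>
      Rect.eqOn_of_ae_eq (hW S hS).1 (hU.mono hsub)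
        ((hW S hS).2.trans (hUG.filter_mono (ae_mono (Measure.restrict_mono hsub le_rfl))).symm)
    rw [key T hT (hR ▸ subset_union_left) hz, key T' hT' (hR ▸ subset_union_right) hz']
  have all : ∀ T ∈ M, ∀ T' ∈ M, ∀ z ∈ T.carrier, z ∈ T'.carrier → W T z = W T' z := by
    intro T hT T' hT' z hz hz'
    obtain ⟨T'', hT'', hz'', c1, c2⟩ := hM.exists_chain_mem hΩ hT hT' hz hz'
    exact (adj T hT T'' hT'' c1 z hz hz'').trans (adj T'' hT'' T' hT' c2 z hz'' hz')
  refine ⟨fun z => if h : ∃ T ∈ M, z ∈ T.carrier then W h.choose z else 0, fun T hT => ?_⟩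
  have e : EqOn (fun z => if h : ∃ T ∈ M, z ∈ T.carrier then W h.choose z else 0) (W T) T.carrier := by
    intro z hz
    have h : ∃ T ∈ M, z ∈ T.carrier := ⟨T, hT, hz⟩
    simp only [dif_pos h]
    exact all _ h.choose_spec.1 T hT z h.choose_spec.2 hz
  refine ⟨(hW T hT).1.congr e, ?_⟩
  filter_upwards [(hW T hT).2, ae_restrict_mem T.measurableSet_carrier] with z h1 h2
  exact (e h2).trans h1

theorem IsMesh.exists_isRep (hM : IsMesh Ω M) (hΩ : IsRectangularDomain Ω) {m : ℕ} (hm : 3 ≤ m)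
    {F : ℕ → ℕ → ℝ × ℝ → ℝ} (hF : ∀ R : Rect, R.inner ⊆ Ω → SobolevOn R m F) :
    ∃ U V₁ V₂ : ℝ × ℝ → ℝ, ∀ T ∈ M, IsRep T F U V₁ V₂ := by
  have key : ∀ c e, c + e ≤ 1 → ∃ U : ℝ × ℝ → ℝ, ∀ T ∈ M,
      ContinuousOn U T.carrier ∧ U =ᵐ[volume.restrict T.carrier] F c e := by
    intro c e hce
    obtain ⟨U, hU⟩ := hM.exists_rep hΩ (G := fun a b => F (a + c) (b + e))
      fun R hR => (hF R hR).shift (by lia)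
    exact ⟨U, by simpa using hU⟩
  obtain ⟨U, hU⟩ := key 0 0 (by lia)
  obtain ⟨V₁, hV₁⟩ := key 1 0 (by lia)
  obtain ⟨V₂, hV₂⟩ := key 0 1 (by lia)
  exact ⟨U, V₁, V₂, fun T hT => ⟨(hU T hT).1, (hV₁ T hT).1, (hV₂ T hT).1, (hU T hT).2, (hV₁ T hT).2,
    (hV₂ T hT).2⟩⟩

theorem IsRep.union {T T' R : Rect} {F : ℕ → ℕ → ℝ × ℝ → ℝ} {U V₁ V₂ : ℝ × ℝ → ℝ}
    (h : IsRep T F U V₁ V₂) (h' : IsRep T' F U V₁ V₂) (hR : R.carrier = T.carrier ∪ T'.carrier) :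
    IsRep R F U V₁ V₂ := by
  have hc := T.isCompact_carrier.isClosed
  have hc' := T'.isCompact_carrier.isClosed
  constructor
  · rw [hR]; exact h.cont.union_of_isClosed h'.cont hc hc'
  · rw [hR]; exact h.cont₁.union_of_isClosed h'.cont₁ hc hc'
  · rw [hR]; exact h.cont₂.union_of_isClosed h'.cont₂ hc hc'
  · rw [hR]; exact ae_restrict_union_iff _ _ _ |>.2 ⟨h.ae, h'.ae⟩
  · rw [hR]; exact ae_restrict_union_iff _ _ _ |>.2 ⟨h.ae₁, h'.ae₁⟩
  · rw [hR]; exact ae_restrict_union_iff _ _ _ |>.2 ⟨h.ae₂, h'.ae₂⟩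

theorem seminormSq_union_le {T T' R : Rect} (hR : R.carrier = T.carrier ∪ T'.carrier) {m : ℕ}
    {F : ℕ → ℕ → ℝ × ℝ → ℝ} (hF : SobolevOn R m F) :
    seminormSq R m F ≤ seminormSq T m F + seminormSq T' m F := by
  unfold seminormSq
  rw [← Finset.sum_add_distrib]
  refine Finset.sum_le_sum fun ab hab => ?_
  have hi : IntegrableOn (fun z => F ab.1 ab.2 z ^ 2) R.carrier :=
    (hF.1 ab.1 ab.2 (Finset.HasAntidiagonal.mem_antidiagonal.1 hab).le).integrable_sq
  rw [hR] at hi ⊢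
  have h1 := hi.mono_set subset_union_left
  have h2 := hi.mono_set subset_union_right
  rw [← integral_add_measure h1 h2]
  exact integral_mono_measure (Measure.restrict_union_le _ _)
    (Filter.Eventually.of_forall fun z => sq_nonneg _) (Integrable.add_measure h1 h2)

end WG

namespace WG

variable {Ω : Set (ℝ × ℝ)}

/-! ### Weak derivatives, the boundary condition and the differential equation -/

theorem ae_eq_zero_of_integral_mul_eq_zero (hΩ : IsOpen Ω) {g : ℝ × ℝ → ℝ}
    (hg : MemLp g 2 (volume.restrict Ω)) (h : ∀ φ, IsTestFunction Ω φ → ∫ z in Ω, g z * φ z = 0) :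
    g =ᵐ[volume.restrict Ω] 0 := by
  have hl : LocallyIntegrableOn g Ω := by
    rw [locallyIntegrableOn_iff hΩ.isLocallyClosed]
    intro K hK hKc
    have : IsFiniteMeasure (volume.restrict K) := ⟨by
      rw [Measure.restrict_apply_univ]; exact hKc.measure_lt_top⟩
    exact (hg.mono_measure (Measure.restrict_mono hK le_rfl)).integrable (by norm_num)
  have := hΩ.ae_eq_zero_of_integral_contDiff_smul_eq_zero hl fun φ h1 h2 h3 => by
    rw [← h φ ⟨h1, h2, h3⟩, ← integral_indicator hΩ.measurableSet]
    congr 1; ext z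
    by_cases hz : z ∈ Ω
    · rw [indicator_of_mem hz, smul_eq_mul, mul_comm]
    · rw [indicator_of_notMem hz, image_eq_zero_of_notMem_tsupport fun h => hz (h3 h), zero_smul]
  rw [Filter.EventuallyEq, ae_restrict_iff' hΩ.measurableSet]
  exact this

theorem IsTestFunction.memLp {φ : ℝ × ℝ → ℝ} (h : IsTestFunction Ω φ) (s : Set (ℝ × ℝ)) :
    MemLp φ 2 (volume.restrict s) :=
  (h.1.continuous.memLp_of_hasCompactSupport h.2.1).restrict s

theorem HasWeakDeriv.ae_eq (hΩ : IsOpen Ω) {a b : ℕ} {u v w : ℝ × ℝ → ℝ} (hv : HasWeakDeriv Ω a b u v)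
    (hw : HasWeakDeriv Ω a b u w) : v =ᵐ[volume.restrict Ω] w := by
  have := ae_eq_zero_of_integral_mul_eq_zero hΩ (hv.2.1.sub hw.2.1) fun φ hφ => by
    have h1 := (hv.2.2 φ hφ).symm.trans (hw.2.2 φ hφ)
    have h2 := mul_left_cancel₀ (pow_ne_zero _ (by norm_num)) h1
    have i1 : Integrable (fun z => v z * φ z) (volume.restrict Ω) := hv.2.1.integrable_mul (hφ.memLp Ω)
    have i2 : Integrable (fun z => w z * φ z) (volume.restrict Ω) := hw.2.1.integrable_mul (hφ.memLp Ω)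
    simp only [Pi.sub_apply, sub_mul]
    rw [integral_sub i1 i2, h2, sub_self]
  filter_upwards [this] with z hz
  have : v z - w z = 0 := hz
  linarith

theorem hasWeakDeriv_weakDeriv {a b : ℕ} {u : ℝ × ℝ → ℝ} (h : ∃ v, HasWeakDeriv Ω a b u v) :
    HasWeakDeriv Ω a b u (weakDeriv Ω a b u) := by
  unfold weakDeriv; rw [dif_pos h]; exact h.choose_spec

theorem HasWeakDeriv.shift {a b c d : ℕ} {u v w : ℝ × ℝ → ℝ} (hv : HasWeakDeriv Ω a b u v)
    (hw : HasWeakDeriv Ω (a + c) (b + d) u w) : HasWeakDeriv Ω c d v w := by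
  refine ⟨hv.2.1, hw.2.1, fun φ hφ => ?_⟩
  have h1 := hv.2.2 _ (hφ.iter c d)
  rw [D_D hφ.1, hw.2.2 φ hφ] at h1
  have e : (-1 : ℝ) ^ (a + c + (b + d)) = (-1) ^ (a + b) * (-1) ^ (c + d) := by
    rw [← pow_add]; congr 1; ring
  rw [e, mul_assoc] at h1
  exact (mul_left_cancel₀ (pow_ne_zero _ (by norm_num)) h1).symm

theorem setIntegral_eq_integral_of_tsupport {g φ : ℝ × ℝ → ℝ} (h : tsupport φ ⊆ Ω) :
    ∫ z in Ω, g z * φ z = ∫ z, g z * φ z :=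
  setIntegral_eq_integral_of_forall_compl_eq_zero fun z hz => by
    rw [image_eq_zero_of_notMem_tsupport fun h' => hz (h h'), mul_zero]

theorem IsTestFunction.hasWeakDeriv {φ : ℝ × ℝ → ℝ} (h : IsTestFunction Ω φ) {a b : ℕ}
    (hab : a + b ≤ 1) : HasWeakDeriv Ω a b φ (WG.dx^[a] (WG.dy^[b] φ)) := by
  refine ⟨h.memLp _, (h.iter a b).memLp _, fun χ hχ => ?_⟩
  have key : ∀ e : ℝ × ℝ, ∫ z, φ z * fderiv ℝ χ z e = -∫ z, fderiv ℝ φ z e * χ z := by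
    intro e
    have c1 : Continuous fun z => fderiv ℝ χ z e := (hχ.1.continuous_fderiv (by simp)).clm_apply continuous_const
    have c2 : Continuous fun z => fderiv ℝ φ z e := (h.1.continuous_fderiv (by simp)).clm_apply continuous_const
    refine integral_mul_fderiv_eq_neg_fderiv_mul_of_integrable ?_ ?_ ?_
      (fun z _ => h.1.diff' z) fun z _ => hχ.1.diff' z
    · exact (c2.mul hχ.1.continuous).integrable_of_hasCompactSupport hχ.2.1.mul_left
    · exact (h.1.continuous.mul c1).integrable_of_hasCompactSupport h.2.1.mul_right
    · exact (h.1.continuous.mul hχ.1.continuous).integrable_of_hasCompactSupport h.2.1.mul_right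
  rw [setIntegral_eq_integral_of_tsupport (hχ.iter a b).2.2, setIntegral_eq_integral_of_tsupport hχ.2.2]
  have : (a = 0 ∧ b = 0) ∨ (a = 1 ∧ b = 0) ∨ (a = 0 ∧ b = 1) := by lia
  rcases this with ⟨rfl, rfl⟩ | ⟨rfl, rfl⟩ | ⟨rfl, rfl⟩
  · simp
  · simpa [WG.dx] using key (1, 0)
  · simpa [WG.dy] using key (0, 1)

theorem IsTestFunction.memH10 (hΩ : IsOpen Ω) {φ : ℝ × ℝ → ℝ} (h : IsTestFunction Ω φ) :
    MemH10 Ω φ := by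
  refine ⟨fun a b hab => ⟨_, h.hasWeakDeriv hab⟩, fun ε hε => ⟨φ, h, ?_⟩⟩
  have h1 := (hasWeakDeriv_weakDeriv ⟨_, h.hasWeakDeriv (a := 1) (b := 0) le_rfl⟩).ae_eq hΩ
    (h.hasWeakDeriv le_rfl)
  have h2 := (hasWeakDeriv_weakDeriv ⟨_, h.hasWeakDeriv (a := 0) (b := 1) le_rfl⟩).ae_eq hΩ
    (h.hasWeakDeriv le_rfl)
  have : ∫ z in Ω, ((φ z - φ z) ^ 2 + (weakDeriv Ω 1 0 φ z - WG.dx φ z) ^ 2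
      + (weakDeriv Ω 0 1 φ z - WG.dy φ z) ^ 2) = 0 := by
    refine integral_eq_zero_of_ae ?_
    filter_upwards [h1, h2] with z e1 e2
    rw [e1, e2]; simp
  rw [this]; exact hε

/-- The differential equation holds almost everywhere. -/
theorem IsWeakSolution.ae_eq (hΩ : IsOpen Ω) {f u : ℝ × ℝ → ℝ} (h : IsWeakSolution Ω f u)
    (hf : MemLp f 2 (volume.restrict Ω)) {F : ℕ → ℕ → ℝ × ℝ → ℝ}
    (hF : ∀ a b, a + b ≤ 2 → HasWeakDeriv Ω a b u (F a b)) :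
    f =ᵐ[volume.restrict Ω] fun z => -(F 2 0 z + F 0 2 z) := by
  have m20 := (hF 2 0 le_rfl).2.1
  have m02 := (hF 0 2 le_rfl).2.1
  have := ae_eq_zero_of_integral_mul_eq_zero hΩ (hf.add (m20.add m02)) fun φ hφ => by
    have e := h.2 φ (hφ.memH10 hΩ)
    have w1 := hasWeakDeriv_weakDeriv ⟨_, hF 1 0 (by lia)⟩
    have w2 := hasWeakDeriv_weakDeriv ⟨_, hF 0 1 (by lia)⟩
    have d1 := (hasWeakDeriv_weakDeriv ⟨_, hφ.hasWeakDeriv (a := 1) (b := 0) le_rfl⟩).ae_eq hΩ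
      (hφ.hasWeakDeriv le_rfl)
    have d2 := (hasWeakDeriv_weakDeriv ⟨_, hφ.hasWeakDeriv (a := 0) (b := 1) le_rfl⟩).ae_eq hΩ
      (hφ.hasWeakDeriv le_rfl)
    have s1 := (w1.shift (c := 1) (d := 0) (hF 2 0 le_rfl)).2.2 φ hφ
    have s2 := (w2.shift (c := 0) (d := 1) (hF 0 2 le_rfl)).2.2 φ hφ
    have i1 : Integrable (fun z => weakDeriv Ω 1 0 u z * dx φ z) (volume.restrict Ω) :=
      w1.2.1.integrable_mul (hφ.dx.memLp Ω)
    have i2 : Integrable (fun z => weakDeriv Ω 0 1 u z * dy φ z) (volume.restrict Ω) :=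
      w2.2.1.integrable_mul (hφ.dy.memLp Ω)
    have e2 : ∫ z in Ω, (weakDeriv Ω 1 0 u z * weakDeriv Ω 1 0 φ z
        + weakDeriv Ω 0 1 u z * weakDeriv Ω 0 1 φ z) =
        (∫ z in Ω, weakDeriv Ω 1 0 u z * dx φ z) + ∫ z in Ω, weakDeriv Ω 0 1 u z * dy φ z := by
      rw [← integral_add i1 i2]
      refine integral_congr_ae ?_
      filter_upwards [d1, d2] with z e1 e2
      rw [e1, e2]; rfl
    simp only [Function.iterate_one, Function.iterate_zero, id, add_zero, zero_add, pow_one] at s1 s2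
    rw [e2, s1, s2] at e
    have i3 : Integrable (fun z => f z * φ z) (volume.restrict Ω) := hf.integrable_mul (hφ.memLp Ω)
    have i4 : Integrable (fun z => F 2 0 z * φ z) (volume.restrict Ω) := m20.integrable_mul (hφ.memLp Ω)
    have i5 : Integrable (fun z => F 0 2 z * φ z) (volume.restrict Ω) := m02.integrable_mul (hφ.memLp Ω)
    have i6 : Integrable (fun z => F 2 0 z * φ z + F 0 2 z * φ z) (volume.restrict Ω) := i4.add i5
    simp only [Pi.add_apply, add_mul]
    rw [integral_add i3 i6, integral_add i4 i5]
    linarith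
  filter_upwards [this] with z hz
  have : f z + (F 2 0 z + F 0 2 z) = 0 := hz
  linarith

theorem MemH10.exists_seq (hΩ : IsOpen Ω) {u : ℝ × ℝ → ℝ} (h : MemH10 Ω u)
    {F : ℕ → ℕ → ℝ × ℝ → ℝ} (hF : ∀ a b, a + b ≤ 1 → HasWeakDeriv Ω a b u (F a b)) :
    ∃ φ : ℕ → ℝ × ℝ → ℝ, (∀ n, IsTestFunction Ω (φ n)) ∧
      ∀ R : Rect, R.inner ⊆ Ω → ∀ a b, a + b ≤ 1 →
        Filter.Tendsto (fun n => ∫ z in R.carrier, ((dx^[a] (dy^[b] (φ n))) z - F a b z) ^ 2)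
          Filter.atTop (nhds 0) := by
  have hu := h.2
  choose φ hφ hlt using fun n : ℕ => hu (1 / ((n : ℝ) + 1)) (by positivity)
  refine ⟨φ, hφ, fun R hR a b hab => ?_⟩
  have w0 := hF 0 0 (by lia)
  have w1 := (hasWeakDeriv_weakDeriv ⟨_, hF 1 0 le_rfl⟩)
  have w2 := (hasWeakDeriv_weakDeriv ⟨_, hF 0 1 le_rfl⟩)
  have e0 : F 0 0 =ᵐ[volume.restrict Ω] u := w0.ae_eq hΩ ⟨w0.1, w0.1, fun χ _ => by simp⟩
  have e1 := (hF 1 0 le_rfl).ae_eq hΩ w1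
  have e2 := (hF 0 1 le_rfl).ae_eq hΩ w2
  refine squeeze_zero (fun n => integral_nonneg fun z => sq_nonneg _) (fun n => ?_)
    tendsto_one_div_add_atTop_nhds_zero_nat
  refine le_trans ?_ (hlt n).le
  have i0 : Integrable (fun z => (u z - φ n z) ^ 2) (volume.restrict Ω) :=
    (w0.1.sub ((hφ n).memLp Ω)).integrable_sq
  have i1 : Integrable (fun z => (weakDeriv Ω 1 0 u z - dx (φ n) z) ^ 2) (volume.restrict Ω) :=
    (w1.2.1.sub ((hφ n).dx.memLp Ω)).integrable_sq
  have i2 : Integrable (fun z => (weakDeriv Ω 0 1 u z - dy (φ n) z) ^ 2) (volume.restrict Ω) :=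
    (w2.2.1.sub ((hφ n).dy.memLp Ω)).integrable_sq
  rw [← setIntegral_congr_set R.inner_ae_eq]
  refine (setIntegral_mono_set (((hF a b hab).2.1.sub (((hφ n).iter a b).memLp Ω)).norm.integrable_sq.congr
    (Filter.Eventually.of_forall fun z => ?_)) (Filter.Eventually.of_forall fun z => sq_nonneg _)
    hR.eventuallyLE).trans (integral_mono_ae ?_ ((i0.add i1).add i2) ?_)
  · simp only [Pi.sub_apply, Real.norm_eq_abs, sq_abs]; ring
  · exact (((hφ n).iter a b).memLp Ω |>.sub (hF a b hab).2.1).integrable_sq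
  · filter_upwards [e0, e1, e2] with z h0 h1 h2
    have : (a = 0 ∧ b = 0) ∨ (a = 1 ∧ b = 0) ∨ (a = 0 ∧ b = 1) := by lia
    change _ ≤ (u z - φ n z) ^ 2 + (weakDeriv Ω 1 0 u z - dx (φ n) z) ^ 2 +
      (weakDeriv Ω 0 1 u z - dy (φ n) z) ^ 2
    rcases this with ⟨rfl, rfl⟩ | ⟨rfl, rfl⟩ | ⟨rfl, rfl⟩
    · rw [h0]; simp only [Function.iterate_zero, id]
      nlinarith [sq_nonneg (weakDeriv Ω 1 0 u z - dx (φ n) z), sq_nonneg (weakDeriv Ω 0 1 u z - dy (φ n) z)]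
    · rw [h1]; simp only [Function.iterate_zero, Function.iterate_one, id]
      nlinarith [sq_nonneg (u z - φ n z), sq_nonneg (weakDeriv Ω 0 1 u z - dy (φ n) z)]
    · rw [h2]; simp only [Function.iterate_zero, Function.iterate_one, id]
      nlinarith [sq_nonneg (u z - φ n z), sq_nonneg (weakDeriv Ω 1 0 u z - dx (φ n) z)]

theorem eqOn_zero_of_integral_mul_eq_zero {g : ℝ → ℝ} {a b : ℝ} (hab : a < b)
    (hg : ContinuousOn g (Icc a b)) (h : ∀ w : ℝ → ℝ, ContDiff ℝ ∞ w → ∫ x in a..b, g x * w x = 0) :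
    ∀ x ∈ Icc a b, g x = 0 := by
  have hl : LocallyIntegrableOn g (Ioo a b) :=
    (hg.mono Ioo_subset_Icc_self).locallyIntegrableOn measurableSet_Ioo
  have := isOpen_Ioo.ae_eq_zero_of_integral_contDiff_smul_eq_zero hl fun w h1 h2 h3 => by
    rw [← h w h1, intervalIntegral.integral_of_le hab.le, integral_Ioc_eq_integral_Ioo,
      ← integral_indicator measurableSet_Ioo]
    congr 1; ext z
    by_cases hz : z ∈ Ioo a b
    · rw [indicator_of_mem hz, smul_eq_mul, mul_comm]
    · rw [indicator_of_notMem hz, image_eq_zero_of_notMem_tsupport fun h => hz (h3 h), zero_smul]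
  have h2 : g =ᵐ[volume.restrict (Icc a b)] fun _ => 0 := by
    rw [← restrict_Ioo_eq_restrict_Icc, Filter.EventuallyEq, ae_restrict_iff' measurableSet_Ioo]
    exact this
  intro x hx
  refine Measure.eqOn_of_ae_eq h2 hg continuousOn_const ?_ hx
  rw [interior_Icc, closure_Ioo hab.ne]

variable {R : Rect} {F : ℕ → ℕ → ℝ × ℝ → ℝ} {m : ℕ}

theorem SobolevOn.eq_zero_fst (h : SobolevOn R m F) (hm : 2 ≤ m) {U : ℝ × ℝ → ℝ}
    (hU : ContinuousOn U R.carrier) (hUF : U =ᵐ[volume.restrict R.carrier] F 0 0)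
    {φ : ℕ → ℝ × ℝ → ℝ} (hφ : ∀ n, ContDiff ℝ ∞ (φ n)) (hl : ∀ a b, a + b ≤ 1 →
      Filter.Tendsto (fun n => ∫ z in R.carrier, ((dx^[a] (dy^[b] (φ n))) z - F a b z) ^ 2)
        Filter.atTop (nhds 0)) {x : ℝ} (hx : x = R.l ∨ x = R.r)
    (h0 : ∀ y ∈ Icc R.b R.t, ∀ n, φ n (x, y) = 0) : ∀ y ∈ Icc R.b R.t, U (x, y) = 0 := by
  have hlr := R.hlr
  have hxm : x ∈ Icc R.l R.r := by rcases hx with rfl | rfl <;> simp [hlr.le]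
  refine eqOn_zero_of_integral_mul_eq_zero R.hbt
    (hU.comp (by fun_prop) fun y hy => ⟨hxm, hy⟩) fun w hw => ?_
  have hv : ContDiff ℝ ∞ fun z : ℝ × ℝ => (z.1 - (R.l + R.r - x)) * w z.2 :=
    (contDiff_fst.sub contDiff_const).mul (hw.comp contDiff_snd)
  have hmem : ∀ a b n, MemLp (dx^[a] (dy^[b] (φ n))) 2 (volume.restrict R.carrier) := fun a b n =>
    (contDiff_iter (hφ n) a b).continuous.memLp_restrict
  have l1 := (tendsto_integral_mul (hmem 1 0) (h.1 1 0 (by lia)) (hv.continuous.memLp_restrict (T := R))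
    (hl 1 0 (by lia))).add (tendsto_integral_mul (hmem 0 0) (h.1 0 0 (by lia))
    ((contDiff_dx hv).continuous.memLp_restrict (T := R)) (hl 0 0 (by lia)))
  rw [h.integral_fst hm hU hUF hv] at l1
  have hz : ∀ n, (∫ z in R.carrier, dx (φ n) z * ((z.1 - (R.l + R.r - x)) * w z.2)) +
      ∫ z in R.carrier, φ n z * dx (fun z => (z.1 - (R.l + R.r - x)) * w z.2) z = 0 := by
    intro n
    have c1 : Continuous fun z => dx (φ n) z * ((z.1 - (R.l + R.r - x)) * w z.2) :=
      (contDiff_dx (hφ n)).continuous.mul hv.continuous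
    have c2 : Continuous fun z => φ n z * dx (fun z => (z.1 - (R.l + R.r - x)) * w z.2) z :=
      (hφ n).continuous.mul (contDiff_dx hv).continuous
    have e := integral_rect_dx ((hφ n).mul hv) R
    have e2 : dx (fun z => φ n z * ((z.1 - (R.l + R.r - x)) * w z.2)) = _ :=
      funext fun z => dx_mul (hφ n).diff' hv.diff' z
    change ∫ z in R.carrier, dx (fun z => φ n z * ((z.1 - (R.l + R.r - x)) * w z.2)) z = _ at e
    rw [e2, integral_add (c1.integrableOn_rect R) (c2.integrableOn_rect R)] at e
    rw [e]
    refine intervalIntegral.integral_zero_ae (Filter.Eventually.of_forall fun y hy => ?_)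
    rw [uIoc_of_le R.hbt.le] at hy
    have := h0 y (Ioc_subset_Icc_self hy) n
    rcases hx with rfl | rfl
    · simp [this]
    · simp [this]
  have l2 := tendsto_nhds_unique (l1.congr fun n => hz n) tendsto_const_nhds
  have hne : (R.r - R.l) ≠ 0 := by linarith
  rcases hx with rfl | rfl
  · have : (∫ y in R.b..R.t, U (R.l, y) * ((R.l - (R.l + R.r - R.l)) * w y)) =
        -(R.r - R.l) * ∫ y in R.b..R.t, U (R.l, y) * w y := by
      rw [← intervalIntegral.integral_const_mul]; congr 1; ext y; ring
    simp only [this] at l2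
    simpa [hne, sub_eq_zero, hlr.ne] using l2
  · have : (∫ y in R.b..R.t, U (R.r, y) * ((R.r - (R.l + R.r - R.r)) * w y)) =
        (R.r - R.l) * ∫ y in R.b..R.t, U (R.r, y) * w y := by
      rw [← intervalIntegral.integral_const_mul]; congr 1; ext y; ring
    simp only [this] at l2
    simpa [hne] using l2

theorem SobolevOn.eq_zero_snd (h : SobolevOn R m F) (hm : 2 ≤ m) {U : ℝ × ℝ → ℝ}
    (hU : ContinuousOn U R.carrier) (hUF : U =ᵐ[volume.restrict R.carrier] F 0 0)
    {φ : ℕ → ℝ × ℝ → ℝ} (hφ : ∀ n, ContDiff ℝ ∞ (φ n)) (hl : ∀ a b, a + b ≤ 1 →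
      Filter.Tendsto (fun n => ∫ z in R.carrier, ((dx^[a] (dy^[b] (φ n))) z - F a b z) ^ 2)
        Filter.atTop (nhds 0)) {y : ℝ} (hy : y = R.b ∨ y = R.t)
    (h0 : ∀ x ∈ Icc R.l R.r, ∀ n, φ n (x, y) = 0) : ∀ x ∈ Icc R.l R.r, U (x, y) = 0 := by
  have hbt := R.hbt
  have hym : y ∈ Icc R.b R.t := by rcases hy with rfl | rfl <;> simp [hbt.le]
  refine eqOn_zero_of_integral_mul_eq_zero R.hlr
    (hU.comp (by fun_prop) fun x hx => ⟨hx, hym⟩) fun w hw => ?_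
  have hv : ContDiff ℝ ∞ fun z : ℝ × ℝ => (z.2 - (R.b + R.t - y)) * w z.1 :=
    (contDiff_snd.sub contDiff_const).mul (hw.comp contDiff_fst)
  have hmem : ∀ a b n, MemLp (dx^[a] (dy^[b] (φ n))) 2 (volume.restrict R.carrier) := fun a b n =>
    (contDiff_iter (hφ n) a b).continuous.memLp_restrict
  have l1 := (tendsto_integral_mul (hmem 0 1) (h.1 0 1 (by lia)) (hv.continuous.memLp_restrict (T := R))
    (hl 0 1 (by lia))).add (tendsto_integral_mul (hmem 0 0) (h.1 0 0 (by lia))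
    ((contDiff_dy hv).continuous.memLp_restrict (T := R)) (hl 0 0 (by lia)))
  rw [h.integral_snd hm hU hUF hv] at l1
  have hz : ∀ n, (∫ z in R.carrier, dy (φ n) z * ((z.2 - (R.b + R.t - y)) * w z.1)) +
      ∫ z in R.carrier, φ n z * dy (fun z => (z.2 - (R.b + R.t - y)) * w z.1) z = 0 := by
    intro n
    have c1 : Continuous fun z => dy (φ n) z * ((z.2 - (R.b + R.t - y)) * w z.1) :=
      (contDiff_dy (hφ n)).continuous.mul hv.continuous
    have c2 : Continuous fun z => φ n z * dy (fun z => (z.2 - (R.b + R.t - y)) * w z.1) z :=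
      (hφ n).continuous.mul (contDiff_dy hv).continuous
    have e := integral_rect_dy ((hφ n).mul hv) R
    have e2 : dy (fun z => φ n z * ((z.2 - (R.b + R.t - y)) * w z.1)) = _ :=
      funext fun z => dy_mul (hφ n).diff' hv.diff' z
    change ∫ z in R.carrier, dy (fun z => φ n z * ((z.2 - (R.b + R.t - y)) * w z.1)) z = _ at e
    rw [e2, integral_add (c1.integrableOn_rect R) (c2.integrableOn_rect R)] at e
    rw [e]
    refine intervalIntegral.integral_zero_ae (Filter.Eventually.of_forall fun x hx => ?_)
    rw [uIoc_of_le R.hlr.le] at hx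
    have := h0 x (Ioc_subset_Icc_self hx) n
    rcases hy with rfl | rfl
    · simp [this]
    · simp [this]
  have l2 := tendsto_nhds_unique (l1.congr fun n => hz n) tendsto_const_nhds
  have hne : (R.t - R.b) ≠ 0 := by linarith
  rcases hy with rfl | rfl
  · have : (∫ x in R.l..R.r, U (x, R.b) * ((R.b - (R.b + R.t - R.b)) * w x)) =
        -(R.t - R.b) * ∫ x in R.l..R.r, U (x, R.b) * w x := by
      rw [← intervalIntegral.integral_const_mul]; congr 1; ext y; ring
    simp only [this] at l2
    simpa [hne, sub_eq_zero, hbt.ne] using l2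
  · have : (∫ x in R.l..R.r, U (x, R.t) * ((R.t - (R.b + R.t - R.t)) * w x)) =
        (R.t - R.b) * ∫ x in R.l..R.r, U (x, R.t) * w x := by
      rw [← intervalIntegral.integral_const_mul]; congr 1; ext y; ring
    simp only [this] at l2
    simpa [hne] using l2

/-- Functions in `H^1_0` vanish on boundary edges. -/
theorem MemH10.eq_zero_of_edge (hΩ : IsOpen Ω) {u : ℝ × ℝ → ℝ} (hu : MemH10 Ω u)
    (hF : ∀ a b, a + b ≤ 1 → HasWeakDeriv Ω a b u (F a b)) (hR : R.inner ⊆ Ω) (h : SobolevOn R m F)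
    (hm : 2 ≤ m) {U : ℝ × ℝ → ℝ} (hU : ContinuousOn U R.carrier)
    (hUF : U =ᵐ[volume.restrict R.carrier] F 0 0) {i : Fin 4}
    (hi : (R.edge i).carrier ⊆ frontier Ω) {z : ℝ × ℝ} (hz : z ∈ (R.edge i).carrier) : U z = 0 := by
  obtain ⟨φ, hφ, hl⟩ := hu.exists_seq hΩ hF
  have hl := hl R hR
  have hlr := R.hlr
  have hbt := R.hbt
  have h0 : ∀ w ∈ (R.edge i).carrier, ∀ n, φ n w = 0 := fun w hw n => by
    have : w ∉ Ω := fun h => by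
      have := hi hw
      rw [hΩ.frontier_eq] at this
      exact this.2 h
    exact image_eq_zero_of_notMem_tsupport fun h => this ((hφ n).2.2 h)
  have hhor : ∀ y x, x ∈ Icc R.l R.r → ((x, y) : ℝ × ℝ) ∈ (⟨(R.l, y), (R.r, y)⟩ : Edge).carrier := by
    intro y x hx
    refine ⟨(x - R.l) / (R.r - R.l), ⟨div_nonneg (by linarith [hx.1]) (by linarith),
      (div_le_one (by linarith)).2 (by linarith [hx.2])⟩, ?_⟩
    have : R.r - R.l ≠ 0 := by linarith
    ext <;> simp [Edge.pt, this]
  have hver : ∀ x y, y ∈ Icc R.b R.t → ((x, y) : ℝ × ℝ) ∈ (⟨(x, R.b), (x, R.t)⟩ : Edge).carrier := by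
    intro x y hy
    refine ⟨(y - R.b) / (R.t - R.b), ⟨div_nonneg (by linarith [hy.1]) (by linarith),
      (div_le_one (by linarith)).2 (by linarith [hy.2])⟩, ?_⟩
    have : R.t - R.b ≠ 0 := by linarith
    ext <;> simp [Edge.pt, this]
  obtain ⟨hzR, hzi⟩ := Rect.edge_carrier_subset hz
  obtain ⟨x, y⟩ := z
  simp only at hzi
  rcases hzi with ⟨rfl, rfl⟩ | ⟨rfl, rfl⟩ | ⟨rfl, rfl⟩ | ⟨rfl, rfl⟩
  · exact h.eq_zero_snd hm hU hUF (fun n => (hφ n).1) hl (Or.inl rfl)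
      (fun x hx => h0 _ (hhor _ x hx)) x hzR.1
  · exact h.eq_zero_fst hm hU hUF (fun n => (hφ n).1) hl (Or.inr rfl)
      (fun y hy => h0 _ (hver _ y hy)) y hzR.2
  · exact h.eq_zero_snd hm hU hUF (fun n => (hφ n).1) hl (Or.inr rfl)
      (fun x hx => h0 _ (hhor _ x hx)) x hzR.1
  · exact h.eq_zero_fst hm hU hUF (fun n => (hφ n).1) hl (Or.inl rfl)
      (fun y hy => h0 _ (hver _ y hy)) y hzR.2

end WG

namespace WG

/-! ### Integrals over edges -/

theorem Edge.integral_add (e : Edge) {f g : ℝ → ℝ} (hf : IntervalIntegrable f volume 0 1)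
    (hg : IntervalIntegrable g volume 0 1) :
    e.integral (fun s => f s + g s) = e.integral f + e.integral g := by
  unfold Edge.integral; rw [intervalIntegral.integral_add hf hg, mul_add]

theorem Edge.integral_sub (e : Edge) {f g : ℝ → ℝ} (hf : IntervalIntegrable f volume 0 1)
    (hg : IntervalIntegrable g volume 0 1) :
    e.integral (fun s => f s - g s) = e.integral f - e.integral g := by
  unfold Edge.integral; rw [intervalIntegral.integral_sub hf hg, mul_sub]

theorem Edge.integral_const_mul (e : Edge) (c : ℝ) (f : ℝ → ℝ) :
    e.integral (fun s => c * f s) = c * e.integral f := by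
  unfold Edge.integral; rw [intervalIntegral.integral_const_mul]; ring

theorem Edge.length_nonneg (e : Edge) : 0 ≤ e.length := Real.sqrt_nonneg _

theorem Edge.integral_congr (e : Edge) {f g : ℝ → ℝ} (h : ∀ s ∈ Icc (0 : ℝ) 1, f s = g s) :
    e.integral f = e.integral g := by
  unfold Edge.integral
  rw [intervalIntegral.integral_congr fun s hs => h s (by rwa [uIcc_of_le zero_le_one] at hs)]

theorem Edge.integral_nonneg (e : Edge) {f : ℝ → ℝ} (h : ∀ s, 0 ≤ f s) : 0 ≤ e.integral f :=
  mul_nonneg e.length_nonneg (intervalIntegral.integral_nonneg zero_le_one fun s _ => h s)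

/-- Young's inequality on an edge. -/
theorem Edge.integral_mul_le (e : Edge) {f g : ℝ → ℝ} {B l : ℝ} (hl : 0 < l)
    (hfg : IntervalIntegrable (fun s => f s * g s) volume 0 1)
    (hg : IntervalIntegrable (fun s => g s ^ 2) volume 0 1) (hB : ∀ s ∈ Icc (0 : ℝ) 1, f s ^ 2 ≤ B) :
    e.integral (fun s => f s * g s) ≤ l * (e.length * B) + l⁻¹ * e.integral fun s => g s ^ 2 := by
  have h1 : ∫ s in (0 : ℝ)..1, f s * g s ≤ ∫ s in (0 : ℝ)..1, (l * B + l⁻¹ * g s ^ 2) := by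
    refine intervalIntegral.integral_mono_on zero_le_one hfg
      (intervalIntegrable_const.add (hg.const_mul l⁻¹)) fun s hs => ?_
    have h2 : f s * g s ≤ l * f s ^ 2 + l⁻¹ * g s ^ 2 := by
      have : l * f s ^ 2 + l⁻¹ * g s ^ 2 - f s * g s =
        l * ((f s - l⁻¹ * g s / 2) ^ 2) + 3 / 4 * (l⁻¹ * g s ^ 2) := by field_simp; ring
      have h3 : 0 ≤ l * ((f s - l⁻¹ * g s / 2) ^ 2) + 3 / 4 * (l⁻¹ * g s ^ 2) := by positivity
      linarith
    nlinarith [mul_le_mul_of_nonneg_left (hB s hs) hl.le]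
  rw [intervalIntegral.integral_add (by simp) (hg.const_mul _), intervalIntegral.integral_const_mul,
    intervalIntegral.integral_const] at h1
  have := mul_le_mul_of_nonneg_left h1 e.length_nonneg
  unfold Edge.integral
  refine this.trans (le_of_eq ?_)
  simp; ring

theorem Rect.edge_length (T : Rect) : (T.edge 0).length = T.width ∧ (T.edge 1).length = T.height ∧
    (T.edge 2).length = T.width ∧ (T.edge 3).length = T.height := by
  have h1 := T.hlr
  have h2 := T.hbt
  simp only [Rect.edge, Edge.length, eDist, Rect.width, Rect.height]
  refine ⟨?_, ?_, ?_, ?_⟩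
  · simpa [abs_of_neg (sub_neg.2 h1)] using (Real.sqrt_sq_eq_abs (T.l - T.r))
  · simpa [abs_of_neg (sub_neg.2 h2)] using (Real.sqrt_sq_eq_abs (T.b - T.t))
  · simpa [abs_of_neg (sub_neg.2 h1)] using (Real.sqrt_sq_eq_abs (T.l - T.r))
  · simpa [abs_of_neg (sub_neg.2 h2)] using (Real.sqrt_sq_eq_abs (T.b - T.t))

theorem Rect.edge_length_le (T : Rect) (i : Fin 4) {d : ℝ} (hw : T.width ≤ d) (hh : T.height ≤ d) :
    (T.edge i).length ≤ d := by
  obtain ⟨h0, h1, h2, h3⟩ := T.edge_length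
  fin_cases i
  · exact h0.trans_le hw
  · exact h1.trans_le hh
  · exact h2.trans_le hw
  · exact h3.trans_le hh

theorem Edge.continuous_pt (e : Edge) : Continuous e.pt := by
  unfold Edge.pt; fun_prop

/-- The flux of `(g₁, g₂)` through the boundary of `T`. -/
theorem Rect.sum_edge_integral (T : Rect) (g₁ g₂ : ℝ × ℝ → ℝ) :
    ∑ i, (T.edge i).integral (fun s => g₁ ((T.edge i).pt s) * (normal i).1 +
      g₂ ((T.edge i).pt s) * (normal i).2) =
    ((∫ y in T.b..T.t, g₁ (T.r, y)) - ∫ y in T.b..T.t, g₁ (T.l, y)) +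
      ((∫ x in T.l..T.r, g₂ (x, T.t)) - ∫ x in T.l..T.r, g₂ (x, T.b)) := by
  obtain ⟨h0, h1, h2, h3⟩ := T.edge_length
  have hx : ∀ (g : ℝ → ℝ), T.width * ∫ s in (0 : ℝ)..1, g (T.l + s * (T.r - T.l)) =
      ∫ x in T.l..T.r, g x := fun g => by
    have := intervalIntegral.smul_integral_comp_add_mul g (a := 0) (b := 1) T.width T.l
    simp only [Rect.width, smul_eq_mul, mul_zero, add_zero, mul_one, add_sub_cancel] at this ⊢
    rw [← this]; congr 2; ext s; rw [mul_comm]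
  have hy : ∀ (g : ℝ → ℝ), T.height * ∫ s in (0 : ℝ)..1, g (T.b + s * (T.t - T.b)) =
      ∫ y in T.b..T.t, g y := fun g => by
    have := intervalIntegral.smul_integral_comp_add_mul g (a := 0) (b := 1) T.height T.b
    simp only [Rect.height, smul_eq_mul, mul_zero, add_zero, mul_one, add_sub_cancel] at this ⊢
    rw [← this]; congr 2; ext s; rw [mul_comm]
  rw [Fin.sum_univ_four]
  simp only [Edge.integral, h0, h1, h2, h3]
  simp only [Rect.edge, normal, Edge.pt, Matrix.cons_val_zero,
    Matrix.cons_val_one, Matrix.cons_val, mul_zero, mul_one, mul_neg, zero_add, add_zero,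
    Prod.mk_sub_mk, sub_self, smul_eq_mul,
    intervalIntegral.integral_neg, Prod.smul_mk, Prod.mk_add_mk]
  rw [hx fun x => g₂ (x, T.b), hx fun x => g₂ (x, T.t), hy fun y => g₁ (T.r, y),
    hy fun y => g₁ (T.l, y)]
  ring

/-- The divergence theorem. -/
theorem Rect.divergence (T : Rect) {g₁ g₂ : ℝ × ℝ → ℝ} (h₁ : ContDiff ℝ ∞ g₁) (h₂ : ContDiff ℝ ∞ g₂) :
    ∫ z in T.carrier, (dx g₁ z + dy g₂ z) =
    ∑ i, (T.edge i).integral (fun s => g₁ ((T.edge i).pt s) * (normal i).1 +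
      g₂ ((T.edge i).pt s) * (normal i).2) := by
  have c : ∀ {g : ℝ × ℝ → ℝ}, ContDiff ℝ ∞ g → ∀ x, Continuous fun y => g (x, y) := fun hg x =>
    hg.continuous.comp (by fun_prop)
  have c' : ∀ {g : ℝ × ℝ → ℝ}, ContDiff ℝ ∞ g → ∀ y, Continuous fun x => g (x, y) := fun hg x =>
    hg.continuous.comp (by fun_prop)
  rw [T.sum_edge_integral, integral_add ((contDiff_dx h₁).continuous.integrableOn_rect T)
    ((contDiff_dy h₂).continuous.integrableOn_rect T), integral_rect_dx h₁, integral_rect_dy h₂,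
    intervalIntegral.integral_sub ((c h₁ _).intervalIntegrable _ _) ((c h₁ _).intervalIntegrable _ _),
    intervalIntegral.integral_sub ((c' h₂ _).intervalIntegrable _ _) ((c' h₂ _).intervalIntegrable _ _)]

theorem Rect.green (T : Rect) {v r₁ r₂ : ℝ × ℝ → ℝ} (hv : ContDiff ℝ ∞ v) (h₁ : ContDiff ℝ ∞ r₁)
    (h₂ : ContDiff ℝ ∞ r₂) :
    -(∫ z in T.carrier, v z * (dx r₁ z + dy r₂ z)) + ∑ i, (T.edge i).integral (fun s =>
      v ((T.edge i).pt s) * (r₁ ((T.edge i).pt s) * (normal i).1 + r₂ ((T.edge i).pt s) * (normal i).2)) =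
    ∫ z in T.carrier, (dx v z * r₁ z + dy v z * r₂ z) := by
  have h := T.divergence (hv.mul h₁) (hv.mul h₂)
  have c1 : Continuous fun z => v z * (dx r₁ z + dy r₂ z) :=
    hv.continuous.mul ((contDiff_dx h₁).continuous.add (contDiff_dy h₂).continuous)
  have c2 : Continuous fun z => dx v z * r₁ z + dy v z * r₂ z :=
    ((contDiff_dx hv).continuous.mul h₁.continuous).add ((contDiff_dy hv).continuous.mul h₂.continuous)
  have e : ∫ z in T.carrier, (dx (fun z => v z * r₁ z) z + dy (fun z => v z * r₂ z) z) =
      (∫ z in T.carrier, v z * (dx r₁ z + dy r₂ z)) + ∫ z in T.carrier, (dx v z * r₁ z + dy v z * r₂ z) := by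
    rw [← integral_add (c1.integrableOn_rect T) (c2.integrableOn_rect T)]
    congr 1; ext z
    rw [dx_mul hv.diff' h₁.diff', dy_mul hv.diff' h₂.diff']; ring
  have e2 : ∑ i, (T.edge i).integral (fun s =>
      v ((T.edge i).pt s) * (r₁ ((T.edge i).pt s) * (normal i).1 + r₂ ((T.edge i).pt s) * (normal i).2)) =
      ∑ i, (T.edge i).integral (fun s => (v ((T.edge i).pt s) * r₁ ((T.edge i).pt s)) * (normal i).1 +
      (v ((T.edge i).pt s) * r₂ ((T.edge i).pt s)) * (normal i).2) := by
    refine Finset.sum_congr rfl fun i _ => ?_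
    congr 1; ext s; ring
  change ∫ z in T.carrier, (dx (fun z => v z * r₁ z) z + dy (fun z => v z * r₂ z) z) = _ at h
  rw [e2, ← h, e]; ring

/-! ### The discrete weak gradient -/

theorem IsP1.continuous {m : ℕ} {g : ℝ → ℝ} (h : IsP1 m g) : Continuous g := by
  obtain ⟨c, hc⟩ := h
  rw [funext hc]; fun_prop

theorem IsP1.sub {m : ℕ} {f g : ℝ → ℝ} (hf : IsP1 m f) (hg : IsP1 m g) :
    IsP1 m fun s => f s - g s := by
  obtain ⟨c, hc⟩ := hf
  obtain ⟨d, hd⟩ := hg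
  refine ⟨fun i => c i - d i, fun s => ?_⟩
  simp only [hc, hd]
  rw [← Finset.sum_sub_distrib]
  exact Finset.sum_congr rfl fun i _ => by ring

open Polynomial in
theorem isP1_eval {m : ℕ} {p : ℝ[X]} (h : p.natDegree ≤ m) : IsP1 m fun s => p.eval s :=
  ⟨p.coeff, fun s => p.eval_eq_sum_range' (Nat.lt_succ_of_le h) s⟩

theorem IsQ.eq_zero_of_integral {m : ℕ} {q : ℝ × ℝ → ℝ} (hq : IsQ m m q) {T : Rect}
    (h : ∫ z in T.carrier, q z ^ 2 = 0) : q = 0 := by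
  ext z
  have hw := T.width_pos
  have hh := T.height_pos
  set K := |z.1 - (T.l + T.r) / 2| / (T.width / 2) + |z.2 - (T.b + T.t) / 2| / (T.height / 2)
  obtain ⟨C, -, hC⟩ := exists_inverse_estimate_rect m K
  have hz : z ∈ T.dilate K := by
    constructor
    · rw [← div_le_iff₀ (by positivity)]; exact le_add_of_nonneg_right (by positivity)
    · rw [← div_le_iff₀ (by positivity)]; exact le_add_of_nonneg_left (by positivity)
  have := (hC q hq T z hz).1
  rw [h, mul_zero] at this
  exact pow_eq_zero_iff (two_ne_zero) |>.1 (le_antisymm this (sq_nonneg _))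

theorem finiteDimensional_polySpan {S : Set (ℕ × ℕ)} (hS : S.Finite) :
    FiniteDimensional ℝ (polySpan S) :=
  FiniteDimensional.span_of_finite ℝ (hS.image _)

theorem MemWk.contDiff {k : ℕ} {q : (ℝ × ℝ → ℝ) × (ℝ × ℝ → ℝ)} (h : MemWk k q) :
    ContDiff ℝ ∞ q.1 ∧ ContDiff ℝ ∞ q.2 := ⟨h.1.contDiff, h.2.contDiff⟩

theorem exists_isWeakGrad {M : Finset Rect} {k : ℕ} {v : WeakFunction} (hv : MemVh M k v) {T : Rect}
    (hT : T ∈ M) : ∃ q, IsWeakGrad k T v q := by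
  set S₁ : Set (ℕ × ℕ) := {p | p.1 ≤ k - 1 ∧ p.2 ≤ k}
  set S₂ : Set (ℕ × ℕ) := {p | p.1 ≤ k ∧ p.2 ≤ k - 1}
  have f₁ : FiniteDimensional ℝ (polySpan S₁) := finiteDimensional_polySpan
    (((finite_Iic (k - 1)).prod (finite_Iic k)).subset fun p hp => hp)
  have f₂ : FiniteDimensional ℝ (polySpan S₂) := finiteDimensional_polySpan
    (((finite_Iic k).prod (finite_Iic (k - 1))).subset fun p hp => hp)
  have hW : ∀ r : (polySpan S₁ × polySpan S₂), MemWk k (r.1.1, r.2.1) := fun r => ⟨isQ_iff.2 r.1.2, isQ_iff.2 r.2.2⟩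
  have c₁ : ∀ r : (polySpan S₁ × polySpan S₂), ContDiff ℝ ∞ r.1.1 := fun r => (hW r).1.contDiff
  have c₂ : ∀ r : (polySpan S₁ × polySpan S₂), ContDiff ℝ ∞ r.2.1 := fun r => (hW r).2.contDiff
  have cb : ∀ i, Continuous (v.vb (T.edge i)) := fun i => (hv.2 _ ⟨T, hT, i, rfl⟩).continuous
  have c0 : Continuous (v.v0 T) := (hv.1 T hT).contDiff.continuous
  have ip : ∀ q r : (polySpan S₁ × polySpan S₂), Continuous fun z => q.1.1 z * r.1.1 z + q.2.1 z * r.2.1 z := fun q r =>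
    ((c₁ q).continuous.mul (c₁ r).continuous).add ((c₂ q).continuous.mul (c₂ r).continuous)
  let B : (polySpan S₁ × polySpan S₂) →ₗ[ℝ] (polySpan S₁ × polySpan S₂) →ₗ[ℝ] ℝ := LinearMap.mk₂ ℝ
    (fun q r => ∫ z in T.carrier, (q.1.1 z * r.1.1 z + q.2.1 z * r.2.1 z))
    (fun q q' r => by
      rw [← integral_add ((ip q r).integrableOn_rect T) ((ip q' r).integrableOn_rect T)]
      congr 1; ext z
      simp only [Prod.fst_add, Prod.snd_add, Submodule.coe_add, Pi.add_apply]; ring)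
    (fun c q r => by
      rw [smul_eq_mul, ← integral_const_mul]
      congr 1; ext z
      simp only [Prod.smul_fst, Prod.smul_snd, Submodule.coe_smul, Pi.smul_apply, smul_eq_mul]; ring)
    (fun q r r' => by
      rw [← integral_add ((ip q r).integrableOn_rect T) ((ip q r').integrableOn_rect T)]
      congr 1; ext z
      simp only [Prod.fst_add, Prod.snd_add, Submodule.coe_add, Pi.add_apply]; ring)
    (fun c q r => by
      rw [smul_eq_mul, ← integral_const_mul]
      congr 1; ext z
      simp only [Prod.smul_fst, Prod.smul_snd, Submodule.coe_smul, Pi.smul_apply, smul_eq_mul]; ring)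
  have idiv : ∀ r : (polySpan S₁ × polySpan S₂), Continuous fun z => v.v0 T z * (dx r.1.1 z + dy r.2.1 z) := fun r =>
    c0.mul ((contDiff_dx (c₁ r)).continuous.add (contDiff_dy (c₂ r)).continuous)
  have iedge : ∀ (r : (polySpan S₁ × polySpan S₂)) i, IntervalIntegrable (fun s => v.vb (T.edge i) s *
      (r.1.1 ((T.edge i).pt s) * (normal i).1 + r.2.1 ((T.edge i).pt s) * (normal i).2)) volume 0 1 := by
    intro r i
    refine Continuous.intervalIntegrable ((cb i).mul ((Continuous.mul ?_ continuous_const).add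
      (Continuous.mul ?_ continuous_const))) _ _
    · exact (c₁ r).continuous.comp (T.edge i).continuous_pt
    · exact (c₂ r).continuous.comp (T.edge i).continuous_pt
  let ℓ : (polySpan S₁ × polySpan S₂) →ₗ[ℝ] ℝ :=
    { toFun := fun r => -(∫ z in T.carrier, v.v0 T z * (dx r.1.1 z + dy r.2.1 z)) +
        ∑ i, (T.edge i).integral fun s => v.vb (T.edge i) s *
          (r.1.1 ((T.edge i).pt s) * (normal i).1 + r.2.1 ((T.edge i).pt s) * (normal i).2)
      map_add' := fun r r' => by
        have e1 : ∫ z in T.carrier, v.v0 T z * (dx (r + r').1.1 z + dy (r + r').2.1 z) =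
            (∫ z in T.carrier, v.v0 T z * (dx r.1.1 z + dy r.2.1 z)) +
            ∫ z in T.carrier, v.v0 T z * (dx r'.1.1 z + dy r'.2.1 z) := by
          rw [← integral_add ((idiv r).integrableOn_rect T) ((idiv r').integrableOn_rect T)]
          congr 1; ext z
          simp only [Prod.fst_add, Prod.snd_add, Submodule.coe_add]
          rw [dx_add (c₁ r).diff' (c₁ r').diff', dy_add (c₂ r).diff' (c₂ r').diff']
          simp only [Pi.add_apply]; ring
        rw [e1]
        have e2 : ∀ i, ((T.edge i).integral fun s => v.vb (T.edge i) s *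
            ((r + r').1.1 ((T.edge i).pt s) * (normal i).1 +
              (r + r').2.1 ((T.edge i).pt s) * (normal i).2)) = _ := fun i =>
          (congrArg (T.edge i).integral (by
            ext s; simp only [Prod.fst_add, Prod.snd_add, Submodule.coe_add, Pi.add_apply]; ring)).trans
            ((T.edge i).integral_add (iedge r i) (iedge r' i))
        simp only [e2, Finset.sum_add_distrib]
        ring
      map_smul' := fun c r => by
        have e1 : ∫ z in T.carrier, v.v0 T z * (dx (c • r).1.1 z + dy (c • r).2.1 z) =
            c * ∫ z in T.carrier, v.v0 T z * (dx r.1.1 z + dy r.2.1 z) := by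
          rw [← integral_const_mul]
          congr 1; ext z
          simp only [Prod.smul_fst, Prod.smul_snd, Submodule.coe_smul]
          rw [dx_smul _ (c₁ r).diff', dy_smul _ (c₂ r).diff']
          simp only [Pi.smul_apply, smul_eq_mul]; ring
        have e2 : ∀ i, ((T.edge i).integral fun s => v.vb (T.edge i) s *
            ((c • r).1.1 ((T.edge i).pt s) * (normal i).1 +
              (c • r).2.1 ((T.edge i).pt s) * (normal i).2)) = _ := fun i =>
          (congrArg (T.edge i).integral (by
            ext s
            simp only [Prod.smul_fst, Prod.smul_snd, Submodule.coe_smul, Pi.smul_apply, smul_eq_mul]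
            ring)).trans ((T.edge i).integral_const_mul c fun s => v.vb (T.edge i) s *
              (r.1.1 ((T.edge i).pt s) * (normal i).1 + r.2.1 ((T.edge i).pt s) * (normal i).2))
        simp only [e1, e2, ← Finset.mul_sum, RingHom.id_apply, smul_eq_mul]
        ring }
  have hinj : Function.Injective B := by
    rw [← LinearMap.ker_eq_bot, LinearMap.ker_eq_bot']
    intro q hq
    have h0 : ∫ z in T.carrier, (q.1.1 z * q.1.1 z + q.2.1 z * q.2.1 z) = 0 :=
      LinearMap.congr_fun hq q
    have i1 : Continuous fun z => q.1.1 z * q.1.1 z := (c₁ q).continuous.mul (c₁ q).continuous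
    have i2 : Continuous fun z => q.2.1 z * q.2.1 z := (c₂ q).continuous.mul (c₂ q).continuous
    rw [integral_add (i1.integrableOn_rect T) (i2.integrableOn_rect T)] at h0
    have n1 : 0 ≤ ∫ z in T.carrier, q.1.1 z * q.1.1 z := integral_nonneg fun z => mul_self_nonneg _
    have n2 : 0 ≤ ∫ z in T.carrier, q.2.1 z * q.2.1 z := integral_nonneg fun z => mul_self_nonneg _
    have z1 : q.1.1 = 0 := ((hW q).1.mono (Nat.sub_le k 1) le_rfl).eq_zero_of_integral (T := T) (by
      simp only [sq]; linarith)
    have z2 : q.2.1 = 0 := ((hW q).2.mono le_rfl (Nat.sub_le k 1)).eq_zero_of_integral (T := T) (by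
      simp only [sq]; linarith)
    exact Prod.ext (Subtype.ext z1) (Subtype.ext z2)
  have hsurj : Function.Surjective B :=
    (LinearMap.injective_iff_surjective_of_finrank_eq_finrank
      (Subspace.dual_finrank_eq (K := ℝ) (V := (polySpan S₁ × polySpan S₂))).symm).1 hinj
  obtain ⟨q, hq⟩ := hsurj ℓ
  refine ⟨(q.1.1, q.2.1), hW q, fun r hr => ?_⟩
  exact LinearMap.congr_fun hq (⟨⟨r.1, isQ_iff.1 hr.1⟩, ⟨r.2, isQ_iff.1 hr.2⟩⟩ : (polySpan S₁ × polySpan S₂))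

theorem isWeakGrad_weakGrad {M : Finset Rect} {k : ℕ} {v : WeakFunction} (hv : MemVh M k v) {T : Rect}
    (hT : T ∈ M) : IsWeakGrad k T v (weakGrad k T v) := by
  have h := exists_isWeakGrad hv hT
  unfold weakGrad; rw [dif_pos h]; exact h.choose_spec

end WG

namespace WG

/-! ### The error equation of the weak Galerkin method -/

/-- The difference of two weak functions. -/
def WeakFunction.sub (v w : WeakFunction) : WeakFunction :=
  ⟨fun T => v.v0 T - w.v0 T, fun e s => v.vb e s - w.vb e s⟩

variable {Ω : Set (ℝ × ℝ)} {M : Finset Rect} {k : ℕ} {ζ : Fin (k + 1) → ℝ}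

theorem MemVh.sub {v w : WeakFunction} (hv : MemVh M k v) (hw : MemVh M k w) : MemVh M k (v.sub w) :=
  ⟨fun T hT => (hv.1 T hT).sub (hw.1 T hT), fun e he => (hv.2 e he).sub (hw.2 e he)⟩

theorem MemVh0.sub {v w : WeakFunction} (hv : MemVh0 Ω M k v) (hw : MemVh0 Ω M k w) :
    MemVh0 Ω M k (v.sub w) :=
  ⟨hv.1.sub hw.1, fun e he hf s hs => by
    simp only [WeakFunction.sub]; rw [hv.2 e he hf s hs, hw.2 e he hf s hs, sub_self]⟩

/-- The interpolant of `U` as a weak function. -/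
noncomputable def interpolant (ζ : Fin (k + 1) → ℝ) (U : ℝ × ℝ → ℝ) : WeakFunction :=
  ⟨fun T => interp ζ T U, fun e s => ∑ j, U (e.pt ((1 + ζ j) / 2)) * (lagr ζ j).eval (2 * s - 1)⟩

theorem interpolant_edge (hk : 1 ≤ k) (hζ : IsLobattoPoints k ζ) (U : ℝ × ℝ → ℝ) (T : Rect) (i : Fin 4)
    (s : ℝ) : (interpolant ζ U).v0 T ((T.edge i).pt s) = (interpolant ζ U).vb (T.edge i) s :=
  interp_edge hk hζ T U i s

theorem memVh_interpolant (hζ : IsLobattoPoints k ζ) (U : ℝ × ℝ → ℝ) :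
    MemVh M k (interpolant ζ U) := by
  refine ⟨fun T _ => isQ_interp hζ T U, fun e _ => ?_⟩
  have := isP1_eval (m := k) (p := ∑ j, Polynomial.C (U (e.pt ((1 + ζ j) / 2))) *
    (lagr ζ j).comp (Polynomial.C 2 * Polynomial.X + Polynomial.C (-1))) (by
      refine Polynomial.natDegree_sum_le_of_forall_le _ _ fun j _ => ?_
      refine (Polynomial.natDegree_C_mul_le _ _).trans (Polynomial.natDegree_comp_le.trans ?_)
      exact (Nat.mul_le_mul (natDegree_lagr hζ j) Polynomial.natDegree_linear_le).trans (by simp))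
  convert this using 1
  ext s
  rw [Polynomial.eval_finsetSum]
  simp [interpolant, sub_eq_add_neg]

theorem memVh0_interpolant (hk : 1 ≤ k) (hζ : IsLobattoPoints k ζ) {U : ℝ × ℝ → ℝ}
    (hU : ∀ T ∈ M, ∀ i, (T.edge i).carrier ⊆ frontier Ω → ∀ z ∈ (T.edge i).carrier, U z = 0) :
    MemVh0 Ω M k (interpolant ζ U) := by
  refine ⟨memVh_interpolant hζ U, fun e he hf s hs => ?_⟩
  obtain ⟨T, hT, i, rfl⟩ := he
  simp only [interpolant]
  refine Finset.sum_eq_zero fun j _ => ?_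
  have h := hζ.mem_Icc hk j
  rw [hU T hT i hf _ ⟨(1 + ζ j) / 2, ⟨by linarith [h.1], by linarith [h.2]⟩, rfl⟩, zero_mul]

/-- The jump term of a weak function on an element. -/
noncomputable def edgeSq (T : Rect) (v : WeakFunction) : ℝ :=
  ∑ i, (T.edge i).integral fun s => (v.v0 T ((T.edge i).pt s) - v.vb (T.edge i) s) ^ 2

theorem MemVh.continuous_jump {v : WeakFunction} (hv : MemVh M k v) {T : Rect} (hT : T ∈ M) (i : Fin 4) :
    Continuous fun s => v.v0 T ((T.edge i).pt s) - v.vb (T.edge i) s :=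
  ((hv.1 T hT).contDiff.continuous.comp (T.edge i).continuous_pt).sub
    (hv.2 _ ⟨T, hT, i, rfl⟩).continuous

theorem MemWk.continuous_flux {r : (ℝ × ℝ → ℝ) × (ℝ × ℝ → ℝ)} (hr : MemWk k r) (T : Rect) (i : Fin 4) :
    Continuous fun s => r.1 ((T.edge i).pt s) * (normal i).1 + r.2 ((T.edge i).pt s) * (normal i).2 :=
  ((hr.1.contDiff.continuous.comp (T.edge i).continuous_pt).mul continuous_const).add
    ((hr.2.contDiff.continuous.comp (T.edge i).continuous_pt).mul continuous_const)

theorem integral_weakGrad_mul {v : WeakFunction} (hv : MemVh M k v) {T : Rect} (hT : T ∈ M)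
    {r : (ℝ × ℝ → ℝ) × (ℝ × ℝ → ℝ)} (hr : MemWk k r) :
    ∫ z in T.carrier, ((weakGrad k T v).1 z * r.1 z + (weakGrad k T v).2 z * r.2 z) =
      (∫ z in T.carrier, (dx (v.v0 T) z * r.1 z + dy (v.v0 T) z * r.2 z)) -
      ∑ i, (T.edge i).integral fun s => (v.v0 T ((T.edge i).pt s) - v.vb (T.edge i) s) *
        (r.1 ((T.edge i).pt s) * (normal i).1 + r.2 ((T.edge i).pt s) * (normal i).2) := by
  rw [(isWeakGrad_weakGrad hv hT).2 r hr, ← T.green (hv.1 T hT).contDiff hr.1.contDiff hr.2.contDiff,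
    add_sub_assoc, ← Finset.sum_sub_distrib]
  congr 1
  refine Finset.sum_congr rfl fun i _ => ?_
  have c1 := hr.continuous_flux T i
  have c2 := (hv.1 T hT).contDiff.continuous.comp (T.edge i).continuous_pt
  have j1 : IntervalIntegrable (fun s => v.v0 T ((T.edge i).pt s) *
      (r.1 ((T.edge i).pt s) * (normal i).1 + r.2 ((T.edge i).pt s) * (normal i).2)) volume 0 1 :=
    (c2.mul c1).intervalIntegrable _ _
  have j2 : IntervalIntegrable (fun s => (v.v0 T ((T.edge i).pt s) - v.vb (T.edge i) s) *
      (r.1 ((T.edge i).pt s) * (normal i).1 + r.2 ((T.edge i).pt s) * (normal i).2)) volume 0 1 :=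
    ((hv.continuous_jump hT i).mul c1).intervalIntegrable _ _
  rw [← (T.edge i).integral_sub j1 j2]
  congr 1; ext s; ring

theorem memWk_grad {q : ℝ × ℝ → ℝ} (hq : IsQ k k q) : MemWk k (dx q, dy q) := ⟨hq.dx, hq.dy⟩

/-- The flux of a function across the interior edges cancels. -/
theorem IsMesh.sum_flux_eq_zero (hM : IsMesh Ω M) (hΩ : IsRectangularDomain Ω) {v : WeakFunction}
    (hv : MemVh0 Ω M k v) (V₁ V₂ : ℝ × ℝ → ℝ) :
    ∑ T ∈ M, ∑ i, (T.edge i).integral (fun s => (V₁ ((T.edge i).pt s) * (normal i).1 +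
      V₂ ((T.edge i).pt s) * (normal i).2) * v.vb (T.edge i) s) = 0 := by
  classical
  rw [← Finset.sum_product']
  have hn : ∀ p : Rect × Fin 4, ∃ T' : Rect, p.1 ∈ M → ¬ (p.1.edge p.2).carrier ⊆ frontier Ω →
      T' ∈ M ∧ p.1.edge p.2 = T'.edge (p.2 + 2) := by
    intro p
    by_cases h : p.1 ∈ M ∧ ¬ (p.1.edge p.2).carrier ⊆ frontier Ω
    · obtain ⟨T', h1, -, h2⟩ := hM.exists_neighbor hΩ h.1 h.2
      exact ⟨T', fun _ _ => ⟨h1, h2⟩⟩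
    · exact ⟨p.1, fun h1 h2 => absurd ⟨h1, h2⟩ h⟩
  choose N hN using hn
  let g : Rect × Fin 4 → Rect × Fin 4 := fun p =>
    if (p.1.edge p.2).carrier ⊆ frontier Ω then p else (N p, p.2 + 2)
  have hb : ∀ p : Rect × Fin 4, p.1 ∈ M → (p.1.edge p.2).carrier ⊆ frontier Ω →
      (p.1.edge p.2).integral (fun s => (V₁ ((p.1.edge p.2).pt s) * (normal p.2).1 +
      V₂ ((p.1.edge p.2).pt s) * (normal p.2).2) * v.vb (p.1.edge p.2) s) = 0 := by
    intro p hp hf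
    rw [Edge.integral_congr (g := fun _ => 0) _ fun s hs => by
      rw [hv.2 _ ⟨p.1, hp, p.2, rfl⟩ hf s hs, mul_zero]]
    simp [Edge.integral]
  have hnormal : ∀ i : Fin 4, normal (i + 2) = -normal i := by
    intro i; fin_cases i <;> simp [normal]
  have hmem : ∀ p ∈ M ×ˢ (Finset.univ : Finset (Fin 4)), g p ∈ M ×ˢ (Finset.univ : Finset (Fin 4)) := by
    intro p hp
    have hp1 := (Finset.mem_product.1 hp).1
    by_cases h : (p.1.edge p.2).carrier ⊆ frontier Ω
    · simp only [g, if_pos h]; exact hp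
    · simp only [g, if_neg h]
      exact Finset.mem_product.2 ⟨(hN p hp1 h).1, Finset.mem_univ _⟩
  refine Finset.sum_involution (fun p _ => g p) ?_ ?_ hmem ?_
  · intro p hp
    have hp1 := (Finset.mem_product.1 hp).1
    by_cases h : (p.1.edge p.2).carrier ⊆ frontier Ω
    · simp only [g, if_pos h]; rw [hb p hp1 h, add_zero]
    · simp only [g, if_neg h]
      rw [← (hN p hp1 h).2, hnormal]
      have : ∀ s, (V₁ ((p.1.edge p.2).pt s) * (-normal p.2).1 + V₂ ((p.1.edge p.2).pt s) *
          (-normal p.2).2) * v.vb (p.1.edge p.2) s = (-1) * ((V₁ ((p.1.edge p.2).pt s) * (normal p.2).1 +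
          V₂ ((p.1.edge p.2).pt s) * (normal p.2).2) * v.vb (p.1.edge p.2) s) := fun s => by
        simp only [Prod.fst_neg, Prod.snd_neg]; ring
      simp only [this]
      rw [Edge.integral_const_mul]; ring
  · intro p hp hne
    have hp1 := (Finset.mem_product.1 hp).1
    by_cases h : (p.1.edge p.2).carrier ⊆ frontier Ω
    · exact absurd (hb p hp1 h) hne
    · simp only [g, if_neg h]
      intro he
      have h2 := congrArg Prod.snd he
      simp only at h2
      revert h2; generalize p.2 = i; revert i; decide
  · intro p hp
    have hp1 := (Finset.mem_product.1 hp).1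
    by_cases h : (p.1.edge p.2).carrier ⊆ frontier Ω
    · simp only [g, if_pos h]
    · have h1 := hN p hp1 h
      have h2 : ¬ ((N p).edge (p.2 + 2)).carrier ⊆ frontier Ω := by rw [← h1.2]; exact h
      simp only [g, if_neg h, if_neg h2]
      have h3 := hN (N p, p.2 + 2) h1.1 h2
      have h4 : p.2 + 2 + 2 = p.2 := by generalize p.2 = i; revert i; decide
      simp only [h4] at h3 ⊢
      rw [← h1.2] at h3
      rw [hM.eq_of_edge_eq h3.1 hp1 h3.2.symm]

/-- Green's formula for a function in `H²(T)`. -/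
theorem integral_mul_eq_of_isRep (hk : 1 ≤ k) {T : Rect} {F : ℕ → ℕ → ℝ × ℝ → ℝ}
    (hF : SobolevOn T (k + 2) F) {U V₁ V₂ : ℝ × ℝ → ℝ} (hr : IsRep T F U V₁ V₂) {f v : ℝ × ℝ → ℝ}
    (hf : f =ᵐ[volume.restrict T.carrier] fun z => -(F 2 0 z + F 0 2 z)) (hv : ContDiff ℝ ∞ v) :
    ∫ z in T.carrier, f z * v z =
      (∫ z in T.carrier, (F 1 0 z * dx v z + F 0 1 z * dy v z)) -
      ∑ i, (T.edge i).integral fun s => (V₁ ((T.edge i).pt s) * (normal i).1 +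
        V₂ ((T.edge i).pt s) * (normal i).2) * v ((T.edge i).pt s) := by
  have h1 := (hF.shift (n := k + 1) (c := 1) (d := 0) (by lia)).integral_fst (by lia) hr.cont₁
    (by simpa using hr.ae₁) hv
  have h2 := (hF.shift (n := k + 1) (c := 0) (d := 1) (by lia)).integral_snd (by lia) hr.cont₂
    (by simpa using hr.ae₂) hv
  simp only [zero_add, add_zero, Nat.reduceAdd] at h1 h2
  have mv : MemLp v 2 (volume.restrict T.carrier) := hv.continuous.memLp_restrict
  have mvx : MemLp (dx v) 2 (volume.restrict T.carrier) := (contDiff_dx hv).continuous.memLp_restrict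
  have mvy : MemLp (dy v) 2 (volume.restrict T.carrier) := (contDiff_dy hv).continuous.memLp_restrict
  have i1 : Integrable (fun z => F 2 0 z * v z) (volume.restrict T.carrier) :=
    (hF.1 2 0 (by lia)).integrable_mul mv
  have i2 : Integrable (fun z => F 0 2 z * v z) (volume.restrict T.carrier) :=
    (hF.1 0 2 (by lia)).integrable_mul mv
  have i3 : Integrable (fun z => F 1 0 z * dx v z) (volume.restrict T.carrier) :=
    (hF.1 1 0 (by lia)).integrable_mul mvx
  have i4 : Integrable (fun z => F 0 1 z * dy v z) (volume.restrict T.carrier) :=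
    (hF.1 0 1 (by lia)).integrable_mul mvy
  have e1 : ∫ z in T.carrier, f z * v z = -((∫ z in T.carrier, F 2 0 z * v z) +
      ∫ z in T.carrier, F 0 2 z * v z) := by
    rw [← integral_add i1 i2, ← integral_neg]
    refine integral_congr_ae ?_
    filter_upwards [hf] with z hz
    rw [hz]; ring
  have e2 : ∑ i, ((T.edge i).integral fun s => (V₁ ((T.edge i).pt s) * (normal i).1 +
        V₂ ((T.edge i).pt s) * (normal i).2) * v ((T.edge i).pt s)) =
      ∑ i, (T.edge i).integral fun s => (V₁ ((T.edge i).pt s) * v ((T.edge i).pt s)) * (normal i).1 +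
        (V₂ ((T.edge i).pt s) * v ((T.edge i).pt s)) * (normal i).2 :=
    Finset.sum_congr rfl fun i _ => congrArg _ (by ext s; ring)
  rw [e1, e2, integral_add i3 i4,
    T.sum_edge_integral (fun z => V₁ z * v z) (fun z => V₂ z * v z)]
  linarith

theorem IsRep.intervalIntegrable_flux {T : Rect} {F : ℕ → ℕ → ℝ × ℝ → ℝ} {U V₁ V₂ : ℝ × ℝ → ℝ}
    (hr : IsRep T F U V₁ V₂) (i : Fin 4) {g : ℝ → ℝ} (hg : Continuous g) :
    IntervalIntegrable (fun s => (V₁ ((T.edge i).pt s) * (normal i).1 +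
        V₂ ((T.edge i).pt s) * (normal i).2) * g s) volume 0 1 := by
  apply ContinuousOn.intervalIntegrable
  rw [uIcc_of_le zero_le_one]
  have hm : MapsTo (T.edge i).pt (Icc 0 1) T.carrier := fun s hs => T.edge_pt_mem i hs
  exact (((hr.cont₁.comp (T.edge i).continuous_pt.continuousOn hm).mul continuousOn_const).add
    ((hr.cont₂.comp (T.edge i).continuous_pt.continuousOn hm).mul continuousOn_const)).mul hg.continuousOn

theorem IsWGSolution.error_eq (hk : 1 ≤ k) (hζ : IsLobattoPoints k ζ) (hΩ : IsRectangularDomain Ω)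
    (hM : IsMesh Ω M) {F : ℕ → ℕ → ℝ × ℝ → ℝ} (hF : ∀ T ∈ M, SobolevOn T (k + 2) F)
    {U V₁ V₂ : ℝ × ℝ → ℝ} (hr : ∀ T ∈ M, IsRep T F U V₁ V₂)
    (hU : ∀ T ∈ M, ∀ i, (T.edge i).carrier ⊆ frontier Ω → ∀ z ∈ (T.edge i).carrier, U z = 0)
    {f : ℝ × ℝ → ℝ} (hf : ∀ T ∈ M, f =ᵐ[volume.restrict T.carrier] fun z => -(F 2 0 z + F 0 2 z))
    {α : ℝ} {uh : WeakFunction} (hu : IsWGSolution Ω M k α f uh) {e : WeakFunction}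
    (he : e = uh.sub (interpolant ζ U)) :
    ∑ T ∈ M, ((∫ z in T.carrier, ((weakGrad k T e).1 z ^ 2 + (weakGrad k T e).2 z ^ 2)) +
        meshSize M ^ (-α) * edgeSq T e) =
      ∑ T ∈ M, ((∫ z in T.carrier, ((F 1 0 z - dx (interp ζ T U) z) * dx (e.v0 T) z +
          (F 0 1 z - dy (interp ζ T U) z) * dy (e.v0 T) z)) -
        ∑ i, (T.edge i).integral fun s =>
          ((V₁ ((T.edge i).pt s) - dx (interp ζ T U) ((T.edge i).pt s)) * (normal i).1 +
          (V₂ ((T.edge i).pt s) - dy (interp ζ T U) ((T.edge i).pt s)) * (normal i).2) *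
          (e.v0 T ((T.edge i).pt s) - e.vb (T.edge i) s)) := by
  have hI := memVh0_interpolant hk hζ hU
  have he0 : MemVh0 Ω M k e := he ▸ hu.1.sub hI
  have hjump : ∀ T i s, uh.v0 T ((T.edge i).pt s) - uh.vb (T.edge i) s =
      e.v0 T ((T.edge i).pt s) - e.vb (T.edge i) s := by
    intro T i s
    have := interpolant_edge hk hζ U T i s
    rw [he]; simp only [WeakFunction.sub, Pi.sub_apply]; linarith
  have sol := hu.2 e he0
  have hflux := hM.sum_flux_eq_zero hΩ he0 V₁ V₂
  unfold wgForm stabilizer at sol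
  rw [← Finset.sum_add_distrib] at sol
  have loc : ∀ T ∈ M, ((∫ z in T.carrier, ((weakGrad k T e).1 z ^ 2 + (weakGrad k T e).2 z ^ 2)) +
        meshSize M ^ (-α) * edgeSq T e) =
      ((∫ z in T.carrier, ((F 1 0 z - dx (interp ζ T U) z) * dx (e.v0 T) z +
          (F 0 1 z - dy (interp ζ T U) z) * dy (e.v0 T) z)) -
        ∑ i, (T.edge i).integral fun s =>
          ((V₁ ((T.edge i).pt s) - dx (interp ζ T U) ((T.edge i).pt s)) * (normal i).1 +
          (V₂ ((T.edge i).pt s) - dy (interp ζ T U) ((T.edge i).pt s)) * (normal i).2) *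
          (e.v0 T ((T.edge i).pt s) - e.vb (T.edge i) s)) +
      (((∫ z in T.carrier, ((weakGrad k T uh).1 z * (weakGrad k T e).1 z +
        (weakGrad k T uh).2 z * (weakGrad k T e).2 z)) +
        meshSize M ^ (-α) * ∑ i, (T.edge i).integral fun s =>
        (uh.v0 T ((T.edge i).pt s) - uh.vb (T.edge i) s) *
        (e.v0 T ((T.edge i).pt s) - e.vb (T.edge i) s)) - ∫ z in T.carrier, f z * e.v0 T z) -
      ∑ i, (T.edge i).integral (fun s => (V₁ ((T.edge i).pt s) * (normal i).1 +
        V₂ ((T.edge i).pt s) * (normal i).2) * e.vb (T.edge i) s) := by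
    intro T hT
    have qe := he0.1.1 T hT
    have qu := hu.1.1.1 T hT
    have qI := isQ_interp hζ T U
    have hge := (isWeakGrad_weakGrad he0.1 hT).1
    have a1 := integral_weakGrad_mul hu.1.1 hT hge
    have a2 := integral_weakGrad_mul he0.1 hT hge
    have a3 := integral_weakGrad_mul he0.1 hT (memWk_grad qI)
    have a4 := integral_mul_eq_of_isRep hk (hF T hT) (hr T hT) (hf T hT) qe.contDiff
    have e1 : ∫ z in T.carrier, ((weakGrad k T e).1 z ^ 2 + (weakGrad k T e).2 z ^ 2) =
        ∫ z in T.carrier, ((weakGrad k T e).1 z * (weakGrad k T e).1 z +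
          (weakGrad k T e).2 z * (weakGrad k T e).2 z) := by congr 1; ext z; ring
    have e2 : (meshSize M ^ (-α) * ∑ i, (T.edge i).integral fun s =>
        (uh.v0 T ((T.edge i).pt s) - uh.vb (T.edge i) s) *
        (e.v0 T ((T.edge i).pt s) - e.vb (T.edge i) s)) = meshSize M ^ (-α) * edgeSq T e := by
      simp only [hjump, edgeSq, sq]
    have cge := hge.contDiff
    have e3 : ∫ z in T.carrier, (dx (uh.v0 T) z * (weakGrad k T e).1 z +
          dy (uh.v0 T) z * (weakGrad k T e).2 z) =
        (∫ z in T.carrier, (dx (e.v0 T) z * (weakGrad k T e).1 z + dy (e.v0 T) z * (weakGrad k T e).2 z)) +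
        ∫ z in T.carrier, ((weakGrad k T e).1 z * dx (interp ζ T U) z +
          (weakGrad k T e).2 z * dy (interp ζ T U) z) := by
      have c1 : Continuous fun z => dx (e.v0 T) z * (weakGrad k T e).1 z + dy (e.v0 T) z * (weakGrad k T e).2 z :=
        ((contDiff_dx qe.contDiff).continuous.mul cge.1.continuous).add
          ((contDiff_dy qe.contDiff).continuous.mul cge.2.continuous)
      have c2 : Continuous fun z => (weakGrad k T e).1 z * dx (interp ζ T U) z +
          (weakGrad k T e).2 z * dy (interp ζ T U) z :=
        (cge.1.continuous.mul (contDiff_dx qI.contDiff).continuous).add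
          (cge.2.continuous.mul (contDiff_dy qI.contDiff).continuous)
      rw [← integral_add (c1.integrableOn_rect T) (c2.integrableOn_rect T)]
      congr 1; ext z
      have d1 : dx (e.v0 T) = dx (uh.v0 T) - dx (interp ζ T U) := by
        rw [he]; exact dx_sub qu.contDiff.diff' qI.contDiff.diff'
      have d2 : dy (e.v0 T) = dy (uh.v0 T) - dy (interp ζ T U) := by
        rw [he]; exact dy_sub qu.contDiff.diff' qI.contDiff.diff'
      rw [d1, d2]; simp only [Pi.sub_apply]; ring
    have mx : MemLp (dx (e.v0 T)) 2 (volume.restrict T.carrier) :=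
      (contDiff_dx qe.contDiff).continuous.memLp_restrict
    have my : MemLp (dy (e.v0 T)) 2 (volume.restrict T.carrier) :=
      (contDiff_dy qe.contDiff).continuous.memLp_restrict
    have i3 : Integrable (fun z => F 1 0 z * dx (e.v0 T) z) (volume.restrict T.carrier) :=
      ((hF T hT).1 1 0 (by lia)).integrable_mul mx
    have i4 : Integrable (fun z => F 0 1 z * dy (e.v0 T) z) (volume.restrict T.carrier) :=
      ((hF T hT).1 0 1 (by lia)).integrable_mul my
    have i5 : Integrable (fun z => F 1 0 z * dx (e.v0 T) z + F 0 1 z * dy (e.v0 T) z)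
      (volume.restrict T.carrier) := i3.add i4
    have c5 : Continuous fun z => dx (e.v0 T) z * dx (interp ζ T U) z +
        dy (e.v0 T) z * dy (interp ζ T U) z :=
      ((contDiff_dx qe.contDiff).continuous.mul (contDiff_dx qI.contDiff).continuous).add
        ((contDiff_dy qe.contDiff).continuous.mul (contDiff_dy qI.contDiff).continuous)
    have e4 : ∫ z in T.carrier, ((F 1 0 z - dx (interp ζ T U) z) * dx (e.v0 T) z +
          (F 0 1 z - dy (interp ζ T U) z) * dy (e.v0 T) z) =
        (∫ z in T.carrier, (F 1 0 z * dx (e.v0 T) z + F 0 1 z * dy (e.v0 T) z)) -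
        ∫ z in T.carrier, (dx (e.v0 T) z * dx (interp ζ T U) z +
          dy (e.v0 T) z * dy (interp ζ T U) z) := by
      rw [← MeasureTheory.integral_sub i5 (c5.integrableOn_rect T)]
      congr 1; ext z; ring
    have e5 : ∑ i, ((T.edge i).integral fun s =>
          ((V₁ ((T.edge i).pt s) - dx (interp ζ T U) ((T.edge i).pt s)) * (normal i).1 +
          (V₂ ((T.edge i).pt s) - dy (interp ζ T U) ((T.edge i).pt s)) * (normal i).2) *
          (e.v0 T ((T.edge i).pt s) - e.vb (T.edge i) s)) =
        (∑ i, (T.edge i).integral fun s => (V₁ ((T.edge i).pt s) * (normal i).1 +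
          V₂ ((T.edge i).pt s) * (normal i).2) * e.v0 T ((T.edge i).pt s)) -
        (∑ i, (T.edge i).integral fun s => (V₁ ((T.edge i).pt s) * (normal i).1 +
          V₂ ((T.edge i).pt s) * (normal i).2) * e.vb (T.edge i) s) -
        ∑ i, (T.edge i).integral fun s => (e.v0 T ((T.edge i).pt s) - e.vb (T.edge i) s) *
          (dx (interp ζ T U) ((T.edge i).pt s) * (normal i).1 +
          dy (interp ζ T U) ((T.edge i).pt s) * (normal i).2) := by
      rw [← Finset.sum_sub_distrib, ← Finset.sum_sub_distrib]
      refine Finset.sum_congr rfl fun i _ => ?_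
      have j1 : IntervalIntegrable (fun s => (V₁ ((T.edge i).pt s) * (normal i).1 +
          V₂ ((T.edge i).pt s) * (normal i).2) * e.v0 T ((T.edge i).pt s)) volume 0 1 :=
        (hr T hT).intervalIntegrable_flux i
          (qe.contDiff.continuous.comp (T.edge i).continuous_pt)
      have j2 := (hr T hT).intervalIntegrable_flux i (he0.1.2 _ ⟨T, hT, i, rfl⟩).continuous
      have j3 : IntervalIntegrable (fun s => (e.v0 T ((T.edge i).pt s) - e.vb (T.edge i) s) *
          (dx (interp ζ T U) ((T.edge i).pt s) * (normal i).1 +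
          dy (interp ζ T U) ((T.edge i).pt s) * (normal i).2)) volume 0 1 :=
        ((he0.1.continuous_jump hT i).mul ((memWk_grad qI).continuous_flux T i)).intervalIntegrable _ _
      have j12 : IntervalIntegrable (fun s => (V₁ ((T.edge i).pt s) * (normal i).1 +
          V₂ ((T.edge i).pt s) * (normal i).2) * e.v0 T ((T.edge i).pt s) -
          (V₁ ((T.edge i).pt s) * (normal i).1 +
          V₂ ((T.edge i).pt s) * (normal i).2) * e.vb (T.edge i) s) volume 0 1 := j1.sub j2
      rw [← Edge.integral_sub _ j1 j2, ← Edge.integral_sub _ j12 j3]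
      congr 1; ext s; ring
    simp only [hjump] at a1
    rw [e1, e2, e4, e5, a1, a4, e3, a3]
    rw [a2]
    ring
  rw [Finset.sum_congr rfl loc, Finset.sum_sub_distrib, hflux, sub_zero, Finset.sum_add_distrib,
    Finset.sum_sub_distrib, Finset.sum_sub_distrib, sol]
  ring

end WG

namespace WG

/-! ### Energy estimate for the weak Galerkin method -/

/-- The sides of `T` are comparable to `h`. -/
structure Rect.HasSize (T : Rect) (κ h : ℝ) : Prop where
  pos : 0 < h
  width_le : T.width ≤ h
  height_le : T.height ≤ h
  le_width : h ≤ κ * T.width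
  le_height : h ≤ κ * T.height

theorem Rect.HasSize.area_le {T : Rect} {κ h : ℝ} (hs : T.HasSize κ h) : T.width * T.height ≤ h ^ 2 := by
  have := T.width_pos
  have := T.height_pos
  have h1 := hs.width_le
  have h2 := hs.height_le
  calc _ ≤ h * h := mul_le_mul h1 h2 (by positivity) hs.pos.le
    _ = _ := by ring

theorem Rect.HasSize.le_area {T : Rect} {κ h : ℝ} (hs : T.HasSize κ h) :
    h ^ 2 ≤ κ ^ 2 * (T.width * T.height) := by
  have h1 := hs.le_width
  have h2 := hs.le_height
  have h3 := hs.pos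
  calc h ^ 2 = h * h := by ring
    _ ≤ (κ * T.width) * (κ * T.height) := by gcongr; linarith
    _ = _ := by ring

/-- The integral of the squared gradient. -/
noncomputable def gradSq (T : Rect) (v : ℝ × ℝ → ℝ) : ℝ := ∫ z in T.carrier, (dx v z ^ 2 + dy v z ^ 2)

theorem gradSq_nonneg (T : Rect) (v : ℝ × ℝ → ℝ) : 0 ≤ gradSq T v :=
  integral_nonneg fun _ => by positivity

theorem gradSq_eq (T : Rect) {v : ℝ × ℝ → ℝ} (hv : ContDiff ℝ ∞ v) :
    gradSq T v = (∫ z in T.carrier, dx v z ^ 2) + ∫ z in T.carrier, dy v z ^ 2 :=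
  integral_add (((contDiff_dx hv).continuous.pow 2).integrableOn_rect T)
    (((contDiff_dy hv).continuous.pow 2).integrableOn_rect T)

theorem edgeSq_nonneg (T : Rect) (v : WeakFunction) : 0 ≤ edgeSq T v :=
  Finset.sum_nonneg fun i _ => (T.edge i).integral_nonneg fun _ => sq_nonneg _

theorem flux_sq_le (a b : ℝ) (i : Fin 4) : (a * (normal i).1 + b * (normal i).2) ^ 2 ≤ a ^ 2 + b ^ 2 := by
  fin_cases i <;> simp [normal] <;> positivity

theorem exists_grad_sq_le (m : ℕ) {κ : ℝ} (hκ : 1 ≤ κ) : ∃ C : ℝ, 0 < C ∧ ∀ q, IsQ m m q →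
    ∀ (T : Rect) (h : ℝ), T.HasSize κ h → ∀ z ∈ T.carrier,
      dx q z ^ 2 + dy q z ^ 2 ≤ C / h ^ 2 * gradSq T q := by
  obtain ⟨C, hC, hinv⟩ := exists_inverse_estimate_rect m 1
  refine ⟨C * κ ^ 2, by positivity, fun q hq T h hs z hz => ?_⟩
  have hh := hs.pos
  have hw := T.width_pos
  have hht := T.height_pos
  have hg0 := gradSq_nonneg T q
  have k1 := (hinv _ (hq.dx.mono (Nat.sub_le m 1) le_rfl) T z (T.carrier_subset_dilate le_rfl hz)).1
  have k2 := (hinv _ (hq.dy.mono le_rfl (Nat.sub_le m 1)) T z (T.carrier_subset_dilate le_rfl hz)).1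
  have k3 : C / (T.width * T.height) ≤ C * κ ^ 2 / h ^ 2 := by
    rw [div_le_div_iff₀ (by positivity) (by positivity)]
    have := hs.le_area
    calc C * h ^ 2 ≤ C * (κ ^ 2 * (T.width * T.height)) := by gcongr
      _ = _ := by ring
  calc _ ≤ C / (T.width * T.height) * gradSq T q := by
          rw [gradSq_eq T hq.contDiff, mul_add]; exact add_le_add k1 k2
    _ ≤ _ := by gcongr

/-- The weak gradient and the jumps control the gradient. -/
theorem exists_gradSq_le (k : ℕ) {κ : ℝ} (hκ : 1 ≤ κ) : ∃ C : ℝ, 0 < C ∧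
    ∀ (M : Finset Rect) (v : WeakFunction), MemVh M k v → ∀ T ∈ M, ∀ h, T.HasSize κ h →
      gradSq T (v.v0 T) ≤ 2 * (∫ z in T.carrier, ((weakGrad k T v).1 z ^ 2 + (weakGrad k T v).2 z ^ 2)) +
        C / h * edgeSq T v := by
  obtain ⟨C, hC, hgrad⟩ := exists_grad_sq_le k hκ
  refine ⟨32 * C, by positivity, fun M v hv T hT h hs => ?_⟩
  have hh := hs.pos
  have qv := hv.1 T hT
  set g := gradSq T (v.v0 T) with hg
  have hg0 : 0 ≤ g := gradSq_nonneg _ _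
  have a1 := integral_weakGrad_mul hv hT (memWk_grad qv)
  have cg := (isWeakGrad_weakGrad hv hT).1.contDiff
  have cx := (contDiff_dx qv.contDiff).continuous
  have cy := (contDiff_dy qv.contDiff).continuous
  have e1 : ∫ z in T.carrier, (dx (v.v0 T) z * dx (v.v0 T) z + dy (v.v0 T) z * dy (v.v0 T) z) = g := by
    rw [hg, gradSq]; congr 1; ext z; ring
  rw [e1] at a1
  have c1 : Continuous fun z => (weakGrad k T v).1 z ^ 2 + (weakGrad k T v).2 z ^ 2 :=
    (cg.1.continuous.pow 2).add (cg.2.continuous.pow 2)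
  have c2 : Continuous fun z => dx (v.v0 T) z ^ 2 + dy (v.v0 T) z ^ 2 := (cx.pow 2).add (cy.pow 2)
  have c3 : Continuous fun z => (weakGrad k T v).1 z * dx (v.v0 T) z + (weakGrad k T v).2 z * dy (v.v0 T) z :=
    (cg.1.continuous.mul cx).add (cg.2.continuous.mul cy)
  have a2 : ∫ z in T.carrier, ((weakGrad k T v).1 z * dx (v.v0 T) z + (weakGrad k T v).2 z * dy (v.v0 T) z) ≤
      (∫ z in T.carrier, ((weakGrad k T v).1 z ^ 2 + (weakGrad k T v).2 z ^ 2)) + 1 / 4 * g := by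
    rw [hg, gradSq, ← integral_const_mul, ← integral_add (c1.integrableOn_rect T)
      ((c2.integrableOn_rect T).const_mul _)]
    refine integral_mono (c3.integrableOn_rect T) ((c1.integrableOn_rect T).add
      ((c2.integrableOn_rect T).const_mul _)) fun z => ?_
    simp only
    nlinarith [sq_nonneg ((weakGrad k T v).1 z - dx (v.v0 T) z / 2),
      sq_nonneg ((weakGrad k T v).2 z - dy (v.v0 T) z / 2)]
  have hB := hgrad _ qv T h hs
  have l0 : 0 < h / (16 * C) := by positivity
  have a3 : ∑ i, (T.edge i).integral (fun s => (v.v0 T ((T.edge i).pt s) - v.vb (T.edge i) s) *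
        (dx (v.v0 T) ((T.edge i).pt s) * (normal i).1 + dy (v.v0 T) ((T.edge i).pt s) * (normal i).2)) ≤
      ∑ i : Fin 4, (1 / 16 * g + (16 * C / h) * (T.edge i).integral fun s =>
        (v.v0 T ((T.edge i).pt s) - v.vb (T.edge i) s) ^ 2) := by
    refine Finset.sum_le_sum fun i _ => ?_
    have cj := hv.continuous_jump hT i
    have cf := (memWk_grad qv).continuous_flux T i
    have i1 : IntervalIntegrable (fun s => (dx (v.v0 T) ((T.edge i).pt s) * (normal i).1 +
      dy (v.v0 T) ((T.edge i).pt s) * (normal i).2) * (v.v0 T ((T.edge i).pt s) - v.vb (T.edge i) s))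
      volume 0 1 := (cf.mul cj).intervalIntegrable _ _
    have i2 : IntervalIntegrable (fun s => (v.v0 T ((T.edge i).pt s) - v.vb (T.edge i) s) ^ 2)
      volume 0 1 := (cj.pow 2).intervalIntegrable _ _
    have := (T.edge i).integral_mul_le l0 i1 i2 (B := C / h ^ 2 * g) fun s hs =>
      (flux_sq_le _ _ i).trans (hB _ (T.edge_pt_mem i hs))
    have e2 : (h / (16 * C))⁻¹ = 16 * C / h := inv_div _ _
    have e3 : h / (16 * C) * ((T.edge i).length * (C / h ^ 2 * g)) ≤ 1 / 16 * g := by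
      calc _ ≤ h / (16 * C) * (h * (C / h ^ 2 * g)) := by
            gcongr; exact T.edge_length_le i hs.width_le hs.height_le
        _ = _ := by field_simp
    rw [e2] at this
    calc _ = _ := congrArg _ (by ext s; ring)
      _ ≤ _ := this.trans (by gcongr)
  rw [Finset.sum_add_distrib, ← Finset.mul_sum, ← Finset.mul_sum] at a3
  simp only [Finset.sum_const, Finset.card_univ, Fintype.card_fin, nsmul_eq_mul, Nat.cast_ofNat] at a3
  have e4 : 32 * C / h * edgeSq T v = 2 * ((16 * C / h) * edgeSq T v) := by ring
  rw [e4]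
  change _ ≤ _ + (16 * C / h) * edgeSq T v at a3
  linarith

variable {k : ℕ} {ζ : Fin (k + 1) → ℝ}

/-- Stability of interpolation. -/
theorem exists_interp_sub_le (hk : 1 ≤ k) (hζ : IsLobattoPoints k ζ) {κ : ℝ} (hκ : 1 ≤ κ) :
    ∃ C : ℝ, 0 < C ∧ ∀ (T : Rect) (h : ℝ), T.HasSize κ h → ∀ (q U : ℝ × ℝ → ℝ) (A : ℝ),
      (∀ z ∈ T.carrier, (U z - q z) ^ 2 ≤ A) → ∀ z ∈ T.carrier,
        (interp ζ T q z - interp ζ T U z) ^ 2 ≤ C * A ∧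
        (dx (interp ζ T q) z - dx (interp ζ T U) z) ^ 2 ≤ C / h ^ 2 * A ∧
        (dy (interp ζ T q) z - dy (interp ζ T U) z) ^ 2 ≤ C / h ^ 2 * A := by
  obtain ⟨C, hC, h1⟩ := exists_abs_le_of_nodes hk hζ
  obtain ⟨C', hC', h2⟩ := exists_inverse_estimate_sup k 1
  refine ⟨C ^ 2 + (C' * κ * C) ^ 2, by positivity, fun T h hs q U A hA z hz => ?_⟩
  have hh := hs.pos
  have hA0 : 0 ≤ A := (sq_nonneg _).trans (hA z hz)
  have qI : IsQ k k (interp ζ T (q - U)) := isQ_interp hζ T _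
  have b1 : ∀ z ∈ T.carrier, |interp ζ T (q - U) z| ≤ C * √A := by
    refine h1 _ qI T _ fun ij => ?_
    rw [interp_node hζ]
    refine Real.abs_le_sqrt ?_
    have := hA _ (T.node_mem hk hζ ij)
    simp only [Pi.sub_apply]; linarith [sub_sq_comm (U (T.node ζ ij)) (q (T.node ζ ij))]
  have b2 := h2 _ qI T _ b1 z (T.carrier_subset_dilate le_rfl hz)
  have e0 : interp ζ T q z - interp ζ T U z = interp ζ T (q - U) z := by rw [interp_sub]; rfl
  have e1 : dx (interp ζ T q) z - dx (interp ζ T U) z = dx (interp ζ T (q - U)) z := by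
    rw [interp_sub, dx_sub (isQ_interp hζ T q).contDiff.diff' (isQ_interp hζ T U).contDiff.diff']; rfl
  have e2 : dy (interp ζ T q) z - dy (interp ζ T U) z = dy (interp ζ T (q - U)) z := by
    rw [interp_sub, dy_sub (isQ_interp hζ T q).contDiff.diff' (isQ_interp hζ T U).contDiff.diff']; rfl
  have hw := T.width_pos
  have hht := T.height_pos
  have key : ∀ {x c : ℝ}, |x| ≤ c * √A → x ^ 2 ≤ c ^ 2 * A := fun {x c} hx => by
    calc x ^ 2 = |x| ^ 2 := (sq_abs x).symm
      _ ≤ (c * √A) ^ 2 := by gcongr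
      _ = _ := by rw [mul_pow, Real.sq_sqrt hA0]
  have k1 : C' / T.width ≤ C' * κ / h := by
    rw [div_le_div_iff₀ hw hh]
    calc C' * h ≤ C' * (κ * T.width) := by gcongr; exact hs.le_width
      _ = _ := by ring
  have k2 : C' / T.height ≤ C' * κ / h := by
    rw [div_le_div_iff₀ hht hh]
    calc C' * h ≤ C' * (κ * T.height) := by gcongr; exact hs.le_height
      _ = _ := by ring
  have kd : ((C' * κ / h) * C) ^ 2 * A ≤ (C ^ 2 + (C' * κ * C) ^ 2) / h ^ 2 * A := by
    have : ((C' * κ / h) * C) ^ 2 = (C' * κ * C) ^ 2 / h ^ 2 := by field_simp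
    rw [this]; gcongr; exact le_add_of_nonneg_left (sq_nonneg _)
  refine ⟨?_, ?_, ?_⟩
  · rw [e0]
    refine (key (b1 z hz)).trans ?_
    gcongr; exact le_add_of_nonneg_right (sq_nonneg _)
  · rw [e1]
    refine (key (c := (C' * κ / h) * C) ?_).trans kd
    refine b2.2.1.trans ?_
    rw [mul_assoc]; gcongr
  · rw [e2]
    refine (key (c := (C' * κ / h) * C) ?_).trans kd
    refine b2.2.2.trans ?_
    rw [mul_assoc]; gcongr

/-- Young's inequality in `L²(T)`. -/
theorem integral_mul_le_young {T : Rect} {φ ψ : ℝ × ℝ → ℝ} (hφ : MemLp φ 2 (volume.restrict T.carrier))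
    (hψ : MemLp ψ 2 (volume.restrict T.carrier)) {δ : ℝ} (hδ : 0 < δ) :
    ∫ z in T.carrier, φ z * ψ z ≤ δ * (∫ z in T.carrier, ψ z ^ 2) + δ⁻¹ * ∫ z in T.carrier, φ z ^ 2 := by
  rw [← integral_const_mul, ← integral_const_mul, ← integral_add (hψ.integrable_sq.const_mul _)
    (hφ.integrable_sq.const_mul _)]
  refine integral_mono (hφ.integrable_mul hψ) ((hψ.integrable_sq.const_mul _).add
    (hφ.integrable_sq.const_mul _)) fun z => ?_
  simp only
  have : δ * ψ z ^ 2 + δ⁻¹ * φ z ^ 2 - φ z * ψ z =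
      δ * (ψ z - δ⁻¹ * φ z / 2) ^ 2 + 3 / 4 * (δ⁻¹ * φ z ^ 2) := by field_simp; ring
  have h2 : 0 ≤ δ * (ψ z - δ⁻¹ * φ z / 2) ^ 2 + 3 / 4 * (δ⁻¹ * φ z ^ 2) := by positivity
  linarith

end WG

namespace WG

variable {k : ℕ} {ζ : Fin (k + 1) → ℝ} {Ω : Set (ℝ × ℝ)} {M : Finset Rect}

theorem add_sq_le_two (a b : ℝ) : (a + b) ^ 2 ≤ 2 * a ^ 2 + 2 * b ^ 2 := by
  nlinarith [sq_nonneg (a - b)]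

theorem add_sq_le_three (a b c : ℝ) : (a + b + c) ^ 2 ≤ 3 * a ^ 2 + 3 * b ^ 2 + 3 * c ^ 2 := by
  nlinarith [sq_nonneg (a - b), sq_nonneg (b - c), sq_nonneg (a - c)]

theorem integral_mul_le_of_split {T : Rect} {h C A : ℝ} (hA : 0 ≤ A) (hC : 0 ≤ C)
    (harea : T.width * T.height ≤ h ^ 2) {φ q' I' J' ψ : ℝ × ℝ → ℝ}
    (hφ : MemLp φ 2 (volume.restrict T.carrier)) (hq' : Continuous q') (hI' : Continuous I')
    (hJ' : Continuous J') (hψ : Continuous ψ)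
    (h0 : ∫ z in T.carrier, (q' z - I' z) * ψ z = 0)
    (h1 : ∫ z in T.carrier, (φ z - q' z) ^ 2 ≤ h ^ 2 * A)
    (h2 : ∀ z ∈ T.carrier, (I' z - J' z) ^ 2 ≤ C * A) {δ : ℝ} (hδ : 0 < δ) :
    ∫ z in T.carrier, (φ z - J' z) * ψ z ≤
      δ * (∫ z in T.carrier, ψ z ^ 2) + δ⁻¹ * ((2 + 2 * C) * h ^ 2 * A) := by
  have mψ : MemLp ψ 2 (volume.restrict T.carrier) := hψ.memLp_restrict
  have cIJ : Continuous fun z => I' z - J' z := hI'.sub hJ'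
  have mIJ : MemLp (fun z => I' z - J' z) 2 (volume.restrict T.carrier) := cIJ.memLp_restrict
  have mφq : MemLp (fun z => φ z - q' z) 2 (volume.restrict T.carrier) := hφ.sub hq'.memLp_restrict
  have mD : MemLp (fun z => (φ z - q' z) + (I' z - J' z)) 2 (volume.restrict T.carrier) := mφq.add mIJ
  have cm : Continuous fun z => (q' z - I' z) * ψ z := (hq'.sub hI').mul hψ
  have e : ∫ z in T.carrier, (φ z - J' z) * ψ z =
      (∫ z in T.carrier, ((φ z - q' z) + (I' z - J' z)) * ψ z) + ∫ z in T.carrier, (q' z - I' z) * ψ z := by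
    have i1 : Integrable (fun z => ((φ z - q' z) + (I' z - J' z)) * ψ z) (volume.restrict T.carrier) :=
      mD.integrable_mul mψ
    rw [← integral_add i1 (cm.integrableOn_rect T)]
    congr 1; ext z; ring
  rw [e, h0, add_zero]
  refine (integral_mul_le_young mD mψ hδ).trans ?_
  gcongr
  have i2 : ∫ z in T.carrier, (I' z - J' z) ^ 2 ≤ C * (h ^ 2 * A) := by
    have := integral_sq_le_of_abs_le (T := T) (g := fun z => I' z - J' z) (ε := √(C * A))
      fun z hz => Real.abs_le_sqrt (h2 z hz)
    rw [Real.sq_sqrt (by positivity)] at this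
    calc _ ≤ _ := this
      _ ≤ h ^ 2 * (C * A) := by gcongr
      _ = _ := by ring
  calc _ ≤ ∫ z in T.carrier, (2 * (φ z - q' z) ^ 2 + 2 * (I' z - J' z) ^ 2) :=
        integral_mono mD.integrable_sq ((mφq.integrable_sq.const_mul 2).add (mIJ.integrable_sq.const_mul 2))
          fun z => add_sq_le_two _ _
    _ = 2 * (∫ z in T.carrier, (φ z - q' z) ^ 2) + 2 * ∫ z in T.carrier, (I' z - J' z) ^ 2 := by
        rw [integral_add (mφq.integrable_sq.const_mul 2) (mIJ.integrable_sq.const_mul 2),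
          integral_const_mul, integral_const_mul]
    _ ≤ 2 * (h ^ 2 * A) + 2 * (C * (h ^ 2 * A)) := by gcongr
    _ = _ := by ring

/-- The constant value of a top order derivative. -/
theorem sq_le_of_integral_sub_sq_le {T : Rect} {κ h : ℝ} (hs : T.HasSize κ h) {φ g : ℝ × ℝ → ℝ} {c Y B : ℝ}
    (hφ : MemLp φ 2 (volume.restrict T.carrier)) (hg : ∀ z, g z = c)
    (hY : ∫ z in T.carrier, φ z ^ 2 ≤ Y) (hB : ∫ z in T.carrier, (φ z - g z) ^ 2 ≤ B) :
    c ^ 2 ≤ 2 * κ ^ 2 / h ^ 2 * (Y + B) := by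
  have hh := hs.pos
  have hc : Continuous g := by rw [funext hg]; exact continuous_const
  have m2 : MemLp (fun z => φ z - g z) 2 (volume.restrict T.carrier) := hφ.sub hc.memLp_restrict
  have h1 : T.width * T.height * c ^ 2 ≤ 2 * (Y + B) := by
    calc _ = ∫ z in T.carrier, g z ^ 2 := by
          simp only [hg, setIntegral_const, T.volume_carrier, smul_eq_mul]
      _ ≤ ∫ z in T.carrier, (2 * φ z ^ 2 + 2 * (φ z - g z) ^ 2) := by
          refine integral_mono ((hc.pow 2).integrableOn_rect T) ((hφ.integrable_sq.const_mul 2).add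
            (m2.integrable_sq.const_mul 2)) fun z => ?_
          simp only
          nlinarith [sq_nonneg (2 * φ z - g z)]
      _ = 2 * (∫ z in T.carrier, φ z ^ 2) + 2 * ∫ z in T.carrier, (φ z - g z) ^ 2 := by
        rw [integral_add (hφ.integrable_sq.const_mul 2) (m2.integrable_sq.const_mul 2),
          integral_const_mul, integral_const_mul]
      _ ≤ _ := by linarith
  have h2 : h ^ 2 * c ^ 2 ≤ κ ^ 2 * (2 * (Y + B)) := by
    calc _ ≤ κ ^ 2 * (T.width * T.height) * c ^ 2 := by gcongr; exact hs.le_area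
      _ = κ ^ 2 * (T.width * T.height * c ^ 2) := by ring
      _ ≤ _ := by gcongr
  rw [div_mul_eq_mul_div, le_div_iff₀ (by positivity)]
  linarith

/-- Consistency: the volume terms and the fluxes of the interpolation error on one element. -/
theorem exists_consistency (hk : 1 ≤ k) (hζ : IsLobattoPoints k ζ) {κ : ℝ} (hκ : 1 ≤ κ) :
    ∃ C : ℝ, 0 < C ∧ ∀ (T : Rect) (h : ℝ), T.HasSize κ h → ∀ (F : ℕ → ℕ → ℝ × ℝ → ℝ)
      (U V₁ V₂ : ℝ × ℝ → ℝ), SobolevOn T (k + 2) F → IsRep T F U V₁ V₂ →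
      (∀ v, IsQ k k v → ∀ δ, 0 < δ → ∫ z in T.carrier, ((F 1 0 z - dx (interp ζ T U) z) * dx v z +
          (F 0 1 z - dy (interp ζ T U) z) * dy v z) ≤
        δ * gradSq T v + δ⁻¹ * (C * h ^ (2 * k + 2) * seminormSq T (k + 2) F)) ∧
      ∀ z ∈ T.carrier, (V₁ z - dx (interp ζ T U) z) ^ 2 + (V₂ z - dy (interp ζ T U) z) ^ 2 ≤
        C * (h ^ (2 * k) * seminormSq T (k + 2) F + h ^ (2 * k) / h ^ 2 * seminormSq T (k + 1) F) := by
  obtain ⟨C₁, hC₁, happ⟩ := exists_isApprox hk hκ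
  obtain ⟨C₂, hC₂, hint⟩ := exists_interp_sub_le hk hζ hκ
  set c : ℝ := (k + 1) ^ 2 * κ ^ 2 with hc
  have hc0 : 0 < c := by positivity
  refine ⟨2 * ((2 + 2 * C₂) * C₁) + 6 * (C₁ + C₂ * C₁ + 2 * c * C₁ + 2 * c), by positivity,
    fun T h hs F U V₁ V₂ hF hr => ?_⟩
  have hh := hs.pos
  obtain ⟨q, hq⟩ := happ T F U V₁ V₂ h hF hs.width_le hs.height_le hs.le_width hs.le_height hr
  set X := seminormSq T (k + 2) F
  set Y := seminormSq T (k + 1) F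
  have hX : 0 ≤ X := seminormSq_nonneg _ _ _
  have hY : 0 ≤ Y := seminormSq_nonneg _ _ _
  set A := C₁ * h ^ (2 * k) * X with hAd
  have hA : 0 ≤ A := by positivity
  have hI := hint T h hs q U _ hq.sub
  have hI1 : ∀ z ∈ T.carrier, (dx (interp ζ T q) z - dx (interp ζ T U) z) ^ 2 ≤ C₂ * A := fun z hz =>
    (hI z hz).2.1.trans_eq (by field_simp)
  have hI2 : ∀ z ∈ T.carrier, (dy (interp ζ T q) z - dy (interp ζ T U) z) ^ 2 ≤ C₂ * A := fun z hz =>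
    (hI z hz).2.2.trans_eq (by field_simp)
  have sq := hq.isP.contDiff
  have sIq := (isQ_interp hζ T q).contDiff
  have sIU := (isQ_interp hζ T U).contDiff
  constructor
  · intro v hv δ hδ
    have sv := hv.contDiff
    have m10 := hF.1 1 0 (by lia)
    have m01 := hF.1 0 1 (by lia)
    have k1 := integral_mul_le_of_split hA hC₂.le hs.area_le m10 (contDiff_dx sq).continuous
      (contDiff_dx sIq).continuous (contDiff_dx sIU).continuous (contDiff_dx sv).continuous
      (integral_dx_sub_interp hk hζ hq.isP T hv) hq.grad₁ hI1 hδ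
    have k2 := integral_mul_le_of_split hA hC₂.le hs.area_le m01 (contDiff_dy sq).continuous
      (contDiff_dy sIq).continuous (contDiff_dy sIU).continuous (contDiff_dy sv).continuous
      (integral_dy_sub_interp hk hζ hq.isP T hv) hq.grad₂ hI2 hδ
    have mx : MemLp (dx v) 2 (volume.restrict T.carrier) := (contDiff_dx sv).continuous.memLp_restrict
    have my : MemLp (dy v) 2 (volume.restrict T.carrier) := (contDiff_dy sv).continuous.memLp_restrict
    have i1 : Integrable (fun z => (F 1 0 z - dx (interp ζ T U) z) * dx v z) (volume.restrict T.carrier) :=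
      (m10.sub (contDiff_dx sIU).continuous.memLp_restrict).integrable_mul mx
    have i2 : Integrable (fun z => (F 0 1 z - dy (interp ζ T U) z) * dy v z) (volume.restrict T.carrier) :=
      (m01.sub (contDiff_dy sIU).continuous.memLp_restrict).integrable_mul my
    rw [integral_add i1 i2, gradSq_eq T sv]
    have e1 : δ⁻¹ * (2 * ((2 + 2 * C₂) * h ^ 2 * A)) ≤
        δ⁻¹ * ((2 * ((2 + 2 * C₂) * C₁) + 6 * (C₁ + C₂ * C₁ + 2 * c * C₁ + 2 * c)) * h ^ (2 * k + 2) * X) := by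
      have : 2 * ((2 + 2 * C₂) * h ^ 2 * A) = (2 * ((2 + 2 * C₂) * C₁)) * h ^ (2 * k + 2) * X := by
        rw [hAd]; ring
      rw [this]
      gcongr
      exact le_add_of_nonneg_right (by positivity)
    linarith
  · intro z hz
    obtain ⟨a, b, hab, ha, hb⟩ := exists_top_of_isP hq.isP
    have fac : (1 : ℝ) ≤ ((k + 1).factorial : ℝ) := by exact_mod_cast Nat.factorial_pos _
    have hB : C₁ * h ^ 2 * X + Y = Y + C₁ * h ^ 2 * X := add_comm _ _
    have top : ∀ {φ g : ℝ × ℝ → ℝ} {a : ℝ}, MemLp φ 2 (volume.restrict T.carrier) →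
        (∀ z, g z = (k + 1).factorial * a) → ∫ z in T.carrier, φ z ^ 2 ≤ Y →
        ∫ z in T.carrier, (φ z - g z) ^ 2 ≤ C₁ * h ^ 2 * X →
        a ^ 2 ≤ 2 * κ ^ 2 / h ^ 2 * (Y + C₁ * h ^ 2 * X) := by
      intro φ g a m h1 h2 h3
      refine le_trans ?_ (sq_le_of_integral_sub_sq_le hs m h1 h2 h3)
      rw [mul_pow]
      exact le_mul_of_one_le_left (sq_nonneg _) (one_le_pow₀ fac)
    have ta := top (hF.1 (k + 1) 0 (by lia)) ha (integral_le_seminormSq T (by lia) F) hq.top₁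
    have tb := top (hF.1 0 (k + 1) (by lia)) hb (integral_le_seminormSq T (by lia) F) hq.top₂
    have one : ∀ {V v i j a n l : ℝ}, (V - v) ^ 2 ≤ A → v - i = a * n → |n| ≤ (k + 1) * l ^ k → 0 ≤ l → l ≤ h →
        (i - j) ^ 2 ≤ C₂ * A → a ^ 2 ≤ 2 * κ ^ 2 / h ^ 2 * (Y + C₁ * h ^ 2 * X) →
        (V - j) ^ 2 ≤ 3 * (C₁ + C₂ * C₁ + 2 * c * C₁ + 2 * c) * (h ^ (2 * k) * X + h ^ (2 * k) / h ^ 2 * Y) := by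
      intro V v i j a n l h1 h2 h3 h4 h5 h6 h7
      have n1 : n ^ 2 ≤ (k + 1) ^ 2 * h ^ (2 * k) := by
        calc n ^ 2 = |n| ^ 2 := (sq_abs n).symm
          _ ≤ ((k + 1) * h ^ k) ^ 2 := by gcongr; exact h3.trans (by gcongr)
          _ = _ := by rw [mul_pow]; ring
      have n2 : (v - i) ^ 2 ≤ 2 * c * C₁ * (h ^ (2 * k) * X) + 2 * c * (h ^ (2 * k) / h ^ 2 * Y) := by
        calc (v - i) ^ 2 = a ^ 2 * n ^ 2 := by rw [h2, mul_pow]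
          _ ≤ (2 * κ ^ 2 / h ^ 2 * (Y + C₁ * h ^ 2 * X)) * ((k + 1) ^ 2 * h ^ (2 * k)) := by gcongr
          _ = _ := by rw [hc]; field_simp; ring
      have n3 : (V - j) ^ 2 ≤ 3 * (V - v) ^ 2 + 3 * (v - i) ^ 2 + 3 * (i - j) ^ 2 := by
        have := add_sq_le_three (V - v) (v - i) (i - j)
        calc _ = _ := by ring
          _ ≤ _ := this
      have n4 : 0 ≤ h ^ (2 * k) * X := by positivity
      have n5 : 0 ≤ h ^ (2 * k) / h ^ 2 * Y := by positivity
      have hA' : A = C₁ * (h ^ (2 * k) * X) := by rw [hAd]; ring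
      rw [hA'] at h1 h6
      generalize h ^ (2 * k) * X = x at *
      generalize h ^ (2 * k) / h ^ 2 * Y = y at *
      have m1 : 0 ≤ C₁ * y := by positivity
      have m2 : 0 ≤ C₂ * C₁ * y := by positivity
      have m3 : 0 ≤ c * C₁ * y := by positivity
      have m4 : 0 ≤ c * x := by positivity
      nlinarith
    rw [Rect.mem_carrier] at hz
    have hz' : z ∈ T.carrier := Rect.mem_carrier.2 hz
    have r1 := one (hq.sub₁ z hz') (dx_sub_interp hζ sq hab T z)
      (abs_derivative_nodal_le hk hζ T.hlr.le hz.1) T.width_pos.le hs.width_le (hI1 z hz') ta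
    have r2 := one (hq.sub₂ z hz') (dy_sub_interp hζ sq hab T z)
      (abs_derivative_nodal_le hk hζ T.hbt.le hz.2) T.height_pos.le hs.height_le (hI2 z hz') tb
    have n4 : 0 ≤ h ^ (2 * k) * X + h ^ (2 * k) / h ^ 2 * Y := by positivity
    calc _ ≤ 6 * (C₁ + C₂ * C₁ + 2 * c * C₁ + 2 * c) * (h ^ (2 * k) * X + h ^ (2 * k) / h ^ 2 * Y) := by
          linarith
      _ ≤ _ := by gcongr; exact le_add_of_nonneg_left (by positivity)

end WG

namespace WG

variable {k : ℕ} {ζ : Fin (k + 1) → ℝ}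

theorem rpow_le_mul_rpow {D h s t u : ℝ} (hD : 1 ≤ D) (hh : 0 < h) (hhD : h ≤ D) (hst : s ≤ t)
    (hu : t - s ≤ u) : h ^ t ≤ D ^ u * h ^ s := by
  have e : h ^ t = h ^ (t - s) * h ^ s := by rw [← Real.rpow_add hh]; congr 1; ring
  rw [e]
  gcongr
  calc h ^ (t - s) ≤ D ^ (t - s) := by gcongr
    _ ≤ D ^ u := Real.rpow_le_rpow_of_exponent_le hD hu

/-- The energy error of the weak Galerkin solution, compared to the interpolant of `u`. -/
theorem exists_energy_le (hk : 1 ≤ k) (hζ : IsLobattoPoints k ζ) {κ D α : ℝ} (hκ : 1 ≤ κ) (hD : 1 ≤ D)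
    (hα : 1 ≤ α) : ∃ C : ℝ, 0 < C ∧ ∀ (Ω : Set (ℝ × ℝ)) (M : Finset Rect), IsRectangularDomain Ω →
      IsMesh Ω M → (∀ T ∈ M, T.HasSize κ (meshSize M)) → meshSize M ≤ D →
      ∀ (F : ℕ → ℕ → ℝ × ℝ → ℝ) (U V₁ V₂ f : ℝ × ℝ → ℝ) (uh : WeakFunction),
      (∀ T ∈ M, SobolevOn T (k + 2) F) → (∀ T ∈ M, IsRep T F U V₁ V₂) →
      (∀ T ∈ M, ∀ i, (T.edge i).carrier ⊆ frontier Ω → ∀ z ∈ (T.edge i).carrier, U z = 0) →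
      (∀ T ∈ M, f =ᵐ[volume.restrict T.carrier] fun z => -(F 2 0 z + F 0 2 z)) →
      IsWGSolution Ω M k α f uh →
      ∑ T ∈ M, (gradSq T ((uh.sub (interpolant ζ U)).v0 T) +
          edgeSq T (uh.sub (interpolant ζ U)) / meshSize M) ≤
        C * meshSize M ^ (2 * min ((k : ℝ) + 1) (k + (α - 1) / 2)) *
          ∑ T ∈ M, (seminormSq T (k + 2) F + seminormSq T (k + 1) F) := by
  obtain ⟨C₁, hC₁, hgrad⟩ := exists_gradSq_le k hκ
  obtain ⟨C₂, hC₂, hcons⟩ := exists_consistency hk hζ hκ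
  set E : ℝ := D ^ (α - 1) with hE
  set E' : ℝ := D ^ (2 * (k : ℝ) + 2 + α) with hE'
  have hE0 : 0 < E := by positivity
  have hE'0 : 0 < E' := by positivity
  set δ : ℝ := 1 / (8 * (1 + C₁ * E)) with hδd
  have hδ : 0 < δ := by positivity
  set K : ℝ := δ⁻¹ * C₂ * E' + 16 * C₂ * E' with hK
  have hK0 : 0 < K := by positivity
  refine ⟨(2 + (C₁ + 1) * E) * (2 * K), by positivity,
    fun Ω M hΩ hM hsize hhD F U V₁ V₂ f uh hF hr hU hf hu => ?_⟩
  obtain ⟨T₀, hT₀⟩ := hM.nonempty hΩ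
  have hh := (hsize T₀ hT₀).pos
  have herr := hu.error_eq hk hζ hΩ hM hF hr hU hf rfl
  set e := uh.sub (interpolant ζ U) with he
  have he0 : MemVh M k e := (hu.1.sub (memVh0_interpolant hk hζ hU)).1
  set h := meshSize M with hhd
  set μ := h ^ (-α) with hμ
  have hμ0 : 0 < μ := by positivity
  set ρ := h ^ (2 * min ((k : ℝ) + 1) (k + (α - 1) / 2)) with hρ
  have hρ0 : 0 < ρ := by positivity
  set a : Rect → ℝ := fun T => ∫ z in T.carrier, ((weakGrad k T e).1 z ^ 2 + (weakGrad k T e).2 z ^ 2) with had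
  set s : Rect → ℝ := fun T => edgeSq T e with hsd
  set g : Rect → ℝ := fun T => gradSq T (e.v0 T) with hgd
  set X : Rect → ℝ := fun T => seminormSq T (k + 2) F with hXd
  set Y : Rect → ℝ := fun T => seminormSq T (k + 1) F with hYd
  have ha0 : ∀ T, 0 ≤ a T := fun T => integral_nonneg fun z => by positivity
  have hs0 : ∀ T, 0 ≤ s T := fun T => edgeSq_nonneg T e
  have hX0 : ∀ T, 0 ≤ X T := fun T => seminormSq_nonneg _ _ _
  have hY0 : ∀ T, 0 ≤ Y T := fun T => seminormSq_nonneg _ _ _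
  have p1 : 1 / h ≤ E * μ := by
    have := rpow_le_mul_rpow (s := -α) (t := -1) (u := α - 1) hD hh hhD (by linarith) (by linarith)
    rwa [Real.rpow_neg_one, ← one_div] at this
  have hmin1 : min ((k : ℝ) + 1) (k + (α - 1) / 2) ≤ k + 1 := min_le_left _ _
  have hmin2 : min ((k : ℝ) + 1) (k + (α - 1) / 2) ≤ k + (α - 1) / 2 := min_le_right _ _
  have hmin0 : 0 ≤ min ((k : ℝ) + 1) (k + (α - 1) / 2) :=
    le_min (by positivity) (add_nonneg (by positivity) (by linarith))
  have p2 : h ^ (2 * k + 2) ≤ E' * ρ := by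
    have := rpow_le_mul_rpow (s := 2 * min ((k : ℝ) + 1) (k + (α - 1) / 2)) (t := ((2 * k + 2 : ℕ) : ℝ))
      (u := 2 * (k : ℝ) + 2 + α) hD hh hhD (by push_cast; linarith) (by push_cast; linarith)
    rwa [Real.rpow_natCast] at this
  have p3 : h ^ α * h * h ^ (2 * k) ≤ E' * ρ := by
    have := rpow_le_mul_rpow (s := 2 * min ((k : ℝ) + 1) (k + (α - 1) / 2)) (t := α + 1 + ((2 * k : ℕ) : ℝ))
      (u := 2 * (k : ℝ) + 2 + α) hD hh hhD (by push_cast; linarith) (by push_cast; linarith)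
    rwa [Real.rpow_add hh, Real.rpow_add hh, Real.rpow_natCast, Real.rpow_one] at this
  have p4 : h ^ α * h * (h ^ (2 * k) / h ^ 2) ≤ E' * ρ := by
    have := rpow_le_mul_rpow (s := 2 * min ((k : ℝ) + 1) (k + (α - 1) / 2))
      (t := α + 1 + (((2 * k : ℕ) : ℝ) - ((2 : ℕ) : ℝ)))
      (u := 2 * (k : ℝ) + 2 + α) hD hh hhD (by push_cast; linarith) (by push_cast; linarith)
    rwa [Real.rpow_add hh, Real.rpow_add hh, Real.rpow_sub hh, Real.rpow_natCast, Real.rpow_natCast,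
      Real.rpow_one] at this
  have hg : ∀ T ∈ M, g T ≤ 2 * a T + C₁ * E * (μ * s T) := fun T hT => by
    refine (hgrad M e he0 T hT h (hsize T hT)).trans ?_
    have : C₁ / h * s T ≤ C₁ * (E * μ) * s T := by
      rw [div_eq_mul_one_div]
      have := hs0 T
      gcongr
    have e2 : C₁ * E * (μ * s T) = C₁ * (E * μ) * s T := by ring
    rw [e2]
    exact add_le_add le_rfl this
  have hloc : ∀ T ∈ M, (∫ z in T.carrier, ((F 1 0 z - dx (interp ζ T U) z) * dx (e.v0 T) z +
          (F 0 1 z - dy (interp ζ T U) z) * dy (e.v0 T) z)) -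
        ∑ i, ((T.edge i).integral fun s =>
          ((V₁ ((T.edge i).pt s) - dx (interp ζ T U) ((T.edge i).pt s)) * (normal i).1 +
          (V₂ ((T.edge i).pt s) - dy (interp ζ T U) ((T.edge i).pt s)) * (normal i).2) *
          (e.v0 T ((T.edge i).pt s) - e.vb (T.edge i) s)) ≤
      (1 / 4 * a T + 3 / 8 * (μ * s T)) + K * ρ * (X T + Y T) := by
    intro T hT
    obtain ⟨c1, c2⟩ := hcons T h (hsize T hT) F U V₁ V₂ (hF T hT) (hr T hT)
    have c1 := c1 _ (he0.1 T hT) δ hδ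
    set B := C₂ * (h ^ (2 * k) * X T + h ^ (2 * k) / h ^ 2 * Y T) with hBd
    have hB0 : 0 ≤ B := by have := hX0 T; have := hY0 T; positivity
    have hl : 0 < 4 * h ^ α := by positivity
    have hl' : (4 * h ^ α)⁻¹ = μ / 4 := by
      rw [hμ, Real.rpow_neg hh.le, mul_inv]; ring
    have c3 : -∑ i, ((T.edge i).integral fun s =>
          ((V₁ ((T.edge i).pt s) - dx (interp ζ T U) ((T.edge i).pt s)) * (normal i).1 +
          (V₂ ((T.edge i).pt s) - dy (interp ζ T U) ((T.edge i).pt s)) * (normal i).2) *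
          (e.v0 T ((T.edge i).pt s) - e.vb (T.edge i) s)) ≤
        ∑ i : Fin 4, (4 * h ^ α * (h * B) + μ / 4 * (T.edge i).integral fun s =>
          (e.v0 T ((T.edge i).pt s) - e.vb (T.edge i) s) ^ 2) := by
      rw [← Finset.sum_neg_distrib]
      refine Finset.sum_le_sum fun i _ => ?_
      have cj := he0.continuous_jump hT i
      have qI := (memWk_grad (isQ_interp hζ T U)).continuous_flux T i
      have i0 := (hr T hT).intervalIntegrable_flux i cj
      have i1 : IntervalIntegrable (fun s => (dx (interp ζ T U) ((T.edge i).pt s) * (normal i).1 +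
          dy (interp ζ T U) ((T.edge i).pt s) * (normal i).2) *
          (e.v0 T ((T.edge i).pt s) - e.vb (T.edge i) s)) volume 0 1 := (qI.mul cj).intervalIntegrable _ _
      have i2 : IntervalIntegrable (fun s =>
          -((V₁ ((T.edge i).pt s) - dx (interp ζ T U) ((T.edge i).pt s)) * (normal i).1 +
          (V₂ ((T.edge i).pt s) - dy (interp ζ T U) ((T.edge i).pt s)) * (normal i).2) *
          (e.v0 T ((T.edge i).pt s) - e.vb (T.edge i) s)) volume 0 1 := by
        refine (i1.sub i0).congr ?_
        intro s _
        ring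
      have i3 : IntervalIntegrable (fun s => (e.v0 T ((T.edge i).pt s) - e.vb (T.edge i) s) ^ 2)
        volume 0 1 := (cj.pow 2).intervalIntegrable _ _
      have := (T.edge i).integral_mul_le hl i2 i3 (B := B) fun s hs => by
        rw [neg_sq]
        exact (flux_sq_le _ _ i).trans (c2 _ (T.edge_pt_mem i hs))
      rw [hl'] at this
      have len := T.edge_length_le i (hsize T hT).width_le (hsize T hT).height_le
      calc _ = _ := by
            rw [← neg_one_mul, ← Edge.integral_const_mul]
            exact congrArg _ (by ext s; ring)
        _ ≤ _ := this
        _ ≤ _ := by gcongr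
    rw [Finset.sum_add_distrib, Finset.sum_const, ← Finset.mul_sum] at c3
    simp only [Finset.card_univ, Fintype.card_fin, nsmul_eq_mul, Nat.cast_ofNat] at c3
    have c4 : 4 * (4 * h ^ α * (h * B)) ≤ 16 * C₂ * E' * ρ * (X T + Y T) := by
      calc 4 * (4 * h ^ α * (h * B)) = 16 * C₂ * ((h ^ α * h * h ^ (2 * k)) * X T +
            (h ^ α * h * (h ^ (2 * k) / h ^ 2)) * Y T) := by rw [hBd]; ring
        _ ≤ 16 * C₂ * ((E' * ρ) * X T + (E' * ρ) * Y T) := by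
            have := hX0 T; have := hY0 T; gcongr
        _ = _ := by ring
    have c5 : δ⁻¹ * (C₂ * h ^ (2 * k + 2) * X T) ≤ δ⁻¹ * C₂ * E' * ρ * (X T + Y T) := by
      have hx := hX0 T
      have hy := hY0 T
      calc δ⁻¹ * (C₂ * h ^ (2 * k + 2) * X T) ≤ δ⁻¹ * (C₂ * (E' * ρ) * (X T + Y T)) := by
            gcongr; linarith
        _ = _ := by ring
    have c6 : δ * g T ≤ 1 / 4 * a T + 1 / 8 * (μ * s T) := by
      have h1 := hg T hT
      have h2 : g T ≤ (1 + C₁ * E) * (2 * a T + μ * s T) := by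
        have : 0 ≤ C₁ * E * (2 * a T) + μ * s T := by have := ha0 T; have := hs0 T; positivity
        linarith
      calc δ * g T ≤ δ * ((1 + C₁ * E) * (2 * a T + μ * s T)) := by gcongr
        _ = _ := by rw [hδd]; field_simp; ring
    have e1 : (∑ i, (T.edge i).integral fun s => (e.v0 T ((T.edge i).pt s) - e.vb (T.edge i) s) ^ 2) = s T := rfl
    rw [e1] at c3
    have e2 : K * ρ * (X T + Y T) = δ⁻¹ * C₂ * E' * ρ * (X T + Y T) + 16 * C₂ * E' * ρ * (X T + Y T) := by
      rw [hK]; ring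
    rw [e2]
    change _ ≤ δ * g T + δ⁻¹ * (C₂ * h ^ (2 * k + 2) * X T) at c1
    linarith
  have tot := (Finset.sum_congr rfl fun T _ => rfl).trans_le (herr.trans_le (Finset.sum_le_sum hloc))
  have hsum : ∑ T ∈ M, (a T + μ * s T) ≤ 2 * K * ρ * ∑ T ∈ M, (X T + Y T) := by
    have h1 : ∑ T ∈ M, (a T + μ * s T) ≤
        ∑ T ∈ M, ((1 / 4 * a T + 3 / 8 * (μ * s T)) + K * ρ * (X T + Y T)) := tot
    have h2 : ∑ T ∈ M, (1 / 4 * a T + 3 / 8 * (μ * s T)) ≤ 1 / 2 * ∑ T ∈ M, (a T + μ * s T) := by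
      rw [Finset.mul_sum]
      refine Finset.sum_le_sum fun T _ => ?_
      have := ha0 T
      have : 0 ≤ μ * s T := mul_nonneg hμ0.le (hs0 T)
      linarith
    have h3 : ∑ T ∈ M, ((1 / 4 * a T + 3 / 8 * (μ * s T)) + K * ρ * (X T + Y T)) =
        ∑ T ∈ M, (1 / 4 * a T + 3 / 8 * (μ * s T)) + K * ρ * ∑ T ∈ M, (X T + Y T) := by
      rw [Finset.sum_add_distrib, Finset.mul_sum]
    rw [h3] at h1
    linarith
  calc ∑ T ∈ M, (g T + s T / h) ≤ ∑ T ∈ M, (2 + (C₁ + 1) * E) * (a T + μ * s T) := by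
        refine Finset.sum_le_sum fun T hT => ?_
        have h1 := hg T hT
        have h2 : s T / h ≤ E * (μ * s T) := by
          rw [div_eq_mul_one_div]
          calc s T * (1 / h) ≤ s T * (E * μ) := mul_le_mul_of_nonneg_left p1 (hs0 T)
            _ = _ := by ring
        have h3 : 0 ≤ (C₁ + 1) * E * a T + 2 * (μ * s T) := by
          have := ha0 T; have := hs0 T; positivity
        linarith
    _ = (2 + (C₁ + 1) * E) * ∑ T ∈ M, (a T + μ * s T) := by rw [Finset.mul_sum]
    _ ≤ (2 + (C₁ + 1) * E) * (2 * K * ρ * ∑ T ∈ M, (X T + Y T)) := by gcongr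
    _ = _ := by ring

end WG

namespace WG

/-! ### Neighbourhoods of elements -/

section nbhd

variable {Ω : Set (ℝ × ℝ)} {M : Finset Rect}

open Classical in
/-- The elements that are reached from `T` in at most `n` steps across edges. -/
noncomputable def nbhd (M : Finset Rect) : ℕ → Rect → Finset Rect
  | 0, T => {T}
  | n + 1, T => (nbhd M n T).biUnion fun T' => M.filter fun T'' => AdjEq T' T''

theorem mem_nbhd_succ {n : ℕ} {T T'' : Rect} :
    T'' ∈ nbhd M (n + 1) T ↔ ∃ T' ∈ nbhd M n T, T'' ∈ M ∧ AdjEq T' T'' := by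
  classical
  simp [nbhd]

theorem mem_of_mem_nbhd {n : ℕ} {T T' : Rect} (hT : T ∈ M) (h : T' ∈ nbhd M n T) : T' ∈ M := by
  cases n with
  | zero => simp only [nbhd, Finset.mem_singleton] at h; exact h ▸ hT
  | succ n => obtain ⟨_, -, h, -⟩ := mem_nbhd_succ.1 h; exact h

theorem nbhd_mono {T : Rect} (hT : T ∈ M) {m n : ℕ} (h : m ≤ n) : nbhd M m T ⊆ nbhd M n T := by
  induction n, h using Nat.le_induction with
  | base => exact subset_rfl
  | succ n _ ih => exact fun T' h' => mem_nbhd_succ.2 ⟨T', ih h', mem_of_mem_nbhd hT h', AdjEq.refl _⟩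

theorem self_mem_nbhd (M : Finset Rect) (T : Rect) : T ∈ nbhd M 0 T := Finset.mem_singleton_self T

theorem IsMesh.mem_nbhd_add_two (hM : IsMesh Ω M) (hΩ : IsRectangularDomain Ω) {n : ℕ} {T T' T'' : Rect}
    (hT : T ∈ M) (h : T' ∈ nbhd M n T) (hT'' : T'' ∈ M) {z : ℝ × ℝ} (hz' : z ∈ T'.carrier)
    (hz'' : z ∈ T''.carrier) : T'' ∈ nbhd M (n + 2) T := by
  obtain ⟨S, hS, -, h1, h2⟩ := hM.exists_chain_mem hΩ (mem_of_mem_nbhd hT h) hT'' hz' hz''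
  exact mem_nbhd_succ.2 ⟨S, mem_nbhd_succ.2 ⟨T', h, hS, h1⟩, hT'', h2⟩

theorem IsMesh.card_nbhd_le (hM : IsMesh Ω M) (n : ℕ) (T : Rect) : (nbhd M n T).card ≤ 5 ^ n := by
  classical
  induction n with
  | zero => simp [nbhd]
  | succ n ih =>
    refine Finset.card_biUnion_le.trans ?_
    calc _ ≤ ∑ _T' ∈ nbhd M n T, 5 := Finset.sum_le_sum fun T' _ => hM.card_adjEq_le T'
      _ = (nbhd M n T).card * 5 := by simp
      _ ≤ 5 ^ n * 5 := Nat.mul_le_mul_right 5 ih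
      _ = _ := (pow_succ 5 n).symm

theorem le_iterate_nbSum {b : Rect → ℝ} (hb : ∀ T, 0 ≤ b T) {n : ℕ} {T T' : Rect}
    (h : T' ∈ nbhd M n T) : b T' ≤ (nbSum M)^[n] b T := by
  induction n generalizing b T' with
  | zero => simp only [nbhd, Finset.mem_singleton] at h; simp [h]
  | succ n ih =>
    obtain ⟨S, hS, h1, h2⟩ := mem_nbhd_succ.1 h
    exact (le_nbSum (fun T _ => hb T) h1 h2).trans (ih (nbSum_nonneg fun T _ => hb T) hS)

theorem iterate_nbSum_nonneg {b : Rect → ℝ} (hb : ∀ T, 0 ≤ b T) (n : ℕ) (T : Rect) :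
    0 ≤ (nbSum M)^[n] b T := by
  induction n generalizing b with
  | zero => exact hb T
  | succ n ih => exact ih (nbSum_nonneg fun T _ => hb T)

theorem IsMesh.sum_iterate_nbSum_le (hM : IsMesh Ω M) {b : Rect → ℝ} (hb : ∀ T, 0 ≤ b T) (n : ℕ) :
    ∑ T ∈ M, (nbSum M)^[n] b T ≤ 5 ^ n * ∑ T ∈ M, b T := by
  induction n generalizing b with
  | zero => simp
  | succ n ih =>
    refine (ih (nbSum_nonneg fun T _ => hb T)).trans ?_
    rw [pow_succ, mul_assoc]
    exact mul_le_mul_of_nonneg_left (hM.sum_nbSum_le fun T _ => hb T) (by positivity)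

end nbhd

/-! ### Oscillation and jumps of weak functions -/

variable {k : ℕ}

theorem abs_sub_le_rect {q : ℝ × ℝ → ℝ} (hq : ContDiff ℝ ∞ q) {T : Rect} {κ h B : ℝ} (hs : T.HasSize κ h)
    (hB : ∀ z ∈ T.carrier, |dx q z| ≤ B ∧ |dy q z| ≤ B) {z w : ℝ × ℝ} (hz : z ∈ T.carrier)
    (hw : w ∈ T.carrier) : |q z - q w| ≤ 2 * (B * h) := by
  have hB0 : 0 ≤ B := (abs_nonneg _).trans (hB z hz).1
  obtain ⟨z1, z2⟩ := z
  obtain ⟨w1, w2⟩ := w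
  have h1 : |q (z1, z2) - q (w1, z2)| ≤ B * |z1 - w1| := by
    have := (convex_Icc T.l T.r).norm_image_sub_le_of_norm_hasDerivWithin_le (C := B)
      (fun s _ => (hasDerivAt_slice_fst hq z2 s).hasDerivWithinAt)
      (fun s hs' => (hB (s, z2) ⟨hs', hz.2⟩).1) hw.1 hz.1
    simpa using this
  have h2 : |q (w1, z2) - q (w1, w2)| ≤ B * |z2 - w2| := by
    have := (convex_Icc T.b T.t).norm_image_sub_le_of_norm_hasDerivWithin_le (C := B)
      (fun s _ => (hasDerivAt_slice_snd hq w1 s).hasDerivWithinAt)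
      (fun s hs' => (hB (w1, s) ⟨hw.1, hs'⟩).2) hw.2 hz.2
    simpa using this
  have hwd := hs.width_le
  have hht := hs.height_le
  rw [Rect.mem_carrier] at hz hw
  simp only [Rect.width, Rect.height] at *
  have h3 : |z1 - w1| ≤ h := abs_le.2 ⟨by linarith, by linarith⟩
  have h4 : |z2 - w2| ≤ h := abs_le.2 ⟨by linarith, by linarith⟩
  calc |q (z1, z2) - q (w1, w2)| ≤ |q (z1, z2) - q (w1, z2)| + |q (w1, z2) - q (w1, w2)| :=
        abs_sub_le _ _ _
    _ ≤ B * h + B * h := add_le_add (h1.trans (by gcongr)) (h2.trans (by gcongr))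
    _ = _ := by ring

theorem IsP1.exists_polynomial {m : ℕ} {g : ℝ → ℝ} (h : IsP1 m g) :
    ∃ p : Polynomial ℝ, p.natDegree ≤ m ∧ ∀ s, g s = p.eval s := by
  obtain ⟨c, hc⟩ := h
  refine ⟨∑ i ∈ Finset.range (m + 1), Polynomial.C (c i) * Polynomial.X ^ i, ?_, fun s => ?_⟩
  · refine Polynomial.natDegree_sum_le_of_forall_le _ _ fun i hi => ?_
    exact (Polynomial.natDegree_C_mul_X_pow_le _ _).trans (by simp at hi; lia)
  · rw [hc, Polynomial.eval_finsetSum]; simp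

theorem IsQ.isP1_edge {q : ℝ × ℝ → ℝ} (hq : IsQ k k q) (T : Rect) (i : Fin 4) :
    IsP1 k fun s => q ((T.edge i).pt s) := by
  have key : ∀ (p : Polynomial ℝ) (a b : ℝ), p.natDegree ≤ k → IsP1 k fun s => p.eval (a + s * b) := by
    intro p a b hp
    have := isP1_eval (m := k) (p := p.comp (Polynomial.C b * Polynomial.X + Polynomial.C a)) (by
      refine Polynomial.natDegree_comp_le.trans ?_
      calc _ ≤ k * 1 := Nat.mul_le_mul hp Polynomial.natDegree_linear_le
        _ = k := mul_one k)
    convert this using 2 with s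
    simp; ring_nf
  have hx : ∀ y, IsP1 k fun s => q (T.l + s * (T.r - T.l), y) := fun y => by
    obtain ⟨p, hp, hpe⟩ := hq.slice_fst y
    simpa only [hpe] using key p T.l (T.r - T.l) hp
  have hy : ∀ x, IsP1 k fun s => q (x, T.b + s * (T.t - T.b)) := fun x => by
    obtain ⟨p, hp, hpe⟩ := hq.slice_snd x
    simpa only [hpe] using key p T.b (T.t - T.b) hp
  fin_cases i
  · simpa [Rect.edge, Edge.pt] using hx T.b
  · simpa [Rect.edge, Edge.pt] using hy T.r
  · simpa [Rect.edge, Edge.pt] using hx T.t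
  · simpa [Rect.edge, Edge.pt] using hy T.l

theorem Rect.HasSize.le_edge_length {T : Rect} {κ h : ℝ} (hs : T.HasSize κ h) (i : Fin 4) :
    h ≤ κ * (T.edge i).length := by
  obtain ⟨h0, h1, h2, h3⟩ := T.edge_length
  have := hs.le_width
  have := hs.le_height
  fin_cases i <;> simp_all

/-- The oscillation and the jumps of a weak function on an element. -/
theorem exists_abs_sub_le (k : ℕ) {κ : ℝ} (hκ : 1 ≤ κ) : ∃ C : ℝ, 0 < C ∧ ∀ (M : Finset Rect)
    (v : WeakFunction), MemVh M k v → ∀ T ∈ M, ∀ h, T.HasSize κ h → ∀ ε, 0 ≤ ε →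
      gradSq T (v.v0 T) + edgeSq T v / h ≤ ε ^ 2 →
      (∀ z ∈ T.carrier, ∀ w ∈ T.carrier, |v.v0 T z - v.v0 T w| ≤ C * ε) ∧
      ∀ i, ∀ s ∈ Icc (0 : ℝ) 1, |v.v0 T ((T.edge i).pt s) - v.vb (T.edge i) s| ≤ C * ε := by
  obtain ⟨C₁, hC₁, hgrad⟩ := exists_grad_sq_le k hκ
  obtain ⟨C₂, hC₂, hinv⟩ := exists_inverse_estimate k 1
  refine ⟨2 * √C₁ + √(C₂ * κ), by positivity, fun M v hv T hT h hs ε hε hE => ?_⟩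
  have hh := hs.pos
  have g0 := gradSq_nonneg T (v.v0 T)
  have s0 : 0 ≤ edgeSq T v / h := div_nonneg (edgeSq_nonneg T v) hh.le
  constructor
  · intro z hz w hw
    have hB : ∀ z ∈ T.carrier, dx (v.v0 T) z ^ 2 + dy (v.v0 T) z ^ 2 ≤ C₁ * (ε / h) ^ 2 := fun z hz => by
      calc _ ≤ C₁ / h ^ 2 * gradSq T (v.v0 T) := hgrad _ (hv.1 T hT) T h hs z hz
        _ ≤ C₁ / h ^ 2 * ε ^ 2 := by gcongr; linarith
        _ = _ := by ring
    have e1 : √(C₁ * (ε / h) ^ 2) = √C₁ * (ε / h) := by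
      rw [Real.sqrt_mul hC₁.le, Real.sqrt_sq (by positivity)]
    have := abs_sub_le_rect (hv.1 T hT).contDiff hs (B := √C₁ * (ε / h)) (fun z hz => by
      rw [← e1]
      exact ⟨Real.abs_le_sqrt (by linarith [hB z hz, sq_nonneg (dy (v.v0 T) z)]),
        Real.abs_le_sqrt (by linarith [hB z hz, sq_nonneg (dx (v.v0 T) z)])⟩) hz hw
    have e2 : 2 * (√C₁ * (ε / h) * h) = 2 * √C₁ * ε := by field_simp
    rw [e2] at this
    refine this.trans ?_
    gcongr
    exact le_add_of_nonneg_right (Real.sqrt_nonneg _)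
  · intro i s hs'
    obtain ⟨p, hp, hpe⟩ := (((hv.1 T hT).isP1_edge T i).sub (hv.2 _ ⟨T, hT, i, rfl⟩)).exists_polynomial
    have h1 := (hinv p hp 0 1 s one_pos (abs_le.2 ⟨by linarith [hs'.1], by linarith [hs'.2]⟩)).1
    simp only [← hpe, sub_zero, div_one] at h1
    have h2 : (T.edge i).integral (fun s => (v.v0 T ((T.edge i).pt s) - v.vb (T.edge i) s) ^ 2) ≤
        edgeSq T v :=
      Finset.single_le_sum (f := fun i => (T.edge i).integral fun s =>
        (v.v0 T ((T.edge i).pt s) - v.vb (T.edge i) s) ^ 2)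
        (fun i _ => (T.edge i).integral_nonneg fun _ => sq_nonneg _) (Finset.mem_univ i)
    unfold Edge.integral at h2
    set J := ∫ s in (0 : ℝ)..1, (v.v0 T ((T.edge i).pt s) - v.vb (T.edge i) s) ^ 2 with hJ
    have J0 : 0 ≤ J := intervalIntegral.integral_nonneg zero_le_one fun _ _ => sq_nonneg _
    have h3 : J ≤ κ * ε ^ 2 := by
      have h4 : h * J ≤ h * (κ * ε ^ 2) := by
        calc h * J ≤ κ * (T.edge i).length * J := by gcongr; exact hs.le_edge_length i
          _ = κ * ((T.edge i).length * J) := by ring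
          _ ≤ κ * edgeSq T v := by gcongr
          _ = κ * (h * (edgeSq T v / h)) := by field_simp
          _ ≤ κ * (h * ε ^ 2) := by gcongr; linarith
          _ = _ := by ring
      exact le_of_mul_le_mul_left h4 hh
    have h5 : |v.v0 T ((T.edge i).pt s) - v.vb (T.edge i) s| ≤ √(C₂ * κ * ε ^ 2) := by
      refine Real.abs_le_sqrt (h1.trans ?_)
      calc C₂ * J ≤ C₂ * (κ * ε ^ 2) := by gcongr
        _ = _ := by ring
    rw [Real.sqrt_mul (by positivity), Real.sqrt_sq hε] at h5
    refine h5.trans ?_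
    gcongr
    exact le_add_of_nonneg_left (by positivity)

/-- A weak function with small energy is almost constant on neighbourhoods. -/
theorem exists_abs_sub_le_nbhd (k : ℕ) {κ : ℝ} (hκ : 1 ≤ κ) (n : ℕ) : ∃ C : ℝ, 0 < C ∧
    ∀ (M : Finset Rect) (h : ℝ) (v : WeakFunction), (∀ T ∈ M, T.HasSize κ h) → MemVh M k v →
      ∀ T ∈ M, ∀ ε, 0 ≤ ε → (∀ T' ∈ nbhd M n T, gradSq T' (v.v0 T') + edgeSq T' v / h ≤ ε ^ 2) →
      ∀ z ∈ T.carrier, ∀ T' ∈ nbhd M n T, ∀ w ∈ T'.carrier, |v.v0 T' w - v.v0 T z| ≤ C * ε := by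
  obtain ⟨C, hC, hosc⟩ := exists_abs_sub_le k hκ
  induction n with
  | zero =>
    refine ⟨C, hC, fun M h v hs hv T hT ε hε hE z hz T' hT' w hw => ?_⟩
    have hE' := hE T' hT'
    simp only [nbhd, Finset.mem_singleton] at hT'
    subst hT'
    exact (hosc M v hv _ hT h (hs _ hT) ε hε hE').1 w hw z hz
  | succ n ih =>
    obtain ⟨C', hC', ih⟩ := ih
    refine ⟨C' + 3 * C, by positivity, fun M h v hs hv T hT ε hε hE z hz T'' hT'' w hw => ?_⟩
    obtain ⟨T', hT', hM'', hadj⟩ := mem_nbhd_succ.1 hT''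
    have hM' := mem_of_mem_nbhd hT hT'
    have ih := ih M h v hs hv T hT ε hε (fun S hS => hE S (nbhd_mono hT n.le_succ hS)) z hz T' hT'
    have o' := hosc M v hv T' hM' h (hs _ hM') ε hε (hE T' (nbhd_mono hT n.le_succ hT'))
    have o'' := hosc M v hv T'' hM'' h (hs _ hM'') ε hε (hE T'' hT'')
    rcases hadj with rfl | hadj
    · refine (ih w hw).trans ?_
      gcongr
      exact le_add_of_nonneg_right (by positivity)
    · obtain ⟨i, hi⟩ := hadj.exists_edge_eq
      have m0 : (0 : ℝ) ∈ Icc (0 : ℝ) 1 := ⟨le_rfl, zero_le_one⟩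
      have p' := T'.edge_pt_mem i m0
      have p'' := T''.edge_pt_mem (i + 2) m0
      have j' := o'.2 i 0 m0
      have j'' := o''.2 (i + 2) 0 m0
      have q := o''.1 w hw _ p''
      have r := ih _ p'
      rw [← hi] at j'' q
      rw [abs_le] at *
      constructor <;> linarith [j'.1, j'.2, j''.1, j''.2, q.1, q.2, r.1, r.2]

end WG

namespace WG

variable {k : ℕ} {ζ : Fin (k + 1) → ℝ} {Ω : Set (ℝ × ℝ)} {M : Finset Rect}

/-! ### Local polynomial approximation on neighbourhoods -/

theorem AdjEq.exists_union {T T' : Rect} (h : AdjEq T T') : ∃ R : Rect,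
    R.carrier = T.carrier ∪ T'.carrier ∧ T.width ≤ R.width ∧ T.height ≤ R.height ∧
      R.width ≤ T.width + T'.width ∧ R.height ≤ T.height + T'.height := by
  rcases h with rfl | h
  · exact ⟨T, (union_self _).symm, le_rfl, le_rfl, by linarith [T.width_pos], by linarith [T.height_pos]⟩
  · exact h.exists_union

/-- A polynomial that approximates `u` on two neighbouring elements. -/
theorem exists_approx_pair (hk : 1 ≤ k) {κ : ℝ} (hκ : 1 ≤ κ) : ∃ C : ℝ, 0 < C ∧
    ∀ (Ω : Set (ℝ × ℝ)) (M : Finset Rect) (h : ℝ), IsRectangularDomain Ω → IsMesh Ω M →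
      (∀ T ∈ M, T.HasSize κ h) → ∀ (F : ℕ → ℕ → ℝ × ℝ → ℝ) (U V₁ V₂ : ℝ × ℝ → ℝ),
      (∀ R : Rect, R.inner ⊆ Ω → SobolevOn R (k + 2) F) → (∀ T ∈ M, IsRep T F U V₁ V₂) →
      ∀ T ∈ M, ∀ T' ∈ M, AdjEq T T' → ∀ ε, 0 ≤ ε → h ^ (2 * k + 2) * seminormSq T (k + 2) F ≤ ε ^ 2 →
        h ^ (2 * k + 2) * seminormSq T' (k + 2) F ≤ ε ^ 2 →
        ∃ q, IsP (k + 1) q ∧ ∀ z ∈ T.carrier ∪ T'.carrier, |U z - q z| ≤ C * ε := by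
  obtain ⟨C, hC, happ⟩ := exists_isApprox hk (κ := 2 * κ) (by linarith)
  refine ⟨√(C * 2 ^ (2 * k + 3)), by positivity, fun Ω M h hΩ hM hs F U V₁ V₂ hF hr T hT T' hT' hadj ε hε
    hX hX' => ?_⟩
  obtain ⟨R, hR, h1, h2, h3, h4⟩ := hadj.exists_union
  have s1 := hs T hT
  have s2 := hs T' hT'
  have hFR := hF R (hM.inner_union_subset hΩ hT hT' hR)
  have hh := s1.pos
  obtain ⟨q, hq⟩ := happ R F U V₁ V₂ (2 * h) hFR (by linarith [s1.width_le, s2.width_le])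
    (by linarith [s1.height_le, s2.height_le])
    (by
      have : κ * T.width ≤ κ * R.width := by gcongr
      linarith [s1.le_width])
    (by
      have : κ * T.height ≤ κ * R.height := by gcongr
      linarith [s1.le_height]) ((hr T hT).union (hr T' hT') hR)
  refine ⟨q, hq.isP, fun z hz => ?_⟩
  have h5 := Real.abs_le_sqrt (hq.sub z (hR ▸ hz))
  have h6 := seminormSq_union_le hR hFR
  have h7 : (2 * h) ^ 2 * (C * (2 * h) ^ (2 * k) * seminormSq R (k + 2) F) ≤ C * 2 ^ (2 * k + 3) * ε ^ 2 := by
    calc _ = C * 2 ^ (2 * k + 2) * (h ^ (2 * k + 2) * seminormSq R (k + 2) F) := by ring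
      _ ≤ C * 2 ^ (2 * k + 2) * (h ^ (2 * k + 2) * (seminormSq T (k + 2) F + seminormSq T' (k + 2) F)) := by
          gcongr
      _ ≤ C * 2 ^ (2 * k + 2) * (ε ^ 2 + ε ^ 2) := by rw [mul_add]; gcongr
      _ = _ := by ring
  refine (h5.trans (Real.sqrt_le_sqrt h7)).trans_eq ?_
  rw [Real.sqrt_mul (by positivity), Real.sqrt_sq hε]

theorem AdjEq.subset_dilate {T T' : Rect} (h : AdjEq T T') {κ d : ℝ} (hs : T.HasSize κ d)
    (hs' : T'.HasSize κ d) : T'.carrier ⊆ T.dilate (4 * κ) := by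
  intro z hz
  have h1 := hs.width_le
  have h2 := hs.height_le
  have h3 := hs.le_width
  have h4 := hs.le_height
  have h5 := hs'.width_le
  have h6 := hs'.height_le
  have h7 := T.hlr
  have h8 := T.hbt
  have h9 := hs.pos
  rw [Rect.mem_carrier] at hz
  have e1 : 4 * κ * (T.width / 2) = 2 * (κ * T.width) := by ring
  have e2 : 4 * κ * (T.height / 2) = 2 * (κ * T.height) := by ring
  simp only [Rect.dilate, Set.mem_ofPred_eq]
  rw [e1, e2]
  generalize κ * T.width = a at *
  generalize κ * T.height = b at *
  simp only [Rect.width, Rect.height, AdjEq, Adj] at *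
  rcases h with rfl | h | h | h | h <;>
    exact ⟨abs_le.2 ⟨by linarith, by linarith⟩, abs_le.2 ⟨by linarith, by linarith⟩⟩

/-- A polynomial that is close to `u` on an element is also close to `u` on neighbourhoods. -/
theorem exists_approx_nbhd (hk : 1 ≤ k) {κ : ℝ} (hκ : 1 ≤ κ) (n : ℕ) : ∃ C : ℝ, 0 < C ∧
    ∀ (Ω : Set (ℝ × ℝ)) (M : Finset Rect) (h : ℝ), IsRectangularDomain Ω → IsMesh Ω M →
      (∀ T ∈ M, T.HasSize κ h) → ∀ (F : ℕ → ℕ → ℝ × ℝ → ℝ) (U V₁ V₂ : ℝ × ℝ → ℝ),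
      (∀ R : Rect, R.inner ⊆ Ω → SobolevOn R (k + 2) F) → (∀ T ∈ M, IsRep T F U V₁ V₂) →
      ∀ T ∈ M, ∀ ε, 0 ≤ ε → (∀ T' ∈ nbhd M n T, h ^ (2 * k + 2) * seminormSq T' (k + 2) F ≤ ε ^ 2) →
      ∀ q, IsP (k + 1) q → (∀ z ∈ T.carrier, |U z - q z| ≤ ε) →
      ∀ T' ∈ nbhd M n T, ∀ w ∈ T'.carrier, |U w - q w| ≤ C * ε := by
  obtain ⟨C, hC, hpair⟩ := exists_approx_pair hk hκ
  obtain ⟨C₂, hC₂, hinv⟩ := exists_inverse_estimate_sup (k + 1) (4 * κ)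
  induction n with
  | zero =>
    refine ⟨1, one_pos, fun Ω M h hΩ hM hs F U V₁ V₂ hF hr T hT ε hε hX q hq hqT T' hT' w hw => ?_⟩
    simp only [nbhd, Finset.mem_singleton] at hT'
    subst hT'
    linarith [hqT w hw]
  | succ n ih =>
    obtain ⟨C', hC', ih⟩ := ih
    refine ⟨C + C₂ * (C + C'), by positivity, fun Ω M h hΩ hM hs F U V₁ V₂ hF hr T hT ε hε hX q hq hqT T''
      hT'' w hw => ?_⟩
    obtain ⟨T', hT', hM'', hadj⟩ := mem_nbhd_succ.1 hT''
    have hM' := mem_of_mem_nbhd hT hT'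
    have ih := ih Ω M h hΩ hM hs F U V₁ V₂ hF hr T hT ε hε
      (fun S hS => hX S (nbhd_mono hT n.le_succ hS)) q hq hqT T' hT'
    obtain ⟨q', hq', hpq⟩ := hpair Ω M h hΩ hM hs F U V₁ V₂ hF hr T' hM' T'' hM'' hadj ε hε
      (hX T' (nbhd_mono hT n.le_succ hT')) (hX T'' hT'')
    have b1 : ∀ z ∈ T'.carrier, |(q' - q) z| ≤ (C + C') * ε := fun z hz => by
      have h1 := hpq z (Or.inl hz)
      have h2 := ih z hz
      rw [Pi.sub_apply]
      rw [abs_le] at *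
      constructor <;> linarith [h1.1, h1.2, h2.1, h2.2]
    have b2 := (hinv _ (hq'.sub hq).isQ T' _ b1 w (hadj.subset_dilate (hs _ hM') (hs _ hM'') hw)).1
    have b3 := hpq w (Or.inr hw)
    rw [Pi.sub_apply] at b2
    rw [abs_le] at *
    constructor <;> linarith [b2.1, b2.2, b3.1, b3.2]

/-! ### Values at the nodes -/

theorem Adj.exists_pt {T T' : Rect} (h : Adj T T') {w : ℝ × ℝ} (hw : w ∈ T.carrier) (hw' : w ∈ T'.carrier) :
    ∃ i j s, T.edge i = T'.edge j ∧ w = (T.edge i).pt s := by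
  have key : ∀ (R : Rect), w ∈ R.carrier → (w.2 = R.b → ∃ s, w = (R.edge 0).pt s) ∧
      (w.1 = R.r → ∃ s, w = (R.edge 1).pt s) ∧ (w.2 = R.t → ∃ s, w = (R.edge 2).pt s) ∧
      (w.1 = R.l → ∃ s, w = (R.edge 3).pt s) := by
    intro R _
    have h1 : R.r - R.l ≠ 0 := by linarith [R.hlr]
    have h2 : R.t - R.b ≠ 0 := by linarith [R.hbt]
    refine ⟨fun h => ⟨(w.1 - R.l) / (R.r - R.l), ?_⟩, fun h => ⟨(w.2 - R.b) / (R.t - R.b), ?_⟩,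
      fun h => ⟨(w.1 - R.l) / (R.r - R.l), ?_⟩, fun h => ⟨(w.2 - R.b) / (R.t - R.b), ?_⟩⟩ <;>
    · simp only [Rect.edge, Edge.pt]
      refine Prod.ext ?_ ?_ <;> simp [h] <;> field_simp <;> ring
  obtain ⟨k0, k1, k2, k3⟩ := key T hw
  rw [Rect.mem_carrier] at hw hw'
  rcases h with h | h | h | h
  · obtain ⟨s, hs⟩ := k1 (by linarith [hw.1.2, hw'.1.1, h.1])
    exact ⟨1, 3, s, by simp [Rect.edge, h.1, h.2.1, h.2.2], hs⟩
  · obtain ⟨s, hs⟩ := k3 (by linarith [hw.1.1, hw'.1.2, h.1])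
    exact ⟨3, 1, s, by simp [Rect.edge, h.1, h.2.1, h.2.2], hs⟩
  · obtain ⟨s, hs⟩ := k2 (by linarith [hw.2.2, hw'.2.1, h.1])
    exact ⟨2, 0, s, by simp [Rect.edge, h.1, h.2.1, h.2.2], hs⟩
  · obtain ⟨s, hs⟩ := k0 (by linarith [hw.2.1, hw'.2.2, h.1])
    exact ⟨0, 2, s, by simp [Rect.edge, h.1, h.2.1, h.2.2], hs⟩

theorem AdjEq.interp_eq (hk : 1 ≤ k) (hζ : IsLobattoPoints k ζ) {T T' : Rect} (h : AdjEq T T') {w : ℝ × ℝ}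
    (hw : w ∈ T.carrier) (hw' : w ∈ T'.carrier) (U : ℝ × ℝ → ℝ) : interp ζ T U w = interp ζ T' U w := by
  rcases h with rfl | h
  · rfl
  · obtain ⟨i, j, s, hij, rfl⟩ := h.exists_pt hw hw'
    have h1 := interpolant_edge hk hζ U T i s
    have h2 := interpolant_edge hk hζ U T' j s
    rw [← hij] at h2
    exact h1.trans h2.symm

/-- The interpolant on any element takes the right value at the mesh nodes. -/
theorem IsMesh.interp_eq (hk : 1 ≤ k) (hζ : IsLobattoPoints k ζ) (hM : IsMesh Ω M)
    (hΩ : IsRectangularDomain Ω) {w : ℝ × ℝ} (hw : w ∈ nodes M ζ) {T : Rect} (hT : T ∈ M)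
    (hwT : w ∈ T.carrier) (U : ℝ × ℝ → ℝ) : interp ζ T U w = U w := by
  classical
  simp only [nodes, Finset.mem_biUnion, Finset.mem_image, Finset.mem_univ, true_and] at hw
  obtain ⟨T', hT', ij, rfl⟩ := hw
  obtain ⟨S, hS, hwS, h1, h2⟩ := hM.exists_chain_mem hΩ hT hT' hwT (T'.node_mem hk hζ ij)
  rw [h1.interp_eq hk hζ hwT hwS, h2.interp_eq hk hζ hwS (T'.node_mem hk hζ ij), interp_node hζ]

/-- On neighbourhoods the nodal averages are close to `u` up to a constant. -/
theorem exists_abs_nodalAverage_sub_le (hk : 1 ≤ k) (hζ : IsLobattoPoints k ζ) {κ : ℝ} (hκ : 1 ≤ κ) (n : ℕ) :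
    ∃ C : ℝ, 0 < C ∧ ∀ (Ω : Set (ℝ × ℝ)) (M : Finset Rect) (h : ℝ), IsRectangularDomain Ω →
      IsMesh Ω M → (∀ T ∈ M, T.HasSize κ h) → ∀ (uh : WeakFunction) (U ubar : ℝ × ℝ → ℝ), MemVh M k uh →
      IsNodalAverage Ω M ζ uh ubar → ∀ T ∈ M, ∀ ε, 0 ≤ ε →
      (∀ T' ∈ nbhd M (n + 2) T, gradSq T' ((uh.sub (interpolant ζ U)).v0 T') +
        edgeSq T' (uh.sub (interpolant ζ U)) / h ≤ ε ^ 2) →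
      ∃ c : ℝ, ∀ T' ∈ nbhd M n T, ∀ w ∈ nodes M ζ, w ∈ T'.carrier → |ubar w - U w - c| ≤ C * ε := by
  obtain ⟨C₁, hC₁, hosc⟩ := exists_abs_sub_le k hκ
  obtain ⟨C₂, hC₂, hnb⟩ := exists_abs_sub_le_nbhd k hκ (n + 2)
  refine ⟨C₁ + C₂, by positivity, fun Ω M h hΩ hM hs uh U ubar hu hav T hT ε hε hE => ?_⟩
  set e := uh.sub (interpolant ζ U) with he
  have hev : MemVh M k e := hu.sub (memVh_interpolant hζ U)
  have z₀ : T.corner 0 ∈ T.carrier := T.corner_mem 0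
  have hnb := hnb M h e hs hev T hT ε hε hE _ z₀
  refine ⟨e.v0 T (T.corner 0), fun T' hT' w hw hwT' => ?_⟩
  set c := e.v0 T (T.corner 0)
  have hval : ∀ y ∈ valuesAt M uh w, |y - U w - c| ≤ (C₁ + C₂) * ε := by
    have h0 : ∀ T'' ∈ M, w ∈ T''.carrier → T'' ∈ nbhd M (n + 2) T := fun T'' hT'' hw'' =>
      hM.mem_nbhd_add_two hΩ hT hT' hT'' hwT' hw''
    rintro y (⟨T'', hT'', hw'', rfl⟩ | ⟨f, ⟨T'', hT'', i, rfl⟩, s, hs', rfl, rfl⟩)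
    · have h1 := hnb T'' (h0 T'' hT'' hw'') w hw''
      have h2 : e.v0 T'' w = uh.v0 T'' w - U w := by
        rw [← hM.interp_eq hk hζ hΩ hw hT'' hw'' U]; rfl
      rw [h2] at h1
      refine h1.trans ?_
      gcongr
      linarith
    · have hw'' := T''.edge_pt_mem i hs'
      have h1 := hnb T'' (h0 T'' hT'' hw'') _ hw''
      have h3 := (hosc M e hev T'' hT'' h (hs _ hT'') ε hε (hE T'' (h0 T'' hT'' hw''))).2 i s hs'
      have h2 : e.vb (T''.edge i) s = uh.vb (T''.edge i) s - U ((T''.edge i).pt s) := by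
        rw [← hM.interp_eq hk hζ hΩ hw hT'' hw'' U]
        have := interpolant_edge hk hζ U T'' i s
        change _ - _ = _ - (interpolant ζ U).v0 T'' _
        rw [this]
      rw [h2] at h3
      rw [abs_le] at *
      constructor <;> linarith [h1.1, h1.2, h3.1, h3.2]
  have hsub : valuesAt M uh w ⊆ Icc (U w + c - (C₁ + C₂) * ε) (U w + c + (C₁ + C₂) * ε) := fun y hy => by
    have := abs_le.1 (hval y hy)
    exact ⟨by linarith [this.1], by linarith [this.2]⟩
  have := convexHull_min hsub (convex_Icc _ _) (hav.2 w hw)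
  exact abs_le.2 ⟨by linarith [this.1], by linarith [this.2]⟩

end WG

namespace WG

variable {k : ℕ} {ζ : Fin (k + 1) → ℝ} {Ω : Set (ℝ × ℝ)} {M : Finset Rect}

/-! ### Stability of the least-squares fit -/

theorem node_mem_patchNodes {T : Rect} (hT : T ∈ M) {z : ℝ × ℝ} (hz : z ∈ T.carrier) (hk : 1 ≤ k)
    (hζ : IsLobattoPoints k ζ) (ij : Fin (k + 1) × Fin (k + 1)) : T.node ζ ij ∈ patchNodes M ζ z := by
  classical
  simp only [patchNodes, nodes, Finset.mem_filter, Finset.mem_biUnion, Finset.mem_image, Finset.mem_univ,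
    true_and]
  exact ⟨⟨T, hT, ij, rfl⟩, T, hT, hz, T.node_mem hk hζ ij⟩

theorem IsMesh.card_patchNodes_le (hk : 1 ≤ k) (hζ : IsLobattoPoints k ζ) (hM : IsMesh Ω M)
    (hΩ : IsRectangularDomain Ω) {T : Rect} (hT : T ∈ M) {z : ℝ × ℝ} (hz : z ∈ T.carrier) :
    (patchNodes M ζ z).card ≤ 5 ^ 4 * (k + 1) ^ 2 := by
  classical
  have hsub : patchNodes M ζ z ⊆ (nbhd M 4 T).biUnion fun T' => Finset.univ.image (T'.node ζ) := by
    intro w hw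
    simp only [patchNodes, nodes, Finset.mem_filter, Finset.mem_biUnion, Finset.mem_image, Finset.mem_univ,
      true_and] at hw ⊢
    obtain ⟨⟨S, hS, ij, rfl⟩, T', hT', hz', hw'⟩ := hw
    exact ⟨S, hM.mem_nbhd_add_two hΩ hT (hM.mem_nbhd_add_two hΩ hT (self_mem_nbhd M T) hT' hz hz') hS hw'
      (S.node_mem hk hζ ij), ij, rfl⟩
  calc _ ≤ _ := Finset.card_le_card hsub
    _ ≤ ∑ _T' ∈ nbhd M 4 T, (k + 1) ^ 2 := Finset.card_biUnion_le.trans (Finset.sum_le_sum fun T' _ =>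
        Finset.card_image_le.trans_eq (by simp [sq]))
    _ = (nbhd M 4 T).card * (k + 1) ^ 2 := by simp
    _ ≤ _ := Nat.mul_le_mul_right _ (hM.card_nbhd_le 4 T)

theorem exists_separated (hk : 1 ≤ k) (hζ : IsLobattoPoints k ζ) {κ : ℝ} (hκ : 1 ≤ κ) : ∃ c : ℝ, 0 < c ∧
    ∀ l z r h : ℝ, z < r → l < z → r - z ≤ h → z - l ≤ h → h ≤ κ * (r - z) → h ≤ κ * (z - l) →
      (∀ i j, i ≠ j → c * h ≤ |(Fin.cons l (scaledPoint ζ z r) : Fin (k + 1 + 1) → ℝ) i -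
        (Fin.cons l (scaledPoint ζ z r) : Fin (k + 1 + 1) → ℝ) j|) ∧
      ∀ i, |z - (Fin.cons l (scaledPoint ζ z r) : Fin (k + 1 + 1) → ℝ) i| ≤ h := by
  obtain ⟨δ, hδ, hgap⟩ := hζ.exists_gap
  refine ⟨min (δ / (2 * κ)) (1 / κ), by positivity, fun l z r h hzr hlz h1 h2 h3 h4 => ?_⟩
  have hh : 0 < h := by linarith
  have hκ0 : 0 < κ := by linarith
  have m := fun i => scaledPoint_mem_Icc hk hζ hzr.le i
  have b1 : min (δ / (2 * κ)) (1 / κ) * h ≤ (r - z) / 2 * δ := by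
    calc _ ≤ δ / (2 * κ) * h := by gcongr; exact min_le_left _ _
      _ ≤ δ / (2 * κ) * (κ * (r - z)) := by gcongr
      _ = _ := by field_simp
  have b2 : min (δ / (2 * κ)) (1 / κ) * h ≤ z - l := by
    calc _ ≤ 1 / κ * h := by gcongr; exact min_le_right _ _
      _ ≤ 1 / κ * (κ * (z - l)) := by gcongr
      _ = _ := by field_simp
  constructor
  · intro i j
    refine Fin.cases ?_ (fun i => ?_) i <;> refine Fin.cases ?_ (fun j => ?_) j <;> intro hij <;>
      simp only [Fin.cons_zero, Fin.cons_succ]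
    · exact absurd rfl hij
    · rw [abs_sub_comm]
      exact b2.trans ((by linarith [(m j).1] : _ ≤ _).trans (le_abs_self _))
    · exact b2.trans ((by linarith [(m i).1] : _ ≤ _).trans (le_abs_self _))
    · rw [abs_scaledPoint_sub ζ hzr]
      refine b1.trans ?_
      have := hgap i j fun h => hij (by rw [h])
      have h0 : 0 ≤ (r - z) / 2 := by linarith
      gcongr
  · intro i
    refine Fin.cases ?_ (fun i => ?_) i
    · simp only [Fin.cons_zero]; rw [abs_of_pos (by linarith)]; exact h2
    · simp only [Fin.cons_succ]
      exact abs_le.2 ⟨by linarith [(m i).2], by linarith [(m i).1]⟩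

/-- The least-squares fit on the patch of an interior vertex is stable. -/
theorem exists_leastSquares_le (hk : 1 ≤ k) (hζ : IsLobattoPoints k ζ) {κ : ℝ} (hκ : 1 ≤ κ) :
    ∃ C : ℝ, 0 < C ∧ ∀ (Ω : Set (ℝ × ℝ)) (M : Finset Rect) (h : ℝ), IsRectangularDomain Ω →
      IsMesh Ω M → (∀ T ∈ M, T.HasSize κ h) → ∀ z ∈ vertices M, z ∈ Ω → ∀ (g p q : ℝ × ℝ → ℝ) (ε : ℝ),
      0 ≤ ε → IsLeastSquaresFit (k + 1) (patchNodes M ζ z) g p → IsP (k + 1) q →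
      (∀ w ∈ patchNodes M ζ z, |g w - q w| ≤ ε) → ∀ x : ℝ × ℝ, |x.1 - z.1| ≤ 2 * h → |x.2 - z.2| ≤ 2 * h →
      |p x - q x| ≤ C * ε := by
  obtain ⟨c, hc, hsep⟩ := exists_separated hk hζ hκ
  set N : ℝ := 5 ^ 4 * ((k : ℝ) + 1) ^ 2 with hN
  set D : ℝ := (((k + 1 : ℕ) : ℝ) + 1) * (3 / c) ^ (k + 1) with hD
  have hD0 : 0 < D := by positivity
  refine ⟨D * (D * (√N + 1)), by positivity, fun Ω M h hΩ hM hs z hz hzΩ g p q ε hε hp hq hgq x hx hy => ?_⟩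
  obtain ⟨T₁, h1, T₂, h2, T₃, h3, T₄, h4, e1, e2, e3, e4⟩ := hM.exists_patch hΩ hz hzΩ
  have s1 := hs _ h1
  have s3 := hs _ h3
  have hh := s1.pos
  have c1 : z ∈ T₁.carrier := Rect.mem_carrier.2 (by have := T₁.hlr; have := T₁.hbt; grind)
  have c2 : z ∈ T₂.carrier := Rect.mem_carrier.2 (by have := T₂.hlr; have := T₂.hbt; grind)
  have c3 : z ∈ T₃.carrier := Rect.mem_carrier.2 (by have := T₃.hlr; have := T₃.hbt; grind)
  have c4 : z ∈ T₄.carrier := Rect.mem_carrier.2 (by have := T₄.hlr; have := T₄.hbt; grind)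
  have hcard : ((patchNodes M ζ z).card : ℝ) ≤ N := by
    rw [hN]; exact_mod_cast hM.card_patchNodes_le hk hζ hΩ h1 c1
  have hnode : ∀ w ∈ patchNodes M ζ z, |p w - q w| ≤ (√N + 1) * ε := by
    intro w hw
    have k1 : (p w - g w) ^ 2 ≤ N * ε ^ 2 := by
      calc (p w - g w) ^ 2 ≤ ∑ w ∈ patchNodes M ζ z, (p w - g w) ^ 2 :=
            Finset.single_le_sum (f := fun w => (p w - g w) ^ 2) (fun _ _ => sq_nonneg _) hw
        _ ≤ ∑ w ∈ patchNodes M ζ z, (q w - g w) ^ 2 := hp.2 q hq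
        _ ≤ ∑ _w ∈ patchNodes M ζ z, ε ^ 2 := Finset.sum_le_sum fun w hw => by
            rw [sub_sq_comm, ← sq_abs]
            have := hgq w hw
            gcongr
        _ = (patchNodes M ζ z).card * ε ^ 2 := by simp
        _ ≤ _ := by gcongr
    have k2 := Real.abs_le_sqrt k1
    rw [Real.sqrt_mul (by positivity), Real.sqrt_sq hε] at k2
    have k3 := hgq w hw
    calc |p w - q w| ≤ |p w - g w| + |g w - q w| := abs_sub_le _ _ _
      _ ≤ √N * ε + ε := add_le_add k2 k3
      _ = _ := by ring
  have hX := hsep T₃.l z.1 T₁.r h (by linarith [T₁.hlr]) (by linarith [T₃.hlr])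
    (by rw [← e1.1]; exact s1.width_le) (by rw [← e3.1]; exact s3.width_le)
    (by rw [← e1.1]; exact s1.le_width) (by rw [← e3.1]; exact s3.le_width)
  have hY := hsep T₃.b z.2 T₁.t h (by linarith [T₁.hbt]) (by linarith [T₃.hbt])
    (by rw [← e1.2]; exact s1.height_le) (by rw [← e3.2.1]; exact s3.height_le)
    (by rw [← e1.2]; exact s1.le_height) (by rw [← e3.2.1]; exact s3.le_height)
  have hl : ∀ a b, scaledPoint ζ a b 0 = a := fun a b => by
    rw [scaledPoint, hζ.apply_zero hk]; ring
  have key := (hp.1.sub hq).isQ.abs_le_of_grid (X := Fin.cons T₃.l (scaledPoint ζ z.1 T₁.r))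
    (Y := Fin.cons T₃.b (scaledPoint ζ z.2 T₁.t)) (δ := c * h) (δ' := c * h) (K := 3 * h) (K' := 3 * h)
    (ε := (√N + 1) * ε) (x := x.1) (y := x.2) (by positivity) (by positivity) hX.1 hY.1
    (by
      intro i j
      refine hnode _ ?_
      refine Fin.cases ?_ (fun i => ?_) i <;> refine Fin.cases ?_ (fun j => ?_) j <;>
        simp only [Fin.cons_zero, Fin.cons_succ]
      · have := node_mem_patchNodes h3 c3 hk hζ (0, 0)
        rwa [Rect.node_eq, hl, hl] at this
      · have := node_mem_patchNodes h2 c2 hk hζ (0, j)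
        rwa [Rect.node_eq, hl, e2.2.1, e2.2.2, ← e3.2.2] at this
      · have := node_mem_patchNodes h4 c4 hk hζ (i, 0)
        rwa [Rect.node_eq, hl, e4.1, e4.2.2.1, e4.2.2.2] at this
      · have := node_mem_patchNodes h1 c1 hk hζ (i, j)
        rwa [Rect.node_eq, e1.1, e1.2] at this)
    (fun i => by
      have := hX.2 i
      rw [abs_le] at *
      constructor <;> linarith [hx.1, hx.2, this.1, this.2])
    (fun i => by
      have := hY.2 i
      rw [abs_le] at *
      constructor <;> linarith [hy.1, hy.2, this.1, this.2])
  have e : 3 * h / (c * h) = 3 / c := by field_simp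
  rw [e] at key
  calc |p x - q x| ≤ _ := key
    _ = _ := by rw [hD]; ring

/-! ### The polynomials of the vertices -/

theorem abs_mean_sub_le {ι : Type*} {s : Finset ι} (hs : s.Nonempty) {a : ι → ℝ} {A B : ℝ}
    (h : ∀ i ∈ s, |a i - A| ≤ B) : |(∑ i ∈ s, a i) / s.card - A| ≤ B := by
  have hc : (0 : ℝ) < s.card := by exact_mod_cast hs.card_pos
  have e : (∑ i ∈ s, a i) / s.card - A = (∑ i ∈ s, (a i - A)) / s.card := by
    rw [Finset.sum_sub_distrib, Finset.sum_const, nsmul_eq_mul]; field_simp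
  rw [e, abs_div, abs_of_pos hc, div_le_iff₀ hc]
  calc _ ≤ ∑ i ∈ s, |a i - A| := Finset.abs_sum_le_sum_abs _ _
    _ ≤ ∑ _i ∈ s, B := Finset.sum_le_sum h
    _ = _ := by rw [Finset.sum_const, nsmul_eq_mul, mul_comm]

theorem abs_sub_le_of_mem {T : Rect} {κ h : ℝ} (hs : T.HasSize κ h) {z w : ℝ × ℝ} (hz : z ∈ T.carrier)
    (hw : w ∈ T.carrier) : |z.1 - w.1| ≤ h ∧ |z.2 - w.2| ≤ h := by
  have h1 := hs.width_le
  have h2 := hs.height_le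
  rw [Rect.mem_carrier] at hz hw
  simp only [Rect.width, Rect.height] at h1 h2
  exact ⟨abs_le.2 ⟨by linarith, by linarith⟩, abs_le.2 ⟨by linarith, by linarith⟩⟩

theorem exists_grad_vertexPolynomial_le (hk : 1 ≤ k) (hζ : IsLobattoPoints k ζ) {κ : ℝ} (hκ : 1 ≤ κ) :
    ∃ C : ℝ, 0 < C ∧ ∀ (Ω : Set (ℝ × ℝ)) (M : Finset Rect) (h : ℝ), IsRectangularDomain Ω →
      IsMesh Ω M → (∀ T ∈ M, T.HasSize κ h) →
      (∀ z ∈ vertices M, z ∈ frontier Ω → (patchInteriorVertices Ω M z).Nonempty) →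
      ∀ (ubar : ℝ × ℝ → ℝ) (p : ℝ × ℝ → ℝ × ℝ → ℝ), IsVertexPolynomials Ω M ζ ubar p →
      ∀ T ∈ M, ∀ (q : ℝ × ℝ → ℝ) (ε : ℝ), 0 ≤ ε → IsP (k + 1) q →
      (∀ T' ∈ nbhd M 4 T, ∀ w ∈ nodes M ζ, w ∈ T'.carrier → |ubar w - q w| ≤ ε) →
      ∀ z ∈ vertices M, z ∈ T.carrier → ∀ x ∈ T.carrier,
        |dx (p z) x - dx q x| ≤ C / h * ε ∧ |dy (p z) x - dy q x| ≤ C / h * ε := by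
  classical
  obtain ⟨C₁, hC₁, hls⟩ := exists_leastSquares_le hk hζ hκ
  obtain ⟨C₂, hC₂, hinv⟩ := exists_inverse_estimate_sup (k + 1) 1
  refine ⟨C₂ * κ * C₁, by positivity, fun Ω M h hΩ hM hs hne ubar p hp T hT q ε hε hq hub z hz hzT => ?_⟩
  have hsT := hs T hT
  have hh := hsT.pos
  have hint : ∀ z' ∈ vertices M, z' ∈ Ω → ∀ T' ∈ M, z ∈ T'.carrier → z' ∈ T'.carrier → ∀ x ∈ T.carrier,
      |p z' x - q x| ≤ C₁ * ε := by
    intro z' hz' hz'Ω T' hT' hzT' hz'T' x hx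
    have m2 := hM.mem_nbhd_add_two hΩ hT (self_mem_nbhd M T) hT' hzT hzT'
    have d1 := abs_sub_le_of_mem hsT hx hzT
    have d2 := abs_sub_le_of_mem (hs T' hT') hzT' hz'T'
    refine hls Ω M h hΩ hM hs z' hz' hz'Ω ubar (p z') q ε hε (hp.1 z' hz' hz'Ω) hq (fun w hw => ?_) x ?_ ?_
    · simp only [patchNodes, Finset.mem_filter] at hw
      obtain ⟨hw, S, hS, h1, h2⟩ := hw
      exact hub S (hM.mem_nbhd_add_two hΩ hT m2 hS hz'T' h1) w hw h2
    · exact (abs_sub_le _ z.1 _).trans (by linarith [d1.1, d2.1])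
    · exact (abs_sub_le _ z.2 _).trans (by linarith [d1.2, d2.2])
  have hpz : IsQ (k + 1) (k + 1) (p z) ∧ ∀ x ∈ T.carrier, |p z x - q x| ≤ C₁ * ε := by
    by_cases hzΩ : z ∈ Ω
    · exact ⟨(hp.1 z hz hzΩ).1.isQ, hint z hz hzΩ T hT hzT hzT⟩
    · have hzf : z ∈ frontier Ω := by
        rw [hΩ.isOpen.frontier_eq]
        exact ⟨hM.carrier_subset hT hzT, hzΩ⟩
      have hmem : ∀ w ∈ patchInteriorVertices Ω M z, w ∈ vertices M ∧ w ∈ Ω ∧ ∃ S ∈ M, z ∈ S.carrier ∧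
          w ∈ S.carrier := fun w hw => by
        simpa only [patchInteriorVertices, Finset.mem_filter] using hw
      have hpe := hp.2 z hz hzf
      constructor
      · have e : p z = ((patchInteriorVertices Ω M z).card : ℝ)⁻¹ •
            ∑ w ∈ patchInteriorVertices Ω M z, p w := by
          ext x
          rw [hpe x, Pi.smul_apply, Finset.sum_apply, smul_eq_mul, div_eq_inv_mul]
        rw [e]
        exact IsQ.smul _ (IsQ.sum _ fun w hw => (hp.1 w (hmem w hw).1 (hmem w hw).2.1).1.isQ)
      · intro x hx
        rw [hpe x]
        refine abs_mean_sub_le (hne z hz hzf) fun w hw => ?_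
        obtain ⟨h1, h2, S, hS, h3, h4⟩ := hmem w hw
        exact hint w h1 h2 S hS h3 h4 x hx
  intro x hx
  have key := hinv _ (hpz.1.sub hq.isQ) T (C₁ * ε) hpz.2 x (T.carrier_subset_dilate le_rfl hx)
  rw [dx_sub hpz.1.contDiff.diff' hq.contDiff.diff', dy_sub hpz.1.contDiff.diff' hq.contDiff.diff'] at key
  have hw := T.width_pos
  have hht := T.height_pos
  have k1 : C₂ / T.width * (C₁ * ε) ≤ C₂ * κ * C₁ / h * ε := by
    have : C₂ / T.width ≤ C₂ * κ / h := by
      rw [div_le_div_iff₀ hw hh]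
      calc C₂ * h ≤ C₂ * (κ * T.width) := by gcongr; exact hsT.le_width
        _ = _ := by ring
    calc _ ≤ C₂ * κ / h * (C₁ * ε) := by gcongr
      _ = _ := by ring
  have k2 : C₂ / T.height * (C₁ * ε) ≤ C₂ * κ * C₁ / h * ε := by
    have : C₂ / T.height ≤ C₂ * κ / h := by
      rw [div_le_div_iff₀ hht hh]
      calc C₂ * h ≤ C₂ * (κ * T.height) := by gcongr; exact hsT.le_height
        _ = _ := by ring
    calc _ ≤ C₂ * κ / h * (C₁ * ε) := by gcongr
      _ = _ := by ring
  exact ⟨key.2.1.trans k1, key.2.2.trans k2⟩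

end WG

namespace WG

variable {k : ℕ} {ζ : Fin (k + 1) → ℝ} {Ω : Set (ℝ × ℝ)} {M : Finset Rect}

/-! ### The recovered gradient on an element -/

theorem Rect.corner_or_edge_or_inner {T : Rect} {z : ℝ × ℝ} (hz : z ∈ T.carrier) :
    (∃ i, z = T.corner i) ∨ (∃ i, z ∈ (T.edge i).inner) ∨ z ∈ T.inner := by
  obtain ⟨x, y⟩ := z
  rw [Rect.mem_carrier] at hz
  have hlr := T.hlr
  have hbt := T.hbt
  have hx : ∀ y, T.l < x → x < T.r → (x, y) ∈ Edge.inner ⟨(T.l, y), (T.r, y)⟩ := fun y h1 h2 => by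
    have : T.r - T.l ≠ 0 := by linarith
    refine ⟨(x - T.l) / (T.r - T.l), ⟨div_pos (by linarith) (by linarith),
      (div_lt_one (by linarith)).2 (by linarith)⟩, ?_⟩
    simp only [Edge.pt]
    refine Prod.ext ?_ ?_ <;> simp <;> field_simp <;> ring
  have hy : ∀ x, T.b < y → y < T.t → (x, y) ∈ Edge.inner ⟨(x, T.b), (x, T.t)⟩ := fun x h1 h2 => by
    have : T.t - T.b ≠ 0 := by linarith
    refine ⟨(y - T.b) / (T.t - T.b), ⟨div_pos (by linarith) (by linarith),
      (div_lt_one (by linarith)).2 (by linarith)⟩, ?_⟩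
    simp only [Edge.pt]
    refine Prod.ext ?_ ?_ <;> simp <;> field_simp <;> ring
  obtain ⟨⟨h1, h2⟩, h3, h4⟩ := hz
  simp only at h1 h2 h3 h4
  rcases h1.eq_or_lt with rfl | h1
  · rcases h3.eq_or_lt with rfl | h3
    · exact Or.inl ⟨0, rfl⟩
    rcases h4.eq_or_lt with rfl | h4
    · exact Or.inl ⟨3, rfl⟩
    exact Or.inr (Or.inl ⟨3, hy _ h3 h4⟩)
  rcases h2.eq_or_lt with rfl | h2
  · rcases h3.eq_or_lt with rfl | h3
    · exact Or.inl ⟨1, rfl⟩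
    rcases h4.eq_or_lt with rfl | h4
    · exact Or.inl ⟨2, rfl⟩
    exact Or.inr (Or.inl ⟨1, hy _ h3 h4⟩)
  rcases h3.eq_or_lt with rfl | h3
  · exact Or.inr (Or.inl ⟨0, hx _ h1 h2⟩)
  rcases h4.eq_or_lt with rfl | h4
  · exact Or.inr (Or.inl ⟨2, hx _ h1 h2⟩)
  exact Or.inr (Or.inr (Rect.mem_inner.2 ⟨⟨h1, h2⟩, h3, h4⟩))

theorem abs_convexCombination_sub_le {A B : ℝ} {l₁ l₂ l₃ l₄ a₁ a₂ a₃ a₄ : ℝ} (h₁ : 0 ≤ l₁) (h₂ : 0 ≤ l₂)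
    (h₃ : 0 ≤ l₃) (h₄ : 0 ≤ l₄) (hl : l₁ + l₂ + l₃ + l₄ = 1) (ha₁ : |a₁ - A| ≤ B) (ha₂ : |a₂ - A| ≤ B)
    (ha₃ : |a₃ - A| ≤ B) (ha₄ : |a₄ - A| ≤ B) : |l₁ * a₁ + l₂ * a₂ + l₃ * a₃ + l₄ * a₄ - A| ≤ B := by
  have e : l₁ * a₁ + l₂ * a₂ + l₃ * a₃ + l₄ * a₄ - A =
      l₁ * (a₁ - A) + l₂ * (a₂ - A) + l₃ * (a₃ - A) + l₄ * (a₄ - A) := by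
    linear_combination A * hl
  have key : ∀ {l a : ℝ}, 0 ≤ l → |a - A| ≤ B → |l * (a - A)| ≤ l * B := fun {l a} h0 h => by
    rw [abs_mul, abs_of_nonneg h0]; gcongr
  rw [e]
  calc _ ≤ |l₁ * (a₁ - A)| + |l₂ * (a₂ - A)| + |l₃ * (a₃ - A)| + |l₄ * (a₄ - A)| :=
        (abs_add_le _ _).trans (by gcongr; exact (abs_add_le _ _).trans (by gcongr; exact abs_add_le _ _))
    _ ≤ l₁ * B + l₂ * B + l₃ * B + l₄ * B := by
        linarith [key h₁ ha₁, key h₂ ha₂, key h₃ ha₃, key h₄ ha₄]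
    _ = (l₁ + l₂ + l₃ + l₄) * B := by ring
    _ = B := by rw [hl, one_mul]

theorem Edge.weights {e : Edge} (he : 0 < e.length) {s : ℝ} (hs : s ∈ Ioo (0 : ℝ) 1) :
    eDist (e.pt s) e.q / e.length = 1 - s ∧ eDist (e.pt s) e.p / e.length = s := by
  constructor
  · rw [div_eq_iff he.ne']
    have h0 : 0 ≤ 1 - s := by linarith [hs.2]
    have := Real.sqrt_mul (sq_nonneg (1 - s)) ((e.p.1 - e.q.1) ^ 2 + (e.p.2 - e.q.2) ^ 2)
    rw [Real.sqrt_sq h0] at this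
    unfold Edge.length eDist
    rw [← this]
    congr 1
    simp [Edge.pt]; ring
  · rw [div_eq_iff he.ne']
    have := Real.sqrt_mul (sq_nonneg s) ((e.p.1 - e.q.1) ^ 2 + (e.p.2 - e.q.2) ^ 2)
    rw [Real.sqrt_sq hs.1.le] at this
    unfold Edge.length eDist
    rw [← this]
    congr 1
    simp [Edge.pt]; ring

theorem exists_recoveredGradient_le (hk : 1 ≤ k) (hζ : IsLobattoPoints k ζ) {κ : ℝ} (hκ : 1 ≤ κ) :
    ∃ C : ℝ, 0 < C ∧ ∀ (Ω : Set (ℝ × ℝ)) (M : Finset Rect) (h : ℝ), IsRectangularDomain Ω →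
      IsMesh Ω M → (∀ T ∈ M, T.HasSize κ h) →
      (∀ z ∈ vertices M, z ∈ frontier Ω → (patchInteriorVertices Ω M z).Nonempty) →
      ∀ (ubar : ℝ × ℝ → ℝ) (G : ℝ × ℝ → ℝ × ℝ), IsRecoveredGradient Ω M ζ ubar G →
      ∀ T ∈ M, ∀ (q : ℝ × ℝ → ℝ) (ε : ℝ), 0 ≤ ε → IsP (k + 1) q →
      (∀ T' ∈ nbhd M 4 T, ∀ w ∈ nodes M ζ, w ∈ T'.carrier → |ubar w - q w| ≤ ε) →
      ∀ x ∈ T.carrier, |(G x).1 - dx q x| ≤ C / h * ε ∧ |(G x).2 - dy q x| ≤ C / h * ε := by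
  classical
  obtain ⟨C₁, hC₁, hvert⟩ := exists_grad_vertexPolynomial_le hk hζ hκ
  obtain ⟨C₂, hC₂, hnode⟩ := exists_abs_le_of_nodes hk hζ
  refine ⟨C₂ * C₁, by positivity, fun Ω M h hΩ hM hs hne ubar G hG T hT q ε hε hq hub => ?_⟩
  obtain ⟨hG1, hG2, p, hp, hGv, hGe, hGi⟩ := hG
  have hv : ∀ i, T.corner i ∈ vertices M := fun i => mem_vertices.2 ⟨T, hT, i, rfl⟩
  have hvert := fun i => hvert Ω M h hΩ hM hs hne ubar p hp T hT q ε hε hq hub _ (hv i) (T.corner_mem i)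
  set B := C₁ / h * ε with hB
  have hat : ∀ z ∈ T.carrier, z ∈ nodes M ζ → |(G z).1 - dx q z| ≤ B ∧ |(G z).2 - dy q z| ≤ B := by
    intro z hz hzn
    rcases Rect.corner_or_edge_or_inner hz with ⟨i, rfl⟩ | ⟨i, hi⟩ | hi
    · rw [hGv _ (hv i)]
      exact hvert i _ hz
    · have hend : ∃ a b, (T.edge i).p = T.corner a ∧ (T.edge i).q = T.corner b := by
        fin_cases i
        · exact ⟨0, 1, rfl, rfl⟩
        · exact ⟨1, 2, rfl, rfl⟩
        · exact ⟨3, 2, rfl, rfl⟩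
        · exact ⟨0, 3, rfl, rfl⟩
      obtain ⟨a, b, ha, hb⟩ := hend
      have hlen : 0 < (T.edge i).length := by
        have h1 := (hs T hT).le_edge_length i
        have h2 := (hs T hT).pos
        by_contra hn
        push Not at hn
        nlinarith
      rw [hGe _ ⟨T, hT, i, rfl⟩ z hzn hi]
      obtain ⟨s, hs', rfl⟩ := hi
      obtain ⟨w1, w2⟩ := Edge.weights hlen hs'
      rw [w1, w2, ha, hb]
      have h1 := hvert a _ hz
      have h2 := hvert b _ hz
      simp only [grad, Prod.smul_mk, Prod.mk_add_mk, smul_eq_mul]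
      constructor
      · simpa using abs_convexCombination_sub_le (l₁ := 1 - s) (l₂ := s) (l₃ := 0) (l₄ := 0)
          (by linarith [hs'.2]) hs'.1.le le_rfl le_rfl (by ring) h1.1 h2.1 h1.1 h1.1
      · simpa using abs_convexCombination_sub_le (l₁ := 1 - s) (l₂ := s) (l₃ := 0) (l₄ := 0)
          (by linarith [hs'.2]) hs'.1.le le_rfl le_rfl (by ring) h1.2 h2.2 h1.2 h1.2
    · rw [hGi T hT z hzn hi]
      rw [Rect.mem_inner] at hi
      obtain ⟨⟨i1, i2⟩, i3, i4⟩ := hi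
      have hw := T.width_pos
      have hht := T.height_pos
      have p1 : 0 ≤ z.1 - T.l := by linarith
      have p2 : 0 ≤ T.r - z.1 := by linarith
      have p3 : 0 ≤ z.2 - T.b := by linarith
      have p4 : 0 ≤ T.t - z.2 := by linarith
      have hsum : (T.r - z.1) * (T.t - z.2) / (T.width * T.height) +
          (z.1 - T.l) * (T.t - z.2) / (T.width * T.height) +
          (z.1 - T.l) * (z.2 - T.b) / (T.width * T.height) +
          (T.r - z.1) * (z.2 - T.b) / (T.width * T.height) = 1 := by
        rw [← add_div, ← add_div, ← add_div, div_eq_one_iff_eq (by positivity)]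
        simp only [Rect.width, Rect.height]; ring
      have h0 := hvert 0 _ hz
      have h1 := hvert 1 _ hz
      have h2 := hvert 2 _ hz
      have h3 := hvert 3 _ hz
      simp only [grad, Prod.smul_mk, Prod.mk_add_mk, smul_eq_mul]
      exact ⟨abs_convexCombination_sub_le (by positivity) (by positivity) (by positivity) (by positivity)
        hsum h0.1 h1.1 h2.1 h3.1, abs_convexCombination_sub_le (by positivity) (by positivity)
        (by positivity) (by positivity) hsum h0.2 h1.2 h2.2 h3.2⟩
  have hnT : ∀ ij, T.node ζ ij ∈ nodes M ζ := fun ij => by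
    simp only [nodes, Finset.mem_biUnion, Finset.mem_image, Finset.mem_univ, true_and]
    exact ⟨T, hT, ij, rfl⟩
  obtain ⟨g₁, hg₁, he₁⟩ := hG1.2 T hT
  obtain ⟨g₂, hg₂, he₂⟩ := hG2.2 T hT
  have m := fun ij => T.node_mem hk hζ ij
  intro x hx
  have eC : C₂ * C₁ / h * ε = C₂ * B := by rw [hB]; ring
  have r₁ := hnode _ (hg₁.sub hq.dx.isQ) T B (fun ij => by
    have := (hat _ (m ij) (hnT ij)).1
    rwa [Pi.sub_apply, ← he₁ (m ij)]) x hx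
  have r₂ := hnode _ (hg₂.sub hq.dy.isQ) T B (fun ij => by
    have := (hat _ (m ij) (hnT ij)).2
    rwa [Pi.sub_apply, ← he₂ (m ij)]) x hx
  rw [Pi.sub_apply, ← he₁ hx] at r₁
  rw [Pi.sub_apply, ← he₂ hx] at r₂
  rw [eC]
  exact ⟨r₁, r₂⟩

theorem integral_sub_sq_le_of_abs_le {T : Rect} {κ h B D : ℝ} (hs : T.HasSize κ h) {φ γ g r : ℝ × ℝ → ℝ}
    (hφ : MemLp φ 2 (volume.restrict T.carrier)) (hg : Continuous g) (hγ : EqOn γ g T.carrier)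
    (hr : Continuous r) (hB : ∀ x ∈ T.carrier, |γ x - r x| ≤ B)
    (hD : ∫ z in T.carrier, (φ z - r z) ^ 2 ≤ D) :
    IntegrableOn (fun z => (γ z - φ z) ^ 2) T.carrier ∧
      ∫ z in T.carrier, (γ z - φ z) ^ 2 ≤ 2 * (h ^ 2 * B ^ 2) + 2 * D := by
  have mr : MemLp (fun z => φ z - r z) 2 (volume.restrict T.carrier) := hφ.sub hr.memLp_restrict
  have cg : Continuous fun z => g z - r z := hg.sub hr
  have mg : MemLp (fun z => g z - r z) 2 (volume.restrict T.carrier) := cg.memLp_restrict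
  have mgφ : MemLp (fun z => g z - φ z) 2 (volume.restrict T.carrier) :=
    (hg.memLp_restrict (T := T)).sub hφ
  have h1 : ∫ z in T.carrier, (g z - r z) ^ 2 ≤ h ^ 2 * B ^ 2 := by
    refine (integral_sq_le_of_abs_le fun z hz => ?_).trans
      (mul_le_mul_of_nonneg_right hs.area_le (sq_nonneg _))
    rw [← hγ hz]; exact hB z hz
  have hc : EqOn (fun z => (g z - φ z) ^ 2) (fun z => (γ z - φ z) ^ 2) T.carrier := fun z hz => by
    simp only [hγ hz]
  refine ⟨IntegrableOn.congr_fun mgφ.integrable_sq hc T.measurableSet_carrier, ?_⟩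
  rw [← setIntegral_congr_fun T.measurableSet_carrier hc]
  calc _ ≤ ∫ z in T.carrier, (2 * (g z - r z) ^ 2 + 2 * (φ z - r z) ^ 2) := by
        refine integral_mono mgφ.integrable_sq ((mg.integrable_sq.const_mul 2).add
          (mr.integrable_sq.const_mul 2)) fun z => ?_
        simp only
        nlinarith [sq_nonneg ((g z - r z) + (φ z - r z))]
    _ = 2 * (∫ z in T.carrier, (g z - r z) ^ 2) + 2 * ∫ z in T.carrier, (φ z - r z) ^ 2 := by
        rw [integral_add (mg.integrable_sq.const_mul 2) (mr.integrable_sq.const_mul 2),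
          integral_const_mul, integral_const_mul]
    _ ≤ _ := by linarith

/-- The error of the recovered gradient on an element. -/
theorem exists_integral_recoveredGradient_le (hk : 1 ≤ k) (hζ : IsLobattoPoints k ζ) {κ : ℝ} (hκ : 1 ≤ κ) :
    ∃ C : ℝ, 0 < C ∧ ∀ (Ω : Set (ℝ × ℝ)) (M : Finset Rect) (h : ℝ), IsRectangularDomain Ω →
      IsMesh Ω M → (∀ T ∈ M, T.HasSize κ h) →
      (∀ z ∈ vertices M, z ∈ frontier Ω → (patchInteriorVertices Ω M z).Nonempty) →
      ∀ (F : ℕ → ℕ → ℝ × ℝ → ℝ) (U V₁ V₂ : ℝ × ℝ → ℝ),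
      (∀ R : Rect, R.inner ⊆ Ω → SobolevOn R (k + 2) F) → (∀ T ∈ M, IsRep T F U V₁ V₂) →
      ∀ (uh : WeakFunction), MemVh M k uh → ∀ (ubar : ℝ × ℝ → ℝ), IsNodalAverage Ω M ζ uh ubar →
      ∀ (G : ℝ × ℝ → ℝ × ℝ), IsRecoveredGradient Ω M ζ ubar G → ∀ T ∈ M, ∀ ε, 0 ≤ ε →
      (∀ T' ∈ nbhd M 6 T, gradSq T' ((uh.sub (interpolant ζ U)).v0 T') +
        edgeSq T' (uh.sub (interpolant ζ U)) / h ≤ ε ^ 2) →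
      (∀ T' ∈ nbhd M 6 T, h ^ (2 * k + 2) * seminormSq T' (k + 2) F ≤ ε ^ 2) →
      IntegrableOn (fun z => ((G z).1 - F 1 0 z) ^ 2 + ((G z).2 - F 0 1 z) ^ 2) T.carrier ∧
      ∫ z in T.carrier, (((G z).1 - F 1 0 z) ^ 2 + ((G z).2 - F 0 1 z) ^ 2) ≤ C * ε ^ 2 := by
  obtain ⟨C₀, hC₀, happ⟩ := exists_isApprox hk hκ
  obtain ⟨C₁, hC₁, hnb⟩ := exists_approx_nbhd hk hκ 4
  obtain ⟨C₂, hC₂, hav⟩ := exists_abs_nodalAverage_sub_le hk hζ hκ 4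
  obtain ⟨C₃, hC₃, hrec⟩ := exists_recoveredGradient_le hk hζ hκ
  set c : ℝ := C₁ * (√C₀ + 1) + C₂ with hc
  have hc0 : 0 < c := by positivity
  refine ⟨2 * (2 * (C₃ * c) ^ 2 + 2 * C₀), by positivity, fun Ω M h hΩ hM hs hne F U V₁ V₂ hF hr uh hu ubar hub
    G hG T hT ε hε hE hX => ?_⟩
  have hsT := hs T hT
  have hh := hsT.pos
  have hFT := hF T (hM.inner_subset hΩ hT)
  have h4 : ∀ T' ∈ nbhd M 4 T, T' ∈ nbhd M 6 T := fun T' h => nbhd_mono hT (by norm_num) h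
  have hXT := hX T (nbhd_mono hT (Nat.zero_le 6) (self_mem_nbhd M T))
  obtain ⟨q, hq⟩ := happ T F U V₁ V₂ h hFT hsT.width_le hsT.height_le hsT.le_width hsT.le_height (hr T hT)
  have hA : h ^ 2 * (C₀ * h ^ (2 * k) * seminormSq T (k + 2) F) ≤ C₀ * ε ^ 2 := by
    calc _ = C₀ * (h ^ (2 * k + 2) * seminormSq T (k + 2) F) := by ring
      _ ≤ _ := by gcongr
  have hUq : ∀ z ∈ T.carrier, |U z - q z| ≤ (√C₀ + 1) * ε := fun z hz => by
    have := Real.abs_le_sqrt ((hq.sub z hz).trans hA)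
    rw [Real.sqrt_mul hC₀.le, Real.sqrt_sq hε] at this
    linarith
  have hε1 : ε ≤ (√C₀ + 1) * ε := by nlinarith [Real.sqrt_nonneg C₀]
  have hnb := hnb Ω M h hΩ hM hs F U V₁ V₂ hF hr T hT ((√C₀ + 1) * ε) (by positivity)
    (fun T' hT' => (hX T' (h4 T' hT')).trans (by gcongr)) q hq.isP hUq
  obtain ⟨a, ha⟩ := hav Ω M h hΩ hM hs uh U ubar hu hub T hT ε hε hE
  have ca : ContDiff ℝ ∞ (fun _ : ℝ × ℝ => a) := contDiff_const
  have hda : WG.dx (fun _ : ℝ × ℝ => a) = 0 ∧ WG.dy (fun _ : ℝ × ℝ => a) = 0 := by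
    constructor <;> · ext z; simp [dx, dy]
  have hrec := hrec Ω M h hΩ hM hs hne ubar G hG T hT (q + fun _ => a) (c * ε) (by positivity)
    (hq.isP.add (IsP.const _ a)) (fun T' hT' w hw hwT' => by
      have h1 := hnb T' hT' w hwT'
      have h2 := ha T' hT' w hw hwT'
      rw [Pi.add_apply, hc]
      rw [abs_le] at *
      constructor <;> linarith [h1.1, h1.2, h2.1, h2.2])
  have sq := hq.isP.contDiff
  rw [dx_add sq.diff' ca.diff', dy_add sq.diff' ca.diff', hda.1, hda.2, add_zero, add_zero] at hrec
  obtain ⟨g₁, hg₁, he₁⟩ := hG.1.2 T hT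
  obtain ⟨g₂, hg₂, he₂⟩ := hG.2.1.2 T hT
  have eB : h ^ 2 * (C₃ / h * (c * ε)) ^ 2 = (C₃ * c) ^ 2 * ε ^ 2 := by field_simp
  obtain ⟨i1, k1⟩ := integral_sub_sq_le_of_abs_le hsT (hFT.1 1 0 (by lia)) hg₁.contDiff.continuous he₁
    (contDiff_dx sq).continuous (fun x hx => (hrec x hx).1) (hq.grad₁.trans hA)
  obtain ⟨i2, k2⟩ := integral_sub_sq_le_of_abs_le hsT (hFT.1 0 1 (by lia)) hg₂.contDiff.continuous he₂
    (contDiff_dy sq).continuous (fun x hx => (hrec x hx).2) (hq.grad₂.trans hA)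
  refine ⟨i1.add i2, ?_⟩
  rw [eB] at k1 k2
  rw [integral_add i1 i2]
  linarith

end WG

namespace WG

variable {Ω : Set (ℝ × ℝ)} {M : Finset Rect}

/-! ### Summation over the mesh -/

theorem IsMesh.sum_integral_eq (hM : IsMesh Ω M) (hΩ : IsRectangularDomain Ω) {g : ℝ × ℝ → ℝ}
    (hg : ∀ T ∈ M, IntegrableOn g T.carrier) :
    ∑ T ∈ M, ∫ z in T.carrier, g z = ∫ z in Ω, g z := by
  have hcarrier : (⋃ T ∈ M, T.inner) =ᵐ[volume] ⋃ T ∈ M, T.carrier :=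
    M.eventuallyEq_iUnion fun T _ => T.inner_ae_eq
  have hsub : (⋃ T ∈ M, T.inner) ⊆ Ω := iUnion₂_subset fun T hT => hM.inner_subset hΩ hT
  have hsub' : Ω ⊆ ⋃ T ∈ M, T.carrier := by rw [hM.cover]; exact subset_closure
  have hΩae : (⋃ T ∈ M, T.inner) =ᵐ[volume] Ω :=
    Filter.EventuallyLE.antisymm hsub.eventuallyLE (hsub'.eventuallyLE.trans hcarrier.symm.le)
  rw [← setIntegral_congr_set hΩae, integral_biUnion_finset M
    (fun T _ => T.isOpen_inner.measurableSet) ?_ (fun T hT => (hg T hT).mono_set T.inner_subset)]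
  · exact Finset.sum_congr rfl fun T _ => setIntegral_congr_set T.inner_ae_eq.symm
  · intro T hT T' hT' hne
    rw [Function.onFun, Set.disjoint_left]
    exact fun z hz hz' => hne (hM.eq_of_mem_inner hT hT' hz (T'.inner_subset hz'))

theorem IsMesh.sum_seminormSq_eq (hM : IsMesh Ω M) (hΩ : IsRectangularDomain Ω) {F : ℕ → ℕ → ℝ × ℝ → ℝ}
    {m n : ℕ} (hF : ∀ T ∈ M, SobolevOn T m F) (hn : n ≤ m) :
    ∑ T ∈ M, seminormSq T n F = ∑ ab ∈ Finset.HasAntidiagonal.antidiagonal n, ∫ z in Ω, F ab.1 ab.2 z ^ 2 := by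
  unfold seminormSq
  rw [Finset.sum_comm]
  refine Finset.sum_congr rfl fun ab hab => hM.sum_integral_eq hΩ fun T hT => ?_
  rw [Finset.HasAntidiagonal.mem_antidiagonal] at hab
  exact ((hF T hT).1 _ _ (hab.trans_le hn)).integrable_sq

theorem sum_antidiagonal_le_sobolevNorm_sq (Ω : Set (ℝ × ℝ)) (k : ℕ) (u : ℝ × ℝ → ℝ) :
    (∑ ab ∈ Finset.HasAntidiagonal.antidiagonal (k + 2), ∫ z in Ω, weakDeriv Ω ab.1 ab.2 u z ^ 2) +
      (∑ ab ∈ Finset.HasAntidiagonal.antidiagonal (k + 1), ∫ z in Ω, weakDeriv Ω ab.1 ab.2 u z ^ 2) ≤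
      sobolevNorm Ω (k + 2) u ^ 2 := by
  have h0 : ∀ n, 0 ≤ ∑ ab ∈ Finset.HasAntidiagonal.antidiagonal n, ∫ z in Ω, weakDeriv Ω ab.1 ab.2 u z ^ 2 :=
    fun n => Finset.sum_nonneg fun _ _ => integral_nonneg fun _ => sq_nonneg _
  rw [sobolevNorm, Real.sq_sqrt (Finset.sum_nonneg fun n _ => h0 n), Finset.sum_range_succ,
    Finset.sum_range_succ]
  linarith [Finset.sum_nonneg fun n (_ : n ∈ Finset.range (k + 1)) => h0 n]

/-- The error estimate for given Lobatto points. -/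
theorem exists_gradError_le {k : ℕ} (hk : 1 ≤ k) {ζ : Fin (k + 1) → ℝ} (hζ : IsLobattoPoints k ζ)
    (hΩ : IsRectangularDomain Ω) {α : ℝ} (hα : 1 ≤ α) (σ : ℝ) :
    ∃ C : ℝ, 0 < C ∧ ∀ (M : Finset Rect), IsMesh Ω M → IsShapeRegular σ M →
      (∀ z ∈ vertices M, z ∈ frontier Ω → (patchInteriorVertices Ω M z).Nonempty) →
      ∀ (f u : ℝ × ℝ → ℝ), MemLp f 2 (volume.restrict Ω) →
      IsWeakSolution Ω f u → MemSobolev Ω (k + 2) u →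
      ∀ (uh : WeakFunction), IsWGSolution Ω M k α f uh →
      ∀ (ubar : ℝ × ℝ → ℝ), IsNodalAverage Ω M ζ uh ubar →
      ∀ (G : ℝ × ℝ → ℝ × ℝ), IsRecoveredGradient Ω M ζ ubar G →
        gradError Ω G u ≤ C * meshSize M ^ (min ((k : ℝ) + 1) ((k : ℝ) + (α - 1) / 2)) *
          sobolevNorm Ω (k + 2) u := by
  obtain ⟨κ, hκ, hsize⟩ := exists_meshSize_le hΩ σ
  obtain ⟨D, hD, hdom⟩ := exists_meshSize_le_domain hΩ
  obtain ⟨C₁, hC₁, henergy⟩ := exists_energy_le hk hζ hκ hD hα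
  obtain ⟨C₂, hC₂, hrec⟩ := exists_integral_recoveredGradient_le hk hζ hκ
  set E : ℝ := D ^ (2 * (k : ℝ) + 2) with hE
  have hE0 : 0 < E := by positivity
  set K : ℝ := C₂ * (5 ^ 6 * (C₁ + E)) with hK
  have hK0 : 0 < K := by positivity
  refine ⟨√K, by positivity, fun M hM hσ hne f u hf hu hS uh huh ubar hub G hG => ?_⟩
  obtain ⟨hh, hs⟩ := hsize M hM hσ
  have hs : ∀ T ∈ M, T.HasSize κ (meshSize M) := fun T hT =>
    ⟨hh, (hs T hT).1, (hs T hT).2.1, (hs T hT).2.2.1, (hs T hT).2.2.2⟩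
  have hhD := hdom M hM
  set F : ℕ → ℕ → ℝ × ℝ → ℝ := fun a b => weakDeriv Ω a b u with hFd
  have hw : ∀ a b, a + b ≤ k + 2 → HasWeakDeriv Ω a b u (F a b) := fun a b hab =>
    hasWeakDeriv_weakDeriv (hS a b hab)
  have hF : ∀ R : Rect, R.inner ⊆ Ω → SobolevOn R (k + 2) F := fun R hR =>
    sobolevOn_of_hasWeakDeriv hΩ.isOpen hR hw
  have hFT : ∀ T ∈ M, SobolevOn T (k + 2) F := fun T hT => hF T (hM.inner_subset hΩ hT)
  obtain ⟨U, V₁, V₂, hr⟩ := hM.exists_isRep hΩ (by lia) hF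
  have hU : ∀ T ∈ M, ∀ i, (T.edge i).carrier ⊆ frontier Ω → ∀ z ∈ (T.edge i).carrier, U z = 0 :=
    fun T hT i hi z hz => hu.1.eq_zero_of_edge hΩ.isOpen (fun a b hab => hw a b (by lia))
      (hM.inner_subset hΩ hT) (hFT T hT) (by lia) (hr T hT).cont (hr T hT).ae hi hz
  have hfT : ∀ T ∈ M, f =ᵐ[volume.restrict T.carrier] fun z => -(F 2 0 z + F 0 2 z) := fun T hT => by
    have h1 := hu.ae_eq hΩ.isOpen hf fun a b hab => hw a b (by lia)
    rw [← Measure.restrict_congr_set T.inner_ae_eq]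
    exact h1.filter_mono (ae_mono (Measure.restrict_mono (hM.inner_subset hΩ hT) le_rfl))
  have hen := henergy Ω M hΩ hM hs hhD F U V₁ V₂ f uh hFT hr hU hfT huh
  set h := meshSize M with hhd
  set r := min ((k : ℝ) + 1) ((k : ℝ) + (α - 1) / 2) with hrd
  set N := sobolevNorm Ω (k + 2) u with hN
  have hN0 : 0 ≤ N := Real.sqrt_nonneg _
  set e := uh.sub (interpolant ζ U) with he
  have hXY : ∑ T ∈ M, (seminormSq T (k + 2) F + seminormSq T (k + 1) F) ≤ N ^ 2 := by
    rw [Finset.sum_add_distrib, hM.sum_seminormSq_eq hΩ hFT le_rfl,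
      hM.sum_seminormSq_eq hΩ hFT (Nat.le_succ _)]
    exact sum_antidiagonal_le_sobolevNorm_sq Ω k u
  have hpow : h ^ (2 * k + 2) ≤ E * h ^ (2 * r) := by
    have hr0 : 0 ≤ r := le_min (by positivity) (add_nonneg (by positivity) (by linarith))
    have hr1 : r ≤ k + 1 := min_le_left _ _
    have := rpow_le_mul_rpow (s := 2 * r) (t := ((2 * k + 2 : ℕ) : ℝ)) (u := 2 * (k : ℝ) + 2) hD hh hhD
      (by push_cast; linarith) (by push_cast; linarith)
    rwa [Real.rpow_natCast] at this
  have hρ0 : 0 < h ^ (2 * r) := by positivity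
  set b : Rect → ℝ := fun T => (gradSq T (e.v0 T) + edgeSq T e / h) +
    h ^ (2 * k + 2) * seminormSq T (k + 2) F with hb
  have b1 : ∀ T, 0 ≤ gradSq T (e.v0 T) + edgeSq T e / h := fun T =>
    add_nonneg (gradSq_nonneg _ _) (div_nonneg (edgeSq_nonneg _ _) hh.le)
  have b2 : ∀ T, 0 ≤ h ^ (2 * k + 2) * seminormSq T (k + 2) F := fun T =>
    mul_nonneg (by positivity) (seminormSq_nonneg _ _ _)
  have hb0 : ∀ T, 0 ≤ b T := fun T => add_nonneg (b1 T) (b2 T)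
  have hbsum : ∑ T ∈ M, b T ≤ (C₁ + E) * h ^ (2 * r) * N ^ 2 := by
    have k1 : ∑ T ∈ M, h ^ (2 * k + 2) * seminormSq T (k + 2) F ≤ E * h ^ (2 * r) * N ^ 2 := by
      rw [← Finset.mul_sum]
      have : ∑ T ∈ M, seminormSq T (k + 2) F ≤ N ^ 2 := (Finset.sum_le_sum fun T _ =>
        le_add_of_nonneg_right (seminormSq_nonneg T (k + 1) F)).trans hXY
      have h0 : 0 ≤ ∑ T ∈ M, seminormSq T (k + 2) F := Finset.sum_nonneg fun T _ => seminormSq_nonneg _ _ _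
      gcongr
    have k2 : C₁ * h ^ (2 * r) * ∑ T ∈ M, (seminormSq T (k + 2) F + seminormSq T (k + 1) F) ≤
        C₁ * h ^ (2 * r) * N ^ 2 := by gcongr
    calc ∑ T ∈ M, b T = _ := Finset.sum_add_distrib
      _ ≤ C₁ * h ^ (2 * r) * N ^ 2 + E * h ^ (2 * r) * N ^ 2 := add_le_add (hen.trans k2) k1
      _ = _ := by ring
  have hloc : ∀ T ∈ M, IntegrableOn (fun z => ((G z).1 - F 1 0 z) ^ 2 + ((G z).2 - F 0 1 z) ^ 2) T.carrier ∧
      ∫ z in T.carrier, (((G z).1 - F 1 0 z) ^ 2 + ((G z).2 - F 0 1 z) ^ 2) ≤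
        C₂ * (nbSum M)^[6] b T := by
    intro T hT
    have n0 := iterate_nbSum_nonneg (M := M) hb0 6 T
    have := hrec Ω M h hΩ hM hs hne F U V₁ V₂ hF hr uh huh.1.1 ubar hub G hG T hT
      (√((nbSum M)^[6] b T)) (Real.sqrt_nonneg _)
      (fun T' hT' => by
        rw [Real.sq_sqrt n0]
        exact (le_add_of_nonneg_right (b2 T')).trans (le_iterate_nbSum hb0 hT'))
      (fun T' hT' => by
        rw [Real.sq_sqrt n0]
        exact (le_add_of_nonneg_left (b1 T')).trans (le_iterate_nbSum hb0 hT'))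
    rwa [Real.sq_sqrt n0] at this
  have hfin : ∫ z in Ω, (((G z).1 - F 1 0 z) ^ 2 + ((G z).2 - F 0 1 z) ^ 2) ≤ K * (h ^ r * N) ^ 2 := by
    rw [← hM.sum_integral_eq hΩ fun T hT => (hloc T hT).1]
    have e1 : h ^ (2 * r) = (h ^ r) ^ 2 := by
      rw [← Real.rpow_natCast, ← Real.rpow_mul hh.le]; congr 1; push_cast; ring
    calc _ ≤ ∑ T ∈ M, C₂ * (nbSum M)^[6] b T := Finset.sum_le_sum fun T hT => (hloc T hT).2
      _ = C₂ * ∑ T ∈ M, (nbSum M)^[6] b T := by rw [Finset.mul_sum]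
      _ ≤ C₂ * (5 ^ 6 * ((C₁ + E) * h ^ (2 * r) * N ^ 2)) := by
          gcongr
          exact (hM.sum_iterate_nbSum_le hb0 6).trans (by gcongr)
      _ = _ := by rw [e1, hK]; ring
  have h0 : 0 ≤ h ^ r * N := by positivity
  calc gradError Ω G u ≤ √(K * (h ^ r * N) ^ 2) := Real.sqrt_le_sqrt hfin
    _ = √K * (h ^ r * N) := by rw [Real.sqrt_mul hK0.le, Real.sqrt_sq h0]
    _ = _ := by ring

end WG

theorem theorem6p4 (Ω : Set (ℝ × ℝ)) (hΩ : WG.IsRectangularDomain Ω)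
    (k : ℕ) (hk : 1 ≤ k) (α : ℝ) (hα : 1 ≤ α) (σ : ℝ) :
    ∃ C : ℝ, 0 < C ∧
      ∀ (ζ : Fin (k + 1) → ℝ), WG.IsLobattoPoints k ζ →
      ∀ (M : Finset WG.Rect), WG.IsMesh Ω M → WG.IsShapeRegular σ M →
      (∀ z ∈ WG.vertices M, z ∈ frontier Ω → (WG.patchInteriorVertices Ω M z).Nonempty) →
      ∀ (f u : ℝ × ℝ → ℝ), MeasureTheory.MemLp f 2 (MeasureTheory.volume.restrict Ω) →
      WG.IsWeakSolution Ω f u → WG.MemSobolev Ω (k + 2) u →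
      ∀ (uh : WG.WeakFunction), WG.IsWGSolution Ω M k α f uh →
      ∀ (ubar : ℝ × ℝ → ℝ), WG.IsNodalAverage Ω M ζ uh ubar →
      ∀ (G : ℝ × ℝ → ℝ × ℝ), WG.IsRecoveredGradient Ω M ζ ubar G →
        WG.gradError Ω G u ≤
          C * WG.meshSize M ^ (min ((k : ℝ) + 1) ((k : ℝ) + (α - 1) / 2)) *
            WG.sobolevNorm Ω (k + 2) u := by
  by_cases h : ∃ ζ : Fin (k + 1) → ℝ, WG.IsLobattoPoints k ζ
  · obtain ⟨ζ₀, hζ₀⟩ := h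
    obtain ⟨C, hC, hmain⟩ := WG.exists_gradError_le hk hζ₀ hΩ hα σ
    refine ⟨C, hC, fun ζ hζ => ?_⟩
    obtain rfl := hζ.unique hk hζ₀
    exact hmain
  · exact ⟨1, one_pos, fun ζ hζ => absurd ⟨ζ, hζ⟩ h⟩
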